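/- **Conventions.** For an undirected graph $G$ let $\mathcal D(G)$ be the directed graph obtained from $G$ by replacing each edge $uv$ by the two directed edges $(u,v),(v,u)$. A *subdivided star* is a subdivision of a star $K_{1,m}$, $m\in\mathbb N$; its *teeth* are its leaves. A *comb* is the union of a finite path $P$ with disjoint (possibly trivial) finite paths that have precisely their first vertex on $P$; the last vertices of these paths are its *teeth*. A *junction* of a comb is a vertex of degree $3$, or a tooth of degree $2$. A directed graph $H$ is *shaped by a star* if it is a directed cycle, or if there is a subdivided star $S$ such that (i) $H=\mathcal D(S)$, or (ii) $H$ is obtained from $\mathcal D(S)$ by replacing the unique vertex $w$ with $d_S(w)>2$ by a directed cycle of length $d_S(w)$ such that the strong components of $\mathcal D(S)-w$ become incident with distinct vertices of this cycle. $H$ is *shaped by a comb* if there is a comb $C$ such that (a) $H=\mathcal D(C)$, or (b) $H$ is obtained from $\mathcal D(C)$ by replacing each junction $j$ of $C$ by a directed cycle of length $3$ such that, if $d_C(j)=3$, the three strong components of $\mathcal D(C)-j$ become incident with distinct vertices of this cycle, and otherwise the tooth $j$ is a vertex of this cycle and the two strong components of $\mathcal D(C)-j$ become incident with the other two vertices of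 this cycle, one with each. The *teeth* of $H$ are the vertices corresponding to the teeth of $S$ or $C$, respectively; all vertices of a directed cycle are teeth. An edge $e=(u,v)$ is *butterfly contractible* if it is the only outgoing edge of $u$ or the only incoming edge of $v$. A *butterfly minor* of a directed graph $D$ is a directed graph obtained from a subgraph of $D$ by successively contracting butterfly contractible edges. When $e=(u,v)$ is contracted, the new vertex is identified with $u$ if $e$ is the only incoming edge of $v$, and with $v$ if $e$ is the only outgoing edge of $u$ (with both, if both hold). A vertex of a butterfly minor of $D$ is *in* a set $U\subseteq V(D)$ if it has been identified in this way with a vertex of $U$. **Theorem.** There exists a function $g:\mathbb N\to\mathbb N$ such that for every $n\in\mathbb N$, every strongly connected directed graph $D$ and every set $U$ of vertices of $D$ with $|U|\ge g(n)$, there is a butterfly minor of $D$ that is shaped by a star or shaped by a comb and has (at least) $n$ teeth in $U$. -/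

import Mathlib

namespace Butterfly

/-! ### Directed graphs with a vertex set, and butterfly minors -/

/-- A directed graph is strongly connected if every vertex reaches every vertex by directed edges. -/
def StronglyConnected {V : Type*} (D : Digraph V) : Prop :=
  ∀ u v : V, Relation.ReflTransGen D.Adj u v

/-- A directed graph whose vertices form a subset of the type `V`. -/
@[ext]
structure VDigraph (V : Type*) where
  /-- the vertex set -/
  verts : Set V
  /-- `Adj u v` says that `(u, v)` is an edge -/
  Adj : V → V → Prop
  left_mem : ∀ {u v : V}, Adj u v → u ∈ verts
  right_mem : ∀ {u v : V}, Adj u v → v ∈ verts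

namespace VDigraph

variable {V : Type*}

/-- `H` is a subgraph of `D`. -/
def IsSubgraphOf (H : VDigraph V) (D : Digraph V) : Prop :=
  ∀ u v : V, H.Adj u v → D.Adj u v

open Classical in
/-- The vertex of the contracted graph that a vertex `z` is mapped to when `y` is merged
into `x`. -/
noncomputable def mergeMap (x y z : V) : V := if z = y then x else z

/-- The graph obtained from `H` by contracting an edge between `x` and `y` to a single vertex that
is identified with `x`. The edges between `x` and `y` disappear, and parallel edges that arise
become one edge. -/
def merge (H : VDigraph V) (x y : V) : VDigraph V where
  verts := mergeMap x y '' H.verts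
  Adj a b := ¬(a = x ∧ b = x) ∧ ∃ a' b', H.Adj a' b' ∧ mergeMap x y a' = a ∧ mergeMap x y b' = b
  left_mem := by
    rintro _ _ ⟨-, a', b', h, rfl, rfl⟩
    exact ⟨a', H.left_mem h, rfl⟩
  right_mem := by
    rintro _ _ ⟨-, a', b', h, rfl, rfl⟩
    exact ⟨b', H.right_mem h, rfl⟩

/-- `(u, v)` is the only outgoing edge of `u`. -/
def IsOnlyOutEdge (H : VDigraph V) (u v : V) : Prop := H.Adj u v ∧ ∀ w, H.Adj u w → w = v

/-- `(u, v)` is the only incoming edge of `v`. -/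
def IsOnlyInEdge (H : VDigraph V) (u v : V) : Prop := H.Adj u v ∧ ∀ w, H.Adj w v → w = u

/-- `H'` arises from `H` by contracting one butterfly contractible edge `e = (u, v)`. The new
vertex is identified with `u` if `e` is the only incoming edge of `v`, and with `v` if `e` is the
only outgoing edge of `u`. If both hold, then the new vertex is both `u` and `v`, so it may be
represented by either of them. -/
def ContractsTo (H H' : VDigraph V) : Prop :=
  ∃ u v : V, u ≠ v ∧
    ((H.IsOnlyInEdge u v ∧ H' = H.merge u v) ∨ (H.IsOnlyOutEdge u v ∧ H' = H.merge v u))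

/-- `H` is a butterfly minor of `D`: it is obtained from a subgraph of `D` by finitely many
contractions of butterfly contractible edges. Its vertices are vertices of `D` by the
identification rule of `ContractsTo`. -/
def IsButterflyMinorOf (H : VDigraph V) (D : Digraph V) : Prop :=
  ∃ H₀ : VDigraph V, H₀.IsSubgraphOf D ∧ Relation.ReflTransGen ContractsTo H₀ H

/-- `H` with the set `T` of vertices is an isomorphic copy of `K` with the set `S` of vertices. -/
def IsCopyOf {X : Type*} (H : VDigraph V) (T : Set V) (K : VDigraph X) (S : Set X) : Prop :=
  ∃ φ : X → V, Set.InjOn φ K.verts ∧ φ '' K.verts = H.verts ∧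
    (∀ x ∈ K.verts, ∀ y ∈ K.verts, H.Adj (φ x) (φ y) ↔ K.Adj x y) ∧ φ '' S = T

end VDigraph

/-! ### Constructions of directed graphs -/

/-- The directed cycle `0 → 1 → ⋯ → k - 1 → 0` of length `k`. -/
def dicycle (k : ℕ) : VDigraph ℕ where
  verts := {i | i < k}
  Adj i j := i < k ∧ j < k ∧ j = (i + 1) % k
  left_mem h := h.1
  right_mem h := h.2.1

/-- `𝒟(G)`: every edge of `G` is replaced by two directed edges, one in each direction. -/
def bidirected {α : Type*} (G : SimpleGraph α) : VDigraph α where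
  verts := Set.univ
  Adj := G.Adj
  left_mem _ := Set.mem_univ _
  right_mem _ := Set.mem_univ _

/-- The directed graph obtained from `𝒟(G)` by replacing every vertex `v ∈ J` by the directed cycle
`(v, 0) → (v, 1) → ⋯ → (v, k - 1) → (v, 0)`. A vertex `v ∉ J` is kept, as `(v, 0)`. For an edge `vw`
of `G`, the vertex `(v, port v w)` takes the role of `v` in the two directed edges that replace
`vw`. -/
def replaceByCycles {α : Type*} (G : SimpleGraph α) (J : Set α) (k : ℕ) (port : α → α → ℕ) :
    VDigraph (α × ℕ) where
  verts := {x | (x.1 ∈ J ∧ x.2 < k) ∨ (x.1 ∉ J ∧ x.2 = 0)}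
  Adj x y := ((x.1 ∈ J ∧ x.2 < k) ∨ (x.1 ∉ J ∧ x.2 = 0)) ∧
    ((y.1 ∈ J ∧ y.2 < k) ∨ (y.1 ∉ J ∧ y.2 = 0)) ∧
    ((x.1 = y.1 ∧ x.1 ∈ J ∧ y.2 = (x.2 + 1) % k) ∨
      (G.Adj x.1 y.1 ∧ x.2 = port x.1 y.1 ∧ y.2 = port y.1 x.1))
  left_mem h := h.1
  right_mem h := h.2.1

/-- Every port is a vertex of the graph that replaces its vertex, and for `v ∈ J` the ports of
distinct neighbours are distinct. If `G` is a tree, then the strong components of `𝒟(G) - v`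
correspond to the neighbours of `v`, so this says that they become incident with distinct vertices
of the cycle that replaces `v`. -/
def ValidPorts {α : Type*} (G : SimpleGraph α) (J : Set α) (k : ℕ) (port : α → α → ℕ) : Prop :=
  (∀ v ∉ J, ∀ w, G.Adj v w → port v w = 0) ∧
  (∀ v ∈ J, (∀ w, G.Adj v w → port v w < k) ∧ Set.InjOn (port v) (G.neighborSet v))

/-- The vertices of `replaceByCycles G J k port` that correspond to the vertices in `T`. A vertex
`v ∈ T ∩ J` is a vertex of the directed cycle that replaces it, different from all of its ports. -/
def replacedTeeth {α : Type*} (G : SimpleGraph α) (J : Set α) (k : ℕ) (port : α → α → ℕ)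
    (T : Set α) : Set (α × ℕ) :=
  {x | x ∈ (replaceByCycles G J k port).verts ∧ x.1 ∈ T ∧
    (x.1 ∈ J → ∀ w, G.Adj x.1 w → port x.1 w ≠ x.2)}

/-! ### Subdivided stars and combs -/

/-- The degree of a vertex. -/
noncomputable def deg {α : Type*} (G : SimpleGraph α) (v : α) : ℕ := (G.neighborSet v).ncard

/-- The vertices of a subdivided star: the centre `none`, and the vertices
`some ⟨i, 0⟩, …, some ⟨i, len i⟩` of the `i`-th leg, in the order of their distance from the
centre. -/
abbrev StarVertex (m : ℕ) (len : Fin m → ℕ) : Type := Option (Σ i : Fin m, Fin (len i + 1))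

/-- The subdivision of the star `K_{1,m}` in which the `i`-th edge has become a path with
`len i + 1` edges. -/
def starGraph (m : ℕ) (len : Fin m → ℕ) : SimpleGraph (StarVertex m len) :=
  SimpleGraph.fromRel fun x y =>
    match x, y with
    | none, some b => (b.2 : ℕ) = 0
    | some a, some b => a.1 = b.1 ∧ (b.2 : ℕ) = (a.2 : ℕ) + 1
    | _, _ => False

/-- The teeth of a subdivided star are its leaves. -/
def starTeeth (m : ℕ) (len : Fin m → ℕ) : Set (StarVertex m len) :=
  {x | deg (starGraph m len) x = 1}

/-- The vertices of a comb. The path has the vertices `⟨0, 0⟩, …, ⟨p, 0⟩`. If `leg i = some ℓ`, then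
a path `⟨i, 0⟩, …, ⟨i, ℓ⟩` with `ℓ` edges is attached at `⟨i, 0⟩`; it is trivial for `ℓ = 0`. If
`leg i = none`, then nothing is attached at `⟨i, 0⟩`. -/
abbrev CombVertex (p : ℕ) (leg : Fin (p + 1) → Option ℕ) : Type :=
  Σ i : Fin (p + 1), Fin ((leg i).getD 0 + 1)

/-- The comb described at `CombVertex`. -/
def combGraph (p : ℕ) (leg : Fin (p + 1) → Option ℕ) : SimpleGraph (CombVertex p leg) :=
  SimpleGraph.fromRel fun x y =>
    (x.1 = y.1 ∧ (y.2 : ℕ) = (x.2 : ℕ) + 1) ∨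
      ((x.2 : ℕ) = 0 ∧ (y.2 : ℕ) = 0 ∧ (y.1 : ℕ) = (x.1 : ℕ) + 1)

/-- The teeth of a comb are the last vertices of the (possibly trivial) attached paths. -/
def combTeeth (p : ℕ) (leg : Fin (p + 1) → Option ℕ) : Set (CombVertex p leg) :=
  {x | leg x.1 = some (x.2 : ℕ)}

/-- A junction of a comb is a vertex of degree three or a tooth of degree two. -/
def combJunctions (p : ℕ) (leg : Fin (p + 1) → Option ℕ) : Set (CombVertex p leg) :=
  {x | deg (combGraph p leg) x = 3 ∨ (x ∈ combTeeth p leg ∧ deg (combGraph p leg) x = 2)}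

/-! ### Directed graphs shaped by a star or by a comb -/

/-- `H` is shaped by a star, with set of teeth `T`: it is a directed cycle, all of whose vertices
are teeth, or `𝒟(S)` for a subdivided star `S`, or it is obtained from `𝒟(S)`, where the centre of
`S` has degree `m > 2`, by replacing the centre by a directed cycle of length `m`. -/
def ShapedByStar {V : Type*} (H : VDigraph V) (T : Set V) : Prop :=
  (∃ k : ℕ, 2 ≤ k ∧ H.IsCopyOf T (dicycle k) (dicycle k).verts) ∨
  ∃ (m : ℕ) (len : Fin m → ℕ),
    H.IsCopyOf T (bidirected (starGraph m len)) (starTeeth m len) ∨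
    (2 < m ∧ ∃ port : StarVertex m len → StarVertex m len → ℕ,
      ValidPorts (starGraph m len) {none} m port ∧
      H.IsCopyOf T (replaceByCycles (starGraph m len) {none} m port)
        (replacedTeeth (starGraph m len) {none} m port (starTeeth m len)))

/-- `H` is shaped by a comb, with set of teeth `T`: it is `𝒟(C)` for a comb `C`, or it is obtained
from `𝒟(C)` by replacing each junction of `C` by a directed cycle of length three. -/
def ShapedByComb {V : Type*} (H : VDigraph V) (T : Set V) : Prop :=
  ∃ (p : ℕ) (leg : Fin (p + 1) → Option ℕ),
    H.IsCopyOf T (bidirected (combGraph p leg)) (combTeeth p leg) ∨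
    ∃ port : CombVertex p leg → CombVertex p leg → ℕ,
      ValidPorts (combGraph p leg) (combJunctions p leg) 3 port ∧
      H.IsCopyOf T (replaceByCycles (combGraph p leg) (combJunctions p leg) 3 port)
        (replacedTeeth (combGraph p leg) (combJunctions p leg) 3 port (combTeeth p leg))

end Butterfly

namespace Butterfly

open Relation

/-! ### Digraphs on subsets of a type: order, union, paths -/

namespace VDigraph

variable {V : Type*}

/-! It suffices to treat a finite strongly connected loopless graph H and n ≥ 3. Everything is built
from two operations: contracting an out-branching or an in-branching to its root (`Red.outCollapse`,
`Red.inCollapse`), and reducing one part of a graph while the vertices it shares with the remainder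
are protected (`Red.frame`).

Stars arise at a hub. Let r be a vertex and consider vertices of U in distinct strong components of
H - r. Reachability in H - r orders them, so a large set contains a large antichain or a long chain
(`exists_chain_or_antichain`). An antichain can be attached to r by bidirected paths (`star_legs`),
which gives a bidirected star. A chain can be attached by bidirected legs to a closed directed path
through r (`chain_legs`); keeping only the trivial or only the nontrivial legs gives a directed
cycle or a star whose centre is replaced by a cycle. So, if no star with n teeth in U can be
obtained, fewer than 2n² vertices of U can be in distinct strong components after the deletion of
one vertex, and this also holds in every subgraph (`hasShape_of_hub`).

Hence some strong component of H - r keeps a fixed proportion of U, and the argument can be repeated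
inside it. The nested components form a `Ladder`: layers with roots, where some layers are marked by
a vertex of U that was lost there. Descending is easy: there is a set C inside which one gets from
each layer to the layer below, via the roots. Climbing happens on free paths, which avoid C until
they land in C again. The crucial estimate `Ladder.card_between` says that only boundedly many
losses lie between layer i and a layer in which the root of layer i lands. The losses are divided
into those that land too high, those that are freely reached from the root, and the others, among
which losses with disjoint intervals of layers are selected. In each of these families a single root
acts as a hub in a suitable subgraph, so a large family would give a star.

Now climb greedily: `ends (t + 1)` is the highest layer in which a root of a layer up to `ends t`
lands. Each stretch between consecutive landmarks has boundedly many losses, so many stretches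
contain one. A block of a few consecutive stretches meets the part beyond it only in a gate vertex,
and its two gates and a lost vertex lie on a closed walk in the block. By `tripod_red`, three such
vertices can be made the ends of three bidirected paths that meet in a vertex (a claw) or in a
directed triangle (a net). Blocks glued at their gates form a comb. Keeping tripods of one kind
only, and replacing the other blocks by bidirected paths, yields one of the two kinds of graphs
shaped by a comb. -/

instance : LE (VDigraph V) := ⟨fun H K => H.verts ⊆ K.verts ∧ ∀ u v, H.Adj u v → K.Adj u v⟩

theorem le_refl' (H : VDigraph V) : H ≤ H := ⟨subset_rfl, fun _ _ h => h⟩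

theorem le_trans' {H K L : VDigraph V} (h : H ≤ K) (h' : K ≤ L) : H ≤ L :=
  ⟨h.1.trans h'.1, fun _ _ e => h'.2 _ _ (h.2 _ _ e)⟩

/-- The union of two directed graphs. -/
instance : Max (VDigraph V) := ⟨fun H K =>
  { verts := H.verts ∪ K.verts
    Adj := fun u v => H.Adj u v ∨ K.Adj u v
    left_mem := fun h => h.imp H.left_mem K.left_mem
    right_mem := fun h => h.imp H.right_mem K.right_mem }⟩

@[simp] theorem sup_verts (H K : VDigraph V) : (H ⊔ K).verts = H.verts ∪ K.verts := rfl

@[simp] theorem sup_adj (H K : VDigraph V) (u v : V) :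
    (H ⊔ K).Adj u v ↔ H.Adj u v ∨ K.Adj u v := Iff.rfl

theorem sup_comm' (H K : VDigraph V) : H ⊔ K = K ⊔ H := by
  ext <;> simp [or_comm]

theorem sup_assoc' (H K L : VDigraph V) : H ⊔ K ⊔ L = H ⊔ (K ⊔ L) := by
  ext <;> simp [or_assoc]

theorem le_sup_left' (H K : VDigraph V) : H ≤ H ⊔ K :=
  ⟨fun _ h => Or.inl h, fun _ _ h => Or.inl h⟩

theorem le_sup_right' (H K : VDigraph V) : K ≤ H ⊔ K :=
  ⟨fun _ h => Or.inr h, fun _ _ h => Or.inr h⟩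

theorem sup_le' {H K L : VDigraph V} (h : H ≤ L) (h' : K ≤ L) : H ⊔ K ≤ L :=
  ⟨Set.union_subset h.1 h'.1, fun _ _ e => e.elim (h.2 _ _) (h'.2 _ _)⟩

theorem sup_le_sup' {H K H' K' : VDigraph V} (h : H ≤ H') (h' : K ≤ K') : H ⊔ K ≤ H' ⊔ K' :=
  sup_le' (le_trans' h (le_sup_left' _ _)) (le_trans' h' (le_sup_right' _ _))

/-- `H` has no loops. -/
def Loopless (H : VDigraph V) : Prop := ∀ v, ¬ H.Adj v v

theorem Loopless.mono {H K : VDigraph V} (hK : K.Loopless) (h : H ≤ K) : H.Loopless :=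
  fun v e => hK v (h.2 _ _ e)

theorem Loopless.sup {H K : VDigraph V} (hH : H.Loopless) (hK : K.Loopless) :
    (H ⊔ K).Loopless := fun v e => e.elim (hH v) (hK v)

/-- The subgraph of `H` induced by the set `S`. -/
def ind (H : VDigraph V) (S : Set V) : VDigraph V where
  verts := H.verts ∩ S
  Adj u v := H.Adj u v ∧ u ∈ S ∧ v ∈ S
  left_mem h := ⟨H.left_mem h.1, h.2.1⟩
  right_mem h := ⟨H.right_mem h.1, h.2.2⟩

theorem ind_le (H : VDigraph V) (S : Set V) : H.ind S ≤ H :=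
  ⟨Set.inter_subset_left, fun _ _ h => h.1⟩

/-- `v` is reachable from `u` in `H`. -/
def Reach (H : VDigraph V) (u v : V) : Prop := ReflTransGen H.Adj u v

theorem Reach.refl {H : VDigraph V} (u : V) : H.Reach u u := ReflTransGen.refl

theorem Reach.trans {H : VDigraph V} {u v w : V} (h : H.Reach u v) (h' : H.Reach v w) :
    H.Reach u w := ReflTransGen.trans h h'

theorem Reach.single {H : VDigraph V} {u v : V} (h : H.Adj u v) : H.Reach u v :=
  ReflTransGen.single h

theorem Reach.tail {H : VDigraph V} {u v w : V} (h : H.Reach u v) (h' : H.Adj v w) :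
    H.Reach u w := ReflTransGen.tail h h'

theorem Reach.head {H : VDigraph V} {u v w : V} (h : H.Adj u v) (h' : H.Reach v w) :
    H.Reach u w := ReflTransGen.head h h'

theorem Reach.mono {H K : VDigraph V} {u v : V} (r : H.Reach u v)
    (h : ∀ u v, H.Adj u v → K.Adj u v) : K.Reach u v := by
  induction r with
  | refl => exact .refl _
  | tail _ e ih => exact ih.tail (h _ _ e)

theorem Reach.of_ind {H : VDigraph V} {S : Set V} {u v : V} (r : (H.ind S).Reach u v) :
    H.Reach u v := r.mono fun _ _ h => h.1

theorem Reach.ind_mono {H : VDigraph V} {S S' : Set V} (h : S ⊆ S') {u v : V}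
    (r : (H.ind S).Reach u v) : (H.ind S').Reach u v :=
  r.mono fun _ _ e => ⟨e.1, h e.2.1, h e.2.2⟩

theorem Reach.mem_of_ind {H : VDigraph V} {S : Set V} {u v : V} (r : (H.ind S).Reach u v)
    (hu : u ∈ S) : v ∈ S := by
  induction r with
  | refl => exact hu
  | tail _ h _ => exact h.2.2

theorem Reach.mem_verts {H : VDigraph V} {u v : V} (r : H.Reach u v) (hu : u ∈ H.verts) :
    v ∈ H.verts := by
  induction r with
  | refl => exact hu
  | tail _ h _ => exact H.right_mem h

/-- A set that contains the start and is closed under the edges contains the whole path. -/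
theorem Reach.closed {H : VDigraph V} {S : Set V} {u v : V} (r : H.Reach u v) (hu : u ∈ S)
    (hS : ∀ a b, a ∈ S → H.Adj a b → b ∈ S) : v ∈ S ∧ (H.ind S).Reach u v := by
  induction r with
  | refl => exact ⟨hu, .refl _⟩
  | tail _ h ih => exact ⟨hS _ _ ih.1 h, ih.2.tail ⟨h, ih.1, hS _ _ ih.1 h⟩⟩

theorem Reach.closed_back {H : VDigraph V} {S : Set V} {u v : V} (r : H.Reach u v) (hv : v ∈ S)
    (hS : ∀ a b, b ∈ S → H.Adj a b → a ∈ S) : u ∈ S ∧ (H.ind S).Reach u v := by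
  induction r using ReflTransGen.head_induction_on with
  | refl => exact ⟨hv, .refl _⟩
  | head h _ ih => exact ⟨hS _ _ ih.1 h, .head ⟨h, hS _ _ ih.1 h, ih.1⟩ ih.2⟩

/-- A path into a set has a first vertex in that set. -/
theorem Reach.first_hit {H : VDigraph V} {S : Set V} {u v : V} (r : H.Reach u v) (hu : u ∉ S)
    (hv : v ∈ S) : ∃ y w, (H.ind Sᶜ).Reach u y ∧ y ∉ S ∧ H.Adj y w ∧ w ∈ S ∧ H.Reach w v := by
  induction r using ReflTransGen.head_induction_on with
  | refl => exact absurd hv hu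
  | @head a c h r ih =>
    by_cases hc : c ∈ S
    · exact ⟨a, c, .refl _, hu, h, hc, r⟩
    · obtain ⟨y, w, h1, h2, h3⟩ := ih hc
      exact ⟨y, w, .head ⟨h, hu, hc⟩ h1, h2, h3⟩

/-- A path that starts in a set has a last vertex in that set. -/
theorem Reach.last_exit {H : VDigraph V} {S : Set V} {u v : V} (r : H.Reach u v) (hu : u ∈ S)
    (hv : v ∉ S) : ∃ y w, H.Reach u y ∧ y ∈ S ∧ H.Adj y w ∧ w ∉ S ∧ (H.ind Sᶜ).Reach w v := by
  induction r with
  | refl => exact absurd hu hv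
  | @tail b c r h ih =>
    by_cases hb : b ∈ S
    · exact ⟨b, c, r, hb, h, hv, .refl _⟩
    · obtain ⟨y, w, h1, h2, h3, h4, h5⟩ := ih hb
      exact ⟨y, w, h1, h2, h3, h4, h5.tail ⟨h, hb, hv⟩⟩

theorem Reach.last_visit {H : VDigraph V} {x v : V} (r : H.Reach x v) (hv : v ≠ x) :
    ∃ w, H.Adj x w ∧ w ≠ x ∧ (H.ind {x}ᶜ).Reach w v := by
  obtain ⟨y, w, -, rfl, h1, h2, h3⟩ := r.last_exit (S := {x}) rfl hv
  exact ⟨w, h1, h2, h3⟩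

theorem Reach.first_visit {H : VDigraph V} {x v : V} (r : H.Reach v x) (hv : v ≠ x) :
    ∃ y, (H.ind {x}ᶜ).Reach v y ∧ y ≠ x ∧ H.Adj y x := by
  obtain ⟨y, w, h1, h2, h3, rfl, -⟩ := r.first_hit (S := {x}) hv rfl
  exact ⟨y, h1, h2, h3⟩

/-- A path either avoids `x` or passes through `x`. -/
theorem Reach.avoid_or {H : VDigraph V} {x u v : V} (r : H.Reach u v) (hu : u ≠ x) :
    (H.ind {x}ᶜ).Reach u v ∨ H.Reach u x := by
  induction r with
  | refl => exact .inl (.refl _)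
  | @tail b c r h ih =>
    by_cases hb : b = x
    · subst hb; exact .inr r
    by_cases hc : c = x
    · subst hc; exact .inr (r.tail h)
    exact ih.imp (fun q => q.tail ⟨h, hb, hc⟩) id

/-- The graph with all edges reversed. -/
def rev (H : VDigraph V) : VDigraph V where
  verts := H.verts
  Adj u v := H.Adj v u
  left_mem h := H.right_mem h
  right_mem h := H.left_mem h

@[simp] theorem rev_rev (H : VDigraph V) : H.rev.rev = H := rfl

theorem rev_ind (H : VDigraph V) (S : Set V) : (H.ind S).rev = H.rev.ind S := by
  ext u v
  · rfl
  · simp [rev, ind, and_comm]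

theorem rev_reach (H : VDigraph V) {u v : V} : H.rev.Reach u v ↔ H.Reach v u :=
  reflTransGen_swap

theorem merge_rev (H : VDigraph V) (x y : V) : (H.merge x y).rev = H.rev.merge x y := by
  ext a b
  · rfl
  · simp only [rev, merge]
    constructor
    · rintro ⟨h, a', b', h1, h2, h3⟩
      exact ⟨fun h' => h ⟨h'.2, h'.1⟩, b', a', h1, h3, h2⟩
    · rintro ⟨h, a', b', h1, h2, h3⟩
      exact ⟨fun h' => h ⟨h'.2, h'.1⟩, b', a', h1, h3, h2⟩

/-! ### Reductions that protect a set of vertices -/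

/-- One reduction step: pass to a subgraph, or contract a butterfly contractible edge in such a way
that no vertex of `T` disappears. -/
def Step (T : Set V) (H H' : VDigraph V) : Prop :=
  H' ≤ H ∨ ∃ u v : V, u ≠ v ∧ ((H.IsOnlyInEdge u v ∧ v ∉ T ∧ H' = H.merge u v) ∨
    (H.IsOnlyOutEdge u v ∧ u ∉ T ∧ H' = H.merge v u))

/-- `H'` is obtained from `H` by reduction steps. -/
def Red (T : Set V) (H H' : VDigraph V) : Prop := ReflTransGen (Step T) H H'

theorem Red.refl {T : Set V} (H : VDigraph V) : Red T H H := ReflTransGen.refl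

theorem Red.trans {T : Set V} {H K L : VDigraph V} (h : Red T H K) (h' : Red T K L) : Red T H L :=
  ReflTransGen.trans h h'

theorem Red.of_le {T : Set V} {H K : VDigraph V} (h : K ≤ H) : Red T H K :=
  ReflTransGen.single (.inl h)

theorem Step.rev {T : Set V} {H K : VDigraph V} (h : Step T H K) : Step T H.rev K.rev := by
  rcases h with h | ⟨u, v, huv, ⟨h, hT, rfl⟩ | ⟨h, hT, rfl⟩⟩
  · exact .inl ⟨h.1, fun u v => h.2 v u⟩
  · exact .inr ⟨v, u, huv.symm, .inr ⟨h, hT, merge_rev _ _ _⟩⟩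
  · exact .inr ⟨v, u, huv.symm, .inl ⟨h, hT, merge_rev _ _ _⟩⟩

theorem Red.rev {T : Set V} {H K : VDigraph V} (h : Red T H K) : Red T H.rev K.rev := by
  induction h with
  | refl => exact .refl _
  | tail _ h ih => exact ih.trans (ReflTransGen.single h.rev)

theorem mergeMap_self (x y : V) : mergeMap x y x = x := by unfold mergeMap; split <;> rfl

theorem mergeMap_of_ne {x y z : V} (h : z ≠ y) : mergeMap x y z = z := if_neg h

theorem mergeMap_right (x y : V) : mergeMap x y y = x := if_pos rfl

theorem mergeMap_mem {x y z : V} {S : Set V} (hx : x ∈ S) (hz : z ∈ S) : mergeMap x y z ∈ S := by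
  unfold mergeMap; split <;> assumption

theorem mergeMap_eq {x y z : V} : mergeMap x y z = z ∨ (z = y ∧ mergeMap x y z = x) := by
  unfold mergeMap; split <;> simp [*]

theorem Step.verts {T : Set V} {H K : VDigraph V} (h : Step T H K) : K.verts ⊆ H.verts := by
  rcases h with h | ⟨u, v, huv, ⟨h, hT, rfl⟩ | ⟨h, hT, rfl⟩⟩
  · exact h.1
  · rintro _ ⟨z, hz, rfl⟩; exact mergeMap_mem (H.left_mem h.1) hz
  · rintro _ ⟨z, hz, rfl⟩; exact mergeMap_mem (H.right_mem h.1) hz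

theorem Red.verts {T : Set V} {H K : VDigraph V} (h : Red T H K) : K.verts ⊆ H.verts := by
  induction h with
  | refl => exact subset_rfl
  | tail _ h ih => exact h.verts.trans ih

theorem Step.mono {T T' : Set V} {H K : VDigraph V} (h : Step T H K)
    (hT : T' ∩ H.verts ⊆ T) : Step T' H K := by
  rcases h with h | ⟨u, v, huv, ⟨h, h', rfl⟩ | ⟨h, h', rfl⟩⟩
  · exact .inl h
  · exact .inr ⟨u, v, huv, .inl ⟨h, fun hv => h' (hT ⟨hv, H.right_mem h.1⟩), rfl⟩⟩
  · exact .inr ⟨u, v, huv, .inr ⟨h, fun hv => h' (hT ⟨hv, H.left_mem h.1⟩), rfl⟩⟩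

theorem Red.mono {T T' : Set V} {H K : VDigraph V} (h : Red T H K)
    (hT : T' ∩ H.verts ⊆ T) : Red T' H K := by
  induction h with
  | refl => exact .refl _
  | tail r h ih =>
    exact ih.trans (ReflTransGen.single (h.mono fun x hx => hT ⟨hx.1, Red.verts r hx.2⟩))

/-- Merging fixes every vertex of `R`. Looplessness is needed because `merge` discards a loop at `x`
even if it comes from `R`. -/
theorem merge_sup {H R : VDigraph V} {x y : V} (hR : R.Loopless) (hy : y ∉ R.verts) :
    (H ⊔ R).merge x y = H.merge x y ⊔ R := by
  have key : ∀ z ∈ R.verts, mergeMap x y z = z := fun z hz =>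
    mergeMap_of_ne fun h => hy (h ▸ hz)
  ext a b
  · simp only [merge, sup_verts, Set.image_union, Set.mem_union]
    refine or_congr Iff.rfl ⟨?_, fun h => ⟨a, h, key a h⟩⟩
    rintro ⟨z, hz, rfl⟩
    rwa [key z hz]
  · simp only [merge, sup_adj]
    constructor
    · rintro ⟨h, a', b', h1 | h1, h2, h3⟩
      · exact .inl ⟨h, a', b', h1, h2, h3⟩
      · rw [key _ (R.left_mem h1)] at h2
        rw [key _ (R.right_mem h1)] at h3
        subst h2 h3; exact .inr h1
    · rintro (⟨h, a', b', h1, h2, h3⟩ | h1)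
      · exact ⟨h, a', b', .inl h1, h2, h3⟩
      · refine ⟨?_, a, b, .inr h1, key _ (R.left_mem h1), key _ (R.right_mem h1)⟩
        rintro ⟨rfl, rfl⟩
        exact hR _ h1

/-- The vertex that disappears is unprotected, hence not in `R`. So `R` contributes no edge at it,
and the contracted edge is still contractible in the union. -/
theorem Step.frame {T : Set V} {H K R : VDigraph V} (h : Step T H K) (hR : R.Loopless)
    (hT : H.verts ∩ R.verts ⊆ T) : Step (T ∪ R.verts) (H ⊔ R) (K ⊔ R) := by
  rcases h with h | ⟨u, v, huv, ⟨h, h', rfl⟩ | ⟨h, h', rfl⟩⟩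
  · exact .inl (sup_le_sup' h (le_refl' _))
  · have hv : v ∉ R.verts := fun hv => h' (hT ⟨H.right_mem h.1, hv⟩)
    refine .inr ⟨u, v, huv, .inl ⟨⟨.inl h.1, ?_⟩, ?_, (merge_sup hR hv).symm⟩⟩
    · rintro w (hw | hw)
      · exact h.2 w hw
      · exact absurd (R.right_mem hw) hv
    · rintro (h1 | h1)
      · exact h' h1
      · exact hv h1
  · have hv : u ∉ R.verts := fun hv => h' (hT ⟨H.left_mem h.1, hv⟩)
    refine .inr ⟨u, v, huv, .inr ⟨⟨.inl h.1, ?_⟩, ?_, (merge_sup hR hv).symm⟩⟩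
    · rintro w (hw | hw)
      · exact h.2 w hw
      · exact absurd (R.left_mem hw) hv
    · rintro (h1 | h1)
      · exact h' h1
      · exact hv h1

/-- Reductions of `H` can be carried out in `H ⊔ R` if the common vertices are protected. -/
theorem Red.frame {T : Set V} {H K R : VDigraph V} (h : Red T H K) (hR : R.Loopless)
    (hT : H.verts ∩ R.verts ⊆ T) : Red (T ∪ R.verts) (H ⊔ R) (K ⊔ R) := by
  induction h with
  | refl => exact .refl _
  | tail r h ih =>
    exact ih.trans (ReflTransGen.single
      (h.frame hR fun x hx => hT ⟨Red.verts r hx.1, hx.2⟩))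

/-- A deletion after a contraction can be carried out before it. If the merged vertex survives in
`C`, pull `C` back to `A` and keep the edges between `x` and `y`; an only incoming or outgoing edge
remains one in a subgraph. Otherwise `C` contains neither `x` nor `y` and is already a subgraph of
`A`. -/
theorem contractsTo_of_le {A B C : VDigraph V} (h : A.ContractsTo B) (hC : C ≤ B) :
    ∃ A', A' ≤ A ∧ (A' = C ∨ A'.ContractsTo C) := by
  have aux : ∀ x y : V, x ≠ y → B = A.merge x y → ∃ A', A' ≤ A ∧
      (A' = C ∨ (C = A'.merge x y ∧ (A.Adj x y → A'.Adj x y) ∧ (A.Adj y x → A'.Adj y x))) := by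
    rintro x y hxy rfl
    by_cases hx : x ∈ C.verts
    · let A' : VDigraph V :=
        { verts := {v | v ∈ A.verts ∧ mergeMap x y v ∈ C.verts}
          Adj := fun v w => A.Adj v w ∧ (C.Adj (mergeMap x y v) (mergeMap x y w) ∨
            (v = x ∧ w = y) ∨ (v = y ∧ w = x))
          left_mem := by
            rintro u v ⟨e, h1 | ⟨rfl, rfl⟩ | ⟨rfl, rfl⟩⟩
            · exact ⟨A.left_mem e, C.left_mem h1⟩
            · exact ⟨A.left_mem e, by rwa [mergeMap_self]⟩
            · exact ⟨A.left_mem e, by rwa [mergeMap_right]⟩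
          right_mem := by
            rintro u v ⟨e, h1 | ⟨rfl, rfl⟩ | ⟨rfl, rfl⟩⟩
            · exact ⟨A.right_mem e, C.right_mem h1⟩
            · exact ⟨A.right_mem e, by rwa [mergeMap_right]⟩
            · exact ⟨A.right_mem e, by rwa [mergeMap_self]⟩ }
      refine ⟨A', ⟨fun v hv => hv.1, fun _ _ h => h.1⟩, .inr ⟨?_, fun h => ⟨h, .inr (.inl ⟨rfl, rfl⟩)⟩,
        fun h => ⟨h, .inr (.inr ⟨rfl, rfl⟩)⟩⟩⟩
      ext a b
      · constructor
        · intro ha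
          obtain ⟨z, hz, rfl⟩ := hC.1 ha
          exact ⟨z, ⟨hz, ha⟩, rfl⟩
        · rintro ⟨z, hz, rfl⟩
          exact hz.2
      · constructor
        · intro hab
          obtain ⟨h1, a', b', h2, rfl, rfl⟩ := hC.2 _ _ hab
          exact ⟨h1, a', b', ⟨h2, .inl hab⟩, rfl, rfl⟩
        · rintro ⟨h1, a', b', ⟨h2, h3 | ⟨rfl, rfl⟩ | ⟨rfl, rfl⟩⟩, rfl, rfl⟩
          · exact h3
          · exact absurd ⟨mergeMap_self _ _, mergeMap_right _ _⟩ h1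
          · exact absurd ⟨mergeMap_right _ _, mergeMap_self _ _⟩ h1
    · have key : ∀ z, mergeMap x y z ∈ C.verts → mergeMap x y z = z := by
        intro z hz
        rcases mergeMap_eq (x := x) (y := y) (z := z) with h | ⟨_, h⟩
        · exact h
        · exact absurd (h ▸ hz) hx
      refine ⟨C, ⟨?_, ?_⟩, .inl rfl⟩
      · intro v hv
        obtain ⟨z, hz, rfl⟩ := hC.1 hv
        rwa [key z hv]
      · intro a b hab
        obtain ⟨-, a', b', h2, rfl, rfl⟩ := hC.2 _ _ hab
        rwa [key a' (C.left_mem hab), key b' (C.right_mem hab)]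
  obtain ⟨u, v, huv, ⟨h, hB⟩ | ⟨h, hB⟩⟩ := h
  · obtain ⟨A', hA', h1 | ⟨h1, h2, -⟩⟩ := aux u v huv hB
    · exact ⟨A', hA', .inl h1⟩
    · exact ⟨A', hA', .inr ⟨u, v, huv, .inl ⟨⟨h2 h.1, fun w hw => h.2 w (hA'.2 _ _ hw)⟩, h1⟩⟩⟩
  · obtain ⟨A', hA', h1 | ⟨h1, -, h2⟩⟩ := aux v u huv.symm hB
    · exact ⟨A', hA', .inl h1⟩
    · exact ⟨A', hA', .inr ⟨u, v, huv, .inr ⟨⟨h2 h.1, fun w hw => h.2 w (hA'.2 _ _ hw)⟩, h1⟩⟩⟩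

theorem contracts_of_le {A B C : VDigraph V} (h : ReflTransGen ContractsTo A B) (hC : C ≤ B) :
    ∃ A', A' ≤ A ∧ ReflTransGen ContractsTo A' C := by
  induction h generalizing C with
  | refl => exact ⟨C, hC, .refl⟩
  | tail r h ih =>
    obtain ⟨A', h1, rfl | h2⟩ := contractsTo_of_le h hC
    · exact ih h1
    · obtain ⟨A'', h3, h4⟩ := ih h1
      exact ⟨A'', h3, h4.tail h2⟩

/-- Reductions produce butterfly minors. -/
theorem Red.isButterflyMinorOf {T : Set V} {H K : VDigraph V} {D : Digraph V} (h : Red T H K)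
    (hD : H.IsSubgraphOf D) : K.IsButterflyMinorOf D := by
  induction h with
  | refl => exact ⟨H, hD, .refl⟩
  | tail _ h ih =>
    obtain ⟨H₀, h0, hc⟩ := ih
    rcases h with h | ⟨u, v, huv, ⟨h, -, rfl⟩ | ⟨h, -, rfl⟩⟩
    -- A butterfly minor starts with a subgraph and then only contracts, so this deletion is moved
    -- in front of all earlier contractions.
    · obtain ⟨A', h1, h2⟩ := contracts_of_le hc h
      exact ⟨A', fun u v e => h0 u v (h1.2 _ _ e), h2⟩
    · exact ⟨H₀, h0, hc.tail ⟨u, v, huv, .inl ⟨h, rfl⟩⟩⟩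
    · exact ⟨H₀, h0, hc.tail ⟨u, v, huv, .inr ⟨h, rfl⟩⟩⟩

/-! ### Contracting branchings to their roots -/

/-- The graph obtained from `H` by contracting an out-branching of `O` with root `q` to `q`: the
edges into `O \ {q}` are deleted, and the edges that leave `O` now start at `q`. -/
def outCollapse (H : VDigraph V) (q : V) (O : Set V) : VDigraph V where
  verts := (H.verts \ O) ∪ {q}
  Adj v w := (v ∉ O ∧ w ∉ O ∧ H.Adj v w) ∨ (v ∉ O ∧ w = q ∧ H.Adj v q) ∨
    (v = q ∧ w ∉ O ∧ ∃ o ∈ O, H.Adj o w)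
  left_mem := by
    rintro u v (⟨h1, h2, h3⟩ | ⟨h1, rfl, h3⟩ | ⟨rfl, h2, h3⟩)
    · exact .inl ⟨H.left_mem h3, h1⟩
    · exact .inl ⟨H.left_mem h3, h1⟩
    · exact .inr rfl
  right_mem := by
    rintro u v (⟨h1, h2, h3⟩ | ⟨h1, rfl, h3⟩ | ⟨rfl, h2, o, ho, h3⟩)
    · exact .inl ⟨H.right_mem h3, h2⟩
    · exact .inr rfl
    · exact .inl ⟨H.right_mem h3, h2⟩

/-- Induction on the size of `O`. An out-neighbour `o` of `q` in `O` can be contracted into `q` once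
all other edges into `o` are deleted. Afterwards `q` still reaches the rest of `O` inside `O`,
because paths through `o` now pass through `q`. -/
theorem Red.outCollapse {T : Set V} {H : VDigraph V} {q : V} {O : Set V} (hfin : O.Finite)
    (hq : q ∈ O) (hqH : q ∈ H.verts) (hO : ∀ o ∈ O, (H.ind O).Reach q o) (hT : T ∩ O ⊆ {q}) :
    Red T H (H.outCollapse q O) := by
  induction hn : O.ncard generalizing H O with
  | zero =>
    rw [Set.ncard_eq_zero hfin] at hn
    simp [hn] at hq
  | succ n ih =>
    by_cases hO1 : O = {q}
    · subst hO1
      refine Red.of_le ⟨?_, ?_⟩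
      · rintro v (hv | rfl)
        · exact hv.1
        · exact hqH
      · rintro u v (⟨h1, h2, h3⟩ | ⟨h1, rfl, h3⟩ | ⟨rfl, h2, o, rfl, h3⟩) <;> exact h3
    obtain ⟨o', ho', hne⟩ : ∃ o' ∈ O, o' ≠ q := by
      by_contra! hcon
      exact hO1 (Set.eq_singleton_iff_unique_mem.2 ⟨hq, hcon⟩)
    obtain ⟨o, ho, hoq, -⟩ := (hO o' ho').last_visit hne
    let H1 : VDigraph V :=
      { verts := H.verts
        Adj := fun v w => H.Adj v w ∧ (w = o → v = q)
        left_mem := fun h => H.left_mem h.1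
        right_mem := fun h => H.right_mem h.1 }
    have hoO : o ∈ O := ho.2.2
    have hqo1 : H1.Adj q o := ⟨ho.1, fun _ => rfl⟩
    have step : Red T H (H1.merge q o) := by
      refine (Red.of_le (K := H1) (show H1 ≤ H from ⟨subset_rfl, fun _ _ h => h.1⟩)).trans (ReflTransGen.single ?_)
      exact .inr ⟨q, o, hoq.symm, .inl ⟨⟨hqo1, fun w hw => hw.2 rfl⟩,
        fun h => hoq (hT ⟨h, hoO⟩), rfl⟩⟩
    have hreach : ∀ w, (H.ind O).Reach q w →
        ((H1.merge q o).ind (O \ {o})).Reach q (mergeMap q o w) := by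
      intro w hw
      induction hw with
      | refl => rw [mergeMap_self]; exact .refl _
      | @tail b c _ h ihw =>
        by_cases hc : c = o
        · subst hc; rw [mergeMap_right]; exact .refl _
        by_cases hcq : c = q
        · subst hcq; rw [mergeMap_self]; exact .refl _
        rw [mergeMap_of_ne hc]
        refine ihw.tail ⟨⟨fun h' => hcq h'.2, b, c, ⟨h.1, fun h' => absurd h' hc⟩, rfl,
          mergeMap_of_ne hc⟩, ?_, h.2.2, hc⟩
        rcases mergeMap_eq (x := q) (y := o) (z := b) with h' | ⟨_, h'⟩
        · rw [h']
          refine ⟨h.2.1, fun hbo : b = o => ?_⟩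
          rw [hbo, mergeMap_right] at h'
          exact hoq h'.symm
        · rw [h']; exact ⟨hq, hoq.symm⟩
    have := ih (H := H1.merge q o) (O := O \ {o}) (hfin.subset Set.sdiff_subset) ⟨hq, hoq.symm⟩
      ⟨q, hqH, mergeMap_self _ _⟩
      (fun w hw => by simpa [mergeMap_of_ne hw.2] using hreach w (hO w hw.1))
      (fun x hx => hT ⟨hx.1, hx.2.1⟩)
      (by rw [Set.ncard_sdiff_singleton_of_mem hoO]; omega)
    refine step.trans (this.trans (Red.of_le ⟨?_, ?_⟩))
    · rintro v (hv | rfl)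
      · exact .inl ⟨⟨v, hv.1, mergeMap_of_ne fun h => hv.2 (h ▸ hoO)⟩, fun h => hv.2 h.1⟩
      · exact .inr rfl
    · have hne' : ∀ {v}, v ∉ O → v ≠ o := fun hv h => hv (h ▸ hoO)
      have hneq : ∀ {v}, v ∉ O → v ≠ q := fun hv h => hv (h ▸ hq)
      rintro u v (⟨h1, h2, h3⟩ | ⟨h1, rfl, h3⟩ | ⟨rfl, h2, p, hp, h3⟩)
      · exact .inl ⟨fun h => h1 h.1, fun h => h2 h.1, fun h => hneq h1 h.1, u, v,
          ⟨h3, fun h => absurd h (hne' h2)⟩, mergeMap_of_ne (hne' h1), mergeMap_of_ne (hne' h2)⟩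
      · exact .inr (.inl ⟨fun h => h1 h.1, rfl, fun h => hneq h1 h.1, u, v,
          ⟨h3, fun h => absurd h hoq.symm⟩, mergeMap_of_ne (hne' h1), mergeMap_self _ _⟩)
      · refine .inr (.inr ⟨rfl, fun h => h2 h.1, mergeMap u o p, ?_, fun h => hneq h2 h.2, p, v,
          ⟨h3, fun h => absurd h (hne' h2)⟩, rfl, mergeMap_of_ne (hne' h2)⟩)
        rcases mergeMap_eq (x := u) (y := o) (z := p) with h' | ⟨_, h'⟩
        · rw [h']
          refine ⟨hp, fun hbo : p = o => ?_⟩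
          rw [hbo, mergeMap_right] at h'
          exact hoq h'.symm
        · rw [h']; exact ⟨hq, hoq.symm⟩

/-- The graph obtained from `H` by contracting an in-branching of `I` with root `q` to `q`. -/
def inCollapse (H : VDigraph V) (q : V) (I : Set V) : VDigraph V := (H.rev.outCollapse q I).rev

theorem inCollapse_adj {H : VDigraph V} {q : V} {I : Set V} {v w : V} :
    (H.inCollapse q I).Adj v w ↔ (v ∉ I ∧ w ∉ I ∧ H.Adj v w) ∨ (v = q ∧ w ∉ I ∧ H.Adj q w) ∨
    (v ∉ I ∧ w = q ∧ ∃ o ∈ I, H.Adj v o) := by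
  simp only [inCollapse, VDigraph.outCollapse, VDigraph.rev]
  tauto

theorem Red.inCollapse {T : Set V} {H : VDigraph V} {q : V} {I : Set V} (hfin : I.Finite)
    (hq : q ∈ I) (hqH : q ∈ H.verts) (hI : ∀ o ∈ I, (H.ind I).Reach o q) (hT : T ∩ I ⊆ {q}) :
    Red T H (H.inCollapse q I) := by
  have := (Red.outCollapse (T := T) (H := H.rev) hfin hq hqH
    (fun o ho => by rw [← rev_ind, rev_reach]; exact hI o ho) hT).rev
  rwa [rev_rev] at this

theorem outCollapse_loopless {H : VDigraph V} (h : H.Loopless) {q : V} {O : Set V} (hq : q ∈ O) :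
    (H.outCollapse q O).Loopless := by
  rintro v (⟨-, -, h3⟩ | ⟨h1, rfl, -⟩ | ⟨rfl, h2, -⟩)
  · exact h v h3
  · exact h1 hq
  · exact h2 hq

theorem inCollapse_loopless {H : VDigraph V} (h : H.Loopless) {q : V} {O : Set V} (hq : q ∈ O) :
    (H.inCollapse q O).Loopless :=
  fun v e => outCollapse_loopless (H := H.rev) (fun v e => h v e) hq v e

theorem Reach.mem_of_ind_back {H : VDigraph V} {S : Set V} {u v : V} (r : (H.ind S).Reach u v)
    (hv : v ∈ S) : u ∈ S := by
  induction r using ReflTransGen.head_induction_on with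
  | refl => exact hv
  | head h _ _ => exact h.2.1

theorem Reach.head_or {H : VDigraph V} {u v : V} (r : H.Reach u v) (h : u ≠ v) :
    ∃ w, H.Adj u w ∧ H.Reach w v := by
  induction r using ReflTransGen.head_induction_on with
  | refl => exact absurd rfl h
  | head e r _ => exact ⟨_, e, r⟩

theorem Reach.mem_verts_left {H : VDigraph V} {u v : V} (r : H.Reach u v) (h : u ≠ v) :
    u ∈ H.verts := by
  obtain ⟨w, hw, -⟩ := r.head_or h
  exact H.left_mem hw

/-- The vertices that `u` reaches are reached within the set of these vertices. -/
theorem Reach.self_reach {H : VDigraph V} {u v : V} (r : H.Reach u v) :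
    (H.ind {w | H.Reach u w}).Reach u v :=
  (r.closed (S := {w | H.Reach u w}) (.refl _) fun _ _ h e => h.tail e).2

theorem Reach.self_reach_ind {H : VDigraph V} {S : Set V} {u v : V} (r : (H.ind S).Reach u v) :
    (H.ind {w | (H.ind S).Reach u w}).Reach u v :=
  r.self_reach.mono fun _ _ e => ⟨e.1.1, e.2⟩

theorem Reach.self_reach_ind_back {H : VDigraph V} {S : Set V} {u v : V}
    (r : (H.ind S).Reach v u) : (H.ind {w | (H.ind S).Reach w u}).Reach v u :=
  (r.closed_back (S := {w | (H.ind S).Reach w u}) (.refl _) fun _ _ h e => h.head e).2.mono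
    fun _ _ e => ⟨e.1.1, e.2⟩

/-! ### Bidirected legs attached to directed paths -/

/-- The graph with the single vertex `v`. -/
def single (v : V) : VDigraph V where
  verts := {v}
  Adj _ _ := False
  left_mem h := h.elim
  right_mem h := h.elim

/-- The graph that consists of the edge `(a, b)`. -/
def edge (a b : V) : VDigraph V where
  verts := {a, b}
  Adj u v := u = a ∧ v = b
  left_mem h := .inl h.1
  right_mem h := .inr h.2

theorem single_le {v : V} {H : VDigraph V} : single v ≤ H ↔ v ∈ H.verts :=
  ⟨fun h => h.1 rfl, fun h => ⟨by rintro _ rfl; exact h, fun _ _ e => e.elim⟩⟩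

theorem edge_le {a b : V} {H : VDigraph V} (h : H.Adj a b) : edge a b ≤ H :=
  ⟨by rintro _ (rfl | rfl); exacts [H.left_mem h, H.right_mem h],
    by rintro _ _ ⟨rfl, rfl⟩; exact h⟩

theorem edge_loopless {a b : V} (h : a ≠ b) : (edge a b).Loopless :=
  fun _ e => h (e.1.symm.trans e.2)

theorem single_loopless (a : V) : (single a).Loopless := fun _ e => e

/-- The bidirected path along a list of vertices. -/
def bip : List V → VDigraph V
  | [] => ⟨∅, fun _ _ => False, fun h => h.elim, fun h => h.elim⟩
  | [a] => single a
  | a :: b :: l => edge a b ⊔ edge b a ⊔ bip (b :: l)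

theorem bip_cons_cons (a b : V) (l : List V) :
    bip (a :: b :: l) = edge a b ⊔ edge b a ⊔ bip (b :: l) := rfl

@[simp] theorem bip_verts (l : List V) : (bip l).verts = {v | v ∈ l} := by
  induction l with
  | nil => simp [bip]
  | cons a l ih =>
    cases l with
    | nil => ext; simp [bip, single]
    | cons b l =>
      rw [bip_cons_cons, sup_verts, ih]
      ext v; simp [edge]; tauto

theorem bip_loopless {l : List V} (h : l.Nodup) : (bip l).Loopless := by
  induction l with
  | nil => exact fun _ e => e
  | cons a l ih =>
    cases l with
    | nil => exact single_loopless a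
    | cons b l =>
      have hab : a ≠ b := fun hab => by simp [hab] at h
      exact ((edge_loopless hab).sup (edge_loopless hab.symm)).sup (ih h.of_cons)

theorem ncard_lt_of_le {H K : VDigraph V} (hK : K.verts.Finite) (h : H.verts ⊆ K.verts) {x : V}
    (hx : x ∈ K.verts) (hx' : x ∉ H.verts) : H.verts.ncard < K.verts.ncard :=
  Set.ncard_lt_ncard ⟨h, fun h' => hx' (h' hx)⟩ hK

theorem ind_loopless {H : VDigraph V} (h : H.Loopless) (S : Set V) : (H.ind S).Loopless :=
  h.mono (ind_le _ _)

theorem outCollapse_verts_subset {H : VDigraph V} {q : V} (hq : q ∈ H.verts) (O : Set V) :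
    (H.outCollapse q O).verts ⊆ H.verts := by
  rintro v (hv | rfl)
  exacts [hv.1, hq]

theorem inCollapse_verts_subset {H : VDigraph V} {q : V} (hq : q ∈ H.verts) (O : Set V) :
    (H.inCollapse q O).verts ⊆ H.verts := by
  rintro v (hv | rfl)
  exacts [hv.1, hq]

/-- A vertex `u` on a route from `s` to `t` through other vertices can be attached by a bidirected
path to a path of length two from `s` to `t`. -/
theorem pairLeg_aux (n : ℕ) : ∀ (H : VDigraph V) (s t u : V), H.verts.Finite → H.Loopless →
    H.verts.ncard ≤ n → u ≠ s → u ≠ t →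
    (∃ x, H.Adj s x ∧ (H.ind {s, t}ᶜ).Reach x u) →
    (∃ y, (H.ind {s, t}ᶜ).Reach u y ∧ H.Adj y t) →
    ∃ c l, (c :: l).Nodup ∧ (c :: l).getLast (by simp) = u ∧
      (∀ v ∈ c :: l, v ∈ H.verts ∧ v ≠ s ∧ v ≠ t) ∧
      Red {s, t, u} H (edge s c ⊔ edge c t ⊔ bip (c :: l)) := by
  induction n with
  | zero =>
    rintro H s t u hfin - hn - - ⟨x, hx, -⟩
    have : H.verts = ∅ := (Set.ncard_eq_zero hfin).1 (by omega)
    simpa [this] using H.left_mem hx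
  | succ n ih =>
    rintro H s t u hfin hloop hn hus hut ⟨x, hsx, hxu⟩ ⟨y, huy, hyt⟩
    have huQ : u ∈ ({s, t}ᶜ : Set V) := by simp [hus, hut]
    have hxQ := hxu.mem_of_ind_back huQ
    have hxs : x ≠ s := fun h => hxQ (by simp [h])
    have hxt : x ≠ t := fun h => hxQ (by simp [h])
    have hxH := H.right_mem hsx
    have hsH := H.left_mem hsx
    have huH : u ∈ H.verts := hxu.of_ind.mem_verts hxH
    by_cases hxeq : x = u
    · subst hxeq
      refine ⟨x, [], by simp, rfl, by simp [hxH, hxs, hxt], ?_⟩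
      -- With the edge from `s` leading to `u` itself, collapsing into `u` everything that `u`
      -- reaches outside `{s, t}` produces the path from `s` through `u` to `t`. The leg is trivial.
      set O := {w | (H.ind {s, t}ᶜ).Reach x w} with hO
      have hOQ : O ⊆ {s, t}ᶜ := fun w hw => hw.mem_of_ind huQ
      have hsO : s ∉ O := fun h => hOQ h (by simp)
      have htO : t ∉ O := fun h => hOQ h (by simp)
      have hxO : x ∈ O := .refl _
      refine (Red.outCollapse (q := x) (O := O)
        (hfin.subset fun w hw => hw.of_ind.mem_verts huH) hxO hxH
        (fun o ho => ho.self_reach_ind) ?_).trans (Red.of_le ?_)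
      · rintro w ⟨rfl | rfl | rfl, hw⟩
        · exact absurd hw hsO
        · exact absurd hw htO
        · rfl
      · refine sup_le' (sup_le' (edge_le (.inr (.inl ⟨hsO, rfl, hsx⟩)))
          (edge_le (.inr (.inr ⟨rfl, htO, y, huy, hyt⟩)))) (single_le.2 (.inr rfl))
    have hux : u ≠ x := Ne.symm hxeq
    obtain ⟨w, hxw, hwx, hwu⟩ := hxu.last_visit hux
    -- If `u` gets to `t` without `x`, then `x` is not needed and is contracted into `s`, which
    -- receives the edge to `w`. Otherwise `x` separates `u` from `t` and becomes the vertex at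
    -- which the leg is attached.
    by_cases hyes : ∃ y, ((H.ind {s, t}ᶜ).ind {x}ᶜ).Reach u y ∧ H.Adj y t
    · obtain ⟨y', huy', hy't⟩ := hyes
      set H' := H.outCollapse s {s, x} with hH'
      have hred : Red {s, t, u} H H' := by
        refine Red.outCollapse ((Set.finite_singleton x).insert s) (by simp) hsH ?_ ?_
        · rintro o (rfl | rfl)
          · exact .refl _
          · exact .single ⟨hsx, by simp, by simp⟩
        · rintro v ⟨rfl | rfl | rfl, h | h⟩ <;> simp_all
      have hedge : ∀ a b, ((H.ind {s, t}ᶜ).ind {x}ᶜ).Adj a b → (H'.ind {s, t}ᶜ).Adj a b := by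
        rintro a b ⟨⟨h1, h2, h3⟩, h4, h5⟩
        simp only [Set.mem_compl_iff, Set.mem_insert_iff, Set.mem_singleton_iff, not_or] at h2 h3 h4 h5
        exact ⟨.inl ⟨by simp [h2, h4], by simp [h3, h5], h1⟩, by simp [h2], by simp [h3]⟩
      have hsub : H'.verts ⊆ H.verts := outCollapse_verts_subset hsH _
      have hxH' : x ∉ H'.verts := by
        rintro (h | h)
        · exact h.2 (by simp)
        · exact hxs h
      have hlt := ncard_lt_of_le hfin hsub hxH hxH'
      have hwQ := hxw.2.2
      simp only [Set.mem_compl_iff, Set.mem_insert_iff, Set.mem_singleton_iff, not_or] at hwQ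
      have hy'x : y' ≠ x := huy'.mem_of_ind hux
      have hy'Q : y' ∈ ({s, t}ᶜ : Set V) := huy'.of_ind.mem_of_ind huQ
      simp only [Set.mem_compl_iff, Set.mem_insert_iff, Set.mem_singleton_iff, not_or] at hy'Q
      obtain ⟨c, l, h1, h2, h3, h4⟩ := ih H' s t u (hfin.subset hsub)
        (outCollapse_loopless hloop (by simp)) (by omega) hus hut
        ⟨w, .inr (.inr ⟨rfl, by simp [hwQ.1, hwx], x, by simp, hxw.1⟩), hwu.mono hedge⟩
        ⟨y', huy'.mono hedge, by
          by_cases hts : t = s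
          · exact .inr (.inl ⟨by simp [hy'Q.1, hy'x], hts, hts ▸ hy't⟩)
          · exact .inl ⟨by simp [hy'Q.1, hy'x], by simp [hts, hxt.symm], hy't⟩⟩
      exact ⟨c, l, h1, h2, fun v hv => ⟨hsub (h3 v hv).1, (h3 v hv).2⟩, hred.trans h4⟩
    -- `R` is the side of `u`. Collapsing into `x` what it reaches outside `R` yields the path from
    -- `s` through `x` to `t`. In `{x} ∪ R` the vertex `u` lies on a closed walk through `x`, so the
    -- induction hypothesis with both `s` and `t` equal to `x` attaches the leg; the graph is
    -- smaller because it misses the old `s`.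
    · set R : Set V := {v | ((H.ind {s, t}ᶜ).ind {x}ᶜ).Reach u v} with hR
      have hRQ : ∀ v ∈ R, v ≠ s ∧ v ≠ t ∧ v ≠ x := fun v hv => by
        have h1 := hv.of_ind.mem_of_ind huQ
        have h2 := hv.mem_of_ind hux
        simp only [Set.mem_compl_iff, Set.mem_insert_iff, Set.mem_singleton_iff, not_or] at h1 h2
        exact ⟨h1.1, h1.2, h2⟩
      have hRcl : ∀ a b, a ∈ R → (H.ind {s, t}ᶜ).Adj a b → b ≠ x → b ∈ R := fun a b ha hab hb =>
        Reach.tail ha ⟨hab, (hRQ a ha).2.2, hb⟩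
      set O : Set V := {v | (H.ind ({s, t}ᶜ \ R)).Reach x v} with hO
      have hxR : x ∉ R := fun h => (hRQ x h).2.2 rfl
      have hxQR : x ∈ ({s, t}ᶜ \ R : Set V) := ⟨hxQ, hxR⟩
      have hOQ : O ⊆ {s, t}ᶜ \ R := fun w hw => hw.mem_of_ind hxQR
      have hsO : s ∉ O := fun h => (hOQ h).1 (by simp)
      have htO : t ∉ O := fun h => (hOQ h).1 (by simp)
      have hRO : ∀ v ∈ R, v ∉ O := fun v hv h => (hOQ h).2 hv
      have hxO : x ∈ O := .refl _
      have hOcl : ∀ a b, a ∈ O → H.Adj a b → b ∈ ({s, t}ᶜ \ R : Set V) → b ∈ O :=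
        fun a b ha hab hb => Reach.tail ha ⟨hab, hOQ ha, hb⟩
      set H' := H.outCollapse x O with hH'
      have hred : Red {s, t, u} H H' := by
        refine Red.outCollapse (hfin.subset fun w hw => hw.of_ind.mem_verts hxH) hxO hxH
          (fun o ho => ho.self_reach_ind) ?_
        rintro w ⟨rfl | rfl | rfl, hw⟩
        · exact absurd hw hsO
        · exact absurd hw htO
        · exact absurd hw (hRO _ (Reach.refl _))
      have hsx' : H'.Adj s x := .inr (.inl ⟨hsO, rfl, hsx⟩)
      -- the vertex `u` reaches `t` only through `x`
      have hux' : (H.ind {s, t}ᶜ).Reach u x := by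
        rcases huy.avoid_or hux with h | h
        · exact absurd ⟨y, h, hyt⟩ hyes
        · exact h
      have hxy : (H.ind ({s, t}ᶜ \ R)).Reach x y := by
        by_cases hyx : y = x
        · rw [hyx]; exact .refl _
        have hyR : y ∉ R := fun h => hyes ⟨y, h, hyt⟩
        have hxy : (H.ind {s, t}ᶜ).Reach x y := by
          rcases huy.closed_back (S := {v | (H.ind {s, t}ᶜ).Reach v y}) (.refl _)
            (fun _ _ h e => h.head e) with ⟨h, -⟩
          by_contra hcon
          have : ∀ v, (H.ind {s, t}ᶜ).Reach u v → (H.ind {s, t}ᶜ).Reach v y →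
              ((H.ind {s, t}ᶜ).ind {x}ᶜ).Reach u v := by
            intro v h1 h2
            induction h1 with
            | refl => exact .refl _
            | @tail b c h3 h4 ih =>
              have hb : b ≠ x := fun hb => hcon (hb ▸ h2.head h4)
              have hc : c ≠ x := fun hc => hcon (hc ▸ h2)
              exact (ih (h2.head h4)).tail ⟨h4, hb, hc⟩
          exact hyR (this y huy (.refl _))
        -- After its last visit to `x` the path to `y` avoids `R`; a vertex of `R` on it would give
        -- a way from `u` to `y` without `x`.
        obtain ⟨z, hxz, hzx, hzy⟩ := hxy.last_visit hyx
        have key : ∀ v, ((H.ind {s, t}ᶜ).ind {x}ᶜ).Reach v y → v ∉ R := fun v hv h =>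
          hyR (Reach.trans h hv)
        have := hzy.closed_back (S := {v | ((H.ind {s, t}ᶜ).ind {x}ᶜ).Reach v y}) (.refl _)
          (fun _ _ h e => h.head e)
        refine Reach.head ⟨hxz.1, hxQR, hxz.2.2, key z this.1⟩ (this.2.mono ?_)
        rintro a b ⟨h1, h2, h3⟩
        exact ⟨h1.1.1, ⟨h1.1.2.1, key a h2⟩, h1.1.2.2, key b h3⟩
      have hxt' : H'.Adj x t := .inr (.inr ⟨rfl, htO, y, hxy, hyt⟩)
      set K := H'.ind ({x} ∪ R) with hK
      have hRadj : ∀ a b, a ∈ R → b ∈ R → H.Adj a b → K.Adj a b := fun a b ha hb hab =>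
        ⟨.inl ⟨hRO a ha, hRO b hb, hab⟩, .inr ha, .inr hb⟩
      have hRadj' : ∀ a b, ((H.ind {s, t}ᶜ).ind {x}ᶜ).Adj a b → a ∈ R → (K.ind {x, x}ᶜ).Adj a b := by
        intro a b hab ha
        have hb := hRcl a b ha hab.1 hab.2.2
        exact ⟨hRadj a b ha hb hab.1.1, by simp [(hRQ a ha).2.2], by simp [(hRQ b hb).2.2]⟩
      have hRreach : ∀ a b, a ∈ R → ((H.ind {s, t}ᶜ).ind {x}ᶜ).Reach a b →
          (K.ind {x, x}ᶜ).Reach a b := by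
        intro a b ha hab
        exact (hab.closed ha fun c d hc e => Reach.tail hc e).2.mono
          fun c d e => hRadj' c d e.1 e.2.1
      have hlt : K.verts.ncard ≤ n := by
        have := ncard_lt_of_le (H := K) (x := s) hfin
          (fun v hv => outCollapse_verts_subset hxH _ hv.1) hsH (by
            rintro ⟨-, h | h⟩
            · exact hxs h.symm
            · exact (hRQ _ h).1 rfl)
        omega
      obtain ⟨c, l, h1, h2, h3, h4⟩ := ih K x x u
        (hfin.subset fun v hv => outCollapse_verts_subset hxH _ hv.1)
        (ind_loopless (outCollapse_loopless hloop hxO) _) hlt hux hux (by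
          by_cases hwR : w ∈ R
          · exact ⟨w, ⟨.inr (.inr ⟨rfl, hRO w hwR, x, hxO, hxw.1⟩), by simp, .inr hwR⟩,
              hRreach w u hwR hwu⟩
          · obtain ⟨y, z, h1, h2, h3, h4, h5⟩ := hwu.first_hit (S := R) hwR (Reach.refl _)
            have hyO : y ∈ O := by
              refine Reach.head ⟨hxw.1, hxQR, hxw.2.2, hwR⟩ ?_
              exact h1.mono fun a b e => ⟨e.1.1.1, ⟨e.1.1.2.1, e.2.1⟩, e.1.1.2.2, e.2.2⟩
            exact ⟨z, ⟨.inr (.inr ⟨rfl, hRO z h4, y, hyO, h3.1.1⟩), by simp, .inr h4⟩,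
              hRreach z u h4 h5⟩) (by
          obtain ⟨z, h1, h2, h3⟩ := hux'.first_visit hux
          have hzR : z ∈ R := h1
          exact ⟨z, hRreach u z (Reach.refl _) h1,
            ⟨.inr (.inl ⟨hRO z hzR, rfl, h3.1⟩), .inr hzR, by simp⟩⟩)
      refine ⟨x, c :: l, ?_, ?_, ?_, ?_⟩
      · refine List.nodup_cons.2 ⟨fun h => (h3 x h).2.1 rfl, h1⟩
      · rw [List.getLast_cons (by simp)]; exact h2
      · intro v hv
        rcases List.mem_cons.1 hv with rfl | hv
        · exact ⟨hxH, hxs, hxt⟩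
        · have := (h3 v hv).1
          refine ⟨outCollapse_verts_subset hxH _ this.1, ?_⟩
          rcases this.2 with h | h
          · exact absurd h (h3 v hv).2.1
          · exact ⟨(hRQ v h).1, (hRQ v h).2.1⟩
      · have hR' : (edge s x ⊔ edge x t).Loopless :=
          (edge_loopless hxs.symm).sup (edge_loopless hxt)
        have hint : K.verts ∩ (edge s x ⊔ edge x t).verts ⊆ {x, x, u} := by
          rintro v ⟨⟨-, h | h⟩, h'⟩
          · simp only [Set.mem_singleton_iff] at h; simp [h]
          · obtain ⟨ha, hb, hc⟩ := hRQ v h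
            simp [edge, ha, hb, hc] at h'
        refine hred.trans ((Red.of_le (K := K ⊔ (edge s x ⊔ edge x t)) ?_).trans
          (((h4.frame hR' hint).mono ?_).trans (Red.of_le ?_)))
        · exact sup_le' (ind_le _ _) (sup_le' (edge_le hsx') (edge_le hxt'))
        · rintro v ⟨rfl | rfl | rfl, h⟩ <;> simp [edge]
        · refine sup_le' (le_sup_right' _ _) ?_
          rw [bip_cons_cons]
          exact le_sup_left' _ _

/-- The vertices `s` and `t` may coincide. Then the two edges at `c` form a bidirected edge, and the
result is a bidirected path from `s` to `u`. -/
theorem pairLeg {H : VDigraph V} {s t u : V} (hfin : H.verts.Finite) (hloop : H.Loopless)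
    (hs : u ≠ s) (ht : u ≠ t) (h : ∃ x, H.Adj s x ∧ (H.ind {s, t}ᶜ).Reach x u)
    (h' : ∃ y, (H.ind {s, t}ᶜ).Reach u y ∧ H.Adj y t) :
    ∃ c l, (c :: l).Nodup ∧ (c :: l).getLast (by simp) = u ∧
      (∀ v ∈ c :: l, v ∈ H.verts ∧ v ≠ s ∧ v ≠ t) ∧
      Red {s, t, u} H (edge s c ⊔ edge c t ⊔ bip (c :: l)) :=
  pairLeg_aux _ H s t u hfin hloop le_rfl hs ht h h'

/-- All vertices on the legs `c :: l` for `(c, l)` in a list. -/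
def legVerts (L : List (V × List V)) : List V := L.flatMap fun p => p.1 :: p.2

@[simp] theorem legVerts_nil : legVerts ([] : List (V × List V)) = [] := rfl

@[simp] theorem legVerts_cons (p : V × List V) (L : List (V × List V)) :
    legVerts (p :: L) = p.1 :: p.2 ++ legVerts L := rfl

/-- The last vertex of a leg. -/
def legEnd (p : V × List V) : V := (p.1 :: p.2).getLast (by simp)

theorem legEnd_mem (p : V × List V) : legEnd p ∈ p.1 :: p.2 := List.getLast_mem _

/-- A directed path from `s` to `t` with bidirected legs attached at its inner vertices. -/
def pathLegs (s : V) : List (V × List V) → V → VDigraph V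
  | [], t => edge s t
  | (c, l) :: L, t => edge s c ⊔ bip (c :: l) ⊔ pathLegs c L t

theorem pathLegs_verts (s : V) (L : List (V × List V)) (t : V) :
    (pathLegs s L t).verts = {s, t} ∪ {v | v ∈ legVerts L} := by
  induction L generalizing s with
  | nil => ext; simp [pathLegs, edge]
  | cons p L ih =>
    obtain ⟨c, l⟩ := p
    ext v
    simp only [pathLegs, sup_verts, ih, bip_verts, edge, legVerts_cons, Set.mem_union,
      Set.mem_insert_iff, Set.mem_singleton_iff, Set.mem_ofPred_eq, List.mem_append, List.mem_cons]
    tauto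

/-- Vertices that are visited in a fixed order, without a way back, on the way from `s` to `t` can
be attached by bidirected legs to a directed path from `s` to `t`. -/
theorem chain_legs (us : List V) : ∀ (H : VDigraph V) (s t u : V), H.verts.Finite → H.Loopless →
    (∀ v ∈ u :: us, v ≠ s ∧ v ≠ t) →
    (∃ x, H.Adj s x ∧ (H.ind {s, t}ᶜ).Reach x u) →
    List.IsChain (H.ind {s, t}ᶜ).Reach (u :: us) →
    (∃ y, (H.ind {s, t}ᶜ).Reach ((u :: us).getLast (by simp)) y ∧ H.Adj y t) →
    List.Pairwise (fun a b => ¬ (H.ind {s, t}ᶜ).Reach b a) (u :: us) →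
    ∃ L, (legVerts L).Nodup ∧ L.map legEnd = u :: us ∧
      (∀ v ∈ legVerts L, v ∈ H.verts ∧ v ≠ s ∧ v ≠ t) ∧
      Red ({s, t} ∪ {v | v ∈ u :: us}) H (pathLegs s L t) := by
  induction us with
  | nil =>
    intro H s t u hfin hloop hst hs _ ht _
    obtain ⟨c, l, h1, h2, h3, h4⟩ := pairLeg hfin hloop (hst u (by simp)).1 (hst u (by simp)).2
      hs (by simpa using ht)
    refine ⟨[(c, l)], by simpa using h1, by simpa [legEnd] using h2, by simpa using h3,
      (h4.mono ?_).trans (Red.of_le ?_)⟩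
    · rintro v ⟨h, -⟩
      simp only [Set.mem_union, Set.mem_insert_iff, Set.mem_singleton_iff, Set.mem_ofPred_eq,
        List.mem_singleton] at h ⊢
      tauto
    · refine sup_le' (sup_le' ?_ (le_sup_right' _ _)) ?_
      · exact le_trans' (le_sup_left' _ _) (le_sup_left' _ _)
      · exact le_trans' (le_sup_right' _ _) (le_sup_left' _ _)
  | cons u₂ us ih =>
    rintro H s t u hfin hloop hst ⟨x, hsx, hxu⟩ hch ⟨y, huy, hyt⟩ hpw
    set G := H.ind {s, t}ᶜ with hG
    have hQ : ∀ v ∈ u :: u₂ :: us, v ∈ ({s, t}ᶜ : Set V) := fun v hv => by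
      simp [(hst v hv).1, (hst v hv).2]
    have hQu := hQ u (by simp)
    have hQu₂ := hQ u₂ (by simp)
    have huH : u ∈ H.verts := hxu.of_ind.mem_verts (H.right_mem hsx)
    obtain ⟨hu12, hch'⟩ := List.isChain_cons_cons.1 hch
    obtain ⟨hback, hpw'⟩ := List.pairwise_cons.1 hpw
    -- No edge of `G` enters `A` from outside, so a path that has left `A` towards `w` never
    -- returns. Hence `u` receives its leg inside `A`, with `s` and `w` as ends of the path, and the
    -- later vertices are treated outside `A`.
    set A : Set V := {v | G.Reach v u} with hA
    have hAQ : A ⊆ {s, t}ᶜ := fun v hv => hv.mem_of_ind_back hQu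
    have hsA : s ∉ A := fun h => hAQ h (by simp)
    have htA : t ∉ A := fun h => hAQ h (by simp)
    have hu₂A : u₂ ∉ A := hback u₂ (by simp)
    obtain ⟨z, w, hz, hzA, hzw, hwA, hwu₂⟩ := hu12.last_exit (S := A) (Reach.refl _) hu₂A
    have hws : w ≠ s := fun h => hzw.2.2 (by simp [h])
    have hwt : w ≠ t := fun h => hzw.2.2 (by simp [h])
    have huw : u ≠ w := fun h => hwA (by rw [← h]; exact Reach.refl _)
    -- the part of the graph up to `w`
    set H₁ := H.ind ({s, w} ∪ A) with hH₁
    have hAadj : ∀ a b, a ∈ A → b ∈ A → G.Adj a b → (H₁.ind {s, w}ᶜ).Adj a b := by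
      intro a b ha hb hab
      refine ⟨⟨hab.1, .inr ha, .inr hb⟩, ?_, ?_⟩
      · rintro (rfl | rfl); exacts [hsA ha, hwA ha]
      · rintro (rfl | rfl); exacts [hsA hb, hwA hb]
    have hAreach : ∀ a b, b ∈ A → G.Reach a b → (H₁.ind {s, w}ᶜ).Reach a b := by
      intro a b hb hab
      exact (hab.closed_back hb fun c d hd e => Reach.head e hd).2.mono
        fun c d e => hAadj c d e.2.1 e.2.2 e.1
    obtain ⟨c, l, h1, h2, h3, h4⟩ := pairLeg (H := H₁) (s := s) (t := w) (u := u)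
      (hfin.subset (ind_le _ _).1) (ind_loopless hloop _) (hst u (by simp)).1 huw
      ⟨x, ⟨hsx, by simp, .inr hxu⟩, hAreach _ _ (Reach.refl _) hxu⟩
      ⟨z, hAreach _ _ hzA hz, ⟨hzw.1, .inr hzA, by simp⟩⟩
    have hlA : ∀ v ∈ c :: l, v ∈ A := fun v hv => by
      obtain ⟨⟨-, h⟩, hvs, hvw⟩ := h3 v hv
      rcases h with (h | h) | h
      exacts [absurd h hvs, absurd h hvw, h]
    have hcA := hlA c (by simp)
    have hct : c ≠ t := fun h => htA (h ▸ hcA)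
    have hcs : c ≠ s := fun h => hsA (h ▸ hcA)
    have hcw : c ≠ w := fun h => hwA (h ▸ hcA)
    -- the rest
    set R := H.ind ({t} ∪ ({s, t}ᶜ \ A)) with hR
    have hRloop : R.Loopless := ind_loopless hloop _
    have hstep : Red ({s, t} ∪ {v | v ∈ u :: u₂ :: us}) H
        (edge s c ⊔ edge c w ⊔ bip (c :: l) ⊔ R) := by
      refine (Red.of_le (K := H₁ ⊔ R) (sup_le' (ind_le _ _) (ind_le _ _))).trans
        ((h4.frame hRloop ?_).mono ?_)
      · rintro v ⟨⟨-, (h | h) | h⟩, -, h'⟩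
        · simp [Set.mem_singleton_iff.1 h]
        · simp [Set.mem_singleton_iff.1 h]
        · rcases h' with h' | h'
          · exact absurd (h' ▸ h) htA
          · exact absurd h h'.2
      · rintro v ⟨hv, hv'⟩
        have hR' : ∀ v, v ∈ H.verts → v ∉ A → v ≠ s → v ∈ R.verts := by
          intro v h1 h2 h3
          refine ⟨h1, ?_⟩
          by_cases hvt : v = t
          · exact .inl hvt
          · exact .inr ⟨by simp [h3, hvt], h2⟩
        have hvH : v ∈ H.verts := hv'.elim (fun h => h.1) (fun h => h.1)
        by_cases hvs : v = s
        · simp [hvs]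
        by_cases hvu : v = u
        · simp [hvu]
        rcases hv with (h | h) | h
        · exact absurd h hvs
        · exact .inr (hR' v hvH (by rw [Set.mem_singleton_iff.1 h]; exact htA) hvs)
        · rcases List.mem_cons.1 h with h | h
          · exact absurd h hvu
          · exact .inr (hR' v hvH (fun hA' => hback v h hA') hvs)
    -- The vertex `c` at which the leg of `u` is attached takes the role of `s` for the remaining
    -- vertices.
    set H₂ := edge c w ⊔ R with hH₂
    have hfin₂ : H₂.verts.Finite := by
      refine Set.Finite.union (by simp [edge]) (hfin.subset (ind_le _ _).1)
    have hQA : ∀ a, a ∈ ({s, t}ᶜ \ A : Set V) → a ∈ ({c, t}ᶜ : Set V) := by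
      rintro a ⟨ha, haA⟩ (rfl | rfl)
      · exact haA hcA
      · exact ha (by simp)
    have hBadj : ∀ a b, a ∉ A → b ∉ A → G.Adj a b → (H₂.ind {c, t}ᶜ).Adj a b := by
      intro a b ha hb hab
      exact ⟨.inr ⟨hab.1, .inr ⟨hab.2.1, ha⟩, .inr ⟨hab.2.2, hb⟩⟩, hQA a ⟨hab.2.1, ha⟩,
        hQA b ⟨hab.2.2, hb⟩⟩
    have hBreach : ∀ a b, a ∉ A → G.Reach a b → (H₂.ind {c, t}ᶜ).Reach a b ∧ b ∉ A := by
      intro a b ha hab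
      have := hab.closed (S := Aᶜ) ha fun p q hp e hq => hp (Reach.head e hq)
      exact ⟨this.2.mono fun p q e => hBadj p q e.2.1 e.2.2 e.1, this.1⟩
    have hBback : ∀ a b, a ∈ ({s, t}ᶜ \ A : Set V) → (H₂.ind {c, t}ᶜ).Reach a b → G.Reach a b := by
      intro a b ha hab
      refine (hab.closed (S := ({s, t}ᶜ \ A : Set V)) ha ?_).2.mono ?_
      · rintro p q hp ⟨h | h, h', h''⟩
        · exact absurd (h.1 ▸ hp.2) (fun h => h hcA)
        · rcases h.2.2 with h2 | h2
          · exact absurd (h2 ▸ h'') (by simp)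
          · exact h2
      · rintro p q ⟨⟨h | h, -⟩, h', h''⟩
        · exact absurd (h.1 ▸ h'.2) (fun h => h hcA)
        · exact ⟨h.1, h'.1, h''.1⟩
    have hnA : ∀ v ∈ u₂ :: us, v ∉ A := fun v hv => hback v hv
    obtain ⟨L, i1, i2, i3, i4⟩ := ih H₂ c t u₂ hfin₂
      ((edge_loopless hcw).sup hRloop)
      (fun v hv => ⟨fun h => hnA v hv (h ▸ hcA), (hst v (by simp [List.mem_cons.1 hv])).2⟩)
      ⟨w, .inl ⟨rfl, rfl⟩, (hBreach w u₂ hwA hwu₂.of_ind).1⟩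
      (by
        refine List.IsChain.imp_of_mem_imp (R := G.Reach) ?_ hch'
        intro a b ha hb hab
        exact (hBreach a b (hnA a ha) hab).1)
      (by
        rw [List.getLast_cons (by simp)] at huy
        have hlast := hnA _ (List.getLast_mem (l := u₂ :: us) (by simp))
        have := hBreach _ _ hlast huy
        have hyQ := huy.mem_of_ind (hQ _ (List.mem_cons_of_mem _ (List.getLast_mem (by simp))))
        exact ⟨y, this.1, .inr ⟨hyt, .inr ⟨hyQ, this.2⟩, by simp⟩⟩)
      (by
        refine List.Pairwise.imp_of_mem ?_ hpw'
        intro a b ha hb hab h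
        exact hab (hBback b a ⟨hQ b (List.mem_cons_of_mem _ hb), hnA b hb⟩ h))
    have hLA : ∀ v ∈ legVerts L, v ∈ H.verts ∧ v ∉ A ∧ v ≠ s ∧ v ≠ t := by
      intro v hv
      obtain ⟨hv1, hvc, hvt⟩ := i3 v hv
      rcases hv1 with (h | h) | h
      · exact absurd h hvc
      · rw [Set.mem_singleton_iff.1 h]
        exact ⟨H.right_mem hzw.1, hwA, hws, hwt⟩
      · refine ⟨h.1, ?_⟩
        rcases h.2 with h2 | h2
        · exact absurd h2 hvt
        · exact ⟨h2.2, fun h => h2.1 (by simp [h]), hvt⟩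
    refine ⟨(c, l) :: L, ?_, ?_, ?_, ?_⟩
    · rw [legVerts_cons]
      exact h1.append i1 fun v hv hv' => (hLA v hv').2.1 (hlA v hv)
    · rw [List.map_cons, i2]; exact congrArg (· :: _) h2
    · intro v hv
      rw [legVerts_cons] at hv
      rcases List.mem_append.1 hv with hv | hv
      · have := hlA v hv
        exact ⟨(h3 v hv).1.1, fun h => hsA (h ▸ this), fun h => htA (h ▸ this)⟩
      · exact ⟨(hLA v hv).1, (hLA v hv).2.2⟩
    · have hR₂ : (edge s c ⊔ bip (c :: l)).Loopless := (edge_loopless hcs.symm).sup (bip_loopless h1)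
      refine hstep.trans ((Red.of_le (K := H₂ ⊔ (edge s c ⊔ bip (c :: l))) ?_).trans
        (((i4.frame hR₂ ?_).mono ?_).trans (Red.of_le ?_)))
      · refine sup_le' (sup_le' ?_ (le_sup_right' _ _)) (sup_le' ?_ ?_)
        · exact le_trans' (le_sup_right' _ _) (le_trans' (le_sup_left' _ _) (le_sup_left' _ _))
        · exact le_trans' (le_sup_left' _ _) (le_trans' (le_sup_left' _ _) (le_sup_left' _ _))
        · exact le_trans' (le_sup_right' _ _) (le_sup_left' _ _)
      · rintro v ⟨hv, hv'⟩
        by_cases hvc : v = c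
        · simp [hvc]
        by_cases hvt : v = t
        · simp [hvt]
        exfalso
        have hvA : v ∉ A := by
          rcases hv with (h | h) | h
          · exact absurd h hvc
          · rwa [Set.mem_singleton_iff.1 h]
          · rcases h.2 with h2 | h2
            exacts [absurd h2 hvt, h2.2]
        have hvs : v ≠ s := by
          rcases hv with (h | h) | h
          · exact absurd h hvc
          · rwa [Set.mem_singleton_iff.1 h]
          · rcases h.2 with h2 | h2
            exacts [absurd h2 hvt, fun h => h2.1 (by simp [h])]
        rcases hv' with (h | h) | h
        · exact hvs h
        · exact hvc h
        · rw [bip_verts] at h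
          exact hvA (hlA v h)
      · rintro v ⟨(h | h) | h, -⟩
        · exact .inr (.inl (.inl h))
        · exact .inl (.inl (.inr h))
        · rcases List.mem_cons.1 h with rfl | h
          · refine .inr (.inr ?_)
            rw [bip_verts]
            exact h2 ▸ List.getLast_mem (l := c :: l) (by simp)
          · exact .inl (.inr h)
      · refine sup_le' (sup_le' ?_ ?_) (le_sup_left' _ _)
        · exact le_trans' (le_sup_left' _ _) (le_sup_right' _ _)
        · exact le_trans' (le_sup_right' _ _) (le_sup_right' _ _)

/-! ### Bidirected legs attached to a single vertex -/

/-- Bidirected legs attached at the vertex `r`. -/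
def starLegs (r : V) : List (V × List V) → VDigraph V
  | [] => single r
  | (c, l) :: L => bip (r :: c :: l) ⊔ starLegs r L

theorem starLegs_verts (r : V) (L : List (V × List V)) :
    (starLegs r L).verts = {r} ∪ {v | v ∈ legVerts L} := by
  induction L with
  | nil => ext; simp [starLegs, single]
  | cons p L ih =>
    obtain ⟨c, l⟩ := p
    ext v
    simp only [starLegs, sup_verts, ih, bip_verts, legVerts_cons, Set.mem_union,
      Set.mem_singleton_iff, Set.mem_ofPred_eq, List.mem_append, List.mem_cons]
    tauto

/-- The graphs on the sets `{r} ∪ A u` share only `r`, so `pairLeg`, with both ends equal to `r`,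
can be applied to one of them after the other while the remaining ones are protected. -/
theorem star_legs_of_disjoint (us : List V) (r : V) (A : V → Set V) (hnd : us.Nodup)
    (hd : ∀ u ∈ us, ∀ u' ∈ us, u ≠ u' → Disjoint (A u) (A u')) (hr : ∀ u ∈ us, r ∉ A u)
    (hu : ∀ u ∈ us, u ∈ A u) :
    ∀ (G : VDigraph V), G.verts.Finite → G.Loopless → r ∈ G.verts →
    (∀ u ∈ us, ∃ x, (G.ind ({r} ∪ A u)).Adj r x ∧
      ((G.ind ({r} ∪ A u)).ind {r, r}ᶜ).Reach x u) →
    (∀ u ∈ us, ∃ y, ((G.ind ({r} ∪ A u)).ind {r, r}ᶜ).Reach u y ∧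
      (G.ind ({r} ∪ A u)).Adj y r) →
    ∃ L, (legVerts L).Nodup ∧ L.map legEnd = us ∧
      (∀ v ∈ legVerts L, v ∈ G.verts ∧ ∃ u ∈ us, v ∈ A u) ∧
      Red ({r} ∪ {v | v ∈ us}) G (starLegs r L) := by
  induction us with
  | nil => exact fun G _ _ h _ _ => ⟨[], by simp, rfl, by simp, Red.of_le (single_le.2 h)⟩
  | cons u us ih =>
    intro G hfin hloop hrG hin hout
    obtain ⟨hunot, hnd'⟩ := List.nodup_cons.1 hnd
    have hur : u ≠ r := fun h => hr u (by simp) (h ▸ hu u (by simp))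
    obtain ⟨c, l, h1, h2, h3, h4⟩ := pairLeg (hfin.subset (ind_le _ _).1)
      (ind_loopless hloop _) hur hur (hin u (by simp)) (hout u (by simp))
    set B : Set V := {v | ∃ u' ∈ us, v ∈ A u'} with hB
    set G' := G.ind ({r} ∪ B) with hG'
    have hsub : ∀ u' ∈ us, A u' ⊆ B := fun u' h v hv => ⟨u', h, hv⟩
    have hadj : ∀ u' ∈ us, ∀ a b, (G.ind ({r} ∪ A u')).Adj a b → (G'.ind ({r} ∪ A u')).Adj a b :=
      fun u' h a b e => ⟨⟨e.1, Set.union_subset_union_right _ (hsub u' h) e.2.1,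
        Set.union_subset_union_right _ (hsub u' h) e.2.2⟩, e.2⟩
    have hadj' : ∀ u' ∈ us, ∀ a b, ((G.ind ({r} ∪ A u')).ind {r, r}ᶜ).Adj a b →
        ((G'.ind ({r} ∪ A u')).ind {r, r}ᶜ).Adj a b :=
      fun u' h a b e => ⟨hadj u' h a b e.1, e.2⟩
    obtain ⟨L, i1, i2, i3, i4⟩ := ih hnd' (fun a ha b hb => hd a (by simp [ha]) b (by simp [hb]))
      (fun a ha => hr a (by simp [ha])) (fun a ha => hu a (by simp [ha])) G'
      (hfin.subset (ind_le _ _).1) (ind_loopless hloop _) ⟨hrG, by simp⟩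
      (fun u' h => by
        obtain ⟨x, hx, hx'⟩ := hin u' (by simp [h])
        exact ⟨x, hadj u' h _ _ hx, hx'.mono (hadj' u' h)⟩)
      (fun u' h => by
        obtain ⟨x, hx, hx'⟩ := hout u' (by simp [h])
        exact ⟨x, hx.mono (hadj' u' h), hadj u' h _ _ hx'⟩)
    have hBA : ∀ v ∈ B, v ∉ A u := by
      rintro v ⟨u', hu', hv⟩ h
      exact Set.disjoint_left.1 (hd u (by simp) u' (by simp [hu'])
        (fun h => hunot (h ▸ hu'))) h hv
    have hrB : r ∉ B := by
      rintro ⟨u', hu', hv⟩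
      exact hr u' (by simp [hu']) hv
    have hlA : ∀ v ∈ c :: l, v ∈ A u := fun v hv => by
      obtain ⟨h, hvs, -⟩ := h3 v hv
      rcases h.2 with h | h
      exacts [absurd h hvs, h]
    have hrl : r ∉ c :: l := fun h => hr u (by simp) (hlA r h)
    refine ⟨(c, l) :: L, ?_, ?_, ?_, ?_⟩
    · rw [legVerts_cons]
      refine h1.append i1 fun v hv hv' => hBA v ?_ (hlA v hv)
      exact (i3 v hv').2
    · rw [List.map_cons, i2]; exact congrArg (· :: _) h2
    · intro v hv
      rw [legVerts_cons] at hv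
      rcases List.mem_append.1 hv with hv | hv
      · exact ⟨(h3 v hv).1.1, u, by simp, hlA v hv⟩
      · obtain ⟨hv1, u', hu', hv2⟩ := i3 v hv
        exact ⟨hv1.1, u', by simp [hu'], hv2⟩
    · have hbl : (bip (r :: c :: l)).Loopless := bip_loopless (List.nodup_cons.2 ⟨hrl, h1⟩)
      refine (Red.of_le (K := G.ind ({r} ∪ A u) ⊔ G') (sup_le' (ind_le _ _) (ind_le _ _))).trans
        (((h4.frame (ind_loopless hloop _) ?_).mono ?_).trans
          ((Red.of_le (K := G' ⊔ bip (r :: c :: l)) ?_).trans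
          (((i4.frame hbl ?_).mono ?_).trans (Red.of_le ?_))))
      · rintro v ⟨⟨-, h | h⟩, -, h'⟩
        · exact .inl h
        · rcases h' with h' | h'
          · exact .inl h'
          · exact absurd h (hBA v h')
      · rintro v ⟨h | h, -⟩
        · exact .inl (.inl h)
        · rcases List.mem_cons.1 h with rfl | h
          · exact .inl (by simp)
          · by_cases hv : v ∈ G.verts
            · exact .inr ⟨hv, .inr ⟨v, h, hu v (by simp [h])⟩⟩
            · exfalso
              obtain ⟨x, hx, hx'⟩ := hin v (by simp [h])
              exact hv (hx'.of_ind.of_ind.mem_verts (G.right_mem hx.1))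
      · refine sup_le' (le_sup_right' _ _) (le_trans' ?_ (le_sup_left' _ _))
        rw [bip_cons_cons]
        exact le_refl' _
      · rintro v ⟨⟨-, h | h⟩, h'⟩
        · exact .inl h
        · rw [bip_verts] at h'
          rcases List.mem_cons.1 h' with h' | h'
          · exact .inl h'
          · exact absurd (hlA v h') (hBA v h)
      · rintro v ⟨h | h, -⟩
        · exact .inl (.inl h)
        · rcases List.mem_cons.1 h with rfl | h
          · refine .inr ?_
            rw [bip_verts]
            exact List.mem_cons_of_mem _ (h2 ▸ List.getLast_mem (l := c :: l) (by simp))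
          · exact .inl (.inr h)
      · exact sup_le' (le_sup_right' _ _) (le_sup_left' _ _)

/-- Vertices that are mutually unreachable in `H - r`, but on closed walks through `r`, can be
attached to `r` by bidirected legs. -/
theorem star_legs {H : VDigraph V} {r : V} {us : List V} (hfin : H.verts.Finite)
    (hloop : H.Loopless) (hrH : r ∈ H.verts) (hnd : us.Nodup) (hne : ∀ u ∈ us, u ≠ r)
    (hin : ∀ u ∈ us, H.Reach r u) (hout : ∀ u ∈ us, H.Reach u r)
    (hanti : ∀ u ∈ us, ∀ u' ∈ us, u ≠ u' → ¬ (H.ind {r}ᶜ).Reach u u') :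
    ∃ L, (legVerts L).Nodup ∧ L.map legEnd = us ∧ (∀ v ∈ legVerts L, v ∈ H.verts ∧ v ≠ r) ∧
      Red ({r} ∪ {v | v ∈ us}) H (starLegs r L) := by
  set G := H.ind {r}ᶜ with hG
  -- First collapse into `r` what it reaches through vertices not reached from `us`, then what
  -- reaches `r` through vertices that do not reach `us`. Afterwards `r` has edges to and from the
  -- strong component in `H - r` of each `u`.
  set W : Set V := {v | v = r ∨ ∀ u ∈ us, ¬ G.Reach u v} with hW
  set O : Set V := {v | (H.ind W).Reach r v} with hO
  have hOW : O ⊆ W := fun v hv => hv.mem_of_ind (.inl rfl)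
  have hrO : r ∈ O := Reach.refl _
  set W' : Set V := {v | v = r ∨ ∀ u ∈ us, ¬ G.Reach v u} with hW'
  set H₁ := H.outCollapse r O with hH₁
  set I : Set V := {v | (H₁.ind W').Reach v r} with hI
  have hIW : I ⊆ W' := fun v hv => hv.mem_of_ind_back (.inl rfl)
  have hrI : r ∈ I := Reach.refl _
  have hrH₁ : r ∈ H₁.verts := .inr rfl
  set H₂ := H₁.inCollapse r I with hH₂
  have hfin₁ : H₁.verts.Finite := hfin.subset (outCollapse_verts_subset hrH _)
  have hred₁ : Red ({r} ∪ {v | v ∈ us}) H H₁ := by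
    refine Red.outCollapse (hfin.subset fun w hw => hw.of_ind.mem_verts hrH) hrO hrH
      (fun o ho => ho.self_reach_ind) ?_
    rintro v ⟨hv | hv, hvO⟩
    · exact hv
    · rcases hOW hvO with h | h
      · exact h
      · exact absurd (Reach.refl _) (h v hv)
  have hred₂ : Red ({r} ∪ {v | v ∈ us}) H₁ H₂ := by
    refine Red.inCollapse (hfin₁.subset fun w hw => ?_) hrI hrH₁
      (fun o ho => ho.self_reach_ind_back) ?_
    · by_cases hwr : w = r
      · rwa [hwr]
      · exact (Reach.of_ind hw).mem_verts_left hwr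
    rintro v ⟨hv | hv, hvO⟩
    · exact hv
    · rcases hIW hvO with h | h
      · exact h
      · exact absurd (Reach.refl _) (h v hv)
  set A : V → Set V := fun u => {v | G.Reach u v ∧ G.Reach v u} with hA
  have hrA : ∀ u ∈ us, r ∉ A u := fun u hu h => h.1.mem_of_ind (hne u hu) rfl
  have hAO : ∀ u ∈ us, ∀ v, G.Reach u v → v ∉ O := fun u hu v hv hvO => by
    rcases hOW hvO with h | h
    · exact hv.mem_of_ind (hne u hu) h
    · exact h u hu hv
  have hAI : ∀ u ∈ us, ∀ v, G.Reach v u → v ∉ I := fun u hu v hv hvO => by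
    rcases hIW hvO with h | h
    · exact hv.mem_of_ind_back (hne u hu) h
    · exact h u hu hv
  have hAadj : ∀ u ∈ us, ∀ a b, a ∈ A u → b ∈ A u → H.Adj a b → H₂.Adj a b :=
    fun u hu a b ha hb hab => inCollapse_adj.2 (.inl ⟨hAI u hu a ha.2, hAI u hu b hb.2,
      .inl ⟨hAO u hu a ha.1, hAO u hu b hb.1, hab⟩⟩)
  have hAne : ∀ u ∈ us, ∀ v ∈ A u, v ≠ r := fun u hu v hv h => hrA u hu (h ▸ hv)
  have hK : ∀ u ∈ us, ∀ a b, a ∈ A u → b ∈ A u → H.Adj a b →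
      ((H₂.ind ({r} ∪ A u)).ind {r, r}ᶜ).Adj a b := fun u hu a b ha hb hab =>
    ⟨⟨hAadj u hu a b ha hb hab, .inr ha, .inr hb⟩, by simp [hAne u hu a ha],
      by simp [hAne u hu b hb]⟩
  obtain ⟨L, h1, h2, h3, h4⟩ := star_legs_of_disjoint us r A hnd
    (fun u hu u' hu' hne => Set.disjoint_left.2 fun v hv hv' =>
      hanti u hu u' hu' hne (hv.1.trans hv'.2)) hrA (fun u _ => ⟨Reach.refl _, Reach.refl _⟩) H₂
    (hfin₁.subset (inCollapse_verts_subset hrH₁ _))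
    (inCollapse_loopless (outCollapse_loopless hloop hrO) hrI) (.inr rfl) (by
      intro u hu
      have huO := hAO u hu u (Reach.refl _)
      obtain ⟨o, x, -, hoO, hox, hxO, hxu⟩ := (hin u hu).last_exit (S := O) hrO huO
      have hOr : ∀ v, v ∉ O → v ∈ ({r}ᶜ : Set V) := fun v hv h => hv (h ▸ hrO)
      have hxu' : G.Reach x u := hxu.ind_mono hOr
      -- The first vertex after `O` is reached from some `u'` in `us` and reaches `u`. As distinct
      -- vertices of `us` do not reach each other, `u' = u`, and this vertex is in the strong
      -- component of `u`.
      have hxW : x ∉ W := fun h => hxO (Reach.tail hoO ⟨hox, hOW hoO, h⟩)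
      have hux : G.Reach u x := by
        simp only [hW, Set.mem_ofPred_eq, not_or, not_forall, not_not] at hxW
        obtain ⟨-, u', hu', hx⟩ := hxW
        by_cases huu : u' = u
        · rwa [huu] at hx
        · exact absurd (hx.trans hxu') (hanti u' hu' u hu huu)
      have hxA : x ∈ A u := ⟨hux, hxu'⟩
      refine ⟨x, ⟨inCollapse_adj.2 (.inr (.inl ⟨rfl, hAI u hu x hxu',
        .inr (.inr ⟨rfl, hxO, o, hoO, hox⟩)⟩)), by simp, .inr hxA⟩, ?_⟩
      have := (hxu'.closed_back (S := A u) ⟨Reach.refl _, Reach.refl _⟩)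
      have := (hxu'.closed (S := {v | G.Reach u v}) hux fun _ _ h e => Reach.tail h e).2.closed_back
        (S := {v | G.Reach v u}) (Reach.refl _) fun _ _ h e => Reach.head e.1 h
      refine this.2.mono fun a b e => hK u hu a b ⟨e.1.2.1, e.2.1⟩ ⟨e.1.2.2, e.2.2⟩ e.1.1.1) (by
      intro u hu
      obtain ⟨y', huy', hy'r, hy'⟩ := (hout u hu).first_visit (hne u hu)
      by_cases hy'u : G.Reach y' u
      · refine ⟨y', ?_, inCollapse_adj.2 (.inr (.inr ⟨hAI u hu y' hy'u, rfl, r, hrI,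
          .inr (.inl ⟨hAO u hu y' huy', rfl, hy'⟩)⟩)), .inr ⟨huy', hy'u⟩, by simp⟩
        have := (huy'.closed (S := {v | G.Reach u v}) (Reach.refl _)
          fun _ _ h e => Reach.tail h e).2.closed_back
          (S := {v | G.Reach v u}) hy'u fun _ _ h e => Reach.head e.1 h
        exact this.2.mono fun a b e => hK u hu a b ⟨e.1.2.1, e.2.1⟩ ⟨e.1.2.2, e.2.2⟩ e.1.1.1
      · obtain ⟨y, z, huy, hyA, hyz, hzA, hzy⟩ := huy'.last_exit (S := {v | G.Reach v u})
          (Reach.refl _) hy'u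
        have hyA' : G.Reach y u := hyA
        have huz : G.Reach u z := huy.tail hyz
        have hW'z : ∀ v, G.Reach z v → v ∈ W' := by
          intro v hv
          refine .inr fun u' hu' h => ?_
          by_cases huu : u = u'
          · subst huu
            exact hzA (hv.trans h)
          · exact hanti u hu u' hu' huu (huz.trans (hv.trans h))
        have hzI : z ∈ I := by
          have h1 := hzy.of_ind.closed (S := {v | G.Reach z v}) (Reach.refl _)
            fun _ _ h e => Reach.tail h e
          have h2 : (H₁.ind W').Reach z y' := h1.2.mono fun a b e =>
            ⟨.inl ⟨hAO u hu a (huz.trans e.2.1), hAO u hu b (huz.trans e.2.2), e.1.1⟩,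
              hW'z a e.2.1, hW'z b e.2.2⟩
          exact h2.tail ⟨.inr (.inl ⟨hAO u hu y' huy', rfl, hy'⟩), hW'z y' h1.1, .inl rfl⟩
        refine ⟨y, ?_, inCollapse_adj.2 (.inr (.inr ⟨hAI u hu y hyA', rfl, z, hzI,
          .inl ⟨hAO u hu y huy, hAO u hu z huz, hyz.1⟩⟩)), .inr ⟨huy, hyA'⟩, by simp⟩
        have := (huy.closed (S := {v | G.Reach u v}) (Reach.refl _)
          fun _ _ h e => Reach.tail h e).2.closed_back
          (S := {v | G.Reach v u}) hyA' fun _ _ h e => Reach.head e.1 h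
        exact this.2.mono fun a b e => hK u hu a b ⟨e.1.2.1, e.2.1⟩ ⟨e.1.2.2, e.2.2⟩ e.1.1.1)
  refine ⟨L, h1, h2, fun v hv => ⟨?_, ?_⟩, hred₁.trans (hred₂.trans h4)⟩
  · exact outCollapse_verts_subset hrH _ (inCollapse_verts_subset hrH₁ _ (h3 v hv).1)
  · obtain ⟨-, u, hu, hv⟩ := h3 v hv
    exact hAne u hu v hv

/-! ### Tripods: joining three vertices -/

theorem sup_right_comm' (H K L : VDigraph V) : H ⊔ K ⊔ L = H ⊔ L ⊔ K := by
  rw [sup_assoc', sup_comm' K, sup_assoc']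

theorem Red.loopless {T : Set V} {H K : VDigraph V} (h : Red T H K) (hH : H.Loopless) :
    K.Loopless := by
  have aux : ∀ (H : VDigraph V) (x y : V), H.Loopless → (H.merge x y).Loopless := by
    rintro H x y hH v ⟨h1, a, b, e, rfl, h2⟩
    rcases mergeMap_eq (x := x) (y := y) (z := a) with h | ⟨-, h⟩
    · rcases mergeMap_eq (x := x) (y := y) (z := b) with h' | ⟨-, h'⟩
      · exact hH a (by rw [h, h'] at h2; rwa [h2] at e)
      · exact h1 ⟨h2.symm.trans h', h2.symm.trans h'⟩
    · exact h1 ⟨h, h⟩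
  induction h with
  | refl => exact hH
  | tail _ h ih =>
    rcases h with h | ⟨u, v, -, ⟨-, -, rfl⟩ | ⟨-, -, rfl⟩⟩
    · exact ih.mono h
    · exact aux _ _ _ ih
    · exact aux _ _ _ ih

/-- Three bidirected paths that end in `a`, `b`, `u` and start in a common vertex. -/
def IsClaw (K : VDigraph V) (a b u : V) : Prop :=
  ∃ w la lb lu, (w :: (la ++ lb ++ lu)).Nodup ∧ legEnd (w, la) = a ∧ legEnd (w, lb) = b ∧
    legEnd (w, lu) = u ∧ K = bip (w :: la) ⊔ bip (w :: lb) ⊔ bip (w :: lu)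

/-- Three disjoint bidirected paths that end in `a`, `b`, `u` and whose first vertices form a
directed triangle, in this order. -/
def IsNet (K : VDigraph V) (a b u : V) : Prop :=
  ∃ x la y lb z lu, (x :: la ++ (y :: lb ++ z :: lu)).Nodup ∧ legEnd (x, la) = a ∧
    legEnd (y, lb) = b ∧ legEnd (z, lu) = u ∧
    K = bip (x :: la) ⊔ bip (y :: lb) ⊔ bip (z :: lu) ⊔ (edge x y ⊔ edge y z ⊔ edge z x)

/-- A claw, or a net in one of the two orientations. -/
def IsTripod (K : VDigraph V) (a b u : V) : Prop :=
  IsClaw K a b u ∨ IsNet K a b u ∨ IsNet K a u b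

theorem IsClaw.rot {K : VDigraph V} {a b u : V} (h : IsClaw K a b u) : IsClaw K b u a := by
  obtain ⟨w, la, lb, lu, h1, h2, h3, h4, rfl⟩ := h
  refine ⟨w, lb, lu, la, ?_, h3, h4, h2, by rw [sup_assoc', sup_comm']⟩
  refine (List.Perm.nodup_iff (List.Perm.cons _ ?_)).1 h1
  rw [List.append_assoc]
  exact List.perm_append_comm

theorem IsClaw.swap {K : VDigraph V} {a b u : V} (h : IsClaw K a b u) : IsClaw K a u b := by
  obtain ⟨w, la, lb, lu, h1, h2, h3, h4, rfl⟩ := h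
  refine ⟨w, la, lu, lb, ?_, h2, h4, h3, by rw [sup_assoc', sup_assoc', sup_comm' (bip (w :: lb))]⟩
  refine (List.Perm.nodup_iff (List.Perm.cons _ ?_)).1 h1
  rw [List.append_assoc, List.append_assoc]
  exact List.Perm.append_left _ List.perm_append_comm

theorem IsNet.rot {K : VDigraph V} {a b u : V} (h : IsNet K a b u) : IsNet K b u a := by
  obtain ⟨x, la, y, lb, z, lu, h1, h2, h3, h4, rfl⟩ := h
  refine ⟨y, lb, z, lu, x, la, ?_, h3, h4, h2, ?_⟩
  · refine (List.Perm.nodup_iff ?_).1 h1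
    exact List.perm_append_comm.trans (by rw [List.append_assoc])
  · congr 1
    · rw [sup_assoc', sup_comm']
    · rw [sup_assoc', sup_comm']

theorem IsTripod.rot {K : VDigraph V} {a b u : V} (h : IsTripod K a b u) : IsTripod K b u a :=
  h.imp IsClaw.rot (Or.imp IsNet.rot fun h => h.rot.rot)

theorem IsTripod.swap {K : VDigraph V} {a b u : V} (h : IsTripod K a b u) : IsTripod K a u b :=
  h.imp IsClaw.swap Or.symm

theorem bip_append (l l' : List V) (x : V) : bip (l ++ x :: l') = bip (l ++ [x]) ⊔ bip (x :: l') := by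
  induction l with
  | nil =>
    have : single x ≤ bip (x :: l') := single_le.2 (by simp)
    ext
    · simp [bip, single]
    · simp [bip, single]
  | cons a l ih =>
    cases l with
    | nil =>
      ext
      · simp; tauto
      · simp only [List.nil_append, List.cons_append, bip_cons_cons, sup_adj, bip, single]; tauto
    | cons b l =>
      simp only [List.cons_append, bip_cons_cons] at ih ⊢
      rw [ih, sup_assoc' (edge a b ⊔ edge b a)]

theorem bip_glue (w a : V) (l l' : List V) (h : legEnd (w, l) = a) :
    bip (w :: l) ⊔ bip (a :: l') = bip (w :: (l ++ l')) := by
  subst h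
  obtain ⟨l₀, h₀⟩ : ∃ l₀, w :: l = l₀ ++ [legEnd (w, l)] :=
    ⟨_, (List.dropLast_append_getLast (l := w :: l) (by simp)).symm⟩
  rw [← List.cons_append, h₀, List.append_assoc, List.singleton_append,
    bip_append l₀ l' (legEnd (w, l))]

theorem legEnd_append {w a : V} {l l' : List V} (h : legEnd (w, l) = a) :
    legEnd (w, l ++ l') = legEnd (a, l') := by
  subst h
  cases l' with
  | nil => simp [legEnd]
  | cons b l' => simp [legEnd, List.getLast_cons]

theorem IsClaw.extend {K : VDigraph V} {a b u : V} (h : IsClaw K a b u) {l : List V}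
    (hl : l.Nodup) (hd : ∀ v ∈ l, v ∉ K.verts) : IsClaw (K ⊔ bip (u :: l)) a b (legEnd (u, l)) := by
  obtain ⟨w, la, lb, lu, h1, h2, h3, h4, rfl⟩ := h
  refine ⟨w, la, lb, lu ++ l, ?_, h2, h3, legEnd_append h4, ?_⟩
  · rw [← List.append_assoc, ← List.cons_append]
    refine h1.append hl fun v hv hv' => hd v hv' ?_
    simp at hv ⊢; tauto
  · rw [sup_assoc', bip_glue _ _ _ _ h4]

theorem IsNet.extend {K : VDigraph V} {a b u : V} (h : IsNet K a b u) {l : List V}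
    (hl : l.Nodup) (hd : ∀ v ∈ l, v ∉ K.verts) : IsNet (K ⊔ bip (u :: l)) a b (legEnd (u, l)) := by
  obtain ⟨x, la, y, lb, z, lu, h1, h2, h3, h4, rfl⟩ := h
  refine ⟨x, la, y, lb, z, lu ++ l, ?_, h2, h3, legEnd_append h4, ?_⟩
  · rw [← List.cons_append, ← List.append_assoc, ← List.append_assoc]
    rw [← List.append_assoc] at h1
    refine h1.append hl fun v hv hv' => hd v hv' ?_
    simp at hv ⊢; tauto
  · rw [← bip_glue _ _ _ l h4, sup_right_comm', sup_assoc' _ (bip (z :: lu))]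

theorem IsTripod.extend {K : VDigraph V} {a b u : V} (h : IsTripod K a b u) {l : List V}
    (hl : l.Nodup) (hd : ∀ v ∈ l, v ∉ K.verts) :
    IsTripod (K ⊔ bip (u :: l)) a b (legEnd (u, l)) :=
  h.imp (fun h => h.extend hl hd)
    (Or.imp (fun h => h.extend hl hd) fun h => (h.rot.rot.extend hl hd).rot)

/-- If two of three vertices are not in the same strong component after deletion of the third, then
there is a tripod that contains the third vertex in its centre. -/
theorem tripod_of_hub {H : VDigraph V} {h p q : V} (hfin : H.verts.Finite) (hloop : H.Loopless)
    (hp : p ≠ h) (hq : q ≠ h) (hpq : p ≠ q) (rp : H.Reach h p) (rp' : H.Reach p h)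
    (rq : H.Reach h q) (rq' : H.Reach q h)
    (hn : ¬ ((H.ind {h}ᶜ).Reach p q ∧ (H.ind {h}ᶜ).Reach q p)) :
    ∃ K, Red {h, p, q} H K ∧ IsTripod K h p q := by
  -- If `p` and `q` are reachable in one direction only, `chain_legs` with `s = t = h` produces a
  -- directed triangle on `h` and the first vertices of two legs: a net whose leg at `h` is trivial.
  -- If neither reaches the other, `star_legs` produces a claw with centre `h`.
  have chain : ∀ p q, p ≠ h → q ≠ h → H.Reach h p → H.Reach q h → (H.ind {h}ᶜ).Reach p q →
      ¬ (H.ind {h}ᶜ).Reach q p → ∃ K, Red {h, p, q} H K ∧ IsTripod K h p q := by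
    intro p q hp hq rp rq' r1 r2
    obtain ⟨x, e1, -, r3⟩ := rp.last_visit hp
    obtain ⟨y, r4, -, e2⟩ := rq'.first_visit hq
    have hs : ({h, h} : Set V) = {h} := by simp
    obtain ⟨L, i1, i2, i3, i4⟩ := chain_legs [q] H h h p hfin hloop (by simp [hp, hq])
      ⟨x, e1, by rwa [hs]⟩ (by simpa [hs] using r1) ⟨y, by simpa [hs] using r4, e2⟩
      (by simpa [hs] using r2)
    match L, i2 with
    | [(c, l), (c', l')], i2 =>
      simp only [List.map_cons, List.map_nil, List.cons.injEq, and_true] at i2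
      refine ⟨_, i4.mono ?_, .inr (.inl ⟨h, [], c, l, c', l', ?_, rfl, i2.1, i2.2, ?_⟩)⟩
      · rintro v ⟨hv, -⟩
        simp at hv ⊢; tauto
      · rw [List.cons_append, List.nodup_cons]
        refine ⟨fun hv => (i3 h ?_).2.1 rfl, ?_⟩
        · simpa using hv
        · simpa using i1
      · have : h ∈ (pathLegs h [(c, l), (c', l')] h).verts := by simp [pathLegs_verts]
        ext v w
        · simp [pathLegs, bip, single, edge]; tauto
        · simp only [pathLegs, bip, single, sup_adj]; tauto
  by_cases h1 : (H.ind {h}ᶜ).Reach p q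
  · exact chain p q hp hq rp rq' h1 fun h2 => hn ⟨h1, h2⟩
  by_cases h2 : (H.ind {h}ᶜ).Reach q p
  · obtain ⟨K, j1, j2⟩ := chain q p hq hp rq rp' h2 h1
    refine ⟨K, j1.mono ?_, j2.swap⟩
    rintro v ⟨hv, -⟩
    simp at hv ⊢; tauto
  obtain ⟨L, i1, i2, i3, i4⟩ := star_legs (us := [p, q]) hfin hloop (rp.mem_verts_left hp.symm)
    (by simp [hpq]) (by simp [hp, hq]) (by simp [rp, rq]) (by simp [rp', rq'])
    (by
      intro a ha b hb hab
      simp only [List.mem_cons, List.not_mem_nil, or_false] at ha hb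
      rcases ha with rfl | rfl <;> rcases hb with rfl | rfl <;> first | exact absurd rfl hab | assumption)
  match L, i2 with
  | [(c, l), (c', l')], i2 =>
    simp only [List.map_cons, List.map_nil, List.cons.injEq, and_true] at i2
    refine ⟨_, i4.mono ?_, .inl ⟨h, [], c :: l, c' :: l', ?_, rfl, ?_, ?_, ?_⟩⟩
    · rintro v ⟨hv, -⟩
      simp at hv ⊢; tauto
    · rw [List.nodup_cons]
      refine ⟨fun hv => (i3 h ?_).2 rfl, ?_⟩
      · simpa using hv
      · simpa using i1
    · simpa [legEnd] using i2.1
    · simpa [legEnd] using i2.2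
    · change bip (h :: c :: l) ⊔ (bip (h :: c' :: l') ⊔ single h) =
        single h ⊔ bip (h :: c :: l) ⊔ bip (h :: c' :: l')
      rw [← sup_assoc', sup_comm' _ (single h), ← sup_assoc']

/-- The part of the path after its last vertex in `O` survives the collapse, and the edge leading to
it now starts at `q`. -/
theorem Reach.outCollapse_root {H : VDigraph V} {q : V} {O : Set V} {o v : V} (r : H.Reach o v)
    (ho : o ∈ O) (hv : v ∉ O) : (H.outCollapse q O).Reach q v := by
  obtain ⟨y, w, -, hy, hyw, hw, r'⟩ := r.last_exit ho hv
  exact .head (.inr (.inr ⟨rfl, hw, y, hy, hyw⟩)) (r'.mono fun a b e => .inl ⟨e.2.1, e.2.2, e.1⟩)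

theorem Reach.outCollapse_of_ind {H : VDigraph V} {q : V} {O : Set V} {u v : V} 
    (r : (H.ind ((O \ {q})ᶜ)).Reach u v) (hq : q ∈ O) (hl : H.Loopless) :
    (H.outCollapse q O).Reach u v := by
  refine r.mono fun a b e => ?_
  have hO : ∀ z, z ∈ ((O \ {q})ᶜ : Set V) → z ∈ O → z = q := fun z hz hz' => by
    by_contra h; exact hz ⟨hz', h⟩
  by_cases ha : a ∈ O
  · obtain rfl := hO a e.2.1 ha
    have hb : b ∉ O := fun hb => hl _ (hO b e.2.2 hb ▸ e.1)
    exact .inr (.inr ⟨rfl, hb, _, ha, e.1⟩)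
  · by_cases hb : b ∈ O
    · obtain rfl := hO b e.2.2 hb
      exact .inr (.inl ⟨ha, rfl, e.1⟩)
    · exact .inl ⟨ha, hb, e.1⟩

/-- The vertices reached from `x` without meeting `a` or a set of vertices closed under the edges
that avoid `x`. -/
theorem escape {H : VDigraph V} {a x : V} {R : Set V} {O : Set V}
    (hxa : x ≠ a) (hxR : x ∉ R)
    (hO : O = {v | (H.ind ({a} ∪ R)ᶜ).Reach x v}) :
    x ∈ O ∧ (∀ v ∈ O, v ≠ a ∧ v ∉ R) ∧ (∀ v ∈ O, (H.ind O).Reach x v) ∧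
      ∀ z, z ∉ O → (H.ind {a}ᶜ).Reach x z →
        ∃ w ∈ R, (H.outCollapse x O).Adj x w ∧ (H.ind {x}ᶜ).Reach w z := by
  have hxO : x ∈ O := by rw [hO]; exact Reach.refl _
  have h2 : ∀ v ∈ O, v ∉ ({a} ∪ R : Set V) := fun v hv => by
    rw [hO] at hv
    exact Reach.mem_of_ind hv (by simp [hxa, hxR])
  refine ⟨hxO, fun v hv => ⟨fun h => h2 v hv (.inl h), fun h => h2 v hv (.inr h)⟩,
    fun v hv => ?_, fun z hz r => ?_⟩
  · rw [hO] at hv ⊢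
    exact Reach.self_reach_ind hv
  · obtain ⟨y, w, -, hy, hyw, hw, r'⟩ := r.last_exit hxO hz
    have hwR : w ∈ R := by
      by_contra hwR
      have hw' : w ∈ ({a} ∪ R : Set V)ᶜ := by
        rintro (h | h)
        · exact hyw.2.2 h
        · exact hwR h
      refine hw ?_
      have hy2 := h2 y hy
      rw [hO] at hy ⊢
      exact Reach.tail hy ⟨hyw.1, hy2, hw'⟩
    refine ⟨w, hwR, .inr (.inr ⟨rfl, hw, y, hy, hyw.1⟩), r'.mono fun c d e => ⟨e.1.1, ?_, ?_⟩⟩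
    · rintro rfl; exact e.2.1 hxO
    · rintro rfl; exact e.2.2 hxO

/-- The induction step of `tripod_red` when the only outgoing edge of `a` is `(a, x)`, and `x`
separates `u` but not `b` from `a`. -/
theorem tripod_step_of_sep {H : VDigraph V} {a b u x : V} (hfin : H.verts.Finite)
    (hloop : H.Loopless) (hab : a ≠ b) (hbu : b ≠ u) (hau : a ≠ u) (hxa : x ≠ a) (hxb : x ≠ b)
    (hxu : x ≠ u) (hax : H.Adj a x)
    (rb : (H.ind {a}ᶜ).Reach x b) (ru : (H.ind {a}ᶜ).Reach x u)
    (ru' : H.Reach u a) (hba : (H.ind {x}ᶜ).Reach b a) (hua : ¬ (H.ind {x}ᶜ).Reach u a)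
    (ih : ∀ (K : VDigraph V) (a b u : V), K.verts.ncard < H.verts.ncard → K.verts.Finite →
      K.Loopless → a ≠ b → b ≠ u → a ≠ u → K.Reach a b → K.Reach b u → K.Reach u a →
      ∃ L, Red {a, b, u} K L ∧ IsTripod L a b u) :
    ∃ L, Red {a, b, u} H L ∧ IsTripod L a b u := by
  have haH : a ∈ H.verts := H.left_mem hax
  have hxH : x ∈ H.verts := H.right_mem hax
  set G := H.ind {x}ᶜ with hG
  obtain ⟨y, hy, hyx, hyx'⟩ := ((ru'.avoid_or hxu.symm).resolve_left hua).first_visit hxu.symm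
  -- If `b` reaches `u` in `H - x`, then `x` is contracted into its successor `x'` on a way to `b`.
  -- The edges into `x` now lead to `x'`, so `a`, `b` and `u` stay on a closed walk in a smaller
  -- graph.
  by_cases hbu' : G.Reach b u
  · obtain ⟨x', e1, hx'x, r1⟩ := rb.last_visit hxb.symm
    have hx'a : x' ≠ a := fun h => e1.2.2 h
    have r2 : G.Reach x' b := r1.mono fun c d e => ⟨e.1.1, e.2⟩
    set K := H.inCollapse x' {x', x} with hK
    have hGK : ∀ c d, G.Adj c d → K.Adj c d := by
      intro c d e
      have hcx : c ≠ x := e.2.1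
      have hdx : d ≠ x := e.2.2
      rw [hK, inCollapse_adj]
      by_cases hc : c = x'
      · subst hc
        have hd : d ≠ c := fun h => hloop _ (h ▸ e.1)
        exact .inr (.inl ⟨rfl, by simp [hd, hdx], e.1⟩)
      · by_cases hd : d = x'
        · subst hd
          exact .inr (.inr ⟨by simp [hc, hcx], rfl, d, by simp, e.1⟩)
        · exact .inl ⟨by simp [hc, hcx], by simp [hd, hdx], e.1⟩
    have hI : ∀ c, H.Adj c x → c ≠ x' → K.Adj c x' := fun c e hc => by
      have hcx : c ≠ x := fun h => hloop _ (h ▸ e)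
      exact inCollapse_adj.2 (.inr (.inr ⟨by simp [hc, hcx], rfl, x, by simp, e⟩))
    have hux' : K.Reach u x' := by
      by_cases hyx'' : y = x'
      · exact hyx'' ▸ hy.mono hGK
      · exact (hy.mono hGK).tail (hI _ hyx' hyx'')
    have hx'H : x' ∈ H.verts := H.right_mem e1.1
    have hxK : x ∉ K.verts := by
      rintro (h | h)
      · exact h.2 (by simp)
      · exact hx'x (Eq.symm h)
    have hKH := inCollapse_verts_subset hx'H {x', x}
    obtain ⟨L, hL, hL'⟩ := ih K a b u (ncard_lt_of_le hfin hKH hxH hxK) (hfin.subset hKH)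
      (inCollapse_loopless hloop (by simp)) hab hbu hau
      (.head (hI a hax hx'a.symm) (r2.mono hGK)) (hbu'.mono hGK)
      (hux'.trans ((r2.trans hba).mono hGK))
    refine ⟨L, (Red.inCollapse (Set.toFinite _) (by simp) hx'H ?_ ?_).trans hL, hL'⟩
    · rintro o (rfl | rfl)
      · exact .refl _
      · exact .single ⟨e1.1, by simp, by simp⟩
    · rintro v ⟨hv, rfl | rfl⟩
      · rfl
      · simp [hxa, hxb, hxu] at hv
  -- Otherwise consider, in `H - x`, the vertices on ways from `b` to `a` and the vertices reached
  -- from `u`. These sets are disjoint, as `u` does not reach `a`. So after a collapse into `x` the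
  -- two sides meet only in `x`; a tripod of `a`, `b`, `x` on one side is extended at its end `x` by
  -- a bidirected path to `u` on the other.
  · obtain ⟨O, hO⟩ : ∃ O, O = {v | (H.ind ({a} ∪ {v | G.Reach b v ∨ G.Reach u v})ᶜ).Reach x v} :=
      ⟨_, rfl⟩
    have hxG : ∀ c, c ≠ x → ¬ G.Reach c x := fun c hc r => r.mem_of_ind hc rfl
    obtain ⟨hxO, hOd, hOr, hOe⟩ := escape hxa
      (by rintro (h | h); exacts [hxG _ hxb.symm h, hxG _ hxu.symm h]) hO
    have haO : a ∉ O := fun h => (hOd _ h).1 rfl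
    have hbO : ∀ v, G.Reach b v → v ∉ O := fun v hv h => (hOd _ h).2 (.inl hv)
    have huO : ∀ v, G.Reach u v → v ∉ O := fun v hv h => (hOd _ h).2 (.inr hv)
    set K := H.outCollapse x O with hK
    have hKH := outCollapse_verts_subset hxH O
    have hOH : O ⊆ H.verts := fun v hv => (hOr v hv).of_ind.mem_verts hxH
    have hred : Red {a, b, u} H K := by
      refine Red.outCollapse (hfin.subset hOH) hxO hxH hOr ?_
      rintro v ⟨rfl | rfl | rfl, hv⟩
      · exact absurd hv haO
      · exact absurd hv (hbO _ (.refl _))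
      · exact absurd hv (huO _ (.refl _))
    have hKl : K.Loopless := outCollapse_loopless hloop hxO
    set A : Set V := {x} ∪ {v | G.Reach b v ∧ G.Reach v a} with hA
    set Y : Set V := {x} ∪ {v | G.Reach u v} with hY
    have hAY : ∀ v ∈ A, v ∈ Y → v = x := by
      rintro v (h | h) (h' | h')
      · exact h
      · exact h
      · exact h'
      · exact absurd (h'.trans h.2) hua
    have hAr : ∀ c d, G.Reach b c → G.Reach c d → G.Reach d a → (K.ind A).Reach c d := by
      intro c d h1 h2 h3
      have h4 := h2.closed (S := {v | G.Reach b v}) h1 fun _ _ h e => Reach.tail h e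
      have h5 := h4.2.closed_back (S := {v | G.Reach v a}) h3 fun _ _ h e => Reach.head e.1 h
      exact h5.2.mono fun p q e => ⟨.inl ⟨hbO _ e.1.2.1, hbO _ e.1.2.2, e.1.1.1⟩,
        .inr ⟨e.1.2.1, e.2.1⟩, .inr ⟨e.1.2.2, e.2.2⟩⟩
    have hYr : ∀ c d, G.Reach u c → G.Reach c d → ((K.ind Y).ind {x, x}ᶜ).Reach c d := by
      intro c d h1 h2
      have h4 := h2.closed (S := {v | G.Reach u v}) h1 fun _ _ h e => Reach.tail h e
      refine h4.2.mono fun p q e => ⟨⟨.inl ⟨huO _ e.2.1, huO _ e.2.2, e.1.1⟩,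
        .inr e.2.1, .inr e.2.2⟩, ?_, ?_⟩
      · simpa using e.1.2.1
      · simpa using e.1.2.2
    have haA : a ∈ A := .inr ⟨hba, .refl _⟩
    have hbA : b ∈ A := .inr ⟨.refl _, hba⟩
    have hax' : (K.ind A).Adj a x := ⟨.inr (.inl ⟨haO, rfl, hax⟩), haA, .inl rfl⟩
    have hxb' : (K.ind A).Reach x b := by
      obtain ⟨w, hw, e, r⟩ := hOe b (hbO _ (.refl _)) rb
      have hbw : G.Reach b w := hw.resolve_right fun h => hua (h.trans (r.trans hba))
      exact .head ⟨e, .inl rfl, .inr ⟨hbw, r.trans hba⟩⟩ (hAr w b hbw r hba)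
    have hba' : (K.ind A).Reach b a := hAr b a (.refl _) hba (.refl _)
    have hKA : (K.ind A).verts ⊆ H.verts := fun v hv => hKH hv.1
    have huA : u ∉ A := by
      rintro (h | h)
      · exact hxu h.symm
      · exact hbu' h.1
    obtain ⟨L, hL, hL'⟩ := ih (K.ind A) a b x
      (ncard_lt_of_le hfin hKA (ru.of_ind.mem_verts hxH) fun h => huA h.2)
      (hfin.subset hKA) (ind_loopless hKl _) hab hxb.symm hxa.symm (.head hax' hxb')
      (hba'.tail hax') (hxb'.trans hba')
    have hLA : L.verts ⊆ A := fun v hv => (hL.verts hv).2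
    obtain ⟨c, l, i1, i2, i3, i4⟩ := pairLeg (H := K.ind Y) (s := x) (t := x) (u := u)
      (hfin.subset fun v hv => hKH hv.1) (ind_loopless hKl _) hxu.symm hxu.symm (by
        obtain ⟨w, hw, e, r⟩ := hOe u (huO _ (.refl _)) ru
        have huw : G.Reach u w := hw.resolve_left fun h => hbu' (h.trans r)
        exact ⟨w, ⟨e, .inl rfl, .inr huw⟩, hYr w u huw r⟩)
      ⟨y, hYr u y (.refl _) hy, .inr (.inl ⟨huO _ hy, rfl, hyx'⟩), .inr hy, .inl rfl⟩
    have hLl : L.Loopless := hL.loopless (ind_loopless hKl _)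
    refine ⟨L ⊔ bip (x :: c :: l), hred.trans ((Red.of_le
      (sup_le' (ind_le K A) (ind_le K Y))).trans ((hL.frame (ind_loopless hKl Y) ?_).mono ?_ |>.trans
        ?_)), ?_⟩
    · rintro v ⟨h1, h2⟩
      exact .inr (.inr (hAY v h1.2 h2.2))
    · rintro v ⟨rfl | rfl | rfl, h⟩
      · exact .inl (by simp)
      · exact .inl (by simp)
      · refine .inr (h.resolve_left fun h => huA h.2)
    · rw [sup_comm' L, sup_comm' L]
      refine (i4.frame hLl ?_).mono ?_
      · rintro v ⟨h1, h2⟩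
        exact .inl (hAY v (hLA h2) h1.2)
      · rintro v ⟨hv, h | h⟩
        · rcases hv with rfl | rfl | rfl
          · exact absurd (hAY _ haA h.2) hxa.symm
          · exact absurd (hAY _ hbA h.2) hxb.symm
          · exact .inl (by simp)
        · exact .inr h
    · have := hL'.extend (l := c :: l) i1 fun v hv h =>
        (i3 v hv).2.1 (hAY v (hLA h) (i3 v hv).1.2)
      have hlast : legEnd (x, c :: l) = u := by simpa [legEnd] using i2
      rwa [hlast] at this

/-- The induction step of `tripod_red`: `a` has only one outgoing edge. -/
theorem tripod_step {H : VDigraph V} {a b u x : V} (hfin : H.verts.Finite) (hloop : H.Loopless)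
    (hab : a ≠ b) (hbu : b ≠ u) (hau : a ≠ u) (hxa : x ≠ a) (hxb : x ≠ b) (hxu : x ≠ u)
    (hax : H.Adj a x)
    (rb : (H.ind {a}ᶜ).Reach x b) (ru : (H.ind {a}ᶜ).Reach x u) (rb' : H.Reach b a)
    (ru' : H.Reach u a)
    (ih : ∀ (K : VDigraph V) (a b u : V), K.verts.ncard < H.verts.ncard → K.verts.Finite →
      K.Loopless → a ≠ b → b ≠ u → a ≠ u → K.Reach a b → K.Reach b u → K.Reach u a →
      ∃ L, Red {a, b, u} K L ∧ IsTripod L a b u) :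
    ∃ L, Red {a, b, u} H L ∧ IsTripod L a b u := by
  have haH : a ∈ H.verts := H.left_mem hax
  have hxH : x ∈ H.verts := H.right_mem hax
  by_cases hba : (H.ind {x}ᶜ).Reach b a <;> by_cases hua : (H.ind {x}ᶜ).Reach u a
  -- Neither `b` nor `u` needs `x` on the way to `a`, so `x` can be contracted into `a`.
  · set K := H.outCollapse a {a, x} with hK
    have hKH := outCollapse_verts_subset haH {a, x}
    have hGK : ∀ c d, (H.ind {x}ᶜ).Reach c d → K.Reach c d := fun c d r =>
      Reach.outCollapse_of_ind (r.ind_mono (S' := ({a, x} \ {a})ᶜ) fun v (hv : v ≠ x) h =>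
        hv (h.1.resolve_left h.2))
        (by simp) hloop
    have h1 : ∀ c, c ≠ a → c ≠ x → H.Reach a c → K.Reach a c := fun c hc hc' r =>
      r.outCollapse_root (by simp) (by simp [hc, hc'])
    have hxK : x ∉ K.verts := by
      rintro (h | h)
      · exact h.2 (by simp)
      · exact hxa h
    obtain ⟨L, hL, hL'⟩ := ih K a b u (ncard_lt_of_le hfin hKH hxH hxK) (hfin.subset hKH)
      (outCollapse_loopless hloop (by simp)) hab hbu hau
      (h1 b hab.symm hxb.symm (rb.of_ind.head hax))
      ((hGK _ _ hba).trans (h1 u hau.symm hxu.symm (ru.of_ind.head hax))) (hGK _ _ hua)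
    refine ⟨L, (Red.outCollapse (Set.toFinite _) (by simp) haH ?_ ?_).trans hL, hL'⟩
    · rintro o (rfl | rfl)
      · exact .refl _
      · exact .single ⟨hax, by simp, by simp⟩
    · rintro v ⟨hv, rfl | rfl⟩
      · rfl
      · simp [hxa, hxb, hxu] at hv
  · exact tripod_step_of_sep hfin hloop hab hbu hau hxa hxb hxu hax rb ru ru' hba hua ih
  · obtain ⟨L, h1, h2⟩ := tripod_step_of_sep hfin hloop hau hbu.symm hab hxa hxu hxb hax ru rb rb'
      hua hba ih
    exact ⟨L, Set.pair_comm u b ▸ h1, h2.swap⟩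
  -- Now `x` separates both `b` and `u` from `a`. Collapsing into `x` what it reaches outside `{a} ∪
  -- R` leaves edges between `a` and `x` in both directions. A tripod of `x`, `b`, `u` in `{x} ∪ R`
  -- is then extended by these two edges.
  · set G := H.ind {x}ᶜ with hG
    obtain ⟨y, hy, hyx, hyx'⟩ := ((rb'.avoid_or hxb.symm).resolve_left hba).first_visit hxb.symm
    obtain ⟨z, hz, hzx, hzx'⟩ := ((ru'.avoid_or hxu.symm).resolve_left hua).first_visit hxu.symm
    obtain ⟨R, hR⟩ : ∃ R : Set V, R = {v | G.Reach b v ∨ G.Reach u v} := ⟨_, rfl⟩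
    obtain ⟨O, hO⟩ : ∃ O, O = {v | (H.ind ({a} ∪ R)ᶜ).Reach x v} := ⟨_, rfl⟩
    have hxG : ∀ c, c ≠ x → ¬ G.Reach c x := fun c hc r => r.mem_of_ind hc rfl
    have hxR : x ∉ R := by
      rw [hR]; rintro (h | h); exacts [hxG _ hxb.symm h, hxG _ hxu.symm h]
    have hRa : ∀ v ∈ R, ¬ G.Reach v a := by
      rw [hR]; rintro v (h | h) h'
      exacts [hba (h.trans h'), hua (h.trans h')]
    obtain ⟨hxO, hOd, hOr, hOe⟩ := escape hxa hxR hO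
    have haO : a ∉ O := fun h => (hOd _ h).1 rfl
    have hbR : b ∈ R := by rw [hR]; exact .inl (.refl _)
    have huR : u ∈ R := by rw [hR]; exact .inr (.refl _)
    have hRO : ∀ v ∈ R, v ∉ O := fun v hv h => (hOd _ h).2 hv
    have hRc : ∀ c d, c ∈ R → G.Adj c d → d ∈ R := by
      rw [hR]; rintro c d (h | h) e
      exacts [.inl (h.tail e), .inr (h.tail e)]
    set K := H.outCollapse x O with hK
    have hKH := outCollapse_verts_subset hxH O
    have hOH : O ⊆ H.verts := fun v hv => (hOr v hv).of_ind.mem_verts hxH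
    have hred : Red {a, b, u} H K := by
      refine Red.outCollapse (hfin.subset hOH) hxO hxH hOr ?_
      rintro v ⟨rfl | rfl | rfl, hv⟩
      · exact absurd hv haO
      · exact absurd hv (hRO _ hbR)
      · exact absurd hv (hRO _ huR)
    have hKl : K.Loopless := outCollapse_loopless hloop hxO
    have hkeep : ∀ c d, c ∈ R → G.Reach c d → (K.ind ({x} ∪ R)).Reach c d := by
      intro c d h1 h2
      exact (h2.closed h1 hRc).2.mono fun p q e => ⟨.inl ⟨hRO _ e.2.1, hRO _ e.2.2, e.1.1⟩,
        .inr e.2.1, .inr e.2.2⟩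
    have hin : ∀ c ∈ R, (H.ind {a}ᶜ).Reach x c → (K.ind ({x} ∪ R)).Reach x c := by
      intro c hc r
      obtain ⟨w, hw, e, r'⟩ := hOe c (hRO _ hc) r
      exact .head ⟨e, .inl rfl, .inr hw⟩ (hkeep w c hw r')
    have hout : ∀ c y, c ∈ R → G.Reach c y → H.Adj y x → (K.ind ({x} ∪ R)).Reach c x := by
      intro c y hc r e
      have hyR := (r.closed hc hRc).1
      exact (hkeep c y hc r).tail ⟨.inr (.inl ⟨hRO _ hyR, rfl, e⟩), .inr hyR, .inl rfl⟩
    have hax' : K.Adj a x := .inr (.inl ⟨haO, rfl, hax⟩)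
    -- After its last visit to `x`, a path to `a` avoids `R`, since no vertex of `R` reaches `a` in
    -- `H - x`. So until it meets `a` it runs inside the collapsed set `O`.
    have hxa' : K.Adj x a := by
      obtain ⟨w, e, hwx, r⟩ := (rb.of_ind.trans rb').last_visit hxa.symm
      by_cases hwa : w = a
      · exact .inr (.inr ⟨rfl, haO, x, hxO, hwa ▸ e⟩)
      obtain ⟨v, r1, hva, e1⟩ := r.first_visit hwa
      have r2 := r1.closed_back (S := {v | G.Reach v a}) (.single e1)
        fun _ _ h e => Reach.head e.1 h
      have hx0 : x ∈ ({a} ∪ R : Set V)ᶜ := by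
        rintro (h | h)
        exacts [hxa h, hxR h]
      have h0 : ∀ v, v ≠ a → G.Reach v a → v ∈ ({a} ∪ R : Set V)ᶜ := by
        rintro v hv hv' (h | h)
        exacts [hv h, hRa v h hv']
      have hvO : v ∈ O := by
        rw [hO]
        exact .head ⟨e, hx0, h0 w hwa r2.1⟩ (r2.2.mono fun p q e =>
          ⟨e.1.1.1, h0 p e.1.2.1 e.2.1, h0 q e.1.2.2 e.2.2⟩)
      exact .inr (.inr ⟨rfl, haO, v, hvO, e1.1⟩)
    have haR : a ∉ ({x} ∪ R : Set V) := by
      rintro (h | h)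
      exacts [hxa (Eq.symm h), hRa a h (.refl _)]
    have hKR : (K.ind ({x} ∪ R)).verts ⊆ H.verts := fun v hv => hKH hv.1
    have hbx := hout b y hbR hy hyx'
    obtain ⟨L, hL, hL'⟩ := ih (K.ind ({x} ∪ R)) x b u (ncard_lt_of_le hfin hKR haH fun h => haR h.2)
      (hfin.subset hKR) (ind_loopless hKl _) hxb hbu hxu (hin b hbR rb) (hbx.trans (hin u huR ru))
      (hout u z huR hz hzx')
    have hle : K.ind ({x} ∪ R) ⊔ bip [x, a] ≤ K :=
      sup_le' (ind_le _ _) (sup_le' (sup_le' (edge_le hxa') (edge_le hax'))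
        (single_le.2 (K.left_mem hax')))
    refine ⟨L ⊔ bip [x, a], hred.trans ((Red.of_le hle).trans
      ((hL.frame (bip_loopless (by simpa using hxa)) ?_).mono ?_)), ?_⟩
    · rintro v ⟨h1, h2⟩
      simp only [bip_verts, List.mem_cons, List.not_mem_nil, or_false, Set.mem_ofPred_eq] at h2
      rcases h2 with rfl | rfl
      · simp
      · exact absurd h1.2 haR
    · rintro v ⟨rfl | rfl | rfl, h⟩ <;> simp
    · exact (hL'.rot.extend (l := [a]) (by simp) fun v hv h => by
        simp only [List.mem_singleton] at hv
        exact haR (hv ▸ (hL.verts h).2)).rot.rot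

/-- Three vertices on common closed walks can be made the ends of a tripod. -/
theorem tripod_red {H : VDigraph V} {a b u : V} (hfin : H.verts.Finite) (hloop : H.Loopless)
    (hab : a ≠ b) (hbu : b ≠ u) (hau : a ≠ u) (rab : H.Reach a b) (rbu : H.Reach b u)
    (rua : H.Reach u a) : ∃ L, Red {a, b, u} H L ∧ IsTripod L a b u := by
  induction hn : H.verts.ncard using Nat.strong_induction_on generalizing H a b u with
  | _ n ih =>
    subst hn
    have ih' : ∀ (K : VDigraph V) (a b u : V), K.verts.ncard < H.verts.ncard → K.verts.Finite →
      K.Loopless → a ≠ b → b ≠ u → a ≠ u → K.Reach a b → K.Reach b u → K.Reach u a →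
      ∃ L, Red {a, b, u} K L ∧ IsTripod L a b u :=
      fun K a b u h1 h2 h3 h4 h5 h6 h7 h8 h9 => ih _ h1 h2 h3 h4 h5 h6 h7 h8 h9 rfl
    by_cases h1 : (H.ind {a}ᶜ).Reach b u ∧ (H.ind {a}ᶜ).Reach u b
    swap
    · exact tripod_of_hub hfin hloop hab.symm hau.symm hbu rab (rbu.trans rua) (rab.trans rbu) rua h1
    obtain ⟨x, hax, hxa, rb⟩ := rab.last_visit hab.symm
    -- In `H - a` the vertices `b` and `u` reach each other and `x` reaches both. So all edges
    -- leaving `a` except `(a, x)` can be deleted without destroying the closed walks.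
    let H₁ : VDigraph V :=
      { verts := H.verts
        Adj := fun v w => H.Adj v w ∧ (v = a → w = x)
        left_mem := fun h => H.left_mem h.1
        right_mem := fun h => H.right_mem h.1 }
    have hle : H₁ ≤ H := ⟨subset_rfl, fun _ _ h => h.1⟩
    have hred : Red {a, b, u} H H₁ := .of_le hle
    have hl : H₁.Loopless := hloop.mono hle
    have hcut : ∀ c d, (H.ind {a}ᶜ).Reach c d → (H₁.ind {a}ᶜ).Reach c d := fun c d r =>
      r.mono fun p q e => ⟨⟨e.1, fun h => absurd h e.2.1⟩, e.2⟩
    have hto : ∀ c, c ≠ a → H.Reach c a → H₁.Reach c a := by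
      intro c hc r
      obtain ⟨y, r1, hya, e⟩ := r.first_visit hc
      exact (hcut _ _ r1).of_ind.tail ⟨e, fun h => absurd h hya⟩
    have hax₁ : H₁.Adj a x := ⟨hax, fun _ => rfl⟩
    -- If `x` is `b` or `u`, then `a` has no way out once `x` is deleted, and `tripod_of_hub`
    -- applies with `x` as the hub.
    have honly : ∀ c d, c ≠ a → d ≠ a → x = d → ¬ (H₁.ind {d}ᶜ).Reach a c := by
      rintro c d hc hd rfl r
      obtain ⟨w, e, -⟩ := r.head_or hc.symm
      exact e.2.2 (e.1.2 rfl)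
    have hxb' := hcut _ _ rb
    have hxu' := hcut _ _ (rb.trans h1.1)
    have hab₁ := hxb'.of_ind.head hax₁
    have hau₁ := hxu'.of_ind.head hax₁
    have hba₁ := hto b hab.symm (rbu.trans rua)
    have hua₁ := hto u hau.symm rua
    have hbu₁ := (hcut _ _ h1.1).of_ind
    have hub₁ := (hcut _ _ h1.2).of_ind
    by_cases hxb : x = b
    · obtain ⟨L, h2, h3⟩ := tripod_of_hub (H := H₁) (h := b) (p := u) (q := a) hfin hl hbu.symm hab
        hau.symm hbu₁ hub₁ hba₁ hab₁ fun h => honly u b hau.symm hab.symm hxb h.2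
      refine ⟨L, hred.trans (h2.mono ?_), h3.rot.rot⟩
      rintro v ⟨rfl | rfl | rfl, h⟩ <;> simp
    by_cases hxu : x = u
    · obtain ⟨L, h2, h3⟩ := tripod_of_hub (H := H₁) (h := u) (p := a) (q := b) hfin hl hau hbu
        hab hua₁ hau₁ hub₁ hbu₁ fun h => honly b u hab.symm hau.symm hxu h.1
      refine ⟨L, hred.trans (h2.mono ?_), h3.rot⟩
      rintro v ⟨rfl | rfl | rfl, h⟩ <;> simp
    obtain ⟨L, h2, h3⟩ := tripod_step (H := H₁) hfin hl hab hbu hau hxa hxb hxu hax₁ hxb' hxu'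
      hba₁ hua₁ ih'
    exact ⟨L, hred.trans h2, h3⟩

end VDigraph

/-! ### Chains and antichains in finite orders -/

/-- The minimal elements form an antichain. If there are fewer than `n` of them, induction on `k` is
applied to the other elements; a chain found there extends downwards, because in a finite order
every nonminimal element lies above a minimal one. -/
theorem exists_chain_or_antichain {α : Type*} [DecidableEq α] (r : α → α → Prop)
    (hr : ∀ a b c, r a b → r b c → r a c) (hi : ∀ a, ¬ r a a) (n k : ℕ) (A : Finset α)
    (hA : k * n ≤ A.card) :
    (∃ B ⊆ A, B.card = n ∧ ∀ a ∈ B, ∀ b ∈ B, ¬ r a b) ∨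
    ∃ l : List α, l.length = k ∧ (∀ a ∈ l, a ∈ A) ∧ l.Pairwise r := by
  classical
  induction k generalizing A with
  | zero => exact .inr ⟨[], rfl, by simp, by simp⟩
  | succ k ih =>
    set B := A.filter fun a => ∀ b ∈ A, ¬ r b a with hB
    by_cases hn : n ≤ B.card
    · obtain ⟨C, h1, h2⟩ := Finset.exists_subset_card_eq hn
      refine .inl ⟨C, h1.trans (Finset.filter_subset _ _), h2, fun a ha b hb => ?_⟩
      exact (Finset.mem_filter.1 (h1 hb)).2 a (Finset.mem_filter.1 (h1 ha)).1
    have hcard : k * n ≤ (A \ B).card := by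
      have h1 := Finset.card_sdiff_add_card_eq_card (Finset.filter_subset (fun a => ∀ b ∈ A, ¬ r b a) A)
      have h2 : (k + 1) * n = k * n + n := by ring
      rw [← hB] at h1
      omega
    obtain ⟨C, h1, h2⟩ | ⟨l, h1, h2, h3⟩ := ih (A \ B) hcard
    · exact .inl ⟨C, h1.trans Finset.sdiff_subset, h2⟩
    have below : ∀ s : ℕ, ∀ a ∈ A, (A.filter fun b => r b a).card = s → a ∉ B → ∃ b ∈ B, r b a := by
      intro s
      induction s using Nat.strong_induction_on with
      | _ s ihs =>
        intro a ha hs haB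
        obtain ⟨b, hb, hba⟩ : ∃ b ∈ A, r b a := by
          by_contra! h
          exact haB (Finset.mem_filter.2 ⟨ha, h⟩)
        by_cases hbB : b ∈ B
        · exact ⟨b, hbB, hba⟩
        obtain ⟨c, hc, hcb⟩ := ihs _ (by
          rw [← hs]
          refine Finset.card_lt_card ⟨fun x hx => ?_, fun h => ?_⟩
          · rw [Finset.mem_filter] at hx ⊢
            exact ⟨hx.1, hr _ _ _ hx.2 hba⟩
          · exact hi b (Finset.mem_filter.1 (h (Finset.mem_filter.2 ⟨hb, hba⟩))).2) b hb rfl hbB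
        exact ⟨c, hc, hr _ _ _ hcb hba⟩
    cases l with
    | nil =>
      obtain rfl : 0 = k := h1
      have hAB : B.Nonempty ∨ n = 0 := by
        by_cases hn0 : n = 0
        · exact .inr hn0
        refine .inl ?_
        obtain ⟨a, ha⟩ := Finset.card_pos.1 (show 0 < A.card by omega)
        by_cases haB : a ∈ B
        · exact ⟨a, haB⟩
        · obtain ⟨b, hb, -⟩ := below _ a ha rfl haB
          exact ⟨b, hb⟩
      rcases hAB with ⟨b, hb⟩ | rfl
      · exact .inr ⟨[b], rfl, by simpa using (Finset.mem_filter.1 hb).1, by simp⟩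
      · exact absurd (Nat.zero_le _) hn
    | cons a l =>
      have ha := Finset.mem_sdiff.1 (h2 a (by simp))
      obtain ⟨b, hb, hba⟩ := below _ a ha.1 rfl ha.2
      refine .inr ⟨b :: a :: l, by simpa using h1, ?_, ?_⟩
      · intro c hc
        rcases List.mem_cons.1 hc with rfl | hc
        · exact (Finset.mem_filter.1 hb).1
        · exact (Finset.mem_sdiff.1 (h2 c hc)).1
      · refine List.pairwise_cons.2 ⟨fun c hc => ?_, h3⟩
        rcases List.mem_cons.1 hc with rfl | hc
        · exact hba
        · exact hr _ _ _ hba ((List.pairwise_cons.1 h3).1 c hc)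

/-! ### Paths and cycles with legs, and graphs shaped by a star -/

namespace VDigraph

variable {V : Type*}

/-- Some reduction of `H` is shaped by a star or by a comb, and has at least `n` teeth in `U`. -/
def HasShape (H : VDigraph V) (U : Set V) (n : ℕ) : Prop :=
  ∃ (K : VDigraph V) (T : Set V), Red ∅ H K ∧ (ShapedByStar K T ∨ ShapedByComb K T) ∧
    (n : ℕ∞) ≤ (T ∩ U).encard

theorem HasShape.of_red {T U : Set V} {n : ℕ} {H K : VDigraph V} (h : HasShape K U n)
    (hr : Red T H K) : HasShape H U n := by
  obtain ⟨L, T, h1, h2⟩ := h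
  exact ⟨L, T, (hr.mono (by simp)).trans h1, h2⟩

theorem isCopyOf_of_map {X : Type*} {H : VDigraph V} {T : Set V} {K : VDigraph X} {S : Set X}
    (φ : X → V) (h1 : Set.InjOn φ K.verts) (h2 : φ '' K.verts = H.verts)
    (h3 : ∀ x y, K.Adj x y → H.Adj (φ x) (φ y))
    (h4 : ∀ u v, H.Adj u v → ∃ x y, K.Adj x y ∧ φ x = u ∧ φ y = v) (h5 : φ '' S = T) :
    H.IsCopyOf T K S := by
  refine ⟨φ, h1, h2, fun x hx y hy => ⟨fun h => ?_, h3 x y⟩, h5⟩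
  obtain ⟨x', y', h, hx', hy'⟩ := h4 _ _ h
  rwa [h1 (K.left_mem h) hx hx', h1 (K.right_mem h) hy hy'] at h

theorem bip_adj {l : List V} {u v : V} : (bip l).Adj u v ↔
    ∃ i : ℕ, (l[i]? = some u ∧ l[i + 1]? = some v) ∨ (l[i]? = some v ∧ l[i + 1]? = some u) := by
  induction l with
  | nil => simp [bip]
  | cons a l ih =>
    cases l with
    | nil => simp [bip, single]
    | cons b l =>
      rw [bip_cons_cons, sup_adj, sup_adj, ih]
      constructor
      · rintro ((⟨rfl, rfl⟩ | ⟨rfl, rfl⟩) | ⟨i, h⟩)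
        · exact ⟨0, .inl (by simp)⟩
        · exact ⟨0, .inr (by simp)⟩
        · exact ⟨i + 1, by simpa using h⟩
      · rintro ⟨i, h⟩
        cases i with
        | zero =>
          rcases h with h | h
          · exact .inl (.inl (by simpa [eq_comm, edge] using h))
          · exact .inl (.inr (by simpa [eq_comm, edge, and_comm] using h))
        | succ i => exact .inr ⟨i, by simpa using h⟩

/-- The first vertex of the path affects only the edges that leave it. This is what allows the first
vertex to be exchanged when the beginning of the path is contracted. -/
theorem pathLegs_adj_left {s t a b : V} {L : List (V × List V)} (h : (pathLegs s L t).Adj a b) :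
    (a = s ∧ ∀ s', (pathLegs s' L t).Adj s' b) ∨
      (a ∈ legVerts L ∧ ∀ s', (pathLegs s' L t).Adj a b) := by
  induction L generalizing s with
  | nil => exact .inl ⟨h.1, fun s' => ⟨rfl, h.2⟩⟩
  | cons p L ih =>
    obtain ⟨c, l⟩ := p
    rcases h with (h | h) | h
    · exact .inl ⟨h.1, fun s' => .inl (.inl ⟨rfl, h.2⟩)⟩
    · have ha : a ∈ c :: l := by simpa using (bip (c :: l)).left_mem h
      exact .inr ⟨List.mem_append_left _ ha, fun s' => .inl (.inr h)⟩
    · rcases ih h with ⟨rfl, -⟩ | h'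
      · exact .inr ⟨by simp, fun s' => .inr h⟩
      · exact .inr ⟨List.mem_append_right _ h'.1, fun s' => .inr h⟩

theorem pathLegs_adj_right' {s t a b : V} {L : List (V × List V)} (h : (pathLegs s L t).Adj a b) :
    (b = t ∧ ∀ t', (pathLegs s L t').Adj a t') ∨
      (b ∈ legVerts L ∧ ∀ t', (pathLegs s L t').Adj a b) := by
  induction L generalizing s with
  | nil => exact .inl ⟨h.2, fun t' => ⟨h.1, rfl⟩⟩
  | cons p L ih =>
    obtain ⟨c, l⟩ := p
    rcases h with (h | h) | h
    · exact .inr ⟨h.2 ▸ by simp, fun t' => .inl (.inl h)⟩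
    · exact .inr ⟨List.mem_append_left _ (by simpa using (bip (c :: l)).right_mem h),
        fun t' => .inl (.inr h)⟩
    · exact (ih h).imp (fun h => ⟨h.1, fun t' => .inr (h.2 t')⟩)
        fun h => ⟨List.mem_append_right _ h.1, fun t' => .inr (h.2 t')⟩

theorem pathLegs_adj_right {s t a b : V} {L : List (V × List V)} (h : (pathLegs s L t).Adj a b) :
    b = t ∨ b ∈ legVerts L :=
  (pathLegs_adj_right' h).imp And.left And.left

theorem pathLegs_loopless {s t : V} {L : List (V × List V)} (hL : L ≠ [] ∨ s ≠ t)
    (hnd : (legVerts L).Nodup) (hs : s ∉ legVerts L) (ht : t ∉ legVerts L) :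
    (pathLegs s L t).Loopless := by
  induction L generalizing s with
  | nil => exact edge_loopless (hL.resolve_left (by simp))
  | cons p L ih =>
    obtain ⟨c, l⟩ := p
    rw [legVerts_cons] at hnd hs ht
    simp only [List.mem_append, not_or] at hs ht
    have hd := List.disjoint_of_nodup_append hnd
    refine ((edge_loopless ?_).sup (bip_loopless hnd.of_append_left)).sup
      (ih (.inr ?_) hnd.of_append_right (fun h => hd (by simp) h) ht.2)
    · rintro rfl; simp at hs
    · rintro rfl; simp at ht

theorem legVerts_subset {L L' : List (V × List V)} (h : L' ⊆ L) : legVerts L' ⊆ legVerts L := by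
  intro v hv
  simp only [legVerts, List.mem_flatMap] at hv ⊢
  obtain ⟨p, hp, hv⟩ := hv
  exact ⟨p, h hp, hv⟩

/-- Removal of some legs. -/
theorem Red.pathLegs_sublist {L L' : List (V × List V)} (h : L'.Sublist L) (s t : V)
    (hL' : L' ≠ [] ∨ s ≠ t) (hnd : (legVerts L).Nodup) (hs : s ∉ legVerts L)
    (ht : t ∉ legVerts L) :
    Red ({s, t} ∪ {v | v ∈ legVerts L'}) (pathLegs s L t) (pathLegs s L' t) := by
  induction h generalizing s with
  | slnil => exact .refl _
  | @cons L' L p h ih =>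
    obtain ⟨c, l⟩ := p
    have hL := legVerts_subset h.subset
    rw [legVerts_cons] at hnd hs ht
    simp only [List.mem_append, not_or] at hs ht
    have hd := List.disjoint_of_nodup_append hnd
    have hcL : c ∉ legVerts L := fun h => hd (by simp) h
    have hsc : s ≠ c := by rintro rfl; simp at hs
    have htc : t ≠ c := by rintro rfl; simp at ht
    have h1 := ih c (.inr htc.symm) hnd.of_append_right hcL ht.2
    have hsL : s ∉ legVerts L' := fun h => hs.2 (hL h)
    have h2 := h1.frame (R := edge s c) (edge_loopless hsc) (by
      rintro v ⟨hv, hv' | hv'⟩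
      · rw [pathLegs_verts] at hv
        rcases hv with (rfl | rfl) | hv
        · simp
        · simp
        · exact absurd (hv' ▸ hv) hs.2
      · obtain rfl : v = c := hv'
        simp)
    have hloop : (VDigraph.pathLegs s L' t).Loopless :=
      pathLegs_loopless hL' (h.flatMap _ |>.nodup hnd.of_append_right) hsL fun h => ht.2 (hL h)
    -- The leg at `c` is dropped by deleting all of it except `c` and contracting `c` into the
    -- preceding vertex `s` of the path.
    refine (Red.of_le ?_).trans ((h2.mono ?_).trans
      ((Red.outCollapse (O := {s, c}) (Set.toFinite _) (q := s) (by simp) (by simp [edge])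
        (by
          rintro o (rfl | rfl)
          · exact .refl _
          · exact .single ⟨.inr ⟨rfl, rfl⟩, by simp, by simp⟩) ?_).trans (Red.of_le ?_)))
    · rw [sup_comm']
      exact sup_le_sup' (le_sup_left' _ _) (le_refl' _)
    · rintro v ⟨hv, -⟩
      simp [edge] at hv ⊢
      tauto
    · rintro v ⟨(rfl | rfl) | hv, hv' | hv'⟩
      · exact hv'
      · exact absurd hv' hsc
      · exact hv'
      · exact absurd hv' htc
      · exact hv'
      · exact absurd (hL (hv' ▸ hv)) hcL
    · constructor
      · rw [pathLegs_verts]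
        have key : ∀ v, v = t ∨ v ∈ legVerts L' → v ∈
            ((VDigraph.pathLegs c L' t ⊔ edge s c).outCollapse s {s, c}).verts := by
          intro v hv
          by_cases hvs : v = s
          · exact .inr hvs
          refine .inl ⟨.inl (by rw [pathLegs_verts]; exact hv.imp (fun h => .inr h) id), ?_⟩
          rintro (h | h)
          · exact hvs h
          · obtain rfl : v = c := h
            exact hv.elim (fun h => htc h.symm) fun h => hcL (hL h)
        rintro v ((rfl | rfl) | hv)
        · exact .inr rfl
        · exact key _ (.inl rfl)
        · exact key _ (.inr hv)
      · intro a b e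
        have hbc : b ≠ c := by
          rintro rfl
          exact (pathLegs_adj_right e).elim (fun h => htc h.symm) fun h => hcL (hL h)
        rcases pathLegs_adj_left e with ⟨rfl, h'⟩ | ⟨ha, h'⟩
        · have hba : b ≠ a := fun h => hloop _ (h ▸ e)
          exact .inr (.inr ⟨rfl, by simp [hba, hbc], c, by simp, .inl (h' c)⟩)
        · have has : a ≠ s := fun h => hsL (h ▸ ha)
          have hac : a ≠ c := fun h => hcL (hL (h ▸ ha))
          by_cases hbs : b = s
          · exact .inr (.inl ⟨by simp [has, hac], hbs, .inl (hbs ▸ h' c)⟩)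
          · exact .inl ⟨by simp [has, hac], by simp [hbs, hbc], .inl (h' c)⟩
  | @cons_cons L' L p h ih =>
    obtain ⟨c, l⟩ := p
    rw [legVerts_cons] at hnd hs ht
    simp only [List.mem_append, not_or] at hs ht
    have hd := List.disjoint_of_nodup_append hnd
    have hcL : c ∉ legVerts L := fun h => hd (by simp) h
    have hsc : s ≠ c := by rintro rfl; simp at hs
    have htc : t ≠ c := by rintro rfl; simp at ht
    have h1 := ih c (.inr htc.symm) hnd.of_append_right hcL ht.2
    have h2 := h1.frame (R := edge s c ⊔ bip (c :: l))
      ((edge_loopless hsc).sup (bip_loopless hnd.of_append_left)) (by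
      rintro v ⟨hv, hv'⟩
      rw [pathLegs_verts] at hv
      rcases hv with (rfl | rfl) | hv
      · simp
      · simp
      · exfalso
        rcases hv' with (hv' | hv') | hv'
        · exact hs.2 (hv' ▸ hv)
        · exact hcL ((show v = c from hv') ▸ hv)
        · exact hd (by simpa using hv') hv)
    change Red _ (edge s c ⊔ bip (c :: l) ⊔ VDigraph.pathLegs c L t)
      (edge s c ⊔ bip (c :: l) ⊔ VDigraph.pathLegs c L' t)
    rw [sup_comm', sup_comm' _ (VDigraph.pathLegs c L' t)]
    refine h2.mono ?_
    rintro v ⟨hv, -⟩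
    simp [edge] at hv ⊢
    tauto

/-- The directed cycle through the first vertices of the legs, together with the legs. -/
def cycleLegs : List (V × List V) → VDigraph V
  | [] => ⟨∅, fun _ _ => False, fun h => h.elim, fun h => h.elim⟩
  | (c, l) :: L => pathLegs c L c ⊔ bip (c :: l)

/-- After the superfluous legs are removed, the only edge leaving `r` leads to the first vertex of
the first leg. Contracting it turns the closed path through `r` into a cycle through the legs. With
a single leg this cycle would be a loop. -/
theorem Red.cycleLegs {L L' : List (V × List V)} (h : L'.Sublist L) (r : V)
    (hL' : 2 ≤ L'.length) (hnd : (legVerts L).Nodup) (hr : r ∉ legVerts L) :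
    Red {v | v ∈ legVerts L'} (pathLegs r L r) (cycleLegs L') := by
  have hr' : r ∉ legVerts L' := fun h' => hr (legVerts_subset h.subset h')
  have hnd' : (legVerts L').Nodup := (h.flatMap _).nodup hnd
  have h1 := Red.pathLegs_sublist h r r (.inl (by rintro rfl; simp at hL')) hnd hr hr
  match L', hL' with
  | (c, l) :: (c', l') :: L₀, _ =>
  have hrc : r ≠ c := by rintro rfl; simp at hr'
  rw [legVerts_cons] at hnd' hr'
  simp only [List.mem_append, not_or] at hr'
  have hd := List.disjoint_of_nodup_append hnd'
  have hcL : c ∉ legVerts ((c', l') :: L₀) := fun h => hd (by simp) h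
  refine (h1.mono ?_).trans ((Red.inCollapse (I := {c, r}) (q := c) (Set.toFinite _) (by simp)
    (by rw [pathLegs_verts]; simp) ?_ ?_).trans (Red.of_le ?_))
  · rintro v ⟨hv, -⟩; exact .inr hv
  · rintro o (rfl | rfl)
    · exact .refl _
    · exact .single ⟨.inl (.inl ⟨rfl, rfl⟩), by simp, by simp⟩
  · rintro v ⟨hv, hv' | hv'⟩
    · exact hv'
    · obtain rfl : v = r := hv'
      simp at hv hr'
      tauto
  · have hbip : ∀ v ∈ c :: l, v ≠ r := fun v hv h => hr'.1 (h ▸ hv)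
    have hl : (bip (c :: l)).Loopless := bip_loopless hnd'.of_append_left
    have hl' : (VDigraph.pathLegs c ((c', l') :: L₀) c).Loopless :=
      pathLegs_loopless (.inl (by simp)) hnd'.of_append_right hcL hcL
    have key : ∀ a b, (VDigraph.pathLegs r ((c, l) :: (c', l') :: L₀) r).Adj a b → a ≠ b → a ≠ r →
        b ≠ r → ((VDigraph.pathLegs r ((c, l) :: (c', l') :: L₀) r).inCollapse c {c, r}).Adj a b := by
      intro a b e hab ha hb
      rw [inCollapse_adj]
      by_cases hac : a = c
      · exact .inr (.inl ⟨hac, by simp [hb]; rintro rfl; exact hab hac, hac ▸ e⟩)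
      · by_cases hbc : b = c
        · exact .inr (.inr ⟨by simp [ha, hac], hbc, c, by simp, hbc ▸ e⟩)
        · exact .inl ⟨by simp [ha, hac], by simp [hb, hbc], e⟩
    constructor
    · rintro v hv
      by_cases hvc : v = c
      · exact .inr hvc
      have hvr : v ∈ legVerts ((c, l) :: (c', l') :: L₀) := by
        rcases hv with hv | hv
        · rw [pathLegs_verts] at hv
          rcases hv with (h | h) | hv
          · exact absurd h hvc
          · exact absurd h hvc
          · exact List.mem_append_right _ hv
        · exact List.mem_append_left _ (by simpa using hv)
      refine .inl ⟨by simp only [VDigraph.rev]; rw [pathLegs_verts]; exact .inr hvr, ?_⟩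
      rintro (h | h)
      · exact hvc h
      · obtain rfl : v = r := h
        rw [legVerts_cons, List.mem_append] at hvr
        exact hvr.elim hr'.1 hr'.2
    · rintro a b (e | e)
      · have ha : a ≠ r := by
          rintro rfl
          rcases pathLegs_adj_left e with ⟨h, -⟩ | ⟨h, -⟩
          · exact hrc h
          · exact hr'.2 h
        have hab : a ≠ b := fun h => hl' _ (h ▸ e)
        rcases pathLegs_adj_right' e with ⟨hb, h⟩ | ⟨hb, h⟩
        · refine inCollapse_adj.2 (.inr (.inr ⟨?_, hb, r, by simp, .inr (h r)⟩))
          simp [ha, hb ▸ hab]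
        · exact key a b (.inr (h r)) hab ha fun h => hr'.2 (h ▸ hb)
      · exact key a b (.inl (.inr e)) (fun h => hl _ (h ▸ e))
          (hbip _ (by simpa using (bip (c :: l)).left_mem e))
          (hbip _ (by simpa using (bip (c :: l)).right_mem e))

/-- The `j`-th vertex of the `i`-th leg. -/
def legAt (L : List (V × List V)) (i j : ℕ) : Option V :=
  L[i]?.bind fun p => (p.1 :: p.2)[j]?

theorem legAt_cons_zero (p : V × List V) (L : List (V × List V)) (j : ℕ) :
    legAt (p :: L) 0 j = (p.1 :: p.2)[j]? := by simp [legAt]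

theorem legAt_cons_succ (p : V × List V) (L : List (V × List V)) (i j : ℕ) :
    legAt (p :: L) (i + 1) j = legAt L i j := by simp [legAt]

theorem legAt_eq_some {L : List (V × List V)} {i j : ℕ} {v : V} :
    legAt L i j = some v ↔ ∃ h : i < L.length, (L[i].1 :: L[i].2)[j]? = some v := by
  by_cases h : i < L.length
  · simp [legAt, h]
  · simp [legAt, h]

theorem legAt_lt {L : List (V × List V)} {i j : ℕ} {v : V} (h : legAt L i j = some v) :
    ∃ h : i < L.length, j < L[i].2.length + 1 := by
  obtain ⟨h1, h2⟩ := legAt_eq_some.1 h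
  obtain ⟨h3, -⟩ := List.getElem?_eq_some_iff.1 h2
  exact ⟨h1, by simpa using h3⟩

theorem legAt_isSome {L : List (V × List V)} {i j : ℕ} (hi : i < L.length)
    (hj : j < L[i].2.length + 1) : ∃ v, legAt L i j = some v :=
  ⟨(L[i].1 :: L[i].2)[j], legAt_eq_some.2 ⟨hi, List.getElem?_eq_getElem _⟩⟩

theorem mem_legVerts {L : List (V × List V)} {v : V} :
    v ∈ legVerts L ↔ ∃ i j, legAt L i j = some v := by
  simp only [legVerts, List.mem_flatMap, legAt_eq_some]
  constructor
  · rintro ⟨p, hp, hv⟩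
    obtain ⟨i, hi, rfl⟩ := List.mem_iff_getElem.1 hp
    obtain ⟨j, hj⟩ := List.mem_iff_getElem?.1 hv
    exact ⟨i, j, hi, hj⟩
  · rintro ⟨i, j, hi, hj⟩
    exact ⟨L[i], List.getElem_mem _, List.mem_iff_getElem?.2 ⟨j, hj⟩⟩

theorem legEnd_eq_legAt {L : List (V × List V)} {i : ℕ} (hi : i < L.length) :
    legAt L i L[i].2.length = some (legEnd L[i]) := by
  rw [legAt_eq_some]
  refine ⟨hi, ?_⟩
  rw [legEnd, List.getLast_eq_getElem, List.getElem?_eq_getElem (by simp)]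
  simp

theorem legAt_inj {L : List (V × List V)} (hnd : (legVerts L).Nodup) {i j i' j' : ℕ} {v : V}
    (h : legAt L i j = some v) (h' : legAt L i' j' = some v) : i = i' ∧ j = j' := by
  obtain ⟨hi, h⟩ := legAt_eq_some.1 h
  obtain ⟨hi', h'⟩ := legAt_eq_some.1 h'
  obtain ⟨h1, h2⟩ := List.nodup_flatMap.1 hnd
  have hii : i = i' := by
    by_contra hne
    rcases lt_or_gt_of_ne hne with hlt | hlt
    · exact List.pairwise_iff_getElem.1 h2 _ _ hi hi' hlt (List.mem_of_getElem? h)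
        (List.mem_of_getElem? h')
    · exact List.pairwise_iff_getElem.1 h2 _ _ hi' hi hlt (List.mem_of_getElem? h')
        (List.mem_of_getElem? h)
  subst hii
  refine ⟨rfl, ?_⟩
  obtain ⟨hj, h⟩ := List.getElem?_eq_some_iff.1 h
  obtain ⟨hj', h'⟩ := List.getElem?_eq_some_iff.1 h'
  exact ((h1 _ (List.getElem_mem hi)).getElem_inj_iff).1 (h.trans h'.symm)

/-- The edges of the legs. -/
def LegAdj (L : List (V × List V)) (a b : V) : Prop :=
  ∃ i j, (legAt L i j = some a ∧ legAt L i (j + 1) = some b) ∨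
    (legAt L i j = some b ∧ legAt L i (j + 1) = some a)

theorem legAdj_cons {p : V × List V} {L : List (V × List V)} {a b : V} :
    LegAdj (p :: L) a b ↔ (bip (p.1 :: p.2)).Adj a b ∨ LegAdj L a b := by
  rw [bip_adj]
  constructor
  · rintro ⟨i, j, h⟩
    cases i with
    | zero => exact .inl ⟨j, by simpa only [legAt_cons_zero] using h⟩
    | succ i => exact .inr ⟨i, j, by simpa only [legAt_cons_succ] using h⟩
  · rintro (⟨j, h⟩ | ⟨i, j, h⟩)
    · exact ⟨0, j, by simpa only [legAt_cons_zero] using h⟩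
    · exact ⟨i + 1, j, by simpa only [legAt_cons_succ] using h⟩

theorem starLegs_adj {r : V} {L : List (V × List V)} {a b : V} : (starLegs r L).Adj a b ↔
    (a = r ∧ ∃ i, legAt L i 0 = some b) ∨ (b = r ∧ ∃ i, legAt L i 0 = some a) ∨ LegAdj L a b := by
  induction L with
  | nil => simp [starLegs, single, legAt, LegAdj]
  | cons p L ih =>
    obtain ⟨c, l⟩ := p
    have h0 : ∀ v, (∃ i, legAt ((c, l) :: L) i 0 = some v) ↔ c = v ∨ ∃ i, legAt L i 0 = some v := by
      intro v
      constructor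
      · rintro ⟨i, h⟩
        cases i with
        | zero => exact .inl (by simpa [legAt_cons_zero] using h)
        | succ i => exact .inr ⟨i, by simpa only [legAt_cons_succ] using h⟩
      · rintro (h | ⟨i, h⟩)
        · exact ⟨0, by simpa [legAt_cons_zero] using h⟩
        · exact ⟨i + 1, by simpa only [legAt_cons_succ] using h⟩
    rw [h0, h0, legAdj_cons, starLegs, sup_adj, ih, bip_cons_cons]
    simp only [sup_adj, edge, eq_comm (a := c)]
    tauto

theorem pathLegs_adj {s t : V} {L : List (V × List V)} {a b : V} : (pathLegs s L t).Adj a b ↔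
    (∃ i, (s :: L.map Prod.fst ++ [t])[i]? = some a ∧
      (s :: L.map Prod.fst ++ [t])[i + 1]? = some b) ∨ LegAdj L a b := by
  induction L generalizing s with
  | nil =>
    simp only [pathLegs, edge, List.map_nil, LegAdj, legAt]
    constructor
    · rintro ⟨rfl, rfl⟩
      exact .inl ⟨0, by simp⟩
    · rintro (⟨i, h⟩ | ⟨i, j, h⟩)
      · match i, h with
        | 0, h => simpa [eq_comm] using h
        | i + 1, h => simp at h
      · simp at h
  | cons p L ih =>
    obtain ⟨c, l⟩ := p
    rw [legAdj_cons, pathLegs, sup_adj, sup_adj, ih]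
    have : (∃ i, (s :: ((c, l) :: L).map Prod.fst ++ [t])[i]? = some a ∧
        (s :: ((c, l) :: L).map Prod.fst ++ [t])[i + 1]? = some b) ↔ (a = s ∧ b = c) ∨
        ∃ i, (c :: L.map Prod.fst ++ [t])[i]? = some a ∧
          (c :: L.map Prod.fst ++ [t])[i + 1]? = some b := by
      constructor
      · rintro ⟨i, h⟩
        cases i with
        | zero => exact .inl (by simpa [eq_comm] using h)
        | succ i => exact .inr ⟨i, by simpa using h⟩
      · rintro (⟨rfl, rfl⟩ | ⟨i, h⟩)
        · exact ⟨0, by simp⟩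
        · exact ⟨i + 1, by simpa using h⟩
    rw [this]
    constructor
    · rintro ((h | h) | h | h)
      exacts [.inl (.inl h), .inr (.inl h), .inl (.inr h), .inr (.inr h)]
    · rintro ((h | h) | h | h)
      exacts [.inl (.inl h), .inr (.inl h), .inl (.inr h), .inr (.inr h)]

theorem cycleLegs_adj {L : List (V × List V)} {a b : V} : (cycleLegs L).Adj a b ↔
    (∃ i < L.length, legAt L i 0 = some a ∧ legAt L ((i + 1) % L.length) 0 = some b) ∨
      LegAdj L a b := by
  cases L with
  | nil => simp [cycleLegs, LegAdj, legAt]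
  | cons p L =>
    obtain ⟨c, l⟩ := p
    rw [cycleLegs, sup_adj, pathLegs_adj, legAdj_cons]
    have h0 : ∀ i, i < L.length + 1 →
        (c :: L.map Prod.fst ++ [c])[i]? = legAt ((c, l) :: L) i 0 := by
      intro i hi
      cases i with
      | zero => simp [legAt]
      | succ i =>
        have : i < L.length := by omega
        simp [legAt, List.getElem?_append, this]
    have h1 : ∀ i, i < L.length + 1 →
        (c :: L.map Prod.fst ++ [c])[i + 1]? = legAt ((c, l) :: L) ((i + 1) % (L.length + 1)) 0 := by
      intro i hi
      by_cases h : i + 1 = L.length + 1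
      · rw [h, Nat.mod_self]
        simp [legAt]
      · rw [Nat.mod_eq_of_lt (by omega), h0 _ (by omega)]
    have : (∃ i, (c :: L.map Prod.fst ++ [c])[i]? = some a ∧
        (c :: L.map Prod.fst ++ [c])[i + 1]? = some b) ↔
        ∃ i < L.length + 1, legAt ((c, l) :: L) i 0 = some a ∧
          legAt ((c, l) :: L) ((i + 1) % (L.length + 1)) 0 = some b := by
      constructor
      · rintro ⟨i, h⟩
        have hi : i < L.length + 1 := by
          obtain ⟨h', -⟩ := List.getElem?_eq_some_iff.1 h.2
          simp at h'
          omega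
        exact ⟨i, hi, by rwa [← h0 i hi, ← h1 i hi]⟩
      · rintro ⟨i, hi, h⟩
        exact ⟨i, by rwa [h0 i hi, h1 i hi]⟩
    rw [this, List.length_cons, or_assoc, or_comm (a := LegAdj L a b)]

theorem cycleLegs_verts (L : List (V × List V)) : (cycleLegs L).verts = {v | v ∈ legVerts L} := by
  cases L with
  | nil => ext; simp [cycleLegs]
  | cons p L =>
    obtain ⟨c, l⟩ := p
    rw [cycleLegs, sup_verts, pathLegs_verts]
    ext v
    simp
    tauto

theorem shapedByStar_dicycle {L : List (V × List V)} (hL : 2 ≤ L.length)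
    (hnd : (legVerts L).Nodup) (hl : ∀ p ∈ L, p.2 = []) :
    ShapedByStar (cycleLegs L) {v | v ∈ legVerts L} := by
  have hz : ∀ {i j v}, legAt L i j = some v → j = 0 := by
    intro i j v h
    obtain ⟨h1, h2⟩ := legAt_lt h
    rw [hl _ (List.getElem_mem h1)] at h2
    simpa using h2
  obtain ⟨p₀, L₀, hL₀⟩ := List.exists_cons_of_ne_nil (show L ≠ [] by rintro rfl; simp at hL)
  have hsome : ∀ i < L.length, legAt L i 0 = some ((legAt L i 0).getD p₀.1) := by
    intro i hi
    obtain ⟨v, hv⟩ := legAt_isSome hi (Nat.succ_pos _)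
    rw [hv]; rfl
  refine .inl ⟨L.length, hL, ?_⟩
  have him : (fun i => (legAt L i 0).getD p₀.1) '' (dicycle L.length).verts =
      {v | v ∈ legVerts L} := by
    ext v
    constructor
    · rintro ⟨i, hi, rfl⟩
      exact mem_legVerts.2 ⟨i, 0, hsome i hi⟩
    · intro hv
      obtain ⟨i, j, h⟩ := mem_legVerts.1 hv
      obtain rfl := hz h
      exact ⟨i, (legAt_lt h).1, by simp [h]⟩
  refine isCopyOf_of_map (fun i => (legAt L i 0).getD p₀.1) ?_ (him.trans (cycleLegs_verts L).symm)
    ?_ ?_ him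
  · intro i hi i' hi' h
    have h1 := hsome i hi
    have h2 := hsome i' hi'
    rw [← (show (legAt L i 0).getD p₀.1 = (legAt L i' 0).getD p₀.1 from h)] at h2
    exact (legAt_inj hnd h1 h2).1
  · rintro i j ⟨hi, hj, rfl⟩
    exact cycleLegs_adj.2 (.inl ⟨i, hi, hsome i hi, hsome _ hj⟩)
  · intro u v h
    rcases cycleLegs_adj.1 h with ⟨i, hi, h1, h2⟩ | ⟨i, j, ⟨-, h⟩ | ⟨-, h⟩⟩
    · exact ⟨i, (i + 1) % L.length, ⟨hi, (legAt_lt h2).1, rfl⟩, by simp [h1], by simp [h2]⟩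
    · exact absurd (hz h) (by simp)
    · exact absurd (hz h) (by simp)

theorem starGraph_adj_none {m : ℕ} {len : Fin m → ℕ} {b : Σ i : Fin m, Fin (len i + 1)} :
    (starGraph m len).Adj none (some b) ↔ (b.2 : ℕ) = 0 := by
  simp [starGraph, SimpleGraph.fromRel_adj]

theorem starGraph_adj_some {m : ℕ} {len : Fin m → ℕ} {i i' : Fin m} {j : Fin (len i + 1)}
    {j' : Fin (len i' + 1)} : (starGraph m len).Adj (some ⟨i, j⟩) (some ⟨i', j'⟩) ↔
      i = i' ∧ ((j' : ℕ) = j + 1 ∨ (j : ℕ) = j' + 1) := by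
  simp only [starGraph, SimpleGraph.fromRel_adj]
  constructor
  · rintro ⟨-, h | h⟩
    · exact ⟨h.1, .inl h.2⟩
    · exact ⟨h.1.symm, .inr h.2⟩
  · rintro ⟨rfl, h⟩
    refine ⟨?_, h.imp (fun h => ⟨rfl, h⟩) fun h => ⟨rfl, h⟩⟩
    intro h'
    simp only [Option.some.injEq, Sigma.mk.injEq, heq_eq_eq, true_and] at h'
    subst h'
    omega

theorem last_mem_starTeeth {m : ℕ} {len : Fin m → ℕ} (i : Fin m) :
    some ⟨i, Fin.last (len i)⟩ ∈ starTeeth m len := by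
  change deg _ _ = 1
  rw [deg, Set.ncard_eq_one]
  by_cases h : len i = 0
  · refine ⟨none, Set.eq_singleton_iff_unique_mem.2 ⟨?_, ?_⟩⟩
    · exact (starGraph_adj_none.2 (by simpa using h)).symm
    · rintro (_ | ⟨i', j'⟩) h'
      · rfl
      · obtain ⟨rfl, h'⟩ := starGraph_adj_some.1 h'
        simp only [Fin.val_last] at h'
        omega
  · refine ⟨some ⟨i, ⟨len i - 1, by omega⟩⟩, Set.eq_singleton_iff_unique_mem.2 ⟨?_, ?_⟩⟩
    · exact starGraph_adj_some.2 ⟨rfl, .inr (by simp only [Fin.val_last]; omega)⟩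
    · rintro (_ | ⟨i', j'⟩) h'
      · exact absurd (starGraph_adj_none.1 (SimpleGraph.Adj.symm h')) (by simpa using h)
      · obtain ⟨rfl, h'⟩ := starGraph_adj_some.1 h'
        simp only [Fin.val_last] at h'
        simp only [Option.some.injEq, Sigma.mk.injEq, heq_eq_eq, true_and]
        ext
        simp only
        omega

theorem shapedByStar_starLegs {r : V} {L : List (V × List V)} (hnd : (legVerts L).Nodup)
    (hr : r ∉ legVerts L) : ∃ T, ShapedByStar (starLegs r L) T ∧ ∀ p ∈ L, legEnd p ∈ T := by
  let len : Fin L.length → ℕ := fun i => L[i].2.length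
  let φ : StarVertex L.length len → V := fun x => match x with
    | none => r
    | some ⟨i, j⟩ => (legAt L i j).getD r
  have hφ : ∀ (i : Fin L.length) (j : Fin (len i + 1)),
      legAt L i j = some (φ (some ⟨i, j⟩)) := by
    intro i j
    obtain ⟨v, hv⟩ := legAt_isSome i.2 j.2
    change _ = some ((legAt L i j).getD r)
    rw [hv]; rfl
  have hφ' : ∀ i j v, legAt L i j = some v → ∃ (hi : i < L.length) (hj : j < len ⟨i, hi⟩ + 1),
      φ (some ⟨⟨i, hi⟩, ⟨j, hj⟩⟩) = v := by
    intro i j v h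
    obtain ⟨hi, hj⟩ := legAt_lt h
    refine ⟨hi, hj, ?_⟩
    change (legAt L i j).getD r = v
    rw [h]; rfl
  have hφr : ∀ (i : Fin L.length) (j : Fin (len i + 1)), φ (some ⟨i, j⟩) ≠ r := fun i j h =>
    hr (mem_legVerts.2 ⟨i, j, h ▸ hφ i j⟩)
  have hinj : Function.Injective φ := by
    rintro (_ | ⟨i, j⟩) (_ | ⟨i', j'⟩) h
    · rfl
    · exact absurd h.symm (hφr i' j')
    · exact absurd h (hφr i j)
    · have h2 := hφ i' j'
      rw [← h] at h2
      obtain ⟨h3, h4⟩ := legAt_inj hnd (hφ i j) h2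
      obtain rfl := Fin.ext h3
      obtain rfl := Fin.ext h4
      rfl
  refine ⟨φ '' starTeeth L.length len, .inr ⟨L.length, len, .inl
    (isCopyOf_of_map φ hinj.injOn ?_ ?_ ?_ rfl)⟩, ?_⟩
  · rw [starLegs_verts]
    ext v
    constructor
    · rintro ⟨_ | ⟨i, j⟩, -, rfl⟩
      · exact .inl rfl
      · exact .inr (mem_legVerts.2 ⟨i, j, hφ i j⟩)
    · rintro (rfl | hv)
      · exact ⟨none, trivial, rfl⟩
      · obtain ⟨i, j, h⟩ := mem_legVerts.1 hv
        obtain ⟨hi, hj, h⟩ := hφ' i j v h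
        exact ⟨some ⟨⟨i, hi⟩, ⟨j, hj⟩⟩, trivial, h⟩
  · have h0 : ∀ (i : Fin L.length) (j : Fin (len i + 1)), (j : ℕ) = 0 →
        ∃ i', legAt L i' 0 = some (φ (some ⟨i, j⟩)) := fun i j hj => ⟨i, hj ▸ hφ i j⟩
    rintro (_ | ⟨i, j⟩) (_ | ⟨i', j'⟩) h
    · exact absurd h (starGraph L.length len).irrefl
    · exact starLegs_adj.2 (.inl ⟨rfl, h0 _ _ (starGraph_adj_none.1 h)⟩)
    · exact starLegs_adj.2 (.inr (.inl ⟨rfl, h0 _ _ (starGraph_adj_none.1 (SimpleGraph.Adj.symm h))⟩))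
    · obtain ⟨rfl, h⟩ := starGraph_adj_some.1 h
      refine starLegs_adj.2 (.inr (.inr ?_))
      rcases h with h | h
      · exact ⟨i, j, .inl ⟨hφ i j, h ▸ hφ i j'⟩⟩
      · exact ⟨i, j', .inr ⟨hφ i j', h ▸ hφ i j⟩⟩
  · intro u v h
    have h1 : ∀ i j a b, legAt L i j = some a → legAt L i (j + 1) = some b →
        ∃ x y, (starGraph L.length len).Adj x y ∧ φ x = a ∧ φ y = b := by
      intro i j a b ha hb
      obtain ⟨hi, hj, h1⟩ := hφ' i j a ha
      obtain ⟨_, hj', h2⟩ := hφ' i (j + 1) b hb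
      exact ⟨some ⟨⟨i, hi⟩, ⟨j, hj⟩⟩, some ⟨⟨i, hi⟩, ⟨j + 1, hj'⟩⟩,
        starGraph_adj_some.2 ⟨rfl, .inl rfl⟩, h1, h2⟩
    rcases starLegs_adj.1 h with ⟨rfl, i, h⟩ | ⟨rfl, i, h⟩ | ⟨i, j, ⟨ha, hb⟩ | ⟨ha, hb⟩⟩
    · obtain ⟨hi, hj, h⟩ := hφ' _ _ _ h
      exact ⟨none, some ⟨⟨i, hi⟩, ⟨0, hj⟩⟩, starGraph_adj_none.2 rfl, rfl, h⟩
    · obtain ⟨hi, hj, h⟩ := hφ' _ _ _ h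
      exact ⟨some ⟨⟨i, hi⟩, ⟨0, hj⟩⟩, none, (starGraph_adj_none.2 rfl).symm, h, rfl⟩
    · exact h1 i j u v ha hb
    · obtain ⟨x, y, h2, h3, h4⟩ := h1 i j v u ha hb
      exact ⟨y, x, h2.symm, h4, h3⟩
  · intro p hp
    obtain ⟨i, hi, rfl⟩ := List.mem_iff_getElem.1 hp
    refine ⟨_, last_mem_starTeeth ⟨i, hi⟩, ?_⟩
    exact Option.some_injective _ ((hφ ⟨i, hi⟩ (Fin.last _)).symm.trans (legEnd_eq_legAt hi))

/-- The first vertices of the legs form the cycle that replaces the centre. So the vertex `j` on a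
leg of the star is the vertex `j + 1` on the corresponding leg in `L`, and `len` is one less than
the length of the tail. A trivial leg would leave no leaf. -/
theorem shapedByStar_cycleLegs {L : List (V × List V)} (hL : 2 < L.length)
    (hnd : (legVerts L).Nodup) (hl : ∀ p ∈ L, p.2 ≠ []) :
    ∃ T, ShapedByStar (cycleLegs L) T ∧ ∀ p ∈ L, legEnd p ∈ T := by
  obtain ⟨p₀, L₀, hL₀⟩ := List.exists_cons_of_ne_nil (show L ≠ [] by rintro rfl; simp at hL)
  let len : Fin L.length → ℕ := fun i => L[i].2.length - 1
  have hlen : ∀ i : Fin L.length, len i + 1 = (L[(i : ℕ)]'i.2).2.length := fun i => by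
    have := List.length_pos_of_ne_nil (hl _ (List.getElem_mem i.2))
    exact Nat.sub_add_cancel this
  let port : StarVertex L.length len → StarVertex L.length len → ℕ := fun x y => match x, y with
    | none, some ⟨i, _⟩ => i
    | _, _ => 0
  let φ : StarVertex L.length len × ℕ → V := fun x => match x with
    | (none, k) => (legAt L k 0).getD p₀.1
    | (some ⟨i, j⟩, _) => (legAt L i (j + 1)).getD p₀.1
  have hφ : ∀ (i : Fin L.length) (j : Fin (len i + 1)) (e : ℕ),
      legAt L i (j + 1) = some (φ (some ⟨i, j⟩, e)) := by
    intro i j e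
    obtain ⟨v, hv⟩ := legAt_isSome (j := j + 1) i.2 (by have := hlen i; have := j.2; omega)
    change _ = some ((legAt L i (j + 1)).getD p₀.1)
    rw [hv]; rfl
  have hφ0 : ∀ i < L.length, legAt L i 0 = some (φ (none, i)) := by
    intro i hi
    obtain ⟨v, hv⟩ := legAt_isSome (j := 0) hi (Nat.succ_pos _)
    change _ = some ((legAt L i 0).getD p₀.1)
    rw [hv]; rfl
  have hφ0' : ∀ i v, legAt L i 0 = some v → i < L.length ∧ φ (none, i) = v := by
    intro i v h
    refine ⟨(legAt_lt h).1, ?_⟩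
    change (legAt L i 0).getD p₀.1 = v
    rw [h]; rfl
  have hφ' : ∀ i j v, legAt L i (j + 1) = some v → ∃ (hi : i < L.length)
      (hj : j < len ⟨i, hi⟩ + 1), φ (some ⟨⟨i, hi⟩, ⟨j, hj⟩⟩, 0) = v := by
    intro i j v h
    obtain ⟨hi, hj⟩ := legAt_lt h
    refine ⟨hi, by rw [hlen]; exact Nat.lt_of_succ_lt_succ hj, ?_⟩
    change (legAt L i (j + 1)).getD p₀.1 = v
    rw [h]; rfl
  set R := replaceByCycles (starGraph L.length len) {none} L.length port with hR
  have hnone : ∀ k, (none, k) ∈ R.verts ↔ k < L.length := fun k => by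
    simp [hR, replaceByCycles]
  have hsome : ∀ b k, (some b, k) ∈ R.verts ↔ k = 0 := fun b k => by
    simp [hR, replaceByCycles]
  have hadj : ∀ x y, R.Adj x y ↔ x ∈ R.verts ∧ y ∈ R.verts ∧
      ((x.1 = y.1 ∧ x.1 = none ∧ y.2 = (x.2 + 1) % L.length) ∨
        ((starGraph L.length len).Adj x.1 y.1 ∧ x.2 = port x.1 y.1 ∧ y.2 = port y.1 x.1)) :=
    fun x y => Iff.rfl
  have hlegs : ∀ i j a b, legAt L i j = some a → legAt L i (j + 1) = some b →
      ∃ x y, R.Adj x y ∧ R.Adj y x ∧ φ x = a ∧ φ y = b := by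
    intro i j a b ha hb
    obtain ⟨hi, hj', h2⟩ := hφ' i j b hb
    cases j with
    | zero =>
      obtain ⟨-, h1⟩ := hφ0' i a ha
      refine ⟨(none, i), (some ⟨⟨i, hi⟩, ⟨0, hj'⟩⟩, 0), ?_, ?_, h1, h2⟩
      · exact (hadj _ _).2 ⟨(hnone _).2 hi, (hsome _ _).2 rfl,
          .inr ⟨starGraph_adj_none.2 rfl, rfl, rfl⟩⟩
      · exact (hadj _ _).2 ⟨(hsome _ _).2 rfl, (hnone _).2 hi,
          .inr ⟨(starGraph_adj_none.2 rfl).symm, rfl, rfl⟩⟩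
    | succ j =>
      obtain ⟨_, hj, h1⟩ := hφ' i j a ha
      refine ⟨(some ⟨⟨i, hi⟩, ⟨j, hj⟩⟩, 0), (some ⟨⟨i, hi⟩, ⟨j + 1, hj'⟩⟩, 0), ?_, ?_, h1, h2⟩
      · exact (hadj _ _).2 ⟨(hsome _ _).2 rfl, (hsome _ _).2 rfl,
          .inr ⟨starGraph_adj_some.2 ⟨rfl, .inl rfl⟩, rfl, rfl⟩⟩
      · exact (hadj _ _).2 ⟨(hsome _ _).2 rfl, (hsome _ _).2 rfl,
          .inr ⟨starGraph_adj_some.2 ⟨rfl, .inr rfl⟩, rfl, rfl⟩⟩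
  refine ⟨φ '' replacedTeeth (starGraph L.length len) {none} L.length port
    (starTeeth L.length len), .inr ⟨L.length, len, .inr ⟨hL, port, ⟨?_, ?_⟩,
      isCopyOf_of_map φ ?_ ?_ ?_ ?_ rfl⟩⟩, ?_⟩
  · rintro (_ | v) hv w h
    · exact absurd rfl hv
    · rfl
  · rintro v rfl
    refine ⟨?_, ?_⟩
    · rintro (_ | ⟨i, j⟩) h
      · exact absurd h (starGraph L.length len).irrefl
      · exact i.2
    · rintro (_ | ⟨i, j⟩) h (_ | ⟨i', j'⟩) h' e
      · rfl
      · exact absurd h (starGraph L.length len).irrefl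
      · exact absurd h' (starGraph L.length len).irrefl
      · have hj := starGraph_adj_none.1 h
        have hj' := starGraph_adj_none.1 h'
        obtain rfl : i = i' := Fin.ext e
        obtain rfl : j = j' := Fin.ext (hj.trans hj'.symm)
        rfl
  · rintro ⟨_ | ⟨i, j⟩, k⟩ hx ⟨_ | ⟨i', j'⟩, k'⟩ hy h
    · rw [hnone] at hx hy
      have h2 := hφ0 k' hy
      rw [← h] at h2
      rw [(legAt_inj hnd (hφ0 k hx) h2).1]
    · rw [hnone] at hx
      have h2 := hφ i' j' k'
      rw [← h] at h2
      exact absurd (legAt_inj hnd (hφ0 k hx) h2).2 (by omega)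
    · rw [hnone] at hy
      have h2 := hφ i j k
      rw [h] at h2
      exact absurd (legAt_inj hnd (hφ0 k' hy) h2).2 (by omega)
    · rw [hsome] at hx hy
      subst hx hy
      have h2 := hφ i' j' 0
      rw [← h] at h2
      obtain ⟨h3, h4⟩ := legAt_inj hnd (hφ i j 0) h2
      obtain rfl := Fin.ext h3
      obtain rfl : j = j' := Fin.ext (by omega)
      rfl
  · rw [cycleLegs_verts]
    ext v
    constructor
    · rintro ⟨⟨_ | ⟨i, j⟩, k⟩, hx, rfl⟩
      · rw [hnone] at hx
        exact mem_legVerts.2 ⟨k, 0, hφ0 k hx⟩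
      · exact mem_legVerts.2 ⟨i, j + 1, hφ i j k⟩
    · intro hv
      obtain ⟨i, j, h⟩ := mem_legVerts.1 hv
      cases j with
      | zero =>
        obtain ⟨h1, h2⟩ := hφ0' i v h
        exact ⟨_, (hnone i).2 h1, h2⟩
      | succ j =>
        obtain ⟨hi, hj, h⟩ := hφ' i j v h
        exact ⟨(some ⟨⟨i, hi⟩, ⟨j, hj⟩⟩, 0), (hsome _ 0).2 rfl, h⟩
  · rintro ⟨x, k⟩ ⟨y, k'⟩ h
    obtain ⟨hx, hy, ⟨h1, h2, h3⟩ | ⟨h1, h2, h3⟩⟩ := (hadj _ _).1 h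
    · simp only at h1 h2 h3
      subst h1 h2 h3
      rw [hnone] at hx hy
      exact cycleLegs_adj.2 (.inl ⟨k, hx, hφ0 k hx, hφ0 _ hy⟩)
    · refine cycleLegs_adj.2 (.inr ?_)
      simp only at h1 h2 h3
      match x, y with
      | none, none => exact absurd h1 (starGraph L.length len).irrefl
      | none, some ⟨i, j⟩ =>
        obtain rfl : k = i := h2
        have hj := starGraph_adj_none.1 h1
        have := hφ i j k'
        simp only at hj
        rw [hj] at this
        exact ⟨i, 0, .inl ⟨hφ0 i i.2, this⟩⟩
      | some ⟨i, j⟩, none =>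
        obtain rfl : k' = i := h3
        have hj := starGraph_adj_none.1 h1.symm
        have := hφ i j k
        simp only at hj
        rw [hj] at this
        exact ⟨i, 0, .inr ⟨hφ0 i i.2, this⟩⟩
      | some ⟨i, j⟩, some ⟨i', j'⟩ =>
        obtain ⟨rfl, h | h⟩ := starGraph_adj_some.1 h1
        · exact ⟨i, j + 1, .inl ⟨hφ i j k, h ▸ hφ i j' k'⟩⟩
        · exact ⟨i, j' + 1, .inr ⟨hφ i j' k', h ▸ hφ i j k⟩⟩
  · intro u v h
    rcases cycleLegs_adj.1 h with ⟨i, hi, h1, h2⟩ | ⟨i, j, ⟨ha, hb⟩ | ⟨ha, hb⟩⟩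
    · obtain ⟨h3, h4⟩ := hφ0' _ _ h1
      obtain ⟨h5, h6⟩ := hφ0' _ _ h2
      exact ⟨(none, i), (none, (i + 1) % L.length), (hadj _ _).2 ⟨(hnone _).2 h3, (hnone _).2 h5,
        .inl ⟨rfl, rfl, rfl⟩⟩, h4, h6⟩
    · obtain ⟨x, y, h1, h2, h3, h4⟩ := hlegs i j u v ha hb
      exact ⟨x, y, h1, h3, h4⟩
    · obtain ⟨x, y, h1, h2, h3, h4⟩ := hlegs i j v u ha hb
      exact ⟨y, x, h2, h4, h3⟩
  · intro p hp
    obtain ⟨i, hi, rfl⟩ := List.mem_iff_getElem.1 hp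
    refine ⟨(some ⟨⟨i, hi⟩, Fin.last _⟩, 0), ⟨(hsome _ _).2 rfl, last_mem_starTeeth ⟨i, hi⟩,
      fun h => absurd h (by simp)⟩, ?_⟩
    have := hφ ⟨i, hi⟩ (Fin.last _) 0
    simp only [Fin.val_last, hlen] at this
    exact Option.some_injective _ (this.symm.trans (legEnd_eq_legAt hi))

theorem le_encard_of_nodup {T U : Set V} {l : List V} (hl : l.Nodup) (h : ∀ v ∈ l, v ∈ T ∧ v ∈ U)
    {n : ℕ} (hn : n ≤ l.length) : (n : ℕ∞) ≤ (T ∩ U).encard := by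
  classical
  have h1 : ((l.toFinset : Set V)).encard ≤ (T ∩ U).encard :=
    Set.encard_le_encard fun v hv => h v (by simpa using hv)
  rw [Set.encard_coe_eq_coe_finsetCard, List.toFinset_card_of_nodup hl] at h1
  exact le_trans (by exact_mod_cast hn) h1

theorem legEnd_nodup {L : List (V × List V)} (hnd : (legVerts L).Nodup) :
    (L.map legEnd).Nodup := by
  rw [List.nodup_iff_injective_get]
  intro i j h
  have hi : (i : ℕ) < L.length := by simpa using i.2
  have hj : (j : ℕ) < L.length := by simpa using j.2
  simp only [List.get_eq_getElem, List.getElem_map] at h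
  have h1 := legEnd_eq_legAt hi
  rw [h] at h1
  exact Fin.ext (legAt_inj hnd h1 (legEnd_eq_legAt hj)).1

/-- Neither a directed cycle nor a star with its centre replaced by a cycle may mix trivial and
nontrivial legs. One of the two kinds makes up at least half of the legs, and only this kind is
kept. A replaced centre has degree greater than two, which is where `3 ≤ n` enters. -/
theorem hasShape_of_pathLegs {r : V} {L : List (V × List V)} {U : Set V} {n : ℕ} (hn : 3 ≤ n)
    (hL : 2 * n ≤ L.length) (hnd : (legVerts L).Nodup) (hr : r ∉ legVerts L)
    (hU : ∀ p ∈ L, legEnd p ∈ U) : HasShape (pathLegs r L r) U n := by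
  have hsum := List.length_eq_length_filter_add (l := L) (fun p => p.2.isEmpty)
  by_cases h : n ≤ (L.filter fun p => p.2.isEmpty).length
  · set L' := L.filter fun p => p.2.isEmpty with hL'
    have hsub : L'.Sublist L := List.filter_sublist
    have hnil : ∀ p ∈ L', p.2 = [] := fun p hp => by simpa using (List.mem_filter.1 hp).2
    have hnd' := (hsub.flatMap _).nodup hnd
    refine ⟨cycleLegs L', _, (Red.cycleLegs hsub r (by omega) hnd hr).mono (by simp),
      .inl (shapedByStar_dicycle (by omega) hnd' hnil), ?_⟩
    refine le_encard_of_nodup (legEnd_nodup hnd') (fun v hv => ?_) (by simpa using h)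
    obtain ⟨p, hp, rfl⟩ := List.mem_map.1 hv
    refine ⟨?_, hU p (hsub.subset hp)⟩
    simp only [Set.mem_ofPred_eq, legVerts, List.mem_flatMap]
    exact ⟨p, hp, legEnd_mem p⟩
  · set L' := L.filter fun p => !p.2.isEmpty with hL'
    have hsub : L'.Sublist L := List.filter_sublist
    have hnil : ∀ p ∈ L', p.2 ≠ [] := fun p hp => by simpa using (List.mem_filter.1 hp).2
    have hnd' := (hsub.flatMap _).nodup hnd
    have hlen : n ≤ L'.length := by omega
    obtain ⟨T, h1, h2⟩ := shapedByStar_cycleLegs (by omega) hnd' hnil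
    refine ⟨cycleLegs L', T, (Red.cycleLegs hsub r (by omega) hnd hr).mono (by simp), .inl h1, ?_⟩
    refine le_encard_of_nodup (legEnd_nodup hnd') (fun v hv => ?_) (by simpa using hlen)
    obtain ⟨p, hp, rfl⟩ := List.mem_map.1 hv
    exact ⟨h2 p hp, hU p (hsub.subset hp)⟩

/-! ### Many strong components at a hub give a star -/

/-- If many vertices of `U` are in the strong component of `r` but in distinct strong components
after deletion of `r`, then there is a star. -/
theorem hasShape_of_hub {H : VDigraph V} {r : V} {U : Set V} {n : ℕ} (hn : 3 ≤ n)
    (hfin : H.verts.Finite) (hloop : H.Loopless) (A : Finset V) (hA : 2 * n * n ≤ A.card)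
    (hU : ∀ a ∈ A, a ∈ U) (hr : ∀ a ∈ A, a ≠ r) (h1 : ∀ a ∈ A, H.Reach r a)
    (h2 : ∀ a ∈ A, H.Reach a r)
    (h3 : ∀ a ∈ A, ∀ b ∈ A, a ≠ b → ¬ ((H.ind {r}ᶜ).Reach a b ∧ (H.ind {r}ᶜ).Reach b a)) :
    HasShape H U n := by
  classical
  set G := H.ind {r}ᶜ with hG
  have hrr : ({r, r} : Set V)ᶜ = {r}ᶜ := by simp
  -- One-way reachability in `H - r` is a strict order on `A`. Since no two vertices of `A` reach
  -- each other in both directions there, the elements of an antichain are mutually unreachable.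
  obtain ⟨B, hB, hBn, hanti⟩ | ⟨l, hl, hlA, hchain⟩ := exists_chain_or_antichain
    (fun a b => G.Reach a b ∧ ¬ G.Reach b a)
    (fun a b c h h' => ⟨h.1.trans h'.1, fun h'' => h.2 (h'.1.trans h'')⟩)
    (fun a h => h.2 h.1) n (2 * n) A hA
  · have hmem : ∀ a ∈ B.toList, a ∈ A := fun a ha => hB (Finset.mem_toList.1 ha)
    have hrH : r ∈ H.verts := by
      obtain ⟨b, hb⟩ := Finset.card_pos.1 (show 0 < B.card by omega)
      exact (h1 b (hB hb)).mem_verts_left (hr b (hB hb)).symm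
    obtain ⟨L, i1, i2, i3, i4⟩ := star_legs hfin hloop hrH B.nodup_toList
      (fun a ha => hr a (hmem a ha)) (fun a ha => h1 a (hmem a ha)) (fun a ha => h2 a (hmem a ha))
      (fun a ha b hb hab h => by
        have hba : G.Reach b a := by
          by_contra h'
          exact hanti a (Finset.mem_toList.1 ha) b (Finset.mem_toList.1 hb) ⟨h, h'⟩
        exact h3 a (hmem a ha) b (hmem b hb) hab ⟨h, hba⟩)
    obtain ⟨T, hT, hT'⟩ := shapedByStar_starLegs i1 fun h => (i3 r h).2 rfl
    refine ⟨_, T, i4.mono (by simp), .inl hT, le_encard_of_nodup (legEnd_nodup i1) ?_ ?_⟩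
    · intro v hv
      obtain ⟨p, hp, rfl⟩ := List.mem_map.1 hv
      rw [i2] at hv
      exact ⟨hT' p hp, hU _ (hmem _ hv)⟩
    · rw [i2, Finset.length_toList, hBn]
  · obtain ⟨u, us, rfl⟩ := List.exists_cons_of_ne_nil (show l ≠ [] by rintro rfl; simp at hl; omega)
    have hne : ∀ v ∈ u :: us, v ≠ r := fun v hv => hr v (hlA v hv)
    have hlast : (u :: us).getLast (by simp) ∈ u :: us := List.getLast_mem _
    obtain ⟨x, hx, -, hxu⟩ := (h1 u (hlA u (by simp))).last_visit (hne u (by simp))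
    obtain ⟨y, hy, -, hyr⟩ := (h2 _ (hlA _ hlast)).first_visit (hne _ hlast)
    obtain ⟨L, i1, i2, i3, i4⟩ := chain_legs us H r r u hfin hloop
      (fun v hv => ⟨hne v hv, hne v hv⟩) ⟨x, hx, by rwa [hrr]⟩
      (by rw [hrr]; exact (hchain.imp fun h => h.1).isChain)
      ⟨y, by rwa [hrr], hyr⟩ (by rw [hrr]; exact hchain.imp fun h => h.2)
    refine HasShape.of_red (hasShape_of_pathLegs hn ?_ i1 (fun h => (i3 r h).2.1 rfl) ?_) i4
    · rw [← hl, ← i2, List.length_map]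
    · intro p hp
      have : legEnd p ∈ u :: us := i2 ▸ List.mem_map_of_mem hp
      exact hU _ (hlA _ this)

/-! ### Ladders: layers of nested strong components -/

theorem rtg_mono {r s : V → V → Prop} {a b : V} (h : ∀ a b, r a b → s a b)
    (h' : ReflTransGen r a b) : ReflTransGen s a b :=
  ReflTransGen.mono h _ _ h'

/-- A step along an edge that does not lead into `C`. -/
def FreeStep (H : VDigraph V) (C : Set V) (a b : V) : Prop := H.Adj a b ∧ b ∉ C

/-- There is a path from `v` whose first vertex in `C` after `v` is in layer `j`. -/
def Lands (H : VDigraph V) (C : Set V) (lay : V → ℕ) (v : V) (j : ℕ) : Prop :=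
  ∃ w, ReflTransGen (H.FreeStep C) v w ∧ ∃ c ∈ C, H.Adj w c ∧ lay c = j

/-- A layering of a strongly connected graph. The vertices of `C` reach the root of their layer
inside the layer, the root of a layer has an edge to the layer below, and the other vertices are
reached from the root of their layer and have no in-edges from higher layers. The set `I` consists
of layers `i` with a distinguished vertex `u i` of `U`. -/
structure Ladder (H : VDigraph V) (U : Set V) where
  N : ℕ
  lay : V → ℕ
  C : Set V
  r : ℕ → V
  I : Finset ℕ
  u : ℕ → V
  lay_le : ∀ v ∈ H.verts, lay v ≤ N
  I_lt : ∀ i ∈ I, i < N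
  C_sub : C ⊆ H.verts
  r_mem : ∀ i ≤ N, r i ∈ C ∧ lay (r i) = i
  local_reach : ∀ v ∈ C, (H.ind {w | w ∈ C ∧ lay w = lay v}).Reach v (r (lay v))
  free_reach : ∀ v ∈ H.verts, v ∉ C →
    (H.ind ({r (lay v)} ∪ {w | w ∉ C ∧ lay w = lay v})).Reach (r (lay v)) v
  down : ∀ i < N, ∃ c ∈ C, lay c = i ∧ H.Adj (r (i + 1)) c ∧
    (i ∈ I → u i ∈ C → u i ≠ r i → (H.ind {w | w ∈ C ∧ lay w = i}).Reach c (u i))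
  up : ∀ v w, H.Adj v w → w ∉ C → lay v ≤ lay w
  land_free : ∀ v ∈ H.verts, v ∉ C → ∃ j, lay v ≤ j ∧ H.Lands C lay v j
  land_root : ∀ i < N, ∃ j, i < j ∧ H.Lands C lay (r i) j
  loss : ∀ i ∈ I, u i ∈ U ∧ u i ∈ H.verts ∧ lay (u i) = i

theorem Lands.head {H : VDigraph V} {C : Set V} {lay : V → ℕ} {v w : V} {j : ℕ}
    (h : H.Lands C lay w j) (r : ReflTransGen (H.FreeStep C) v w) : H.Lands C lay v j :=
  let ⟨x, h1, h2⟩ := h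
  ⟨x, r.trans h1, h2⟩

theorem lands_of_reach {H : VDigraph V} {C : Set V} {v w : V} (r : H.Reach v w)
    (hv : v ∉ C) (hw : w ∈ C) : ∃ y c, ReflTransGen (H.FreeStep C) v y ∧ c ∈ C ∧ H.Adj y c := by
  obtain ⟨y, c, h1, -, h2, h3, -⟩ := r.first_hit hv hw
  exact ⟨y, c, rtg_mono (fun a b e => ⟨e.1, e.2.2⟩) h1, h3, h2⟩

/-- The ladder with a single layer. -/
def Ladder.base {H : VDigraph V} (hsc : ∀ v ∈ H.verts, ∀ w ∈ H.verts, H.Reach v w) (U : Set V)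
    {r : V} (hr : r ∈ H.verts) : Ladder H U where
  N := 0
  lay _ := 0
  C := H.verts
  r _ := r
  I := ∅
  u _ := r
  lay_le _ _ := le_rfl
  I_lt i hi := absurd hi (by simp)
  C_sub := subset_rfl
  r_mem i hi := ⟨hr, by omega⟩
  local_reach v hv := (hsc v hv r hr).mono fun a b e =>
    ⟨e, ⟨H.left_mem e, rfl⟩, ⟨H.right_mem e, rfl⟩⟩
  free_reach v hv hv' := absurd hv hv'
  down i hi := absurd hi (by omega)
  up v w e hw := le_rfl
  land_free v hv hv' := absurd hv hv'
  land_root i hi := absurd hi (by omega)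
  loss i hi := absurd hi (by simp)

/-- The vertices in the strong component of `v` in `H - r`. -/
def comp (H : VDigraph V) (r v : V) : Set V :=
  {w | (H.ind {r}ᶜ).Reach v w ∧ (H.ind {r}ᶜ).Reach w v}

theorem comp_ne {H : VDigraph V} {r v w : V} (hv : v ≠ r) (hw : w ∈ H.comp r v) : w ≠ r :=
  hw.1.mem_of_ind hv

theorem comp_reach {H : VDigraph V} {r v a b : V} (ha : a ∈ H.comp r v) (hb : b ∈ H.comp r v) :
    (H.ind (H.comp r v)).Reach a b := by
  have h1 := (ha.2.trans hb.1).closed (S := {w | (H.ind {r}ᶜ).Reach v w}) ha.1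
    fun _ _ h e => Reach.tail h e
  exact (h1.2.closed_back (S := {w | (H.ind {r}ᶜ).Reach w v}) hb.2
    fun _ _ h e => Reach.head e.1 h).2.mono fun p q e =>
      ⟨e.1.1.1, ⟨e.1.2.1, e.2.1⟩, ⟨e.1.2.2, e.2.2⟩⟩

/-- The vertices of `H - v` reached from the strong component of `v` but not in it, and `r`. -/
def below (H : VDigraph V) (r v : V) : Set V :=
  {r} ∪ {w | w ∉ H.comp r v ∧ (H.ind {r}ᶜ).Reach v w}

/-- The vertex `r'`, which becomes the root of the next layer, is the last vertex of the strong
component of `v` on a path to the lost vertex `u`, provided that `u ≠ r` lies in `below`. Thus the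
root above will be able to reach the loss. In all other cases any edge that leaves the component
will do. -/
theorem exists_descent {H : VDigraph V} (hsc : ∀ v ∈ H.verts, ∀ w ∈ H.verts, H.Reach v w) {r v : V}
    (hr : r ∈ H.verts) (hv : v ∈ H.verts) (hvr : v ≠ r) (u : V) :
    ∃ r' ∈ H.comp r v, ∃ c ∈ H.below r v, H.Adj r' c ∧
      (u ∈ H.below r v → u ≠ r → (H.ind (H.below r v)).Reach c u) := by
  have hrK : r ∉ H.comp r v := fun h => comp_ne hvr h rfl
  have hvK : v ∈ H.comp r v := ⟨.refl _, .refl _⟩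
  by_cases hu : u ∈ H.below r v ∧ u ≠ r
  · obtain ⟨hu1, hu2⟩ := hu.1.resolve_left hu.2
    obtain ⟨y, w, h1, h2, h3, h4, h5⟩ := hu2.last_exit hvK hu1
    have hw : (H.ind {r}ᶜ).Reach v w := h1.tail h3
    refine ⟨y, h2, w, .inr ⟨h4, hw⟩, h3.1, fun _ _ => ?_⟩
    exact (h5.closed (S := {x | (H.ind {r}ᶜ).Reach v x}) hw fun _ _ h e => Reach.tail h e.1).2.mono
      fun a b e => ⟨e.1.1.1, .inr ⟨e.1.2.1, e.2.1⟩, .inr ⟨e.1.2.2, e.2.2⟩⟩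
  · obtain ⟨y, w, h1, h2, h3, h4, -⟩ := (hsc v hv r hr).first_hit (S := (H.comp r v)ᶜ)
      (fun h => h hvK) hrK
    have hy : y ∈ H.comp r v := by by_contra h; exact h2 h
    refine ⟨y, hy, w, ?_, h3, fun h1 h2 => absurd ⟨h1, h2⟩ hu⟩
    by_cases hwr : w = r
    · exact .inl hwr
    · exact .inr ⟨h4, Reach.tail hy.1 ⟨h3, comp_ne hvr hy, hwr⟩⟩

open Classical in
/-- The extension of a ladder of the strong component of `v` in `H - r` by a lowest layer with
root `r`. -/
noncomputable def Ladder.cons {H : VDigraph V}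
    (hsc : ∀ v ∈ H.verts, ∀ w ∈ H.verts, H.Reach v w) {U : Set V}
    {r v : V} (hr : r ∈ H.verts) (hv : v ∈ H.verts) (hvr : v ≠ r) (L : Ladder (H.ind (H.comp r v)) U)
    (I : Finset ℕ) (hI : ∀ i ∈ I, i = 0) (u : V)
    (hu : 0 ∈ I → u ∈ U ∧ u ∈ H.verts ∧ u ∉ H.comp r v)
    (hL : ∃ c ∈ H.below r v, H.Adj (L.r 0) c ∧
      (u ∈ H.below r v → u ≠ r → (H.ind (H.below r v)).Reach c u)) : Ladder H U :=
  have hrK : r ∉ H.comp r v := fun h => comp_ne hvr h rfl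
  have hvK : v ∈ H.comp r v := ⟨.refl _, .refl _⟩
  have hCK : L.C ⊆ H.comp r v := fun w hw => (L.C_sub hw).2
  have hK0 : ∀ w ∈ H.comp r v, w ∉ H.below r v := by
    rintro w hw (h | h)
    · exact hrK ((show w = r from h) ▸ hw)
    · exact h.1 hw
  have hKC : ∀ w ∈ H.comp r v, w ∉ L.C → w ∉ H.below r v ∪ L.C := fun w hw hw' h =>
    h.elim (hK0 w hw) hw'
  have hlands : ∀ {w j}, (H.ind (H.comp r v)).Lands L.C L.lay w j → H.Lands (H.below r v ∪ L.C)
      (fun w => if w ∈ H.comp r v then L.lay w + 1 else 0) w (j + 1) := by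
    rintro w j ⟨x, h1, c, hc, h2, rfl⟩
    exact ⟨x, rtg_mono (fun a b e => ⟨e.1.1, hKC b e.1.2.2 e.2⟩) h1, c, .inr hc, h2.1,
      if_pos (hCK hc)⟩
  { N := L.N + 1
    lay := fun w => if w ∈ H.comp r v then L.lay w + 1 else 0
    C := H.below r v ∪ L.C
    r := fun i => match i with
      | 0 => r
      | i + 1 => L.r i
    I := I ∪ L.I.image Nat.succ
    u := fun i => match i with
      | 0 => u
      | i + 1 => L.u i
    lay_le := by
      intro w hw
      split_ifs with h
      · exact Nat.succ_le_succ (L.lay_le w ⟨hw, h⟩)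
      · exact Nat.zero_le _
    I_lt := by
      intro i hi
      rcases Finset.mem_union.1 hi with hi | hi
      · rw [hI i hi]; exact Nat.succ_pos _
      · obtain ⟨j, hj, rfl⟩ := Finset.mem_image.1 hi
        exact Nat.succ_lt_succ (L.I_lt j hj)
    C_sub := by
      rintro w ((h | h) | h)
      · exact (show w = r from h) ▸ hr
      · exact h.2.of_ind.mem_verts hv
      · exact (L.C_sub h).1
    r_mem := by
      rintro (_ | i) hi
      · exact ⟨.inl (.inl rfl), if_neg hrK⟩
      · have h := L.r_mem i (Nat.le_of_succ_le_succ hi)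
        exact ⟨.inr h.1, (if_pos (hCK h.1)).trans (by rw [h.2])⟩
    local_reach := by
      rintro w (hw | hw)
      · have hwK : w ∉ H.comp r v := fun h => hK0 w h hw
        simp only [if_neg hwK]
        have hmem : ∀ x ∈ H.below r v, x ∈ {x | x ∈ H.below r v ∪ L.C ∧
            (if x ∈ H.comp r v then L.lay x + 1 else 0) = 0} := fun x hx =>
          ⟨.inl hx, if_neg fun h => hK0 x h hx⟩
        rcases hw with hw' | hw'
        · rw [show w = r from hw']; exact .refl _
        · have hwr : w ≠ r := hw'.2.mem_of_ind hvr
          obtain ⟨y, h1, -, h2⟩ := (hsc w (hw'.2.of_ind.mem_verts hv) r hr).first_visit hwr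
          have h3 := h1.closed (S := {x | (H.ind {r}ᶜ).Reach w x}) (Reach.refl _)
            fun _ _ h e => Reach.tail h e
          -- Nothing that `w` reaches in `H - r` is in the strong component of `v`, since `w`, being
          -- reached from `v`, would then be in it too.
          have h4 : ∀ x, (H.ind {r}ᶜ).Reach w x → x ∈ H.below r v := fun x hx =>
            .inr ⟨fun h => hwK ⟨hw'.2, hx.trans h.2⟩, hw'.2.trans hx⟩
          refine Reach.tail (v := y) (h3.2.mono fun a b e => ⟨e.1.1, hmem _ (h4 a e.2.1),
            hmem _ (h4 b e.2.2)⟩) ⟨h2, hmem _ (h4 y h3.1), hmem _ (.inl rfl)⟩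
      · have hwK := hCK hw
        simp only [if_pos hwK]
        refine (L.local_reach w hw).mono fun a b e => ⟨e.1.1, ⟨.inr e.2.1.1, ?_⟩, .inr e.2.2.1, ?_⟩
        · rw [if_pos (hCK e.2.1.1), e.2.1.2]
        · rw [if_pos (hCK e.2.2.1), e.2.2.2]
    free_reach := by
      intro w hwH hw
      by_cases hwK : w ∈ H.comp r v
      · simp only [if_pos hwK]
        have hmem : ∀ x ∈ H.comp r v, x ∈ ({L.r (L.lay w)} ∪ {x | x ∉ L.C ∧ L.lay x = L.lay w} :
            Set V) → x ∈ ({L.r (L.lay w)} ∪ {x | x ∉ H.below r v ∪ L.C ∧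
            (if x ∈ H.comp r v then L.lay x + 1 else 0) = L.lay w + 1} : Set V) := by
          rintro x hx (h | h)
          · exact .inl h
          · exact .inr ⟨hKC x hx h.1, by rw [if_pos hx, h.2]⟩
        exact (L.free_reach w ⟨hwH, hwK⟩ fun h => hw (.inr h)).mono fun a b e =>
          ⟨e.1.1, hmem a e.1.2.1 e.2.1, hmem b e.1.2.2 e.2.2⟩
      · simp only [if_neg hwK]
        have hwr : w ≠ r := fun h => hw (.inl (.inl h))
        obtain ⟨x, h1, -, h2⟩ := (hsc r hr w hwH).last_visit hwr
        have h3 := h2.closed_back (S := {x | (H.ind {r}ᶜ).Reach x w}) (Reach.refl _)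
          fun _ _ h e => Reach.head e h
        have hw0 : ¬ (H.ind {r}ᶜ).Reach v w := fun h => hw (.inl (.inr ⟨hwK, h⟩))
        -- As `w` is not reached from `v` in `H - r`, no vertex that reaches `w` there can be in the
        -- component of `v` or be reached from it.
        have h4 : ∀ x, (H.ind {r}ᶜ).Reach x w → x ∈ ({r} ∪ {x | x ∉ H.below r v ∪ L.C ∧
            (if x ∈ H.comp r v then L.lay x + 1 else 0) = 0} : Set V) := by
          intro x hx
          have hxK : x ∉ H.comp r v := fun h => hw0 (h.1.trans hx)
          refine .inr ⟨?_, if_neg hxK⟩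
          rintro ((h | h) | h)
          · exact Reach.mem_of_ind_back hx hwr h
          · exact hw0 (h.2.trans hx)
          · exact hxK (hCK h)
        exact .head ⟨h1, .inl rfl, h4 x h3.1⟩
          (h3.2.mono fun a b e => ⟨e.1.1, h4 a e.2.1, h4 b e.2.2⟩)
    down := by
      rintro (_ | i) hi
      · obtain ⟨c, hc, h1, h2⟩ := hL
        refine ⟨c, .inl hc, if_neg fun h => hK0 c h hc, h1, fun h0 h3 h4 => ?_⟩
        have h0' : 0 ∈ I := by
          rcases Finset.mem_union.1 h0 with h | h
          · exact h
          · obtain ⟨j, -, hj⟩ := Finset.mem_image.1 h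
            exact absurd hj (by simp)
        refine (h2 (h3.resolve_right fun h => (hu h0').2.2 (hCK h)) h4).mono fun a b e =>
          ⟨e.1, ⟨.inl e.2.1, if_neg fun h => hK0 _ h e.2.1⟩,
            ⟨.inl e.2.2, if_neg fun h => hK0 _ h e.2.2⟩⟩
      · obtain ⟨c, hc, h1, h2, h3⟩ := L.down i (Nat.lt_of_succ_lt_succ hi)
        refine ⟨c, .inr hc, (if_pos (hCK hc)).trans (by rw [h1]), h2.1, fun h0 h4 h5 => ?_⟩
        have h0' : i ∈ L.I := by
          rcases Finset.mem_union.1 h0 with h | h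
          · exact absurd (hI _ h) (by simp)
          · obtain ⟨j, hj, hji⟩ := Finset.mem_image.1 h
            exact Nat.succ_injective hji ▸ hj
        have huK : L.u i ∈ H.comp r v := (L.loss i h0').2.1.2
        refine (h3 h0' (h4.resolve_left (hK0 _ huK)) h5).mono fun a b e =>
          ⟨e.1.1, ⟨.inr e.2.1.1, ?_⟩, ⟨.inr e.2.2.1, ?_⟩⟩
        · rw [if_pos (hCK e.2.1.1), e.2.1.2]
        · rw [if_pos (hCK e.2.2.1), e.2.2.2]
    up := by
      intro a b e hb
      by_cases haK : a ∈ H.comp r v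
      · by_cases hbK : b ∈ H.comp r v
        · simp only [if_pos haK, if_pos hbK]
          exact Nat.succ_le_succ (L.up a b ⟨e, haK, hbK⟩ fun h => hb (.inr h))
        -- An edge that leaves the component of `v` ends in `below`, hence in `C`. So free steps
        -- never lead down to the new lowest layer.
        · exfalso
          refine hb (.inl ?_)
          by_cases hbr : b = r
          · exact .inl hbr
          · exact .inr ⟨hbK, Reach.tail haK.1 ⟨e, comp_ne hvr haK, hbr⟩⟩
      · simp only [if_neg haK]
        exact Nat.zero_le _
    land_free := by
      intro w hwH hw
      by_cases hwK : w ∈ H.comp r v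
      · obtain ⟨j, h1, h2⟩ := L.land_free w ⟨hwH, hwK⟩ fun h => hw (.inr h)
        refine ⟨j + 1, ?_, hlands h2⟩
        simp only [if_pos hwK]
        exact Nat.succ_le_succ h1
      · obtain ⟨y, c, h1, h2, h3⟩ := lands_of_reach (hsc w hwH r hr) hw (.inl (.inl rfl))
        exact ⟨_, by simp only [if_neg hwK]; exact Nat.zero_le _, y, h1, c, h2, h3, rfl⟩
    land_root := by
      rintro (_ | i) hi
      · have hr' := (L.r_mem 0 (Nat.zero_le _)).1
        have hr'K := hCK hr'
        obtain ⟨y, w, -, hy, e, hw, h1⟩ := (hsc r hr (L.r 0) (L.C_sub hr').1).last_exit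
          (S := H.below r v) (.inl rfl) (hK0 _ hr'K)
        have h2 : (H.ind {r}ᶜ).Reach w (L.r 0) := h1.ind_mono (S' := {r}ᶜ)
          fun x (hx : x ∉ H.below r v) (h : x = r) => hx (.inl h)
        have hwr : w ≠ r := fun h => hw (.inl h)
        -- The last vertex in `below` on a way up to the next root must be `r` itself: any other
        -- vertex of `below` is reached from the component of `v` and would now reach it as well, so
        -- it would belong to it.
        have hyr : y = r := by
          by_contra hyr
          have hy' := hy.resolve_left hyr
          exact hy'.1 ⟨hy'.2, Reach.head ⟨e, hyr, hwr⟩ (h2.trans hr'K.2)⟩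
        subst hyr
        have hpos : ∀ c ∈ L.C, 0 < (if c ∈ H.comp y v then L.lay c + 1 else 0) := fun c hc => by
          rw [if_pos (hCK hc)]; exact Nat.succ_pos _
        by_cases hwC : w ∈ L.C
        · exact ⟨_, hpos w hwC, y, .refl, w, .inr hwC, e, rfl⟩
        · obtain ⟨x, c, h3, h4, h5, h6, -⟩ := h1.first_hit hwC hr'
          refine ⟨_, hpos c h6, x, ReflTransGen.head ⟨e, fun h => h.elim hw hwC⟩
            (rtg_mono (fun a b e => ⟨e.1.1, fun h => h.elim e.1.2.2 e.2.2⟩) h3), c,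
            .inr h6, h5.1, rfl⟩
      · obtain ⟨j, h1, h2⟩ := L.land_root i (Nat.lt_of_succ_lt_succ hi)
        exact ⟨j + 1, Nat.succ_lt_succ h1, hlands h2⟩
    loss := by
      intro i hi
      rcases Finset.mem_union.1 hi with hi | hi
      · obtain rfl := hI i hi
        exact ⟨(hu hi).1, (hu hi).2.1, if_neg (hu hi).2.2⟩
      · obtain ⟨j, hj, rfl⟩ := Finset.mem_image.1 hi
        obtain ⟨h1, h2, h3⟩ := L.loss j hj
        exact ⟨h1, h2.1, (if_pos h2.2).trans (by rw [h3])⟩ }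

/-- A maximal set of vertices of `U` in distinct strong components of `H - r` has fewer than `2 * n
* n` elements by `hasShape_of_hub`. The components of its elements cover all of `U` in `H` except
possibly `r`, which accounts for the summand `1`, so one component contains at least `g` of these
vertices. -/
theorem exists_comp {H : VDigraph V} {r : V} {U : Set V} {n : ℕ} (hn : 3 ≤ n)
    (hfin : H.verts.Finite) (hloop : H.Loopless)
    (hsc : ∀ v ∈ H.verts, ∀ w ∈ H.verts, H.Reach v w) (hr : r ∈ H.verts) (hno : ¬ HasShape H U n)
    {g : ℕ} (hg : 1 ≤ g) (hU : 2 * n * n * g + 1 ≤ (U ∩ H.verts).ncard) :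
    ∃ v ∈ H.verts, v ≠ r ∧ g ≤ (U ∩ H.comp r v).ncard := by
  classical
  have hUf : (U ∩ H.verts).Finite := hfin.subset Set.inter_subset_right
  set A : Finset V := hUf.toFinset.erase r with hA
  have hAm : ∀ a, a ∈ A ↔ a ≠ r ∧ a ∈ U ∧ a ∈ H.verts := fun a => by simp [hA]
  have hAc : 2 * n * n * g ≤ A.card := by
    have h1 := Finset.pred_card_le_card_erase (s := hUf.toFinset) (a := r)
    rw [Set.ncard_eq_toFinset_card _ hUf] at hU
    rw [← hA] at h1
    omega
  let P : Finset V → Prop := fun B => ∀ a ∈ B, ∀ b ∈ B, a ≠ b → b ∉ H.comp r a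
  obtain ⟨B, hB, hmax⟩ := Finset.exists_max_image (A.powerset.filter P) Finset.card
    ⟨∅, by simp [P]⟩
  rw [Finset.mem_filter, Finset.mem_powerset] at hB
  have hBc : B.card < 2 * n * n := by
    by_contra h
    refine hno (hasShape_of_hub hn hfin hloop B (not_lt.1 h) ?_ ?_ ?_ ?_ hB.2)
    · exact fun a ha => ((hAm a).1 (hB.1 ha)).2.1
    · exact fun a ha => ((hAm a).1 (hB.1 ha)).1
    · exact fun a ha => hsc _ hr _ ((hAm a).1 (hB.1 ha)).2.2
    · exact fun a ha => hsc _ ((hAm a).1 (hB.1 ha)).2.2 _ hr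
  have hcover : A ⊆ B.biUnion fun b => A.filter fun a => a ∈ H.comp r b := by
    intro a ha
    by_cases haB : a ∈ B
    · exact Finset.mem_biUnion.2 ⟨a, haB, Finset.mem_filter.2 ⟨ha, .refl _, .refl _⟩⟩
    by_contra hcon
    have hna : ∀ b ∈ B, a ∉ H.comp r b := fun b hb h =>
      hcon (Finset.mem_biUnion.2 ⟨b, hb, Finset.mem_filter.2 ⟨ha, h⟩⟩)
    have h1 := hmax (insert a B) (Finset.mem_filter.2 ⟨Finset.mem_powerset.2
      (Finset.insert_subset ha hB.1), by
        intro x hx y hy hxy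
        rcases Finset.mem_insert.1 hx with rfl | hx' <;>
          rcases Finset.mem_insert.1 hy with rfl | hy'
        · exact absurd rfl hxy
        · exact fun h => hna y hy' h.symm
        · exact hna x hx'
        · exact hB.2 x hx' y hy' hxy⟩)
    rw [Finset.card_insert_of_notMem haB] at h1
    omega
  obtain ⟨b, hb, hgb⟩ : ∃ b ∈ B, g ≤ (A.filter fun a => a ∈ H.comp r b).card := by
    by_contra! hcon
    have h1 := (Finset.card_le_card hcover).trans Finset.card_biUnion_le
    have h2 := Finset.sum_le_card_nsmul B _ g fun b hb => (hcon b hb).le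
    have h3 : B.card * g < 2 * n * n * g := Nat.mul_lt_mul_of_pos_right hBc hg
    rw [smul_eq_mul] at h2
    omega
  have hbA := (hAm b).1 (hB.1 hb)
  refine ⟨b, hbA.2.2, hbA.1, hgb.trans ?_⟩
  rw [← Set.ncard_coe_finset]
  refine Set.ncard_le_ncard ?_ (hUf.subset ?_)
  · intro a ha
    have ha := Finset.mem_filter.1 (Finset.mem_coe.1 ha)
    exact ⟨((hAm a).1 ha.1).2.1, ha.2⟩
  · rintro a ⟨h1, h2⟩
    exact ⟨h1, h2.1.of_ind.mem_verts hbA.2.2⟩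

/-- The number of vertices of `U` that guarantees a ladder with `k` distinguished layers. -/
def ladderBound (n : ℕ) : ℕ → ℕ
  | 0 => 1
  | k + 1 => 2 * n * n * ladderBound n k + 1

theorem ladderBound_pos (n k : ℕ) : 1 ≤ ladderBound n k := by
  cases k
  · exact le_rfl
  · exact Nat.le_add_left _ _

/-- Pass to a strong component of `H - r` with many vertices of `U`. If it misses a vertex of `U`,
this vertex marks the lowest layer and `k` decreases. Otherwise no vertex of `U` is lost and only
the graph becomes smaller. The root `r` is prescribed so that each layer can choose the root above
it by `exists_descent`. -/
theorem exists_ladder {U : Set V} {n : ℕ} (hn : 3 ≤ n) (m : ℕ) : ∀ (H : VDigraph V) (k : ℕ) (r : V),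
    H.verts.ncard = m → H.verts.Finite → H.Loopless →
    (∀ v ∈ H.verts, ∀ w ∈ H.verts, H.Reach v w) → r ∈ H.verts → ¬ HasShape H U n →
    ladderBound n k ≤ (U ∩ H.verts).ncard → ∃ L : Ladder H U, L.r 0 = r ∧ k ≤ L.I.card := by
  classical
  induction m using Nat.strong_induction_on with
  | _ m ih =>
    intro H k r hm hfin hloop hsc hr hno hU
    cases k with
    | zero => exact ⟨Ladder.base hsc U hr, rfl, Nat.zero_le _⟩
    | succ k =>
      obtain ⟨v, hv, hvr, hg⟩ := exists_comp hn hfin hloop hsc hr hno (ladderBound_pos n k) hU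
      have hrK : r ∉ H.comp r v := fun h => comp_ne hvr h rfl
      have hvK : v ∈ H.comp r v := ⟨.refl _, .refl _⟩
      have hKH : H.comp r v ⊆ H.verts := fun x hx => hx.1.of_ind.mem_verts hv
      have hverts : (H.ind (H.comp r v)).verts = H.comp r v := Set.inter_eq_right.2 hKH
      have hlt : (H.ind (H.comp r v)).verts.ncard < m :=
        hm ▸ ncard_lt_of_le hfin (ind_le _ _).1 hr fun h => hrK h.2
      have hno' : ¬ HasShape (H.ind (H.comp r v)) U n := fun h =>
        hno (h.of_red (Red.of_le (T := ∅) (ind_le _ _)))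
      have rec' := fun k' r' (hr' : r' ∈ H.comp r v) (hk' : ladderBound n k' ≤ _) =>
        ih _ hlt (H.ind (H.comp r v)) k' r' rfl (hfin.subset (ind_le _ _).1)
        (ind_loopless hloop _) (fun a ha b hb => comp_reach ha.2 hb.2) ⟨hKH hr', hr'⟩ hno' hk'
      by_cases hloss : ∃ u ∈ U, u ∈ H.verts ∧ u ∉ H.comp r v
      · obtain ⟨u, hu⟩ := hloss
        obtain ⟨r', hr', hc⟩ := exists_descent hsc hr hv hvr u
        obtain ⟨L, rfl, hL⟩ := rec' k r' hr' (by rwa [hverts])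
        refine ⟨L.cons hsc hr hv hvr {0} (by simp) u (fun _ => hu) hc, rfl, ?_⟩
        change k + 1 ≤ ({0} ∪ L.I.image Nat.succ).card
        rw [Finset.card_union_of_disjoint (by simp), Finset.card_singleton,
          Finset.card_image_of_injective _ Nat.succ_injective]
        omega
      · push Not at hloss
        obtain ⟨r', hr', hc⟩ := exists_descent hsc hr hv hvr r
        have hUK : U ∩ H.verts = U ∩ H.comp r v :=
          Set.Subset.antisymm (fun x hx => ⟨hx.1, hloss x hx.1 hx.2⟩) fun x hx => ⟨hx.1, hKH hx.2⟩
        obtain ⟨L, rfl, hL⟩ := rec' (k + 1) r' hr' (by rwa [hverts, ← hUK])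
        refine ⟨L.cons hsc hr hv hvr ∅ (by simp) r (by simp) hc, rfl, ?_⟩
        change k + 1 ≤ (∅ ∪ L.I.image Nat.succ).card
        rwa [Finset.empty_union, Finset.card_image_of_injective _ Nat.succ_injective]

end VDigraph

/-! ### Bounding the losses between a layer and its landing layer -/

/-- Greedy choice: take the interval with the smallest right end `f l₀`. Every interval that does
not start after `f l₀` contains this point, so at most `d` intervals are discarded at each step. -/
theorem exists_disjoint_intervals (f : ℕ → ℕ) (d k : ℕ) (J : Finset ℕ) (hf : ∀ l ∈ J, l ≤ f l)
    (hd : ∀ x, (J.filter fun l => l ≤ x ∧ x ≤ f l).card ≤ d) (hk : k * d < J.card) :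
    ∃ J' ⊆ J, J'.card = k + 1 ∧ ∀ l ∈ J', ∀ l' ∈ J', l < l' → f l < l' := by
  induction k generalizing J with
  | zero =>
    obtain ⟨l, hl⟩ := Finset.card_pos.1 (show 0 < J.card by omega)
    exact ⟨{l}, by simpa using hl, rfl, by simp⟩
  | succ k ih =>
    obtain ⟨l₀, hl₀, hmin⟩ := Finset.exists_min_image J f (Finset.card_pos.1 (by omega))
    have hsub : (J.filter fun l => f l₀ < l) ⊆ J := Finset.filter_subset _ _
    have hrest : (J.filter fun l => ¬ f l₀ < l).card ≤ d :=
      (Finset.card_le_card fun l hl => by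
        rw [Finset.mem_filter] at hl ⊢
        exact ⟨hl.1, not_lt.1 hl.2, hmin l hl.1⟩).trans (hd (f l₀))
    have hsum := Finset.card_filter_add_card_filter_not (s := J) (fun l => f l₀ < l)
    have hmul : (k + 1) * d = k * d + d := by ring
    obtain ⟨J', h1, h2, h3⟩ := ih (J.filter fun l => f l₀ < l) (fun l hl => hf l (hsub hl))
      (fun x => (Finset.card_le_card (Finset.filter_subset_filter _ hsub)).trans (hd x)) (by omega)
    have hlt : ∀ l ∈ J', f l₀ < l := fun l hl => (Finset.mem_filter.1 (h1 hl)).2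
    have hl₀' := hf l₀ hl₀
    refine ⟨insert l₀ J', Finset.insert_subset hl₀ (h1.trans hsub), ?_, ?_⟩
    · rw [Finset.card_insert_of_notMem fun h => by have := hlt l₀ h; omega, h2]
    · intro l hl l' hl' hll
      rcases Finset.mem_insert.1 hl with rfl | h <;> rcases Finset.mem_insert.1 hl' with rfl | h'
      · omega
      · exact hlt l' h'
      · have := hlt l h; omega
      · exact h3 l h l' h' hll

namespace VDigraph

variable {V : Type*}

/-- The subgraph of the edges that satisfy `E`. -/
def sub (H : VDigraph V) (E : V → V → Prop) : VDigraph V where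
  verts := H.verts
  Adj a b := H.Adj a b ∧ E a b
  left_mem h := H.left_mem h.1
  right_mem h := H.right_mem h.1

theorem Reach.sub_mono {H : VDigraph V} {E E' : V → V → Prop} {a b : V}
    (r : (H.sub E).Reach a b) (h : ∀ a b, E a b → E' a b) : (H.sub E').Reach a b :=
  r.mono fun _ _ e => ⟨e.1, h _ _ e.2⟩

theorem sub_le (H : VDigraph V) (E : V → V → Prop) : H.sub E ≤ H := ⟨subset_rfl, fun _ _ e => e.1⟩

namespace Ladder

variable {H : VDigraph V} {U : Set V} (L : Ladder H U)

/-- There is a path from `a` to `b` that meets `C` at most in `a`. -/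
def Free (a b : V) : Prop := ReflTransGen (H.FreeStep L.C) a b

open Classical in
/-- The highest layer in which `v` lands. -/
noncomputable def top (v : V) : ℕ := Nat.findGreatest (H.Lands L.C L.lay v) L.N

theorem lands_le {v : V} {j : ℕ} (h : H.Lands L.C L.lay v j) : j ≤ L.N := by
  obtain ⟨w, -, c, hc, -, rfl⟩ := h
  exact L.lay_le c (L.C_sub hc)

theorem le_top {v : V} {j : ℕ} (h : H.Lands L.C L.lay v j) : j ≤ L.top v := by
  classical exact Nat.le_findGreatest (L.lands_le h) h

theorem top_le (v : V) : L.top v ≤ L.N := by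
  classical exact Nat.findGreatest_le _

theorem lands_top {v : V} {j : ℕ} (h : H.Lands L.C L.lay v j) : H.Lands L.C L.lay v (L.top v) := by
  classical exact Nat.findGreatest_spec (P := H.Lands L.C L.lay v) (L.lands_le h) h

theorem top_le_top {v w : V} (h : L.Free v w) : L.top w ≤ L.top v := by
  rcases Nat.eq_zero_or_pos (L.top w) with h0 | h0
  · omega
  · classical
    have : H.Lands L.C L.lay w (L.top w) := Nat.findGreatest_of_ne_zero rfl h0.ne'
    exact L.le_top (this.head h)

theorem lay_le_top {v : V} (hv : v ∈ H.verts) (hC : v ∉ L.C) :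
    L.lay v ≤ L.top v ∧ H.Lands L.C L.lay v (L.top v) := by
  obtain ⟨j, h1, h2⟩ := L.land_free v hv hC
  exact ⟨h1.trans (L.le_top h2), L.lands_top h2⟩

theorem lt_top_root {i : ℕ} (hi : i < L.N) : i < L.top (L.r i) ∧
    H.Lands L.C L.lay (L.r i) (L.top (L.r i)) := by
  obtain ⟨j, h1, h2⟩ := L.land_root i hi
  exact ⟨h1.trans_le (L.le_top h2), L.lands_top h2⟩

theorem lay_le_of_free {v w : V} (h : L.Free v w) : L.lay v ≤ L.lay w := by
  induction h with
  | refl => exact le_rfl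
  | tail _ e ih => exact ih.trans (L.up _ _ e.1 e.2)

/-- Edges inside a layer of `C`, or from the root of a layer to the layer below. -/
def Dn (a b : V) : Prop := a ∈ L.C ∧ b ∈ L.C ∧
  (L.lay a = L.lay b ∨ (L.lay a = L.lay b + 1 ∧ a = L.r (L.lay a)))

/-- The path alternates between going to the root inside a layer of `C` (`local_reach`) and stepping
from the root into `C` one layer below (`down`). -/
theorem reach_down {c : V} (hc : c ∈ L.C) {i : ℕ} (hi : i ≤ L.lay c) :
    (H.sub fun a b => L.Dn a b ∧ i ≤ L.lay b ∧ L.lay a ≤ L.lay c).Reach c (L.r i) := by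
  have key : ∀ d j, L.lay c = j + d → i ≤ j →
      (H.sub fun a b => L.Dn a b ∧ i ≤ L.lay b ∧ L.lay a ≤ L.lay c).Reach c (L.r j) := by
    have hin : ∀ v ∈ L.C, i ≤ L.lay v → L.lay v ≤ L.lay c →
        (H.sub fun a b => L.Dn a b ∧ i ≤ L.lay b ∧ L.lay a ≤ L.lay c).Reach v
          (L.r (L.lay v)) := by
      intro v hv h1 h2
      refine (L.local_reach v hv).mono fun a b e =>
        ⟨e.1, ⟨e.2.1.1, e.2.2.1, .inl (e.2.1.2.trans e.2.2.2.symm)⟩, ?_, ?_⟩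
      · rw [e.2.2.2]; exact h1
      · rw [e.2.1.2]; exact h2
    intro d
    induction d with
    | zero =>
      intro j h1 h2
      obtain rfl : j = L.lay c := by omega
      exact hin c hc hi le_rfl
    | succ d ih =>
      intro j h1 h2
      have hjN : j < L.N := by have := L.lay_le c (L.C_sub hc); omega
      obtain ⟨x, hx, hxj, e, -⟩ := L.down j hjN
      have hr := L.r_mem (j + 1) hjN
      refine (ih (j + 1) (by omega) (by omega)).trans (.head ⟨e, ⟨hr.1, hx, .inr ⟨?_, ?_⟩⟩, ?_, ?_⟩ ?_)
      · rw [hr.2, hxj]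
      · rw [hr.2]
      · omega
      · rw [hr.2]; omega
      · have := hin x hx (by omega) (by omega)
        rwa [hxj] at this
  obtain ⟨d, hd⟩ := Nat.exists_eq_add_of_le hi
  exact key d i hd le_rfl

/-- The edge descending from the root of layer `l + 1` was chosen so that its end reaches `u l`
inside the layer. If `u l` is itself the root of its layer, the ordinary descent suffices. -/
theorem reach_loss {l : ℕ} (hl : l ∈ L.I) (hC : L.u l ∈ L.C) :
    (H.sub fun a b => L.Dn a b ∧ l ≤ L.lay b ∧ L.lay a ≤ l + 1).Reach (L.r (l + 1)) (L.u l) := by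
  have hN := L.I_lt l hl
  have hr := L.r_mem (l + 1) hN
  by_cases h : L.u l = L.r l
  · rw [h]
    have := L.reach_down hr.1 (i := l) (by omega)
    rwa [hr.2] at this
  · obtain ⟨x, hx, hxj, e, h1⟩ := L.down l hN
    refine .head ⟨e, ⟨hr.1, hx, .inr ⟨?_, ?_⟩⟩, ?_, ?_⟩ ((h1 hl hC h).mono fun a b e =>
      ⟨e.1, ⟨e.2.1.1, e.2.2.1, .inl (e.2.1.2.trans e.2.2.2.symm)⟩, ?_, ?_⟩)
    · rw [hr.2, hxj]
    · rw [hr.2]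
    · omega
    · rw [hr.2]
    · rw [e.2.2.2]
    · rw [e.2.1.2]; omega

/-- The record that every vertex after the root freely reaches `v` shows later that such a vertex
lands at least as high as `v`, and keeps the path away from vertices freely reached from a root that
does not freely reach `v`. -/
theorem reach_up {v : V} (hv : v ∈ H.verts) (hC : v ∉ L.C) :
    (H.sub fun a b => b ∉ L.C ∧ L.lay b = L.lay v ∧ L.Free b v ∧
      (a = L.r (L.lay v) ∨ (a ∉ L.C ∧ L.lay a = L.lay v ∧ L.Free a v))).Reach
        (L.r (L.lay v)) v := by
  have hr := L.r_mem (L.lay v) (L.lay_le v hv)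
  obtain ⟨w, e, hw, h1⟩ := (L.free_reach v hv hC).last_visit (fun h => hC (h ▸ hr.1))
  have hmem : ∀ x, x ≠ L.r (L.lay v) →
      x ∈ ({L.r (L.lay v)} ∪ {w | w ∉ L.C ∧ L.lay w = L.lay v} : Set V) →
      x ∉ L.C ∧ L.lay x = L.lay v := fun x h h' => h'.resolve_left h
  have h2 : L.Free w v ∧ (H.sub fun a b => b ∉ L.C ∧ L.lay b = L.lay v ∧ L.Free b v ∧
      (a = L.r (L.lay v) ∨ (a ∉ L.C ∧ L.lay a = L.lay v ∧ L.Free a v))).Reach w v := by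
    clear e hw
    induction h1 using ReflTransGen.head_induction_on with
    | refl => exact ⟨.refl, .refl _⟩
    | @head a b e _ ih =>
      have ha := hmem a e.2.1 e.1.2.1
      have hb := hmem b e.2.2 e.1.2.2
      have hav : L.Free a v := ReflTransGen.head ⟨e.1.1, hb.1⟩ ih.1
      exact ⟨hav, .head ⟨e.1.1, hb.1, hb.2, ih.1, .inr ⟨ha.1, ha.2, hav⟩⟩ ih.2⟩
  have hw' := hmem w hw e.2.2
  exact .head ⟨e.1, hw'.1, hw'.2, h2.1, .inl rfl⟩ h2.2

theorem reach_land {v : V} {j : ℕ} (h : H.Lands L.C L.lay v j) :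
    ∃ c ∈ L.C, L.lay c = j ∧ (H.sub fun a b => (a = v ∨ (a ∉ L.C ∧ L.Free v a ∧
      H.Lands L.C L.lay a j)) ∧ ((b ∉ L.C ∧ L.Free v b ∧ H.Lands L.C L.lay b j) ∨
        (b ∈ L.C ∧ L.lay b = j))).Reach v c := by
  obtain ⟨w, h1, c, hc, h2, h3⟩ := h
  refine ⟨c, hc, h3, ?_⟩
  have key : ∀ x, ReflTransGen (H.FreeStep L.C) x w → L.Free v x → (x = v ∨ x ∉ L.C) →
      (H.sub fun a b => (a = v ∨ (a ∉ L.C ∧ L.Free v a ∧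
      H.Lands L.C L.lay a j)) ∧ ((b ∉ L.C ∧ L.Free v b ∧ H.Lands L.C L.lay b j) ∨
        (b ∈ L.C ∧ L.lay b = j))).Reach x c := by
    intro x hx
    induction hx using ReflTransGen.head_induction_on with
    | refl =>
      intro h4 h5
      exact .single ⟨h2, h5.imp id fun h => ⟨h, h4, w, .refl, c, hc, h2, h3⟩, .inr ⟨hc, h3⟩⟩
    | @head a b e r ih =>
      intro h4 h5
      have hb : L.Free v b := ReflTransGen.tail h4 e
      exact .head ⟨e.1, h5.imp id fun h => ⟨h, h4, w, .head e r, c, hc, h2, h3⟩,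
        .inl ⟨e.2, hb, w, r, c, hc, h2, h3⟩⟩ (ih hb (.inr e.2))
  exact key v h1 .refl (.inl rfl)

variable {L} {n : ℕ}

/-- In the graph of the edges that satisfy `E`, the set `X` cannot be left once `r` is deleted. So
two losses of which exactly one is in `X` are in distinct strong components after the deletion of
`r`, and `hasShape_of_hub` bounds their number. -/
theorem card_lt_of_separated (hn : 3 ≤ n) (hfin : H.verts.Finite) (hloop : H.Loopless)
    (hno : ¬ HasShape H U n) (E : V → V → Prop) (r : V) (J : Finset ℕ) (hJ : J ⊆ L.I)
    (hne : ∀ l ∈ J, L.u l ≠ r) (h1 : ∀ l ∈ J, (H.sub E).Reach r (L.u l))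
    (h2 : ∀ l ∈ J, (H.sub E).Reach (L.u l) r)
    (h3 : ∀ l ∈ J, ∀ l' ∈ J, l < l' → ∃ X : Set V,
      (∀ a b, a ∈ X → a ≠ r → E a b → H.Adj a b → b ∈ X) ∧
      ((L.u l ∈ X ∧ L.u l' ∉ X) ∨ (L.u l' ∈ X ∧ L.u l ∉ X))) : J.card < 2 * n * n := by
  classical
  have hlay : ∀ l ∈ J, L.lay (L.u l) = l := fun l hl => (L.loss l (hJ hl)).2.2
  have hinj : Set.InjOn L.u J := fun a ha b hb h => by rw [← hlay a ha, h, hlay b hb]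
  rw [← Finset.card_image_of_injOn hinj]
  by_contra hcon
  refine hno (HasShape.of_red (T := ∅) (K := H.sub E) (hasShape_of_hub (r := r) hn
    (H := H.sub E) hfin (hloop.mono (sub_le _ _)) _ (not_lt.1 hcon) ?_ ?_ ?_ ?_ ?_)
    (.of_le (sub_le _ _)))
  · intro a ha
    obtain ⟨l, hl, rfl⟩ := Finset.mem_image.1 ha
    exact (L.loss l (hJ hl)).1
  · intro a ha
    obtain ⟨l, hl, rfl⟩ := Finset.mem_image.1 ha
    exact hne l hl
  · intro a ha
    obtain ⟨l, hl, rfl⟩ := Finset.mem_image.1 ha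
    exact h1 l hl
  · intro a ha
    obtain ⟨l, hl, rfl⟩ := Finset.mem_image.1 ha
    exact h2 l hl
  · have key : ∀ l ∈ J, ∀ l' ∈ J, l < l' → ¬ (((H.sub E).ind {r}ᶜ).Reach (L.u l) (L.u l') ∧
        ((H.sub E).ind {r}ᶜ).Reach (L.u l') (L.u l)) := by
      rintro l hl l' hl' hll ⟨q1, q2⟩
      obtain ⟨X, hX, ⟨i1, i2⟩ | ⟨i1, i2⟩⟩ := h3 l hl l' hl' hll
      · exact i2 (q1.closed i1 fun a b ha e => hX a b ha e.2.1 e.1.2 e.1.1).1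
      · exact i2 (q2.closed i1 fun a b ha e => hX a b ha e.2.1 e.1.2 e.1.1).1
    intro a ha b hb hab
    obtain ⟨l, hl, rfl⟩ := Finset.mem_image.1 ha
    obtain ⟨l', hl', rfl⟩ := Finset.mem_image.1 hb
    rcases lt_trichotomy l l' with h | rfl | h
    · exact key l hl l' hl' h
    · exact absurd rfl hab
    · exact fun q => key l' hl' l hl h q.symm

/-- The hub is the root of layer `j`. It descends to layer `l` and goes from there to `u l`, which
lands in layer `j` or higher, where one descends to the hub again. Free steps never lead down, and
the chosen edges enter `C` from outside only in layers from `j` on. So for `l < l'` there is no way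
from `u l'` to `u l` avoiding the hub. -/
theorem card_top_ge (hn : 3 ≤ n) (hfin : H.verts.Finite) (hloop : H.Loopless)
    (hno : ¬ HasShape H U n) {j : ℕ} (hj : j ≤ L.N) (J : Finset ℕ) (hJ : J ⊆ L.I)
    (h : ∀ l ∈ J, l < j ∧ L.u l ∉ L.C ∧ j ≤ L.top (L.u l)) : J.card < 2 * n * n := by
  have hr := L.r_mem j hj
  have hlay : ∀ l ∈ J, L.lay (L.u l) = l := fun l hl => (L.loss l (hJ hl)).2.2
  have hverts : ∀ l ∈ J, L.u l ∈ H.verts := fun l hl => (L.loss l (hJ hl)).2.1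
  refine card_lt_of_separated hn hfin hloop hno (fun a b => L.Dn a b ∨
    (b ∉ L.C ∧ (a ∉ L.C ∨ ∃ k < j, a = L.r k)) ∨ (a ∉ L.C ∧ b ∈ L.C ∧ j ≤ L.lay b)) (L.r j) J hJ
    (fun l hl e => (h l hl).2.1 (e ▸ hr.1)) ?_ ?_ ?_
  · intro l hl
    have h1 := L.reach_down hr.1 (i := l) (by rw [hr.2]; exact (h l hl).1.le)
    have h2 := L.reach_up (hverts l hl) (h l hl).2.1
    rw [hlay l hl] at h2
    refine (h1.sub_mono fun a b e => .inl e.1).trans (h2.sub_mono fun a b e => .inr (.inl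
      ⟨e.1, e.2.2.2.symm.imp And.left fun e => ⟨l, (h l hl).1, e⟩⟩))
  · intro l hl
    obtain ⟨h0, h1, h2⟩ := h l hl
    obtain ⟨c, hc, h3, h4⟩ := L.reach_land (L.lay_le_top (hverts l hl) h1).2
    have h5 := L.reach_down hc (i := j) (by omega)
    refine (h4.sub_mono ?_).trans (h5.sub_mono fun a b e => .inl e.1)
    rintro a b ⟨ha, hb⟩
    have ha : a ∉ L.C := ha.elim (fun h => h ▸ h1) And.left
    rcases hb with hb | hb
    · exact .inr (.inl ⟨hb.1, .inl ha⟩)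
    · exact .inr (.inr ⟨ha, hb.1, by omega⟩)
  · intro l hl l' hl' hll
    refine ⟨{v | (v ∉ L.C ∧ l' ≤ L.lay v) ∨ (v ∈ L.C ∧ j ≤ L.lay v)}, ?_, .inr ⟨?_, ?_⟩⟩
    · rintro a b (ha | ha) har (e | e | e) e'
      · exact absurd e.1 ha.1
      · exact .inl ⟨e.1, ha.2.trans (L.up a b e' e.1)⟩
      · exact .inr ⟨e.2.1, e.2.2⟩
      · refine .inr ⟨e.2.1, ?_⟩
        rcases e.2.2 with h | ⟨h, h'⟩
        · exact h ▸ ha.2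
        · by_contra hb
          have : L.lay a = j := by have := ha.2; omega
          exact har (this ▸ h')
      · exfalso
        rcases e.2 with h | ⟨k, hk, rfl⟩
        · exact h ha.1
        · have := (L.r_mem k (by omega)).2
          have := ha.2
          omega
      · exact absurd ha.1 e.1
    · exact .inl ⟨(h l' hl').2.1, (hlay l' hl').ge⟩
    · rintro (h' | h')
      · have := h'.2; rw [hlay l hl] at this; omega
      · exact (h l hl).2.1 h'.1

/-- The hub is the root of layer `i`, which freely reaches each `u l`; from there one lands in `C`
and descends to the hub. The chosen edges leave `C` only at the hub and free steps never lead down,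
so for `l < l'` there is no way from `u l'` to `u l` avoiding the hub. -/
theorem card_free (hn : 3 ≤ n) (hfin : H.verts.Finite) (hloop : H.Loopless)
    (hno : ¬ HasShape H U n) {i : ℕ} (hi : i ≤ L.N) (J : Finset ℕ) (hJ : J ⊆ L.I)
    (h : ∀ l ∈ J, i < l ∧ L.u l ∉ L.C ∧ L.Free (L.r i) (L.u l)) : J.card < 2 * n * n := by
  have hr := L.r_mem i hi
  have hlay : ∀ l ∈ J, L.lay (L.u l) = l := fun l hl => (L.loss l (hJ hl)).2.2
  have hverts : ∀ l ∈ J, L.u l ∈ H.verts := fun l hl => (L.loss l (hJ hl)).2.1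
  refine card_lt_of_separated hn hfin hloop hno (fun a b => L.Dn a b ∨
    (b ∉ L.C ∧ (a ∉ L.C ∨ a = L.r i)) ∨ (a ∉ L.C ∧ b ∈ L.C)) (L.r i) J hJ
    (fun l hl e => (h l hl).2.1 (e ▸ hr.1)) ?_ ?_ ?_
  · intro l hl
    have key : ∀ v, L.Free (L.r i) v → (H.sub fun a b => L.Dn a b ∨
        (b ∉ L.C ∧ (a ∉ L.C ∨ a = L.r i)) ∨ (a ∉ L.C ∧ b ∈ L.C)).Reach (L.r i) v := by
      intro v hv
      suffices (v = L.r i ∨ v ∉ L.C) ∧ (H.sub fun a b => L.Dn a b ∨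
        (b ∉ L.C ∧ (a ∉ L.C ∨ a = L.r i)) ∨ (a ∉ L.C ∧ b ∈ L.C)).Reach (L.r i) v from this.2
      induction hv with
      | refl => exact ⟨.inl rfl, .refl _⟩
      | tail _ e ih => exact ⟨.inr e.2, ih.2.tail ⟨e.1, .inr (.inl ⟨e.2, ih.1.symm⟩)⟩⟩
    exact key _ (h l hl).2.2
  · intro l hl
    obtain ⟨h0, h1, -⟩ := h l hl
    have h2 := L.lay_le_top (hverts l hl) h1
    obtain ⟨c, hc, h3, h4⟩ := L.reach_land h2.2
    have h5 := L.reach_down hc (i := i) (by rw [h3]; have := hlay l hl; omega)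
    refine (h4.sub_mono ?_).trans (h5.sub_mono fun a b e => .inl e.1)
    rintro a b ⟨ha, hb⟩
    have ha : a ∉ L.C := ha.elim (fun h => h ▸ h1) And.left
    rcases hb with hb | hb
    · exact .inr (.inl ⟨hb.1, .inl ha⟩)
    · exact .inr (.inr ⟨ha, hb.1⟩)
  · intro l hl l' hl' hll
    refine ⟨{v | (v ∉ L.C ∧ l' ≤ L.lay v) ∨ v ∈ L.C}, ?_, .inr ⟨?_, ?_⟩⟩
    · rintro a b (ha | ha) har (e | e | e) e'
      · exact .inr e.2.1
      · exact .inl ⟨e.1, ha.2.trans (L.up a b e' e.1)⟩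
      · exact .inr e.2
      · exact .inr e.2.1
      · exact absurd ha (e.2.resolve_right har)
      · exact .inr e.2
    · exact .inl ⟨(h l' hl').2.1, (hlay l' hl').ge⟩
    · rintro (h' | h')
      · have := h'.2; rw [hlay l hl] at this; omega
      · exact (h l hl).2.1 h'

open Classical in
/-- The last layer that is needed to separate `u l` from higher layers. -/
noncomputable def reachTop (L : Ladder H U) (l : ℕ) : ℕ := if L.u l ∈ L.C then l else L.top (L.u l)

theorem le_reachTop {l : ℕ} (hl : l ∈ L.I) : l ≤ L.reachTop l := by
  have h := L.loss l hl
  unfold reachTop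
  split_ifs with h'
  · exact le_rfl
  · exact h.2.2.ge.trans (L.lay_le_top h.2.1 h').1

/-- The hub is the root of layer `j`. It descends and gets to `u l`; from there one reaches the root
of layer `i`, after a landing below `j` if `u l` is not in `C`, then follows the landing of this
root to layer `j` or higher and descends to the hub. The climbing path runs in `Z`, which the paths
for the individual losses avoid. As their intervals of layers are disjoint, no way from a lower to a
higher loss avoids the hub. -/
theorem card_disjoint (hn : 3 ≤ n) (hfin : H.verts.Finite) (hloop : H.Loopless)
    (hno : ¬ HasShape H U n) {i j j' : ℕ} (hij : i < j) (hj : j ≤ L.N)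
    (hjj : j ≤ j') (hland : H.Lands L.C L.lay (L.r i) j') (J : Finset ℕ) (hJ : J ⊆ L.I)
    (h : ∀ l ∈ J, i < l ∧ l < j ∧ (L.u l ∈ L.C ∨ (L.u l ∉ L.C ∧ ¬ L.Free (L.r i) (L.u l) ∧
      L.top (L.u l) < j)))
    (hd : ∀ l ∈ J, ∀ l' ∈ J, l < l' → L.reachTop l < l') : J.card < 2 * n * n := by
  have hr := L.r_mem j hj
  have hri := L.r_mem i (by omega)
  have hlay : ∀ l ∈ J, L.lay (L.u l) = l := fun l hl => (L.loss l (hJ hl)).2.2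
  have hverts : ∀ l ∈ J, L.u l ∈ H.verts := fun l hl => (L.loss l (hJ hl)).2.1
  obtain ⟨Z, hZ⟩ : ∃ Z : Set V, Z = {v | v ∉ L.C ∧ L.Free (L.r i) v ∧ j ≤ L.top v} := ⟨_, rfl⟩
  have hZC : ∀ v ∈ Z, v ∉ L.C := by rw [hZ]; exact fun v hv => hv.1
  have hCZ : ∀ v ∈ L.C, v ∉ Z := fun v hv hv' => hZC v hv' hv
  have htop : ∀ l ∈ J, L.reachTop l < j := by
    intro l hl
    obtain ⟨h0, h1, h2⟩ := h l hl
    unfold reachTop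
    split_ifs with h'
    · exact h1
    · exact (h2.resolve_left h').2.2
  have huZ : ∀ l ∈ J, L.u l ∉ Z := by
    intro l hl hl'
    rw [hZ] at hl'
    exact ((h l hl).2.2.resolve_left hl'.1).2.1 hl'.2.1
  -- Allowed are descents in `C`, edges inside the interval of a single loss that avoid `Z`, and the
  -- climb from the root of layer `i` through `Z` to layer `j` or higher.
  obtain ⟨E, hE⟩ : ∃ E : V → V → Prop, E = fun a b => L.Dn a b ∨
    (a ∉ Z ∧ b ∉ Z ∧ ∃ m ∈ J, m ≤ L.lay a ∧ L.lay a ≤ L.reachTop m ∧ m ≤ L.lay b ∧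
      L.lay b ≤ L.reachTop m) ∨
    ((a = L.r i ∨ a ∈ Z) ∧ (b ∈ Z ∨ (b ∈ L.C ∧ j ≤ L.lay b))) := ⟨_, rfl⟩
  have hdown : ∀ c ∈ L.C, ∀ k ≤ L.lay c, (H.sub E).Reach c (L.r k) := fun c hc k hk =>
    (L.reach_down hc hk).sub_mono fun a b e => by rw [hE]; exact .inl e.1
  have hup : (H.sub E).Reach (L.r i) (L.r j) := by
    obtain ⟨c, hc, h3, h4⟩ := L.reach_land hland
    refine (h4.sub_mono ?_).trans (hdown c hc j (by omega))
    rintro a b ⟨ha, hb⟩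
    rw [hE]
    have hz : ∀ v, v ∉ L.C → L.Free (L.r i) v → H.Lands L.C L.lay v j' → v ∈ Z := fun v h1 h2 h3 => by
      rw [hZ]; exact ⟨h1, h2, hjj.trans (L.le_top h3)⟩
    exact .inr (.inr ⟨ha.imp id fun h => hz a h.1 h.2.1 h.2.2,
      hb.imp (fun h => hz b h.1 h.2.1 h.2.2) fun h => ⟨h.1, by omega⟩⟩)
  refine card_lt_of_separated hn hfin hloop hno E (L.r j) J hJ (fun l hl e => ?_) ?_ ?_ ?_
  · have h1 := hlay l hl
    rw [e, hr.2] at h1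
    have := (h l hl).2.1
    omega
  · intro l hl
    obtain ⟨h0, h1, h2⟩ := h l hl
    by_cases hC : L.u l ∈ L.C
    · exact (hdown _ hr.1 (l + 1) (by rw [hr.2]; omega)).trans
        ((L.reach_loss (hJ hl) hC).sub_mono fun a b e => by rw [hE]; exact .inl e.1)
    · have h3 := L.reach_up (hverts l hl) hC
      rw [hlay l hl] at h3
      have hrl := L.r_mem l (by omega)
      refine (hdown _ hr.1 l (by rw [hr.2]; omega)).trans (h3.sub_mono ?_)
      have hz : ∀ v, L.Free v (L.u l) → v ∉ Z := by
        intro v hv hv'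
        rw [hZ] at hv'
        exact (h2.resolve_left hC).2.1 (hv'.2.1.trans hv)
      have hle := le_reachTop (hJ hl)
      rintro a b ⟨e1, e2, e3, e4⟩
      rw [hE]
      have ha : a ∉ Z ∧ L.lay a = l := by
        rcases e4 with rfl | e4
        · exact ⟨hCZ _ hrl.1, hrl.2⟩
        · exact ⟨hz a e4.2.2, e4.2.1⟩
      exact .inr (.inl ⟨ha.1, hz b e3, l, hl, by omega, by omega, by omega, by omega⟩)
  · intro l hl
    obtain ⟨h0, h1, h2⟩ := h l hl
    suffices (H.sub E).Reach (L.u l) (L.r i) from this.trans hup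
    by_cases hC : L.u l ∈ L.C
    · exact hdown _ hC i (by rw [hlay l hl]; omega)
    · have h3 := L.lay_le_top (hverts l hl) hC
      have htop' : L.reachTop l = L.top (L.u l) := if_neg hC
      obtain ⟨c, hc, h4, h5⟩ := L.reach_land h3.2
      rw [hlay l hl] at h3
      refine (h5.sub_mono ?_).trans (hdown c hc i (by omega))
      have hfree : ∀ v, L.Free (L.u l) v → H.Lands L.C L.lay v (L.top (L.u l)) → v ∉ L.C →
          v ∉ Z ∧ l ≤ L.lay v ∧ L.lay v ≤ L.reachTop l := by
        intro v hv hv' hvC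
        have i1 := L.top_le_top hv
        have i2 := L.lay_le_of_free hv
        rw [hlay l hl] at i2
        obtain ⟨w, j1, c', hc', j2, j3⟩ := hv'
        have hvH : v ∈ H.verts := by
          rcases ReflTransGen.cases_head j1 with rfl | ⟨x, hx, -⟩
          · exact H.left_mem j2
          · exact H.left_mem hx.1
        have i3 := (L.lay_le_top hvH hvC).1
        refine ⟨fun hvZ => ?_, i2, by omega⟩
        rw [hZ] at hvZ
        have := (h2.resolve_left hC).2.2
        have := hvZ.2.2
        omega
      rintro a b ⟨e1, e2⟩
      rw [hE]
      have ha : a ∉ Z ∧ l ≤ L.lay a ∧ L.lay a ≤ L.reachTop l := by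
        rcases e1 with rfl | e1
        · exact hfree _ .refl h3.2 hC
        · exact hfree a e1.2.1 e1.2.2 e1.1
      have hb : b ∉ Z ∧ l ≤ L.lay b ∧ L.lay b ≤ L.reachTop l := by
        rcases e2 with e2 | e2
        · exact hfree b e2.2.1 e2.2.2 e2.1
        · exact ⟨hCZ b e2.1, by omega, by omega⟩
      exact .inr (.inl ⟨ha.1, hb.1, l, hl, ha.2.1, ha.2.2, hb.2.1, hb.2.2⟩)
  · intro l hl l' hl' hll
    have hlt := hd l hl l' hl' hll
    -- From `u l` one stays outside `Z` up to the end of its interval, or climbs through `Z`, or has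
    -- arrived in `C` in layer `j` or higher. Descending from there to below layer `j` requires the
    -- hub, and `u l'` lies in a layer strictly between `reachTop l` and `j`.
    refine ⟨{v | (v ∉ Z ∧ L.lay v ≤ L.reachTop l) ∨ v ∈ Z ∨ (v ∈ L.C ∧ j ≤ L.lay v)}, ?_,
      .inl ⟨?_, ?_⟩⟩
    · intro a b ha har e e'
      rw [hE] at e
      rcases e with e | e | e
      · rcases ha with ha | ha | ha
        · refine .inl ⟨hCZ b e.2.1, ?_⟩
          have := ha.2
          rcases e.2.2 with h | ⟨h, -⟩ <;> omega
        · exact absurd e.1 (hZC a ha)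
        · refine .inr (.inr ⟨e.2.1, ?_⟩)
          rcases e.2.2 with h | ⟨h, h'⟩
          · exact h ▸ ha.2
          · by_contra hb
            have : L.lay a = j := by have := ha.2; omega
            exact har (this ▸ h')
      · obtain ⟨e1, e2, m, hm, e3, e4, e5, e6⟩ := e
        have hmj := htop m hm
        rcases ha with ha | ha | ha
        · refine .inl ⟨e2, ?_⟩
          have h2 := ha.2
          have h3 := le_reachTop (hJ hl)
          rcases lt_trichotomy m l with h | rfl | h
          · have := hd m hm l hl h; omega
          · exact e6
          · have := hd l hl m hm h; omega
        · exact absurd ha e1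
        · have := ha.2; omega
      · rcases e.2 with h | h
        · exact .inr (.inl h)
        · exact .inr (.inr h)
    · exact .inl ⟨huZ l hl, by rw [hlay l hl]; exact le_reachTop (hJ hl)⟩
    · have h1 := hlay l' hl'
      have h2 := (h l' hl').2.1
      rintro (h' | h' | h')
      · have := h'.2; omega
      · exact huZ l' hl' h'
      · have := h'.2; omega

/-- Only few losses are in the layers between `i` and a layer in which the root of layer `i`
lands. -/
theorem card_between (hn : 3 ≤ n) (hfin : H.verts.Finite) (hloop : H.Loopless)
    (hno : ¬ HasShape H U n) {i j : ℕ} (hij : i < j) (hland : H.Lands L.C L.lay (L.r i) j) :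
    (L.I.filter fun l => i < l ∧ l < j).card ≤ 2 * n * n * (2 * n * n + 2) := by
  classical
  have hj := L.lands_le hland
  set M := 2 * n * n with hM
  set S := L.I.filter fun l => i < l ∧ l < j with hS
  have hSI : ∀ l ∈ S, l ∈ L.I ∧ i < l ∧ l < j := fun l hl => Finset.mem_filter.1 hl
  set A := S.filter fun l => L.u l ∉ L.C ∧ j ≤ L.top (L.u l) with hA
  set B := S.filter fun l => L.u l ∉ L.C ∧ L.Free (L.r i) (L.u l) with hB
  set D := S.filter fun l => L.u l ∈ L.C ∨ (L.u l ∉ L.C ∧ ¬ L.Free (L.r i) (L.u l) ∧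
      L.top (L.u l) < j) with hD
  have hcover : S ⊆ A ∪ B ∪ D := by
    intro l hl
    simp only [hA, hB, hD, Finset.mem_union, Finset.mem_filter, hl, true_and]
    by_cases h1 : L.u l ∈ L.C <;> by_cases h2 : L.Free (L.r i) (L.u l) <;>
      by_cases h3 : j ≤ L.top (L.u l) <;> simp [h1, h2, h3]; omega
  have hAc : A.card < M := card_top_ge hn hfin hloop hno hj A
    (fun l hl => (hSI l (Finset.mem_filter.1 hl).1).1) fun l hl =>
      ⟨(hSI l (Finset.mem_filter.1 hl).1).2.2, (Finset.mem_filter.1 hl).2⟩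
  have hBc : B.card < M := card_free hn hfin hloop hno (hij.le.trans hj) B
    (fun l hl => (hSI l (Finset.mem_filter.1 hl).1).1) fun l hl =>
      ⟨(hSI l (Finset.mem_filter.1 hl).1).2.1, (Finset.mem_filter.1 hl).2⟩
  have hDI : ∀ l ∈ D, l ∈ L.I := fun l hl => (hSI l (Finset.mem_filter.1 hl).1).1
  have hDc : D.card ≤ M * M := by
    by_contra hcon
    -- At most `M` of the intervals contain a given `x`: one may start in `x`, and the others belong
    -- to losses outside `C` in lower layers that land in layer `x` or higher, of which
    -- `card_top_ge` allows fewer than `M`.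
    obtain ⟨J', h1, h2, h3⟩ := exists_disjoint_intervals L.reachTop M M D
      (fun l hl => le_reachTop (hDI l hl)) (fun x => by
        by_cases hx : x ≤ L.N
        · have h1 : ((D.filter fun l => l ≤ x ∧ x ≤ L.reachTop l).erase x).card < M := by
            refine card_top_ge hn hfin hloop hno hx _ (fun l hl => ?_) fun l hl => ?_
            · exact hDI l (Finset.mem_filter.1 (Finset.mem_of_mem_erase hl)).1
            · have h2 := Finset.ne_of_mem_erase hl
              have h3 := (Finset.mem_filter.1 (Finset.mem_of_mem_erase hl)).2
              have h4 : L.u l ∉ L.C := fun h => by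
                have : L.reachTop l = l := if_pos h
                omega
              refine ⟨by omega, h4, ?_⟩
              rw [show L.top (L.u l) = L.reachTop l from (if_neg h4).symm]
              exact h3.2
          have h2 := Finset.pred_card_le_card_erase
            (s := D.filter fun l => l ≤ x ∧ x ≤ L.reachTop l) (a := x)
          omega
        · rw [Finset.card_eq_zero.2 (Finset.filter_eq_empty_iff.2 fun l hl h => ?_)]
          · exact Nat.zero_le _
          · have h1 : L.reachTop l ≤ L.N := by
              unfold reachTop
              split_ifs
              · exact (L.I_lt l (hDI l hl)).le
              · exact L.top_le _
            omega) (by omega)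
    have := card_disjoint hn hfin hloop hno hij hj le_rfl hland J' (fun l hl => hDI l (h1 hl))
      (fun l hl => ⟨(hSI l (Finset.mem_filter.1 (h1 hl)).1).2.1,
        (hSI l (Finset.mem_filter.1 (h1 hl)).1).2.2, (Finset.mem_filter.1 (h1 hl)).2⟩) h3
    omega
  have h1 := (Finset.card_le_card hcover).trans ((Finset.card_union_le _ _).trans
    (Nat.add_le_add_right (Finset.card_union_le _ _) _))
  have h2 : M * (M + 2) = M * M + 2 * M := by ring
  omega

end Ladder

/-! ### Landmark layers, gates and blocks -/

namespace Ladder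

variable {H : VDigraph V} {U : Set V} (L : Ladder H U)

/-- The landmark layers: from the layers up to `ends t` one lands at most in `ends (t + 1)`. -/
noncomputable def ends : ℕ → ℕ
  | 0 => 0
  | t + 1 => (Finset.range (ends t + 1)).sup fun l => L.top (L.r l)

theorem exists_jump (t : ℕ) : ∃ l ≤ L.ends t, L.top (L.r l) = L.ends (t + 1) := by
  obtain ⟨l, hl, h⟩ := Finset.exists_mem_eq_sup (Finset.range (L.ends t + 1)) ⟨0, by simp⟩
    fun l => L.top (L.r l)
  exact ⟨l, Nat.le_of_lt_succ (Finset.mem_range.1 hl), h.symm⟩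

/-- A layer below `ends t` whose root lands in `ends (t + 1)`. -/
noncomputable def jump (t : ℕ) : ℕ := (L.exists_jump t).choose

theorem jump_le (t : ℕ) : L.jump t ≤ L.ends t := (L.exists_jump t).choose_spec.1

theorem top_jump (t : ℕ) : L.top (L.r (L.jump t)) = L.ends (t + 1) :=
  (L.exists_jump t).choose_spec.2

theorem top_le_ends {t l : ℕ} (h : l ≤ L.ends t) : L.top (L.r l) ≤ L.ends (t + 1) :=
  Finset.le_sup (f := fun l => L.top (L.r l)) (Finset.mem_range.2 (Nat.lt_succ_of_le h))

theorem ends_le (t : ℕ) : L.ends t ≤ L.N := by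
  cases t with
  | zero => exact Nat.zero_le _
  | succ t => exact Finset.sup_le fun l _ => L.top_le _

theorem ends_lt {t : ℕ} (h : L.ends t < L.N) : L.ends t < L.ends (t + 1) :=
  (L.lt_top_root h).1.trans_le (L.top_le_ends le_rfl)

theorem ends_le_succ (t : ℕ) : L.ends t ≤ L.ends (t + 1) := by
  rcases (L.ends_le t).lt_or_eq with h | h
  · exact (L.ends_lt h).le
  · cases t with
    | zero => exact Nat.zero_le _
    | succ t =>
      have h1 : L.jump t ≤ L.ends (t + 1) := by
        by_contra hlt
        have h2 := L.jump_le t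
        have h3 := L.ends_le t
        omega
      have := L.top_le_ends h1
      rwa [L.top_jump] at this

theorem ends_mono {t t' : ℕ} (h : t ≤ t') : L.ends t ≤ L.ends t' :=
  monotone_nat_of_le_succ L.ends_le_succ h

theorem ends_lt_of_lt {t t' : ℕ} (h : t < t') (ht : L.ends t < L.N) : L.ends t < L.ends t' :=
  (L.ends_lt ht).trans_le (L.ends_mono h)

/-- From the layers up to `ends t` one lands at most in `ends (t + 1)`, so a jump to the strictly
higher layer `ends (t + 2)` starts above `ends t`. -/
theorem lt_jump {t : ℕ} (h : L.ends (t + 1) < L.N) : L.ends t < L.jump (t + 1) := by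
  by_contra hcon
  have h1 := L.top_le_ends (not_lt.1 hcon)
  rw [L.top_jump] at h1
  have := L.ends_lt h
  omega

theorem lt_jump_of_lt {t t' : ℕ} (h : t < t') (ht : L.ends t' < L.N) : L.ends t < L.jump t' := by
  obtain ⟨d, rfl⟩ := Nat.exists_eq_add_of_lt h
  exact (L.ends_mono (Nat.le_add_right t d)).trans_lt (L.lt_jump ht)

/-- The root of the layer `jump t`. -/
noncomputable def gate (t : ℕ) : V := L.r (L.jump t)

theorem gate_mem (t : ℕ) : L.gate t ∈ L.C ∧ L.lay (L.gate t) = L.jump t :=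
  L.r_mem _ ((L.jump_le t).trans (L.ends_le t))

/-- The layers between `jump t` and `ends t`. -/
def gateSet (t : ℕ) : Set V := {c | c ∈ L.C ∧ L.jump t ≤ L.lay c ∧ L.lay c ≤ L.ends t}

theorem gate_mem_gateSet (t : ℕ) : L.gate t ∈ L.gateSet t :=
  ⟨(L.gate_mem t).1, (L.gate_mem t).2.ge, (L.gate_mem t).2.le.trans (L.jump_le t)⟩

theorem gateSet_reach {t : ℕ} {c : V} (hc : c ∈ L.gateSet t) :
    (H.ind (L.gateSet t)).Reach c (L.gate t) := by
  refine (L.reach_down hc.1 hc.2.1).mono fun a b e => ?_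
  obtain ⟨e, ⟨ha, hb, h1⟩, h2, h3⟩ := e
  have h4 := hc.2.2
  have h5 : L.lay b ≤ L.lay a := by rcases h1 with h | h <;> omega
  exact ⟨e, ⟨ha, by omega, by omega⟩, hb, by omega, by omega⟩

/-- The vertices beyond the layer `ends t`. -/
def beyond (t : ℕ) : Set V :=
  {v | (v ∈ L.C ∧ L.ends t < L.lay v) ∨ (v ∈ H.verts ∧ v ∉ L.C ∧ L.ends t < L.top v)}

theorem notMem_beyond {t t' : ℕ} (h : t ≤ t') {c : V} (hc : c ∈ L.gateSet t) :
    c ∉ L.beyond t' := by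
  have := L.ends_mono h
  rintro (h | h)
  · have := hc.2.2; have := h.2; omega
  · exact h.2.1 hc.1

/-- The graph beyond the layer `ends t`, together with the set `gateSet t` contracted to
`gate t`. -/
def rest (t : ℕ) : VDigraph V where
  verts := {L.gate t} ∪ L.beyond t
  Adj a b := (a ∈ L.beyond t ∧ b ∈ L.beyond t ∧ H.Adj a b) ∨
    (a = L.gate t ∧ b ∈ L.beyond t ∧ H.Adj a b) ∨
    (b = L.gate t ∧ a ∈ L.beyond t ∧ ∃ c ∈ L.gateSet t, H.Adj a c)
  left_mem := by
    rintro a b (h | h | h)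
    exacts [.inr h.1, .inl h.1, .inr h.2.1]
  right_mem := by
    rintro a b (h | h | h)
    exacts [.inr h.2.1, .inr h.2.1, .inl h.1]

theorem beyond_sub (t : ℕ) : L.beyond t ⊆ H.verts := by
  rintro v (h | h)
  exacts [L.C_sub h.1, h.1]

theorem rest_verts_sub (t : ℕ) : (L.rest t).verts ⊆ H.verts := by
  rintro v (h | h)
  · rw [show v = L.gate t from h]; exact L.C_sub (L.gate_mem t).1
  · exact L.beyond_sub t h

theorem gate_notMem_rest {t t' : ℕ} (h : t < t') (ht' : L.ends t' < L.N) :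
    L.gate t ∉ (L.rest t').verts := by
  rintro (h' | h')
  · have h1 := (L.gate_mem t).2
    rw [show L.gate t = L.gate t' from h', (L.gate_mem t').2] at h1
    have := L.lt_jump_of_lt h ht'
    have := L.jump_le t
    omega
  · exact L.notMem_beyond h.le (L.gate_mem_gateSet t) h'

theorem rest_loopless (hloop : H.Loopless) (t : ℕ) : (L.rest t).Loopless := by
  have hg := L.notMem_beyond (le_refl t) (L.gate_mem_gateSet t)
  rintro v (h | h | h)
  · exact hloop v h.2.2
  · exact hloop v h.2.2
  · exact hg (h.1 ▸ h.2.1)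

/-- Every vertex of `gateSet t` descends to `gate t` within the set, so the set contracts to this
vertex; everything below is deleted. -/
theorem red_rest (hfin : H.verts.Finite) (t : ℕ) : Red ∅ H (L.rest t) := by
  have hsub : L.gateSet t ⊆ H.verts := fun c hc => L.C_sub hc.1
  refine (Red.inCollapse (hfin.subset hsub) (L.gate_mem_gateSet t) (hsub (L.gate_mem_gateSet t))
    (fun _ hc => L.gateSet_reach hc) (by simp)).trans (.of_le ⟨?_, ?_⟩)
  · rintro v (h | h)
    · exact .inr h
    · exact .inl ⟨L.beyond_sub t h, fun h' => L.notMem_beyond le_rfl h' h⟩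
  · have hn : ∀ v ∈ L.beyond t, v ∉ L.gateSet t := fun v h h' => L.notMem_beyond le_rfl h' h
    rintro a b (h | h | h)
    · exact inCollapse_adj.2 (.inl ⟨hn a h.1, hn b h.2.1, h.2.2⟩)
    · exact inCollapse_adj.2 (.inr (.inl ⟨h.1, hn b h.2.1, h.1 ▸ h.2.2⟩))
    · exact inCollapse_adj.2 (.inr (.inr ⟨hn a h.2.1, h.1, h.2.2⟩))

/-- The vertices between the layers `ends t` and `jump t'`. -/
def between (t t' : ℕ) : Set V :=
  {v | (v ∈ L.C ∧ L.ends t < L.lay v ∧ L.lay v < L.jump t') ∨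
    (v ∈ H.verts ∧ v ∉ L.C ∧ L.ends t < L.top v ∧ L.top v ≤ L.ends t')}

/-- The part of `rest t` from `gate t` to `gate t'`. -/
noncomputable def block (t t' : ℕ) : VDigraph V :=
  ((L.rest t).inCollapse (L.gate t') (L.gateSet t')).ind
    ({L.gate t, L.gate t'} ∪ L.between t t')

variable {L} {t t' : ℕ}

theorem gateSet_sub_beyond (h : t < t') (ht' : L.ends t' < L.N) :
    L.gateSet t' ⊆ L.beyond t := fun _ hc =>
  .inl ⟨hc.1, (L.lt_jump_of_lt h ht').trans_le hc.2.1⟩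

theorem between_sub : L.between t t' ⊆ L.beyond t := by
  rintro v (h | h)
  exacts [.inl ⟨h.1, h.2.1⟩, .inr ⟨h.1, h.2.1, h.2.2.1⟩]

theorem between_notMem {v : V} (hv : v ∈ L.between t t') : v ∉ (L.rest t').verts := by
  have hj := L.jump_le t'
  rintro (h | h)
  · obtain rfl : v = L.gate t' := h
    have := L.gate_mem t'
    rcases hv with hv | hv
    · have := hv.2.2; omega
    · exact hv.2.1 this.1
  · rcases hv with hv | hv <;> rcases h with h | h
    · have := hv.2.2; have := h.2; omega
    · exact h.2.1 hv.1
    · exact hv.2.1 h.1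
    · have := hv.2.2.2; have := h.2.2; omega

theorem gateSet_between {v : V} (hv : v ∈ L.between t t') : v ∉ L.gateSet t' := by
  intro h
  rcases hv with hv | hv
  · have := hv.2.2; have := h.2.1; omega
  · exact hv.2.1 h.1

theorem block_verts_sub (h : t < t') (ht' : L.ends t' < L.N) :
    (L.block t t').verts ⊆ (L.rest t).verts := fun _ hv =>
  inCollapse_verts_subset (H := L.rest t) (q := L.gate t')
    (Or.inr (gateSet_sub_beyond h ht' (L.gate_mem_gateSet t'))) _ hv.1

theorem block_inter_rest (h : t < t') (ht' : L.ends t' < L.N) {v : V}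
    (hv : v ∈ (L.block t t').verts) (hv' : v ∈ (L.rest t').verts) : v = L.gate t' := by
  rcases hv.2 with (h1 | h1) | h1
  · exact absurd (show v = L.gate t from h1) fun h1 => L.gate_notMem_rest h ht' (h1 ▸ hv')
  · exact h1
  · exact absurd hv' (between_notMem h1)

theorem block_loopless (hloop : H.Loopless) : (L.block t t').Loopless :=
  ind_loopless (inCollapse_loopless (L.rest_loopless hloop t) (L.gate_mem_gateSet t')) _

/-- Reductions of a block and of the part beyond it can be combined. -/
theorem red_rest_step (hfin : H.verts.Finite) (hloop : H.Loopless) (h : t < t')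
    (ht' : L.ends t' < L.N) {K K' : VDigraph V}
    (hK : Red {L.gate t, L.gate t'} (L.block t t') K) (hK' : Red {L.gate t'} (L.rest t') K') :
    Red {L.gate t} (L.rest t) (K ⊔ K') := by
  have hs := gateSet_sub_beyond h ht'
  have hg : L.gate t ∉ L.gateSet t' := fun h' =>
    L.notMem_beyond (le_refl t) (L.gate_mem_gateSet t) (hs h')
  have hgH : L.gate t' ∈ (L.rest t).verts := .inr (hs (L.gate_mem_gateSet t'))
  have h1 : Red {L.gate t} (L.rest t) ((L.rest t).inCollapse (L.gate t') (L.gateSet t')) := by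
    refine Red.inCollapse (hfin.subset fun c hc => L.C_sub hc.1) (L.gate_mem_gateSet t') hgH
      (fun c hc => (L.gateSet_reach hc).mono fun a b e =>
        ⟨.inl ⟨hs e.2.1, hs e.2.2, e.1⟩, e.2⟩) ?_
    rintro v ⟨hv, hv'⟩
    exact absurd ((show v = L.gate t from hv) ▸ hv') hg
  -- Once `gateSet t'` is contracted, the block and the part beyond it share only `gate t'`. With
  -- this vertex protected they can be reduced one after the other.
  have hle : L.block t t' ⊔ L.rest t' ≤ (L.rest t).inCollapse (L.gate t') (L.gateSet t') := by
    have hb : L.beyond t' ⊆ L.beyond t := by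
      have := L.ends_mono h.le
      rintro v (h | h)
      · exact .inl ⟨h.1, by omega⟩
      · exact .inr ⟨h.1, h.2.1, by omega⟩
    have hn : ∀ v ∈ L.beyond t', v ∉ L.gateSet t' := fun v h h' => L.notMem_beyond le_rfl h' h
    refine sup_le' (ind_le _ _) ⟨?_, ?_⟩
    · rintro v (h | h)
      · exact .inr h
      · exact .inl ⟨.inr (hb h), hn v h⟩
    · rintro a b (h | h | h)
      · exact inCollapse_adj.2 (.inl ⟨hn a h.1, hn b h.2.1, .inl ⟨hb h.1, hb h.2.1, h.2.2⟩⟩)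
      · exact inCollapse_adj.2 (.inr (.inl ⟨h.1, hn b h.2.1, .inl
          ⟨hs (L.gate_mem_gateSet t'), hb h.2.1, h.1 ▸ h.2.2⟩⟩))
      · obtain ⟨h1, h2, c, hc, h3⟩ := h
        exact inCollapse_adj.2 (.inr (.inr ⟨hn a h2, h1, c, hc, .inl ⟨hb h2, hs hc, h3⟩⟩))
  have h2 := hK.frame (R := L.rest t') (L.rest_loopless hloop t')
    fun v hv => .inr (block_inter_rest h ht' hv.1 hv.2)
  have h3 := hK'.frame (R := K) (hK.loopless (block_loopless hloop))
    fun v hv => block_inter_rest h ht' (hK.verts hv.2) hv.1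
  rw [sup_comm', sup_comm' K'] at h3
  refine h1.trans ((Red.of_le hle).trans ((h2.mono ?_).trans (h3.mono ?_)))
  · rintro v ⟨hv, -⟩
    exact .inl (.inl hv)
  · rintro v ⟨hv, hv' | hv'⟩
    · exact .inr hv'
    · exact absurd ((show v = L.gate t from hv) ▸ hv') (L.gate_notMem_rest h ht')

theorem block_adj (h : t < t') (ht' : L.ends t' < L.N) {a b : V}
    (ha : a = L.gate t ∨ a = L.gate t' ∨ a ∈ L.between t t') (hb : b ∈ L.between t t')
    (e : H.Adj a b) : (L.block t t').Adj a b := by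
  have hs := gateSet_sub_beyond h ht'
  have hb' := gateSet_between hb
  have hB := between_sub hb
  rcases ha with rfl | rfl | ha
  · exact ⟨inCollapse_adj.2 (.inl ⟨fun h' => L.notMem_beyond (le_refl t) (L.gate_mem_gateSet t)
      (hs h'), hb', .inr (.inl ⟨rfl, hB, e⟩)⟩), .inl (.inl rfl), .inr hb⟩
  · exact ⟨inCollapse_adj.2 (.inr (.inl ⟨rfl, hb', .inl ⟨hs (L.gate_mem_gateSet t'), hB, e⟩⟩)),
      .inl (.inr rfl), .inr hb⟩
  · exact ⟨inCollapse_adj.2 (.inl ⟨gateSet_between ha, hb', .inl ⟨between_sub ha, hB, e⟩⟩),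
      .inr ha, .inr hb⟩

theorem block_adj_left (h : t < t') (ht' : L.ends t' < L.N) {a c : V} (ha : a ∈ L.between t t')
    (hc : c ∈ L.gateSet t) (e : H.Adj a c) : (L.block t t').Adj a (L.gate t) :=
  ⟨inCollapse_adj.2 (.inl ⟨gateSet_between ha, fun h' => L.notMem_beyond (le_refl t)
    (L.gate_mem_gateSet t) (gateSet_sub_beyond h ht' h'),
    .inr (.inr ⟨rfl, between_sub ha, c, hc, e⟩)⟩), .inr ha, .inl (.inl rfl)⟩

theorem block_adj_right (h : t < t') (ht' : L.ends t' < L.N) {a c : V}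
    (ha : a ∈ L.between t t') (hc : c ∈ L.gateSet t') (e : H.Adj a c) :
    (L.block t t').Adj a (L.gate t') :=
  ⟨inCollapse_adj.2 (.inr (.inr ⟨gateSet_between ha, rfl, c, hc,
    .inl ⟨between_sub ha, gateSet_sub_beyond h ht' hc, e⟩⟩)), .inr ha, .inl (.inr rfl)⟩

theorem block_reach_down (h : t < t') (ht' : L.ends t' < L.N) {c : V} (hc : c ∈ L.C) {i : ℕ}
    (hi : L.ends t < i) (hi' : i ≤ L.lay c) (hc' : L.lay c < L.jump t') :
    (L.block t t').Reach c (L.r i) := by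
  refine (L.reach_down hc hi').mono ?_
  rintro a b ⟨e, ⟨ha, hb, h1⟩, h2, h3⟩
  have h4 : L.lay b ≤ L.lay a := by rcases h1 with h | h <;> omega
  exact block_adj h ht' (.inr (.inr (.inl ⟨ha, by omega, by omega⟩)))
    (.inl ⟨hb, by omega, by omega⟩) e

/-- The descent to the root of layer `ends t + 1` is followed by one more edge, whose end in layer
`ends t` belongs to `gateSet t` and hence has been contracted to `gate t`. -/
theorem block_reach_left (h : t < t') (ht' : L.ends t' < L.N) {c : V} (hc : c ∈ L.C)
    (hi : L.ends t < L.lay c) (hc' : L.lay c < L.jump t') :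
    (L.block t t').Reach c (L.gate t) := by
  have hN : L.ends t < L.N := (L.ends_mono h.le).trans_lt ht'
  have h1 := block_reach_down h ht' hc (Nat.lt_succ_self _) hi hc'
  obtain ⟨x, hx, hx', e, -⟩ := L.down _ hN
  have hr := L.r_mem (L.ends t + 1) hN
  exact h1.tail (block_adj_left h ht' (.inl ⟨hr.1, by rw [hr.2]; omega, by rw [hr.2]; omega⟩)
    ⟨hx, by rw [hx']; exact L.jump_le t, hx'.le⟩ e)

theorem block_reach_root (h : t + 1 < t') (ht' : L.ends t' < L.N) {i : ℕ} (hi : L.ends t < i)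
    (hi' : i < L.jump t') : (L.block t t').Reach (L.gate t') (L.r i) := by
  have hj : L.jump t' - 1 + 1 = L.jump t' := by omega
  have hjN := (L.jump_le t').trans_lt ht'
  obtain ⟨x, hx, hx', e, -⟩ := L.down (L.jump t' - 1) (by omega)
  rw [hj] at e
  refine .head (block_adj (by omega) ht' (.inr (.inl rfl)) (.inl ⟨hx, by omega, by omega⟩) e)
    (block_reach_down (by omega) ht' hx hi (by omega) (by omega))

theorem lands_top_jump (h : L.ends t < L.N) :
    H.Lands L.C L.lay (L.gate t) (L.ends (t + 1)) := by
  have := (L.lt_top_root ((L.jump_le t).trans_lt h)).2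
  rwa [L.top_jump] at this

/-- The path on which `v` lands, and its last vertex outside `C`. -/
theorem exists_reach_land {v : V} {j : ℕ} (h : H.Lands L.C L.lay v j) :
    ∃ w, ∃ c ∈ L.C, L.lay c = j ∧ H.Adj w c ∧
      (w = v ∨ (w ∈ H.verts ∧ w ∉ L.C ∧ L.Free v w ∧ H.Lands L.C L.lay w j)) ∧
      (H.sub fun a b => (a = v ∨ (a ∈ H.verts ∧ a ∉ L.C ∧ L.Free v a ∧ H.Lands L.C L.lay a j)) ∧
        (b ∈ H.verts ∧ b ∉ L.C ∧ L.Free v b ∧ H.Lands L.C L.lay b j)).Reach v w := by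
  obtain ⟨w, h1, c, hc, h2, h3⟩ := h
  refine ⟨w, c, hc, h3, h2, ?_, ?_⟩
  · rcases ReflTransGen.cases_tail h1 with h | ⟨x, -, hx⟩
    · exact .inl h
    · exact .inr ⟨H.right_mem hx.1, hx.2, h1, w, .refl, c, hc, h2, h3⟩
  · suffices key : ∀ x, ReflTransGen (H.FreeStep L.C) x w → L.Free v x → (x = v ∨ x ∉ L.C) →
        (H.sub fun a b => (a = v ∨ (a ∈ H.verts ∧ a ∉ L.C ∧ L.Free v a ∧ H.Lands L.C L.lay a j)) ∧
        (b ∈ H.verts ∧ b ∉ L.C ∧ L.Free v b ∧ H.Lands L.C L.lay b j)).Reach x w from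
      key v h1 .refl (.inl rfl)
    intro x hx
    induction hx using ReflTransGen.head_induction_on with
    | refl => exact fun _ _ => .refl _
    | @head a b e r ih =>
      intro h4 h5
      have hb : L.Free v b := ReflTransGen.tail h4 e
      exact .head ⟨e.1, h5.imp id fun h => ⟨H.left_mem e.1, h, h4, w, .head e r, c, hc, h2, h3⟩,
        H.right_mem e.1, e.2, hb, w, r, c, hc, h2, h3⟩ (ih hb (.inr e.2))

/-- The path on which `v` lands is in the block. -/
theorem block_reach_land (h : t < t') (ht' : L.ends t' < L.N) {v : V} {j : ℕ}
    (hv : v = L.gate t ∨ v ∈ L.between t t') (hl : H.Lands L.C L.lay v j) (hj : L.ends t < j)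
    (htop : L.top v ≤ L.ends t') :
    ∃ w, ∃ c ∈ L.C, L.lay c = j ∧ H.Adj w c ∧ (w = v ∨ w ∈ L.between t t') ∧
      (L.block t t').Reach v w := by
  obtain ⟨w, c, hc, h1, h2, h3, h4⟩ := exists_reach_land hl
  have key : ∀ b, (b ∈ H.verts ∧ b ∉ L.C ∧ L.Free v b ∧ H.Lands L.C L.lay b j) →
      b ∈ L.between t t' := fun b hb =>
    .inr ⟨hb.1, hb.2.1, hj.trans_le (L.le_top hb.2.2.2), (L.top_le_top hb.2.2.1).trans htop⟩
  refine ⟨w, c, hc, h1, h2, h3.imp id (key w), h4.mono ?_⟩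
  rintro a b ⟨e, ha, hb⟩
  refine block_adj h ht' ?_ (key b hb) e
  rcases ha with rfl | ha
  · exact hv.imp id .inr
  · exact .inr (.inr (key a ha))

/-- One climbs from gate to gate: `gate m` lands in layer `ends (m + 1)`, and from there one
descends to layer `jump (m + 1)`, whose root is the next gate. The last landing is in `gateSet t'`,
which has been contracted. -/
theorem block_reach_gate (h : t + 1 < t') (ht' : L.ends t' < L.N) :
    (L.block t t').Reach (L.gate t) (L.gate t') := by
  have htt : t < t' := by omega
  have key : ∀ d m, m + 1 + d = t' → t ≤ m → (L.block t t').Reach (L.gate m) (L.gate t') := by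
    intro d
    induction d with
    | zero =>
      intro m hm htm
      obtain rfl : m + 1 = t' := hm
      have hm' : L.ends m < L.N := (L.ends_mono (Nat.le_succ m)).trans_lt ht'
      have h1 := L.lt_jump_of_lt (show t < m by omega) hm'
      have h2 := L.lt_jump_of_lt (show m < m + 1 by omega) ht'
      have h3 := L.jump_le m
      have hg : L.gate m ∈ L.between t (m + 1) :=
        .inl ⟨(L.gate_mem m).1, by rw [(L.gate_mem m).2]; exact h1, by rw [(L.gate_mem m).2]; omega⟩
      obtain ⟨w, c, hc, hl, e, hw, r⟩ := block_reach_land htt ht' (.inr hg) (lands_top_jump hm')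
        (L.ends_lt_of_lt htt (by have := L.ends_mono htt.le; omega)) (L.top_jump m).le
      have hw' : w ∈ L.between t (m + 1) := hw.elim (fun h => h ▸ hg) id
      exact r.tail (block_adj_right htt ht' hw' ⟨hc, by rw [hl]; exact L.jump_le _, hl.le⟩ e)
    | succ d ih =>
      intro m hm htm
      have hm1 : L.ends (m + 1) < L.N := (L.ends_mono (by omega)).trans_lt ht'
      have hm' : L.ends m < L.N := (L.ends_mono (Nat.le_succ m)).trans_lt hm1
      have h2 := L.lt_jump_of_lt (show m + 1 < t' by omega) ht'
      have h3 := L.jump_le m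
      have h4 := L.ends_lt_of_lt (show t < m + 1 by omega) (by have := L.ends_mono htm; omega)
      have hg : L.gate m = L.gate t ∨ L.gate m ∈ L.between t t' := by
        rcases htm.eq_or_lt with rfl | htm
        · exact .inl rfl
        · have h1 := L.lt_jump_of_lt htm hm'
          have h5 := L.ends_le_succ m
          exact .inr (.inl ⟨(L.gate_mem m).1, by rw [(L.gate_mem m).2]; exact h1,
            by rw [(L.gate_mem m).2]; omega⟩)
      obtain ⟨w, c, hc, hl, e, hw, r⟩ := block_reach_land htt ht' hg (lands_top_jump hm')
        h4 ((L.top_jump m).trans_le (L.ends_mono (by omega)))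
      have hw' : w = L.gate t ∨ w = L.gate t' ∨ w ∈ L.between t t' := by
        rcases hw with rfl | hw
        · exact hg.imp id .inr
        · exact .inr (.inr hw)
      have hcb : c ∈ L.between t t' := .inl ⟨hc, by omega, by omega⟩
      refine (r.tail (block_adj htt ht' hw' hcb e)).trans (.trans ?_ (ih (m + 1) (by omega) (by omega)))
      exact block_reach_down htt ht' hc (L.lt_jump_of_lt (by omega) hm1)
        ((L.jump_le _).trans hl.ge) (by omega)
  obtain ⟨d, hd⟩ := Nat.exists_eq_add_of_lt htt
  exact key d t (by omega) le_rfl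

theorem block_reach_gate_back (h : t + 1 < t') (ht' : L.ends t' < L.N) :
    (L.block t t').Reach (L.gate t') (L.gate t) := by
  have htt : t < t' := by omega
  have hN : L.ends t < L.N := (L.ends_mono htt.le).trans_lt ht'
  have h1 := L.lt_jump_of_lt h ht'
  have h2 := L.ends_lt hN
  have hr := L.r_mem (L.ends t + 1) hN
  exact (block_reach_root h ht' (Nat.lt_succ_self _) (by omega)).trans
    (block_reach_left htt ht' hr.1 (by rw [hr.2]; omega) (by rw [hr.2]; omega))

/-- As `l ≤ ends (t + 1)`, the root of layer `l` lands at most in `ends (t + 2)`, and so does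
everything it freely reaches. Since `t + 2 < t'`, this is below layer `jump t'`, so the paths to and
from the loss remain inside the block. -/
theorem block_reach_loss (h : t + 2 < t') (ht' : L.ends t' < L.N) {l : ℕ} (hl : l ∈ L.I)
    (hlt : L.ends t < l) (hlt' : l ≤ L.ends (t + 1)) :
    L.u l ∈ L.between t t' ∧ (L.block t t').Reach (L.gate t') (L.u l) ∧
      (L.block t t').Reach (L.u l) (L.gate t) := by
  have htt : t < t' := by omega
  have h1 := L.lt_jump_of_lt h ht'
  have h2 : L.ends (t + 1) < L.ends (t + 2) :=
    L.ends_lt (L.ends_mono (show t + 1 ≤ t' by omega) |>.trans_lt ht')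
  have h3 := L.ends_mono h.le
  obtain ⟨-, huH, hlay⟩ := L.loss l hl
  by_cases hC : L.u l ∈ L.C
  · refine ⟨.inl ⟨hC, by omega, by omega⟩, ?_, block_reach_left htt ht' hC (by omega) (by omega)⟩
    refine (block_reach_root (by omega) ht' (i := l + 1) (by omega) (by omega)).trans
      ((L.reach_loss hl hC).mono ?_)
    rintro a b ⟨e, ⟨ha, hb, h5⟩, h6, h7⟩
    have h4 : L.lay b ≤ L.lay a := by rcases h5 with h | h <;> omega
    exact block_adj htt ht' (.inr (.inr (.inl ⟨ha, by omega, by omega⟩)))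
      (.inl ⟨hb, by omega, by omega⟩) e
  · have h4 := L.lay_le_top huH hC
    rw [hlay] at h4
    have h5 := L.reach_up huH hC
    rw [hlay] at h5
    have hr := L.r_mem l (by have := L.ends_le (t + 1); omega)
    have htop : L.top (L.r l) ≤ L.ends (t + 2) := L.top_le_ends hlt'
    have h6 := h5.closed (S := {x | L.Free (L.r l) x}) ReflTransGen.refl
      fun a b ha e => ReflTransGen.tail ha ⟨e.1, e.2.1⟩
    have h7 : L.top (L.u l) ≤ L.top (L.r l) := L.top_le_top h6.1
    have hu : L.u l ∈ L.between t t' := .inr ⟨huH, hC, by omega, by omega⟩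
    have hB : ∀ x ∈ H.verts, x ∉ L.C → L.Free (L.r l) x → L.Free x (L.u l) → x ∈ L.between t t' := by
      intro x hx hxC i1 i2
      have i3 := L.top_le_top i1
      have i4 := L.top_le_top i2
      exact .inr ⟨hx, hxC, by omega, by omega⟩
    refine ⟨hu, (block_reach_root (by omega) ht' hlt (by omega)).trans (h6.2.mono ?_), ?_⟩
    · rintro a b ⟨⟨e, e1, e2, e3, e4⟩, ha, hb⟩
      refine block_adj htt ht' (.inr (.inr ?_)) (hB b (H.right_mem e) e1 hb e3) e
      rcases e4 with rfl | e4
      · exact .inl ⟨hr.1, by omega, by omega⟩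
      · exact hB a (H.left_mem e) e4.1 ha e4.2.2
    · obtain ⟨w, c, hc, hl', e, hw, r⟩ := block_reach_land htt ht' (.inr hu) h4.2 (by omega)
        (by omega)
      have hw' : w ∈ L.between t t' := hw.elim (fun h => h ▸ hu) id
      exact (r.tail (block_adj htt ht' (.inr (.inr hw')) (.inl ⟨hc, by omega, by omega⟩) e)).trans
        (block_reach_left htt ht' hc (by omega) (by omega))

theorem block_finite (hfin : H.verts.Finite) (h : t < t') (ht' : L.ends t' < L.N) :
    (L.block t t').verts.Finite :=
  hfin.subset ((block_verts_sub h ht').trans (L.rest_verts_sub t))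

theorem gate_ne (h : t < t') (ht' : L.ends t' < L.N) : L.gate t ≠ L.gate t' := fun h' =>
  L.gate_notMem_rest h ht' (h' ▸ .inl rfl)

/-- A block contains a tripod with a vertex of `U`. -/
theorem block_tripod (hfin : H.verts.Finite) (hloop : H.Loopless) (h : t + 2 < t')
    (ht' : L.ends t' < L.N) {l : ℕ} (hl : l ∈ L.I) (hlt : L.ends t < l)
    (hlt' : l ≤ L.ends (t + 1)) :
    ∃ K, Red {L.gate t, L.gate t', L.u l} (L.block t t') K ∧
      IsTripod K (L.gate t) (L.gate t') (L.u l) := by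
  have htt : t < t' := by omega
  obtain ⟨h1, h2, h3⟩ := block_reach_loss h ht' hl hlt hlt'
  refine tripod_red (block_finite hfin htt ht') (block_loopless hloop) (gate_ne htt ht') ?_ ?_
    (block_reach_gate (by omega) ht') h2 h3
  · intro h'
    exact between_notMem h1 (h' ▸ .inl rfl)
  · intro h'
    exact L.notMem_beyond (le_refl t) (L.gate_mem_gateSet t) (h' ▸ between_sub h1)

/-- A block contains a bidirected path. -/
theorem block_path (hfin : H.verts.Finite) (hloop : H.Loopless) (h : t + 1 < t')
    (ht' : L.ends t' < L.N) :
    ∃ c l, (L.gate t :: c :: l).Nodup ∧ legEnd (L.gate t, c :: l) = L.gate t' ∧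
      Red {L.gate t, L.gate t'} (L.block t t') (bip (L.gate t :: c :: l)) := by
  have htt : t < t' := by omega
  have hne := gate_ne htt ht'
  obtain ⟨x, hx, -, hx'⟩ := (block_reach_gate h ht').last_visit hne.symm
  obtain ⟨y, hy, -, hy'⟩ := (block_reach_gate_back h ht').first_visit hne.symm
  have hs : ({L.gate t, L.gate t} : Set V) = {L.gate t} := by simp
  obtain ⟨c, l, i1, i2, i3, i4⟩ := pairLeg (block_finite hfin htt ht') (block_loopless hloop)
    hne.symm hne.symm ⟨x, hx, by rwa [hs]⟩ ⟨y, by rwa [hs], hy'⟩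
  refine ⟨c, l, List.nodup_cons.2 ⟨fun h => (i3 _ h).2.1 rfl, i1⟩, by simpa [legEnd] using i2,
    i4.mono ?_⟩
  rintro v ⟨hv, -⟩
  simp at hv ⊢
  tauto

end Ladder

/-! ### Combs composed of items -/

theorem sup_of_le {H K : VDigraph V} (h : H ≤ K) : H ⊔ K = K := by
  ext
  · exact ⟨fun h' => h'.elim (fun h' => h.1 h') id, .inr⟩
  · exact ⟨fun h' => h'.elim (h.2 _ _) id, .inr⟩

/-- The parts a comb is composed of along its path: a vertex, a vertex with a path attached to it, or
a directed triangle with a path attached to its third vertex, in one of the two orientations. -/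
inductive Item (V : Type*)
  | plain (v : V)
  | claw (w : V) (l : List V)
  | net (o : Bool) (x y z : V) (l : List V)

namespace Item

/-- The vertex that is incident with the previous item. -/
def inp : Item V → V
  | plain v => v
  | claw w _ => w
  | net _ x _ _ _ => x

/-- The vertex that is incident with the next item. -/
def out : Item V → V
  | plain v => v
  | claw w _ => w
  | net _ _ y _ _ => y

/-- The attached path, together with the vertex to which it is attached. -/
def stem : Item V → V × List V
  | plain v => (v, [])
  | claw w l => (w, l)
  | net _ _ _ z l => (z, l)

/-- The directed triangle. -/
def tri : Item V → VDigraph V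
  | plain v => single v
  | claw w _ => single w
  | net true x y z _ => edge x y ⊔ edge y z ⊔ edge z x
  | net false x y z _ => edge x z ⊔ edge z y ⊔ edge y x

/-- The graph of an item. -/
def body (X : Item V) : VDigraph V := bip (X.stem.1 :: X.stem.2) ⊔ X.tri

/-- The vertices of an item. -/
def vertices : Item V → List V
  | plain v => [v]
  | claw w l => w :: l
  | net _ x y z l => x :: y :: z :: l

/-- `true` for a `claw`. -/
def isClaw : Item V → Bool
  | claw _ _ => true
  | _ => false

/-- `true` for a `net`. -/
def isNet : Item V → Bool
  | net _ _ _ _ _ => true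
  | _ => false

theorem body_verts (X : Item V) : X.body.verts = {v | v ∈ X.vertices} := by
  ext v
  rcases X with v | ⟨w, l⟩ | ⟨_ | _, x, y, z, l⟩ <;>
    simp [body, stem, tri, vertices, single, edge]
  all_goals tauto

theorem inp_mem (X : Item V) : X.inp ∈ X.vertices := by
  cases X <;> simp [inp, vertices]

theorem out_mem (X : Item V) : X.out ∈ X.vertices := by
  cases X <;> simp [out, vertices]

theorem stem_sublist (X : Item V) : (X.stem.1 :: X.stem.2).Sublist X.vertices := by
  rcases X with v | ⟨w, l⟩ | ⟨o, x, y, z, l⟩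
  · exact .refl _
  · exact .refl _
  · exact .cons _ (.cons _ (.refl _))

end Item

open Item

/-- The comb composed of a list of items. -/
def combOf : List (Item V) → VDigraph V
  | [] => bip []
  | [X] => X.body
  | X :: Y :: L => X.body ⊔ (edge X.out Y.inp ⊔ edge Y.inp X.out) ⊔ combOf (Y :: L)

/-- The vertices of a comb. -/
def combVerts (L : List (Item V)) : List V := L.flatMap Item.vertices

@[simp] theorem combVerts_cons (X : Item V) (L : List (Item V)) :
    combVerts (X :: L) = X.vertices ++ combVerts L := rfl

@[simp] theorem combVerts_append (L L' : List (Item V)) :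
    combVerts (L ++ L') = combVerts L ++ combVerts L' := List.flatMap_append

@[simp] theorem combVerts_plain (l : List V) : combVerts (l.map plain) = l := by
  induction l with
  | nil => rfl
  | cons a l ih => simp [ih, vertices]

theorem combOf_verts (L : List (Item V)) : (combOf L).verts = {v | v ∈ combVerts L} := by
  induction L with
  | nil => simp [combOf, combVerts]
  | cons X L ih =>
    cases L with
    | nil => simp [combOf, combVerts, body_verts]
    | cons Y L =>
      rw [combOf, sup_verts, sup_verts, ih, body_verts]
      have h1 := X.out_mem
      have h2 := Y.inp_mem
      ext v
      simp only [sup_verts, edge, combVerts_cons, Set.mem_union, Set.mem_ofPred_eq,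
        List.mem_append, Set.mem_insert_iff, Set.mem_singleton_iff]
      constructor
      · rintro ((h | (rfl | rfl) | rfl | rfl) | h) <;> tauto
      · tauto

theorem combOf_adj {L : List (Item V)} {a b : V} : (combOf L).Adj a b ↔
    (∃ X ∈ L, X.tri.Adj a b) ∨ LegAdj (L.map stem) a b ∨
      ∃ i X Y, L[i]? = some X ∧ L[i + 1]? = some Y ∧
        ((a = X.out ∧ b = Y.inp) ∨ (b = X.out ∧ a = Y.inp)) := by
  induction L with
  | nil => simp [combOf, bip, LegAdj, legAt]
  | cons X L ih =>
    rw [List.map_cons, legAdj_cons]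
    cases L with
    | nil =>
      simp [combOf, LegAdj, legAt, body]
      tauto
    | cons Y L =>
      rw [combOf, sup_adj, sup_adj, ih, body]
      have : (∃ i X' Y', (X :: Y :: L)[i]? = some X' ∧ (X :: Y :: L)[i + 1]? = some Y' ∧
          ((a = X'.out ∧ b = Y'.inp) ∨ (b = X'.out ∧ a = Y'.inp))) ↔
          ((a = X.out ∧ b = Y.inp) ∨ (b = X.out ∧ a = Y.inp)) ∨
          ∃ i X' Y', (Y :: L)[i]? = some X' ∧ (Y :: L)[i + 1]? = some Y' ∧
          ((a = X'.out ∧ b = Y'.inp) ∨ (b = X'.out ∧ a = Y'.inp)) := by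
        constructor
        · rintro ⟨i, X', Y', h1, h2, h3⟩
          cases i with
          | zero =>
            obtain rfl : X = X' := by simpa using h1
            obtain rfl : Y = Y' := by simpa using h2
            exact .inl h3
          | succ i => exact .inr ⟨i, X', Y', by simpa using h1, by simpa using h2, h3⟩
        · rintro (h | ⟨i, X', Y', h1, h2, h3⟩)
          · exact ⟨0, X, Y, by simp, by simp, h⟩
          · exact ⟨i + 1, X', Y', by simpa using h1, by simpa using h2, h3⟩
      rw [this]
      have hm : (∃ Z ∈ X :: Y :: L, Z.tri.Adj a b) ↔ X.tri.Adj a b ∨ ∃ Z ∈ Y :: L, Z.tri.Adj a b :=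
        List.exists_mem_cons_iff _ _ _
      rw [hm]
      have h : (edge X.out Y.inp ⊔ edge Y.inp X.out).Adj a b ↔
          ((a = X.out ∧ b = Y.inp) ∨ (b = X.out ∧ a = Y.inp)) :=
        or_congr Iff.rfl and_comm
      rw [h, sup_adj]
      exact iff_of_eq (by ac_rfl)

/-- The first item is joined to the rest only at `out`, so it can be split off and this vertex left
in its place. This is how a tripod is glued to a comb that starts at a gate. -/
theorem combOf_replace {X : Item V} {v : V} (L : List (Item V)) (h : X.out = v) :
    combOf (X :: L) = X.body ⊔ combOf (plain v :: L) := by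
  subst h
  have h1 : single X.out ≤ X.body := single_le.2 (by rw [body_verts]; exact X.out_mem)
  have h2 : (plain X.out).body = single X.out := sup_of_le (le_refl' _)
  cases L with
  | nil => rw [combOf, combOf, h2, sup_comm', sup_of_le h1]
  | cons Y L =>
    rw [combOf, combOf, h2, sup_assoc' (single _), ← sup_assoc' X.body (single _),
      sup_comm' X.body (single _), sup_of_le h1, sup_assoc']
    rfl

theorem bip_sup_combOf (m : List V) (Y : Item V) (L : List (Item V)) :
    bip (m ++ [Y.inp]) ⊔ combOf (Y :: L) = combOf (m.map plain ++ Y :: L) := by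
  induction m with
  | nil =>
    refine sup_of_le (single_le.2 ?_)
    rw [combOf_verts]
    simp [Y.inp_mem]
  | cons a m ih =>
    have key : ∀ (Z : Item V) (L' : List (Item V)) (l : List V), Z.inp = l.head?.getD Z.inp →
        bip l ⊔ combOf (Y :: L) = combOf (Z :: L') → l ≠ [] →
        bip (a :: l) ⊔ combOf (Y :: L) = combOf (plain a :: Z :: L') := by
      intro Z L' l hZ h hl
      obtain ⟨b, l, rfl⟩ := List.exists_cons_of_ne_nil hl
      obtain rfl : Z.inp = b := by simpa using hZ
      rw [bip_cons_cons, sup_assoc', h]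
      have h' : single a ⊔ (edge a Z.inp ⊔ edge Z.inp a) = edge a Z.inp ⊔ edge Z.inp a :=
        sup_of_le (single_le.2 (Or.inl (Or.inl rfl)))
      rw [combOf, show (plain a).body = single a from sup_of_le (le_refl' _), ← h']
      rfl
    cases m with
    | nil => exact key Y L [Y.inp] (by simp) ih (by simp)
    | cons b m => exact key (plain b) _ (b :: m ++ [Y.inp]) (by simp [inp]) ih (by simp)

theorem bip_sup_combOf_plain (w : V) (l : List V) (L : List (Item V)) :
    bip (w :: l) ⊔ combOf (plain (legEnd (w, l)) :: L) = combOf ((w :: l).map plain ++ L) := by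
  obtain ⟨m, hm⟩ : ∃ m, w :: l = m ++ [legEnd (w, l)] :=
    ⟨_, (List.dropLast_append_getLast (l := w :: l) (by simp)).symm⟩
  rw [hm]
  generalize legEnd (w, l) = v
  have := bip_sup_combOf m (plain v) L
  rw [inp] at this
  rw [this, List.map_append, List.append_assoc]
  rfl

theorem bip_reverse (l : List V) : bip l.reverse = bip l := by
  ext a b
  · simp
  · suffices h : ∀ (l : List V) a b, (bip l).Adj a b → (bip l.reverse).Adj a b from
      ⟨fun e => l.reverse_reverse ▸ h _ _ _ e, h _ _ _⟩
    intro l a b e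
    induction l with
    | nil => exact e
    | cons x l ih =>
      cases l with
      | nil => exact e
      | cons y l =>
        rw [List.reverse_cons, List.reverse_cons, List.append_assoc, List.singleton_append,
          bip_append]
        rw [bip_cons_cons] at e
        rcases e with (e | e) | e
        · exact .inr (.inl (.inr e))
        · exact .inr (.inl (.inl e))
        · rw [← List.reverse_cons]
          exact .inl (ih e)

/-- A tripod extends a comb. -/
theorem IsTripod.sup_combOf {K : VDigraph V} {a b u : V} (h : IsTripod K a b u) :
    ∃ (m : List V) (X : Item V) (m' : List V), (X.isClaw = true ∨ X.isNet = true) ∧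
      ((m.map plain ++ [X]).head (by simp)).inp = a ∧ legEnd X.stem = u ∧
      (combVerts (m.map plain ++ X :: m'.map plain)).Nodup ∧
      (∀ v, v ∈ combVerts (m.map plain ++ X :: m'.map plain) ↔ v ∈ K.verts) ∧
      ∀ L, K ⊔ combOf (plain b :: L) = combOf (m.map plain ++ X :: m'.map plain ++ L) := by
  have hrev : ∀ (x : V) (l : List V) (X : Item V), X.inp = x →
      ((l.reverse.map plain ++ [X]).head (by simp)).inp = legEnd (x, l) := by
    rintro x l X rfl
    induction l using List.reverseRecOn with
    | nil => rfl
    | append_singleton l y _ => simp [legEnd, inp]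
  have hbip : ∀ (x : V) (l : List V), bip (x :: l) = bip (l.reverse ++ [x]) := by
    intro x l
    rw [← List.reverse_cons, bip_reverse]
  have key : ∀ (x y : V) (X : Item V) (la lb : List V) (L : List (Item V)), X.inp = x → X.out = y →
      legEnd (y, lb) = b → bip (x :: la) ⊔ X.body ⊔ bip (y :: lb) ⊔ combOf (plain b :: L) =
        combOf (la.reverse.map plain ++ X :: lb.map plain ++ L) := by
    rintro x y X la lb L rfl rfl rfl
    rw [sup_assoc', bip_sup_combOf_plain, sup_assoc', List.map_cons, List.cons_append,
      ← combOf_replace _ rfl, hbip, bip_sup_combOf, List.append_assoc, List.cons_append]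
  have hperm : ∀ (X : Item V) (la lb : List V),
      (combVerts (la.reverse.map plain ++ X :: lb.map plain)).Perm (la ++ (X.vertices ++ lb)) := by
    intro X la lb
    rw [combVerts_append, combVerts_cons, combVerts_plain, combVerts_plain]
    exact (List.reverse_perm la).append (.refl _)
  -- A tripod is an item together with a bidirected path from its `inp` to `a` and one from its
  -- `out` to `b`. The first path is traversed towards the item, so its vertices are listed in
  -- reverse.
  have main : ∀ (X : Item V) (la lb : List V), (X.isClaw = true ∨ X.isNet = true) →
      legEnd (X.inp, la) = a → legEnd (X.out, lb) = b → legEnd X.stem = u →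
      (la ++ (X.vertices ++ lb)).Nodup →
      K = bip (X.inp :: la) ⊔ X.body ⊔ bip (X.out :: lb) →
      ∃ (m : List V) (X : Item V) (m' : List V), (X.isClaw = true ∨ X.isNet = true) ∧
        ((m.map plain ++ [X]).head (by simp)).inp = a ∧ legEnd X.stem = u ∧
        (combVerts (m.map plain ++ X :: m'.map plain)).Nodup ∧
        (∀ v, v ∈ combVerts (m.map plain ++ X :: m'.map plain) ↔ v ∈ K.verts) ∧
        ∀ L, K ⊔ combOf (plain b :: L) = combOf (m.map plain ++ X :: m'.map plain ++ L) := by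
    intro X la lb h1 h2 h3 h4 h5 h6
    refine ⟨la.reverse, X, lb, h1, (hrev _ _ _ rfl).trans h2, h4, (hperm _ _ _).nodup_iff.2 h5, ?_, ?_⟩
    · intro v
      have hi := X.inp_mem
      have ho := X.out_mem
      rw [(hperm _ _ _).mem_iff, h6]
      simp only [sup_verts, bip_verts, body_verts, List.mem_append, Set.mem_union,
        Set.mem_ofPred_eq, List.mem_cons]
      constructor
      · tauto
      · rintro (((rfl | h) | h) | (rfl | h)) <;> tauto
    · intro L
      rw [h6]
      exact key _ _ _ _ _ _ rfl rfl h3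
  rcases h with ⟨w, la, lb, lu, h1, h2, h3, h4, rfl⟩ | ⟨x, la, y, lb, z, lu, h1, h2, h3, h4, rfl⟩ |
    ⟨x, la, z, lu, y, lb, h1, h2, h4, h3, rfl⟩
  · refine main (claw w lu) la lb (.inl rfl) h2 h3 h4 ?_ ?_
    · refine (List.Perm.nodup_iff ?_).1 h1
      refine .trans ?_ List.perm_middle.symm
      refine .cons _ ?_
      rw [List.append_assoc]
      exact .append_left _ List.perm_append_comm
    · have : (claw w lu).body = bip (w :: lu) := by
        rw [body, sup_comm']
        exact sup_of_le (single_le.2 (by simp [stem]))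
      rw [this, sup_right_comm']
      rfl
  · refine main (net true x y z lu) la lb (.inr rfl) h2 h3 h4 ?_ ?_
    · refine (List.Perm.nodup_iff ?_).1 h1
      refine .trans ?_ List.perm_middle.symm
      refine .cons _ (.append_left _ (.cons _ ?_))
      exact List.perm_append_comm (l₁ := lb)
    · rw [body, stem, tri, inp, out]
      ext <;> simp only [sup_verts, sup_adj, Set.mem_union] <;> tauto
  · refine main (net false x y z lu) la lb (.inr rfl) h2 h3 h4 ?_ ?_
    · refine (List.Perm.nodup_iff ?_).1 h1
      refine .trans ?_ List.perm_middle.symm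
      refine .cons _ (.append_left _ ?_)
      exact List.perm_middle (l₁ := z :: lu)
    · rw [body, stem, tri, inp, out]
      ext <;> simp only [sup_verts, sup_adj, Set.mem_union] <;> tauto

/-- A reduction of `G` to a comb that starts at `q`, ends with a vertex, and has its teeth in
`U`. -/
structure IsComb (G : VDigraph V) (q : V) (U : Set V) (L : List (Item V)) : Prop where
  last : ∃ L₀ v, L = L₀ ++ [plain v]
  head : L.head?.map inp = some q
  red : Red {q} G (combOf L)
  nodup : (combVerts L).Nodup
  tip : ∀ X ∈ L, X.isClaw = true ∨ X.isNet = true → legEnd X.stem ∈ U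

/-- Many claws and no nets, or many nets and no claws. -/
def Item.Uniform (k₁ k₂ : ℕ) (C : List (Item V)) : Prop :=
  (k₁ ≤ C.countP isClaw ∧ ∀ X ∈ C, X.isNet = false) ∨
    (k₂ ≤ C.countP isNet ∧ ∀ X ∈ C, X.isClaw = false)

theorem Item.Uniform.plain_append {k₁ k₂ : ℕ} {C : List (Item V)}
    (h : Uniform k₁ k₂ C) (m : List V) : Uniform k₁ k₂ (m.map plain ++ C) := by
  induction m with
  | nil => exact h
  | cons a m ih =>
    rcases ih with ⟨h1, h2⟩ | ⟨h1, h2⟩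
    · refine .inl ⟨by simpa [isClaw] using h1, fun X hX => ?_⟩
      rcases List.mem_cons.1 hX with rfl | hX
      exacts [rfl, h2 X hX]
    · refine .inr ⟨by simpa [isNet] using h1, fun X hX => ?_⟩
      rcases List.mem_cons.1 hX with rfl | hX
      exacts [rfl, h2 X hX]

/-! ### Combs with many tripods of one kind -/

namespace Ladder

variable {H : VDigraph V} {U : Set V} {L : Ladder H U}

theorem isComb_gate (t : ℕ) : IsComb (L.rest t) (L.gate t) U [plain (L.gate t)] where
  last := ⟨[], _, rfl⟩
  head := rfl
  red := .of_le (by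
    rw [show combOf [plain (L.gate t)] = single (L.gate t) from sup_of_le (le_refl' _)]
    exact single_le.2 (.inl rfl))
  nodup := by simp [combVerts, vertices]
  tip X hX h := by
    obtain rfl : X = plain (L.gate t) := by simpa using hX
    simp [isClaw, isNet] at h

/-- A block can always be bridged without a tooth. This connects tripods with each other and skips
tripods of the unwanted kind. -/
theorem exists_isComb_path (hfin : H.verts.Finite) (hloop : H.Loopless) {t t' : ℕ} (h : t + 1 < t')
    (ht' : L.ends t' < L.N) {C : List (Item V)} (hC : IsComb (L.rest t') (L.gate t') U C) :
    ∃ m : List V, IsComb (L.rest t) (L.gate t) U (plain (L.gate t) :: (m.map plain ++ C)) := by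
  obtain ⟨c, l, hnd, hend, hred⟩ := block_path (L := L) hfin hloop h ht'
  obtain ⟨m, hm⟩ : ∃ m, c :: l = m ++ [L.gate t'] :=
    ⟨_, by
      rw [← hend, legEnd, List.getLast_cons (by simp)]
      exact (List.dropLast_append_getLast (l := c :: l) (by simp)).symm⟩
  rw [hm] at hnd hred
  obtain ⟨Y, C, rfl⟩ := List.exists_cons_of_ne_nil (show C ≠ [] by
    rintro rfl; simpa using hC.head)
  obtain ⟨⟨C₀, v, hlast⟩, hhead, hr, hn, htip⟩ := hC
  have hY : Y.inp = L.gate t' := by simpa using hhead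
  refine ⟨m, ⟨plain (L.gate t) :: (m.map plain ++ C₀), v, by simp [hlast]⟩, rfl, ?_, ?_, ?_⟩
  · have := red_rest_step hfin hloop (by omega) ht' hred hr
    rw [← hY, ← List.cons_append, bip_sup_combOf] at this
    simpa using this
  · have h1 : (combVerts (plain (L.gate t) :: (m.map plain ++ Y :: C))) =
        (L.gate t :: m) ++ combVerts (Y :: C) := by simp [vertices]
    rw [h1]
    rw [← List.cons_append] at hnd
    refine (List.Nodup.of_append_left hnd).append hn fun v hv hv' => ?_
    have h2 : v ∈ (L.block t t').verts := hred.verts (by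
      simp only [bip_verts, Set.mem_ofPred_eq, ← List.cons_append]
      exact List.mem_append_left _ hv)
    have h3 : v ∈ (L.rest t').verts := hr.verts (by rw [combOf_verts]; exact hv')
    obtain rfl := block_inter_rest (by omega) ht' h2 h3
    exact (List.nodup_append.1 hnd).2.2 _ hv _ (by simp) rfl
  · intro X hX h
    rcases List.mem_cons.1 hX with rfl | hX
    · simp [isClaw, isNet] at h
    rcases List.mem_append.1 hX with hX | hX
    · obtain ⟨w, -, rfl⟩ := List.mem_map.1 hX
      simp [isClaw, isNet] at h
    · exact htip X hX h

/-- The item `X` depends only on the block and not on the comb beyond it, so its kind is known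
before that comb is constructed. The condition `C ≠ []` ensures that the comb still ends with a
plain vertex when its first one is absorbed by the tripod. -/
theorem exists_isComb_tripod (hfin : H.verts.Finite) (hloop : H.Loopless) {t t' : ℕ}
    (h : t + 2 < t') (ht' : L.ends t' < L.N) {l : ℕ} (hl : l ∈ L.I) (hlt : L.ends t < l)
    (hlt' : l ≤ L.ends (t + 1)) :
    ∃ (m : List V) (X : Item V) (m' : List V), (X.isClaw = true ∨ X.isNet = true) ∧
      ∀ C, IsComb (L.rest t') (L.gate t') U (plain (L.gate t') :: C) → C ≠ [] →
        IsComb (L.rest t) (L.gate t) U (m.map plain ++ X :: m'.map plain ++ C) := by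
  obtain ⟨K, hK, htri⟩ := block_tripod (L := L) hfin hloop h ht' hl hlt hlt'
  obtain ⟨m, X, m', h1, h2, h3, h4, h5, h6⟩ := htri.sup_combOf
  refine ⟨m, X, m', h1, fun C hC hne => ?_⟩
  obtain ⟨⟨C₀, v, hlast⟩, hhead, hr, hn, htip⟩ := hC
  refine ⟨?_, ?_, ?_, ?_, ?_⟩
  · cases C₀ with
    | nil => simp at hlast; exact absurd hlast.2 hne
    | cons Y C₀ =>
      have : C = C₀ ++ [plain v] := by simpa using (List.cons.inj hlast).2
      exact ⟨m.map plain ++ X :: m'.map plain ++ C₀, v, by simp [this]⟩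
  · rw [← h2]
    cases m <;> simp
  · rw [← h6]
    refine red_rest_step hfin hloop (by omega) ht' (hK.mono ?_) hr
    rintro x ⟨rfl | rfl, -⟩
    · exact .inl rfl
    · exact .inr (.inl rfl)
  · rw [combVerts_append]
    have h7 : (L.gate t' :: combVerts C).Nodup := hn
    refine h4.append h7.of_cons fun v hv hv' => ?_
    have h8 := hK.verts ((h5 v).1 hv)
    have h9 : v ∈ (L.rest t').verts := hr.verts (by
      rw [combOf_verts]; exact List.mem_cons_of_mem _ hv')
    obtain rfl := block_inter_rest (by omega) ht' h8 h9
    exact (List.nodup_cons.1 h7).1 hv'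
  · intro Y hY h
    rcases List.mem_append.1 hY with hY | hY
    · rcases List.mem_append.1 hY with hY | hY
      · obtain ⟨w, -, rfl⟩ := List.mem_map.1 hY
        simp [isClaw, isNet] at h
      · rcases List.mem_cons.1 hY with rfl | hY
        · rw [h3]
          exact (L.loss l hl).1
        · obtain ⟨w, -, rfl⟩ := List.mem_map.1 hY
          simp [isClaw, isNet] at h
    · exact htip Y (List.mem_cons_of_mem _ hY) h

/-- Induction on `d`. First the kind of the tripod at position `i` is determined, then a comb is
constructed beyond it with the demand for this kind lowered by one. If that comb is of the same
kind, the tripod is added. Otherwise it already has enough tripods of the other kind, and the block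
is bridged by a path. A gap of 6 has room for a tripod block of length 3 followed by a path block,
which needs length at least 2. -/
theorem exists_isComb_uniform (hfin : H.verts.Finite) (hloop : H.Loopless) (s : ℕ → ℕ) (m : ℕ)
    (hs : ∀ i < m, s i + 6 ≤ s (i + 1)) (hN : L.ends (s m) < L.N)
    (hl : ∀ i < m, ∃ l ∈ L.I, L.ends (s i) < l ∧ l ≤ L.ends (s i + 1)) (d : ℕ) :
    ∀ i k₁ k₂, k₁ + k₂ = d → i + d ≤ m →
      ∃ C, IsComb (L.rest (s i)) (L.gate (s i)) U C ∧ Uniform k₁ k₂ C := by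
  have hmono : ∀ d i, i + d = m → s i ≤ s m := by
    intro d
    induction d with
    | zero => rintro i rfl; rfl
    | succ d ih =>
      intro i hi
      have h1 := hs i (by omega)
      have h2 := ih (i + 1) (by omega)
      omega
  induction d with
  | zero =>
    intro i k₁ k₂ hk hi
    refine ⟨_, isComb_gate _, .inl ⟨by omega, ?_⟩⟩
    simp [isNet]
  | succ d ih =>
    intro i k₁ k₂ hk hi
    by_cases h1 : k₁ = 0
    · exact ⟨_, isComb_gate _, .inl ⟨by omega, by simp [isNet]⟩⟩
    by_cases h2 : k₂ = 0
    · exact ⟨_, isComb_gate _, .inr ⟨by omega, by simp [isClaw]⟩⟩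
    obtain ⟨l, hl1, hl2, hl3⟩ := hl i (by omega)
    have hsi := hs i (by omega)
    have hN1 : L.ends (s (i + 1)) < L.N := by
      obtain ⟨e, he⟩ := Nat.exists_eq_add_of_le (show i + 1 ≤ m by omega)
      exact (L.ends_mono (hmono e (i + 1) he.symm)).trans_lt hN
    have hN2 : L.ends (s i + 3) < L.N := (L.ends_mono (by omega)).trans_lt hN1
    obtain ⟨p, X, p', hX, hcomb⟩ := exists_isComb_tripod hfin hloop (show s i + 2 < s i + 3 by omega)
      hN2 hl1 hl2 hl3
    have hpath : ∀ C, IsComb (L.rest (s (i + 1))) (L.gate (s (i + 1))) U C →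
        ∃ q : List V, IsComb (L.rest (s i)) (L.gate (s i)) U (plain (L.gate (s i)) :: q.map plain ++ C) :=
      fun C hC => exists_isComb_path hfin hloop (by omega) hN1 hC
    have htri : ∀ C, IsComb (L.rest (s (i + 1))) (L.gate (s (i + 1))) U C → ∃ q : List V,
        IsComb (L.rest (s i)) (L.gate (s i)) U
          (p.map plain ++ X :: (p'.map plain ++ (q.map plain ++ C))) := by
      intro C hC
      obtain ⟨q, hq⟩ := exists_isComb_path hfin hloop (show s i + 3 + 1 < s (i + 1) by omega) hN1 hC
      refine ⟨q, ?_⟩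
      have := hcomb _ hq (by
        intro h
        obtain ⟨C₀, v, rfl⟩ := hC.last
        simp at h)
      rwa [List.append_assoc, List.cons_append] at this
    rcases hX with hX | hX
    · obtain ⟨C, hC, ⟨h3, h4⟩ | hU⟩ := ih (i + 1) (k₁ - 1) k₂ (by omega) (by omega)
      · obtain ⟨q, hq⟩ := htri C hC
        refine ⟨_, hq, Uniform.plain_append (.inl ⟨?_, ?_⟩) p⟩
        · simp only [List.countP_cons, List.countP_append, hX]
          simp only [if_true]
          omega
        · intro Y hY
          simp only [List.mem_cons, List.mem_append, List.mem_map] at hY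
          rcases hY with rfl | ⟨v, -, rfl⟩ | ⟨v, -, rfl⟩ | hY
          · cases Y <;> simp_all [isClaw, isNet]
          · rfl
          · rfl
          · exact h4 Y hY
      · obtain ⟨q, hq⟩ := hpath C hC
        exact ⟨_, hq, Uniform.plain_append (.inr hU) (_ :: q)⟩
    · obtain ⟨C, hC, hU | ⟨h3, h4⟩⟩ := ih (i + 1) k₁ (k₂ - 1) (by omega) (by omega)
      · obtain ⟨q, hq⟩ := hpath C hC
        exact ⟨_, hq, Uniform.plain_append (.inl hU) (_ :: q)⟩
      · obtain ⟨q, hq⟩ := htri C hC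
        refine ⟨_, hq, Uniform.plain_append (.inr ⟨?_, ?_⟩) p⟩
        · simp only [List.countP_cons, List.countP_append, hX]
          simp only [if_true]
          omega
        · intro Y hY
          simp only [List.mem_cons, List.mem_append, List.mem_map] at hY
          rcases hY with rfl | ⟨v, -, rfl⟩ | ⟨v, -, rfl⟩ | hY
          · cases Y <;> simp_all [isClaw, isNet]
          · rfl
          · rfl
          · exact h4 Y hY

/-- The layer intervals that contain a loss. -/
def Toothed (L : Ladder H U) (t : ℕ) : Prop := ∃ l ∈ L.I, L.ends t < l ∧ l ≤ L.ends (t + 1)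

/-- By `card_between`, applied to layer `jump t` and its landing layer `ends (t + 1)`, each stretch
contains boundedly many losses, and as long as losses lie ahead the landmarks strictly increase, so
the stretches cover all positive layers that contain one. The two summands `1` stand for a loss in
layer `ends (t + 1)` itself and a loss in layer `0`. -/
theorem exists_toothed {n : ℕ} (hn : 3 ≤ n) (hfin : H.verts.Finite) (hloop : H.Loopless)
    (hno : ¬ HasShape H U n) (k : ℕ)
    (hk : 1 + k * (2 * n * n * (2 * n * n + 2) + 1) ≤ L.I.card) :
    ∃ Z : Finset ℕ, Z.card = k ∧ ∀ t ∈ Z, L.Toothed t := by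
  classical
  set Z := (Finset.range L.N).filter L.Toothed with hZ
  suffices h : k ≤ Z.card by
    obtain ⟨Z', h1, h2⟩ := Finset.exists_subset_card_eq h
    exact ⟨Z', h2, fun t ht => (Finset.mem_filter.1 (h1 ht)).2⟩
  have hcover : L.I ⊆ {0} ∪ Z.biUnion fun t =>
      L.I.filter fun l => L.ends t < l ∧ l ≤ L.ends (t + 1) := by
    intro l hl
    rcases Nat.eq_zero_or_pos l with rfl | hpos
    · simp
    have hlN := L.I_lt l hl
    have hex : ∃ t, l ≤ L.ends t := by
      by_contra! hcon
      have : ∀ t, t ≤ L.ends t := by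
        intro t
        induction t with
        | zero => exact Nat.zero_le _
        | succ t ih =>
          have := L.ends_lt ((hcon t).trans hlN)
          omega
      exact absurd (this l) (not_le.2 (hcon l))
    obtain ⟨t, ht, hmin⟩ : ∃ t, l ≤ L.ends t ∧ ∀ t' < t, L.ends t' < l :=
      ⟨Nat.find hex, Nat.find_spec hex, fun t' ht' => not_le.1 (Nat.find_min hex ht')⟩
    cases t with
    | zero =>
      have : L.ends 0 = 0 := rfl
      omega
    | succ t =>
      have h1 := hmin t (Nat.lt_succ_self t)
      have h2 : t ≤ L.ends t := by
        have : ∀ j ≤ t, j ≤ L.ends j := by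
          intro j
          induction j with
          | zero => exact fun _ => Nat.zero_le _
          | succ j ih =>
            intro hj
            have := L.ends_lt ((hmin j (by omega)).trans hlN)
            have := ih (by omega)
            omega
        exact this t le_rfl
      refine Finset.mem_union_right _ (Finset.mem_biUnion.2 ⟨t, ?_, ?_⟩)
      · exact Finset.mem_filter.2 ⟨Finset.mem_range.2 (by omega), l, hl, h1, ht⟩
      · exact Finset.mem_filter.2 ⟨hl, h1, ht⟩
  have hsmall : ∀ t ∈ Z, (L.I.filter fun l => L.ends t < l ∧ l ≤ L.ends (t + 1)).card ≤
      2 * n * n * (2 * n * n + 2) + 1 := by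
    intro t ht
    obtain ⟨l, hl, h1, h2⟩ := (Finset.mem_filter.1 ht).2
    have hlN := L.I_lt l hl
    have hj := L.jump_le t
    refine le_trans ?_ (Nat.add_le_add_right (L.card_between hn hfin hloop hno
      (i := L.jump t) (j := L.ends (t + 1)) (by omega) (lands_top_jump (h1.trans hlN))) 1)
    rw [← Finset.card_singleton (L.ends (t + 1))]
    refine (Finset.card_le_card ?_).trans (Finset.card_union_le _ _)
    intro l' hl'
    obtain ⟨h3, h4, h5⟩ := Finset.mem_filter.1 hl'
    rcases h5.eq_or_lt with rfl | h5
    · simp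
    · exact Finset.mem_union_left _ (Finset.mem_filter.2 ⟨h3, by omega, h5⟩)
  have h1 := (Finset.card_le_card hcover).trans (Finset.card_union_le _ _)
  have h2 := Finset.card_biUnion_le_card_mul _ _ _ hsmall
  rw [Finset.card_singleton] at h1
  by_contra hlt
  have h3 := Nat.mul_le_mul_right (2 * n * n * (2 * n * n + 2) + 1) (show Z.card + 1 ≤ k by omega)
  rw [Nat.add_mul] at h3
  omega

theorem exists_uniform_comb {n : ℕ} (hn : 3 ≤ n) (hfin : H.verts.Finite) (hloop : H.Loopless)
    (hno : ¬ HasShape H U n)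
    (hk : 1 + (12 * n + 3) * (2 * n * n * (2 * n * n + 2) + 1) ≤ L.I.card) :
    ∃ (v : V) (C : List (Item V)) (w : V), Red ∅ H (combOf (plain v :: (C ++ [plain w]))) ∧
      (combVerts (plain v :: (C ++ [plain w]))).Nodup ∧
      (∀ X ∈ C, X.isClaw = true ∨ X.isNet = true → legEnd X.stem ∈ U) ∧ Uniform n n C := by
  classical
  obtain ⟨Z, hZ, htooth⟩ := exists_toothed hn hfin hloop hno _ hk
  set f := Z.orderEmbOfFin hZ with hf
  -- Every sixth toothed stretch is used, so consecutive positions differ by at least 6. The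
  -- positions `0, …, 2 * n - 1` carry tripods and position `2 * n` is the far end; its index `12 *
  -- n + 2` explains the number `12 * n + 3`. The offset 2 makes room for a path block at the
  -- beginning, so that the comb also starts with a plain vertex. The default value is never used.
  set s : ℕ → ℕ := fun i => if h : 6 * i + 2 < 12 * n + 3 then f ⟨6 * i + 2, h⟩ else 0 with hs
  have hs' : ∀ i (h : 6 * i + 2 < 12 * n + 3), s i = f ⟨6 * i + 2, h⟩ := fun i h => dif_pos h
  have hgap : ∀ d a (h : a + d < 12 * n + 3), f ⟨a, by omega⟩ + d ≤ f ⟨a + d, h⟩ := by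
    intro d
    induction d with
    | zero => exact fun a h => le_rfl
    | succ d ih =>
      intro a h
      have h1 := ih a (by omega)
      have h2 : f ⟨a + d, by omega⟩ < f ⟨a + (d + 1), h⟩ := f.strictMono (by
        rw [Fin.mk_lt_mk]; omega)
      omega
  have htooth' : ∀ i < 2 * n + 1, L.Toothed (s i) := by
    intro i hi
    rw [hs' i (by omega)]
    exact htooth _ (Finset.orderEmbOfFin_mem _ _ _)
  have hends : ∀ i < 2 * n + 1, L.ends (s i) < L.N := by
    intro i hi
    obtain ⟨l, hl, h1, -⟩ := htooth' i hi
    exact h1.trans (L.I_lt l hl)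
  obtain ⟨C, hC, hU⟩ := exists_isComb_uniform (L := L) hfin hloop s (2 * n) (fun i hi => by
      rw [hs' i (by omega), hs' (i + 1) (by omega)]
      exact hgap 6 (6 * i + 2) (by omega))
    (hends _ (by omega)) (fun i hi => htooth' i (by omega)) (2 * n) 0 n n (by omega) (by omega)
  have h2 : 0 + 1 < s 0 := by
    rw [hs' 0 (by omega)]
    have := hgap 2 0 (by omega)
    simp only [Nat.zero_add] at this
    exact lt_of_lt_of_le (by omega) this
  obtain ⟨m, hm⟩ := exists_isComb_path hfin hloop h2 (hends 0 (by omega)) hC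
  have hU' := hU.plain_append m
  obtain ⟨C₀, w, rfl⟩ := hC.last
  rw [← List.append_assoc] at hm hU'
  refine ⟨_, _, w, (L.red_rest hfin 0).trans (hm.red.mono (by simp)), hm.nodup,
    fun X hX => hm.tip X (.tail _ (List.mem_append_left _ hX)), ?_⟩
  refine hU'.imp (And.imp (fun h => ?_) fun h X hX => h X (List.mem_append_left _ hX))
    (And.imp (fun h => ?_) fun h X hX => h X (List.mem_append_left _ hX))
  · rwa [List.countP_append (l₂ := [plain w])] at h
  · rwa [List.countP_append (l₂ := [plain w])] at h

end Ladder

end VDigraph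

/-! ### Identifying the constructed combs with the prescribed shapes -/

theorem combGraph_adj {p : ℕ} {leg : Fin (p + 1) → Option ℕ} {x y : CombVertex p leg} :
    (combGraph p leg).Adj x y ↔ (x.1 = y.1 ∧ ((y.2 : ℕ) = x.2 + 1 ∨ (x.2 : ℕ) = y.2 + 1)) ∨
      ((x.2 : ℕ) = 0 ∧ (y.2 : ℕ) = 0 ∧ ((y.1 : ℕ) = x.1 + 1 ∨ (x.1 : ℕ) = y.1 + 1)) := by
  simp only [combGraph, SimpleGraph.fromRel_adj]
  constructor
  · rintro ⟨-, (h | h) | (h | h)⟩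
    · exact .inl ⟨h.1, .inl h.2⟩
    · exact .inr ⟨h.1, h.2.1, .inl h.2.2⟩
    · exact .inl ⟨h.1.symm, .inr h.2⟩
    · exact .inr ⟨h.2.1, h.1, .inr h.2.2⟩
  · intro h
    refine ⟨?_, ?_⟩
    · rintro rfl
      omega
    · rcases h with ⟨h, h' | h'⟩ | ⟨h, h', h'' | h''⟩
      · exact .inl (.inl ⟨h, h'⟩)
      · exact .inr (.inl ⟨h.symm, h'⟩)
      · exact .inl (.inr ⟨h, h', h''⟩)
      · exact .inr (.inr ⟨h', h, h''⟩)

theorem combVertex_ext {p : ℕ} {leg : Fin (p + 1) → Option ℕ} {x y : CombVertex p leg}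
    (h : (x.1 : ℕ) = y.1) (h' : (x.2 : ℕ) = y.2) : x = y := by
  obtain ⟨i, j⟩ := x
  obtain ⟨i', j'⟩ := y
  obtain rfl : i = i' := Fin.ext h
  obtain rfl : j = j' := Fin.ext h'
  rfl

/-- Replacing vertices by their pairs of coordinates turns the degree into the size of a set of
pairs of natural numbers, which avoids the dependent type. -/
theorem deg_comb {p : ℕ} {leg : Fin (p + 1) → Option ℕ} (x : CombVertex p leg) :
    deg (combGraph p leg) x = ((fun y : CombVertex p leg => ((y.1 : ℕ), (y.2 : ℕ))) ''
      (combGraph p leg).neighborSet x).ncard :=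
  (Set.ncard_image_of_injective _ fun _ _ h =>
    combVertex_ext (Prod.mk.inj h).1 (Prod.mk.inj h).2).symm

/-- If nothing is attached to the ends of the path, then the junctions are the vertices to which
something is attached. -/
theorem mem_combJunctions {p : ℕ} {leg : Fin (p + 1) → Option ℕ} (h0 : leg 0 = none)
    (hp : leg (Fin.last p) = none) {x : CombVertex p leg} :
    x ∈ combJunctions p leg ↔ (x.2 : ℕ) = 0 ∧ leg x.1 ≠ none := by
  obtain ⟨i, j⟩ := x
  simp only [combJunctions, combTeeth, Set.mem_ofPred_eq, deg_comb]
  set N := (fun y : CombVertex p leg => ((y.1 : ℕ), (y.2 : ℕ))) ''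
    (combGraph p leg).neighborSet ⟨i, j⟩ with hN
  have hsub : ∀ S : Finset (ℕ × ℕ), (∀ y, (combGraph p leg).Adj ⟨i, j⟩ y →
      ((y.1 : ℕ), (y.2 : ℕ)) ∈ S) → N.ncard ≤ S.card := by
    intro S hS
    rw [← Set.ncard_coe_finset]
    refine Set.ncard_le_ncard ?_ S.finite_toSet
    rintro _ ⟨y, hy, rfl⟩
    exact hS y hy
  have hlast : ∀ y : CombVertex p leg, y.1 = i → (y.2 : ℕ) ≤ (leg i).getD 0 := by
    rintro ⟨i', j'⟩ rfl
    exact Nat.le_of_lt_succ j'.2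
  by_cases hj : (j : ℕ) = 0
  · simp only [hj, true_and]
    cases hi : leg i with
    | none =>
      have h1 := hsub {((i : ℕ) - 1, 0), ((i : ℕ) + 1, 0)} fun y hy => by
        rcases combGraph_adj.1 hy with ⟨h, h'⟩ | ⟨h, h', h''⟩
        · have := hlast y h.symm
          rw [hi] at this
          simp only [Option.getD_none] at this
          simp only at h'
          omega
        · simp only at h''
          rw [h']
          rcases h'' with h'' | h''
          · simp [h'']
          · simp [show (y.1 : ℕ) = i - 1 by omega]
      have h2 := h1.trans Finset.card_le_two
      simp
      omega
    | some l =>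
      have hi0 : (i : ℕ) ≠ 0 := fun h => by
        obtain rfl : i = 0 := Fin.ext h
        rw [h0] at hi; simp at hi
      have hip : (i : ℕ) < p := by
        refine lt_of_le_of_ne (Nat.le_of_lt_succ i.2) fun h => ?_
        obtain rfl : i = Fin.last p := Fin.ext h
        rw [hp] at hi; simp at hi
      have hm1 : ((i : ℕ) - 1, 0) ∈ N :=
        ⟨⟨⟨i - 1, by omega⟩, 0⟩, combGraph_adj.2 (.inr ⟨hj, rfl, .inr (by simp only; omega)⟩), rfl⟩
      have hm2 : ((i : ℕ) + 1, 0) ∈ N :=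
        ⟨⟨⟨i + 1, by omega⟩, 0⟩, combGraph_adj.2 (.inr ⟨hj, rfl, .inl rfl⟩), rfl⟩
      simp only [ne_eq, reduceCtorEq, not_false_eq_true, iff_true, Option.some.injEq]
      -- Two neighbours lie on the path of the comb, because `i` is not one of its ends. A trivial
      -- leg makes the vertex a tooth of degree two, and a nontrivial leg adds a third neighbour.
      by_cases hl : l = 0
      · refine .inr ⟨hl, ?_⟩
        have : N = (({((i : ℕ) - 1, 0), ((i : ℕ) + 1, 0)} : Finset (ℕ × ℕ)) : Set (ℕ × ℕ)) := by
          refine Set.Subset.antisymm ?_ (by simp [Set.insert_subset_iff, hm1, hm2])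
          rintro _ ⟨y, hy, rfl⟩
          rcases combGraph_adj.1 hy with ⟨h, h'⟩ | ⟨h, h', h''⟩
          · have := hlast y h.symm
            rw [hi] at this
            simp only [Option.getD_some] at this
            simp only at h'
            omega
          · simp only at h''
            simp only [h']
            rcases h'' with h'' | h''
            · simp [h'']
            · simp [show (y.1 : ℕ) = i - 1 by omega]
        rw [this, Set.ncard_coe_finset, Finset.card_pair]
        simp
      · refine .inl ?_
        have hm3 : ((i : ℕ), 1) ∈ N :=
          ⟨⟨i, ⟨1, by rw [hi]; simp; omega⟩⟩, combGraph_adj.2 (.inl ⟨rfl, .inl (by simp [hj])⟩), rfl⟩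
        have : N = (({((i : ℕ) - 1, 0), ((i : ℕ) + 1, 0), ((i : ℕ), 1)} : Finset (ℕ × ℕ)) :
            Set (ℕ × ℕ)) := by
          refine Set.Subset.antisymm ?_ (by simp [Set.insert_subset_iff, hm1, hm2, hm3])
          rintro _ ⟨y, hy, rfl⟩
          rcases combGraph_adj.1 hy with ⟨h, h'⟩ | ⟨h, h', h''⟩
          · simp only at h h'
            have h2 : (y.2 : ℕ) = 1 := by omega
            simp [h2, ← h]
          · simp only at h''
            simp only [h']
            rcases h'' with h'' | h''
            · simp [h'']
            · simp [show (y.1 : ℕ) = i - 1 by omega]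
        rw [this, Set.ncard_coe_finset, Finset.card_eq_three]
        exact ⟨_, _, _, by simp, by simp, by simp, rfl⟩
  -- A vertex with `j ≠ 0` has at most two neighbours, and if it is a tooth, it is the last vertex
  -- of its leg and has at most one. So it is not a junction.
  · have h1 := hsub {((i : ℕ), (j : ℕ) - 1), ((i : ℕ), (j : ℕ) + 1)} fun y hy => by
      rcases combGraph_adj.1 hy with ⟨h, h'⟩ | ⟨h, -⟩
      · simp only at h h'
        have hh : (y.1 : ℕ) = i := congrArg Fin.val h.symm
        rcases h' with h' | h'
        · simp [h', hh]
        · simp [show (y.2 : ℕ) = j - 1 by omega, hh]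
      · exact absurd h hj
    have h2 := h1.trans Finset.card_le_two
    simp only [hj, false_and, iff_false]
    rintro (h | ⟨h3, h4⟩)
    · omega
    · have h5 := hsub {((i : ℕ), (j : ℕ) - 1)} fun y hy => by
        rcases combGraph_adj.1 hy with ⟨h, h'⟩ | ⟨h, -⟩
        · have h6 := hlast y h.symm
          simp only [h3, Option.getD_some] at h6
          simp only at h h'
          have hh : (y.1 : ℕ) = i := congrArg Fin.val h.symm
          simp only [hh, Finset.mem_singleton, Prod.mk.injEq, true_and]
          omega
        · exact absurd h hj
      rw [Finset.card_singleton] at h5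
      omega

namespace VDigraph

variable {V : Type*}

open Item

/-- The length of the attached path. -/
def Item.len : Item V → Option ℕ
  | plain _ => none
  | claw _ l => some l.length
  | net _ _ _ _ l => some l.length

theorem Item.len_getD (X : Item V) : X.len.getD 0 = X.stem.2.length := by cases X <;> rfl

theorem Item.len_tooth {X : Item V} (h : X.isClaw = true ∨ X.isNet = true) :
    X.len = some X.stem.2.length := by
  cases X
  · simp [isClaw, isNet] at h
  · rfl
  · rfl

theorem legAt_map_stem {L : List (Item V)} {i j : ℕ} {v : V} :
    legAt (L.map stem) i j = some v ↔
      ∃ X, L[i]? = some X ∧ (X.stem.1 :: X.stem.2)[j]? = some v := by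
  simp [legAt, Option.bind_eq_some_iff]

theorem legVerts_map_stem_sublist (L : List (Item V)) :
    (legVerts (L.map stem)).Sublist (combVerts L) := by
  induction L with
  | nil => exact .refl _
  | cons X L ih => exact X.stem_sublist.append ih

section

variable (A : Item V) (B : List (Item V))

/-- The lengths of the paths attached to the path of a comb. -/
def combLen (i : Fin (B.length + 1)) : Option ℕ := ((A :: B)[(i : ℕ)]'i.2).len

/-- The vertices of the attached paths. -/
def stemVertex (x : CombVertex B.length (combLen A B)) : V :=
  (legAt ((A :: B).map stem) x.1 x.2).getD A.inp

variable {A B}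

theorem legAt_stemVertex (x : CombVertex B.length (combLen A B)) :
    legAt ((A :: B).map stem) x.1 x.2 = some (stemVertex A B x) := by
  have h : (x.2 : ℕ) < ((A :: B)[(x.1 : ℕ)]'x.1.2).stem.2.length + 1 := by
    rw [← len_getD]
    exact x.2.2
  obtain ⟨v, hv⟩ := legAt_isSome (L := (A :: B).map stem) (i := x.1) (j := x.2)
    (by simpa using x.1.2) (by rw [List.getElem_map]; exact h)
  rw [stemVertex, hv]
  rfl

theorem exists_stemVertex {i j : ℕ} {v : V} (h : legAt ((A :: B).map stem) i j = some v) :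
    ∃ x : CombVertex B.length (combLen A B), (x.1 : ℕ) = i ∧ (x.2 : ℕ) = j ∧
      stemVertex A B x = v := by
  obtain ⟨hi, hj⟩ := legAt_lt h
  have hi' : i < B.length + 1 := by simpa using hi
  refine ⟨⟨⟨i, hi'⟩, ⟨j, ?_⟩⟩, rfl, rfl, ?_⟩
  · rw [combLen, len_getD]
    rwa [List.getElem_map] at hj
  · rw [stemVertex, h]
    rfl

theorem stemVertex_inj (hnd : (combVerts (A :: B)).Nodup)
    {x y : CombVertex B.length (combLen A B)} (h : stemVertex A B x = stemVertex A B y) : x = y := by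
  have h1 := legAt_stemVertex x
  rw [h] at h1
  have h2 := legAt_inj ((legVerts_map_stem_sublist _).nodup hnd) h1 (legAt_stemVertex y)
  exact combVertex_ext h2.1 h2.2

/-- Without nets there are no triangles, and `inp`, `out` and the first vertex of the stem coincide
for each item. So the coordinates on the stems are the coordinates of the comb. -/
theorem shapedByComb_claws (hnet : ∀ X ∈ A :: B, X.isNet = false)
    (hnd : (combVerts (A :: B)).Nodup) : ∃ T, ShapedByComb (combOf (A :: B)) T ∧
      ∀ X ∈ A :: B, X.isClaw = true → legEnd X.stem ∈ T := by
  have hstem : ∀ X ∈ A :: B, X.vertices = X.stem.1 :: X.stem.2 ∧ X.inp = X.stem.1 ∧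
      X.out = X.stem.1 ∧ ∀ a b, ¬ X.tri.Adj a b := by
    intro X hX
    have := hnet X hX
    cases X with
    | plain v => exact ⟨rfl, rfl, rfl, fun _ _ h => h⟩
    | claw w l => exact ⟨rfl, rfl, rfl, fun _ _ h => h⟩
    | net o x y z l => simp [isNet] at this
  have hzero : ∀ {i : ℕ} {X : Item V}, (A :: B)[i]? = some X →
      legAt ((A :: B).map stem) i 0 = some X.stem.1 := fun {i X} h =>
    legAt_map_stem.2 ⟨X, h, rfl⟩
  refine ⟨stemVertex A B '' combTeeth B.length (combLen A B),
    ⟨B.length, combLen A B, .inl (isCopyOf_of_map (stemVertex A B)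
      (fun x _ y _ h => stemVertex_inj hnd h) ?_ ?_ ?_ rfl)⟩, ?_⟩
  · rw [combOf_verts]
    ext v
    simp only [Set.mem_image, Set.mem_ofPred_eq, combVerts, List.mem_flatMap]
    constructor
    · rintro ⟨x, -, rfl⟩
      obtain ⟨X, h1, h2⟩ := legAt_map_stem.1 (legAt_stemVertex x)
      have hX := List.mem_of_getElem? h1
      exact ⟨X, hX, (hstem X hX).1 ▸ List.mem_of_getElem? h2⟩
    · rintro ⟨X, hX, hv⟩
      rw [(hstem X hX).1] at hv
      obtain ⟨i, hi⟩ := List.mem_iff_getElem?.1 hX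
      obtain ⟨j, hj⟩ := List.mem_iff_getElem?.1 hv
      obtain ⟨x, -, -, h⟩ := exists_stemVertex (legAt_map_stem.2 ⟨X, hi, hj⟩)
      exact ⟨x, trivial, h⟩
  · have key : ∀ x y : CombVertex B.length (combLen A B), (x.2 : ℕ) = 0 → (y.2 : ℕ) = 0 →
        (y.1 : ℕ) = x.1 + 1 → ∃ i X Y, (A :: B)[i]? = some X ∧ (A :: B)[i + 1]? = some Y ∧
          stemVertex A B x = X.out ∧ stemVertex A B y = Y.inp := by
      intro x y hx hy hxy
      have h1 := legAt_stemVertex x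
      have h2 := legAt_stemVertex y
      rw [hx] at h1
      rw [hy, hxy] at h2
      obtain ⟨X, h3, h4⟩ := legAt_map_stem.1 h1
      obtain ⟨Y, h5, h6⟩ := legAt_map_stem.1 h2
      refine ⟨x.1, X, Y, h3, h5, ?_, ?_⟩
      · rw [(hstem X (List.mem_of_getElem? h3)).2.2.1]
        simpa using h4.symm
      · rw [(hstem Y (List.mem_of_getElem? h5)).2.1]
        simpa using h6.symm
    intro x y h
    refine combOf_adj.2 (.inr ?_)
    have h1 := legAt_stemVertex x
    have h2 := legAt_stemVertex y
    rcases combGraph_adj.1 h with ⟨h, h' | h'⟩ | ⟨hx, hy, h | h⟩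
    · rw [h', ← congrArg Fin.val h] at h2
      exact .inl ⟨x.1, x.2, .inl ⟨h1, h2⟩⟩
    · rw [h', congrArg Fin.val h] at h1
      exact .inl ⟨y.1, y.2, .inr ⟨h2, h1⟩⟩
    · obtain ⟨i, X, Y, h3, h4, h5⟩ := key x y hx hy h
      exact .inr ⟨i, X, Y, h3, h4, .inl h5⟩
    · obtain ⟨i, X, Y, h3, h4, h5, h6⟩ := key y x hy hx h
      exact .inr ⟨i, X, Y, h3, h4, .inr ⟨h5, h6⟩⟩
  · have hleg : ∀ i j a b, legAt ((A :: B).map stem) i j = some a →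
        legAt ((A :: B).map stem) i (j + 1) = some b →
        ∃ x y : CombVertex B.length (combLen A B), (combGraph B.length (combLen A B)).Adj x y ∧
          stemVertex A B x = a ∧ stemVertex A B y = b := by
      intro i j a b ha hb
      obtain ⟨x, h1, h2, h3⟩ := exists_stemVertex ha
      obtain ⟨y, h4, h5, h6⟩ := exists_stemVertex hb
      exact ⟨x, y, combGraph_adj.2 (.inl ⟨Fin.ext (by omega), .inl (by omega)⟩), h3, h6⟩
    have hcon : ∀ i X Y, (A :: B)[i]? = some X → (A :: B)[i + 1]? = some Y →
        ∃ x y : CombVertex B.length (combLen A B), (combGraph B.length (combLen A B)).Adj x y ∧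
          stemVertex A B x = X.out ∧ stemVertex A B y = Y.inp := by
      intro i X Y hX hY
      obtain ⟨x, h1, h2, h3⟩ := exists_stemVertex (hzero hX)
      obtain ⟨y, h4, h5, h6⟩ := exists_stemVertex (hzero hY)
      exact ⟨x, y, combGraph_adj.2 (.inr ⟨h2, h5, .inl (by omega)⟩),
        h3.trans (hstem X (List.mem_of_getElem? hX)).2.2.1.symm,
        h6.trans (hstem Y (List.mem_of_getElem? hY)).2.1.symm⟩
    intro a b h
    rcases combOf_adj.1 h with ⟨X, hX, h⟩ | ⟨i, j, ⟨h1, h2⟩ | ⟨h1, h2⟩⟩ |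
      ⟨i, X, Y, h1, h2, ⟨rfl, rfl⟩ | ⟨rfl, rfl⟩⟩
    · exact absurd h ((hstem X hX).2.2.2 a b)
    · exact hleg i j a b h1 h2
    · obtain ⟨x, y, h3, h4, h5⟩ := hleg i j b a h1 h2
      exact ⟨y, x, h3.symm, h5, h4⟩
    · exact hcon i X Y h1 h2
    · obtain ⟨x, y, h3, h4, h5⟩ := hcon i X Y h1 h2
      exact ⟨y, x, h3.symm, h5, h4⟩
  · intro X hX hc
    obtain ⟨i, hi⟩ := List.mem_iff_getElem?.1 hX
    have : (X.stem.1 :: X.stem.2)[X.stem.2.length]? = some (legEnd X.stem) := by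
      rw [legEnd, List.getLast_eq_getElem, List.getElem?_eq_getElem (by simp)]
      simp
    obtain ⟨x, h1, h2, h3⟩ := exists_stemVertex (legAt_map_stem.2 ⟨X, hi, this⟩)
    refine ⟨x, ?_, h3⟩
    have : (A :: B)[(x.1 : ℕ)]'x.1.2 = X := by
      rw [← h1] at hi
      exact (List.getElem?_eq_some_iff.1 hi).2
    change ((A :: B)[(x.1 : ℕ)]'x.1.2).len = some (x.2 : ℕ)
    rw [this, len_tooth (.inl hc), h2]

end

namespace Item

/-- The vertices of the directed triangle, in their order on it. -/
def cyc : Item V → ℕ → V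
  | plain v, _ => v
  | claw w _, _ => w
  | net _ x _ _ _, 0 => x
  | net true _ y _ _, 1 => y
  | net false _ _ z _, 1 => z
  | net true _ _ z _, _ => z
  | net false _ y _ _, _ => y

/-- The position of `out` on the triangle. -/
def outPort : Item V → ℕ
  | net true _ _ _ _ => 1
  | net false _ _ _ _ => 2
  | _ => 0

/-- The position of the vertex to which the path is attached on the triangle. -/
def stemPort : Item V → ℕ
  | net true _ _ _ _ => 2
  | net false _ _ _ _ => 1
  | _ => 0

theorem cyc_zero (X : Item V) : X.cyc 0 = X.inp := by
  rcases X with v | ⟨w, l⟩ | ⟨_ | _, x, y, z, l⟩ <;> rfl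

theorem cyc_outPort (X : Item V) : X.cyc X.outPort = X.out := by
  rcases X with v | ⟨w, l⟩ | ⟨_ | _, x, y, z, l⟩ <;> rfl

theorem cyc_stemPort (X : Item V) : X.cyc X.stemPort = X.stem.1 := by
  rcases X with v | ⟨w, l⟩ | ⟨_ | _, x, y, z, l⟩ <;> rfl

theorem ports_net {X : Item V} (h : X.isNet = true) : X.outPort < 3 ∧ X.stemPort < 3 ∧
    X.outPort ≠ 0 ∧ X.stemPort ≠ 0 ∧ X.outPort ≠ X.stemPort := by
  rcases X with v | ⟨w, l⟩ | ⟨_ | _, x, y, z, l⟩ <;> simp_all [isNet, outPort, stemPort]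

theorem ports_not_net {X : Item V} (h : X.isNet = false) : X.outPort = 0 ∧ X.stemPort = 0 := by
  rcases X with v | ⟨w, l⟩ | ⟨_ | _, x, y, z, l⟩ <;> simp_all [isNet, outPort, stemPort]

theorem cyc_inj {X : Item V} (h : X.isNet = true) (hnd : X.vertices.Nodup) {k k' : ℕ} (hk : k < 3)
    (hk' : k' < 3) (e : X.cyc k = X.cyc k') : k = k' := by
  rcases X with v | ⟨w, l⟩ | ⟨o, x, y, z, l⟩
  · simp [isNet] at h
  · simp [isNet] at h
  · simp only [vertices, List.nodup_cons, List.mem_cons, not_or] at hnd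
    obtain ⟨⟨h1, h2, -⟩, ⟨h3, -⟩, -⟩ := hnd
    cases o <;> interval_cases k <;> interval_cases k' <;>
      first
      | rfl
      | exact absurd e h1
      | exact absurd e.symm h1
      | exact absurd e h2
      | exact absurd e.symm h2
      | exact absurd e h3
      | exact absurd e.symm h3

theorem cyc_notMem {X : Item V} (hnd : X.vertices.Nodup) (k : ℕ) : X.cyc k ∉ X.stem.2 := by
  rcases X with v | ⟨w, l⟩ | ⟨o, x, y, z, l⟩
  · simp [stem]
  · exact (List.nodup_cons.1 hnd).1
  · simp only [vertices, List.nodup_cons, List.mem_cons, not_or] at hnd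
    obtain ⟨⟨-, -, h1⟩, ⟨-, h2⟩, h3, -⟩ := hnd
    cases o <;> rcases k with _ | _ | k <;> assumption

theorem cyc_mem (X : Item V) (k : ℕ) : X.cyc k ∈ X.vertices := by
  rcases X with v | ⟨w, l⟩ | ⟨o, x, y, z, l⟩
  · simp [cyc, vertices]
  · simp [cyc, vertices]
  · cases o <;> rcases k with _ | _ | k <;> simp [cyc, vertices]

theorem mem_vertices_cases {X : Item V} {v : V} (h : v ∈ X.vertices) : v ∈ X.stem.2 ∨
    ∃ k, ((X.isNet = true ∧ k < 3) ∨ (X.isNet = false ∧ k = 0)) ∧ X.cyc k = v := by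
  rcases X with w | ⟨w, l⟩ | ⟨o, x, y, z, l⟩
  · exact .inr ⟨0, .inr ⟨rfl, rfl⟩, (List.mem_singleton.1 h).symm⟩
  · rcases List.mem_cons.1 h with h | h
    · exact .inr ⟨0, .inr ⟨rfl, rfl⟩, h.symm⟩
    · exact .inl h
  · simp only [vertices, List.mem_cons] at h
    rcases h with rfl | rfl | rfl | h
    · exact .inr ⟨0, .inl ⟨rfl, by omega⟩, cyc_zero _⟩
    · exact .inr ⟨_, .inl ⟨rfl, (ports_net rfl).1⟩, cyc_outPort (net o x v z l)⟩
    · exact .inr ⟨_, .inl ⟨rfl, (ports_net rfl).2.1⟩, cyc_stemPort (net o x y v l)⟩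
    · exact .inl h

theorem tri_adj {X : Item V} {a b : V} :
    X.tri.Adj a b ↔ X.isNet = true ∧ ∃ k < 3, X.cyc k = a ∧ X.cyc ((k + 1) % 3) = b := by
  rcases X with w | ⟨w, l⟩ | ⟨o, x, y, z, l⟩
  · simp [isNet, tri, single]
  · simp [isNet, tri, single]
  · constructor
    · intro h
      refine ⟨rfl, ?_⟩
      cases o <;> rcases h with (⟨rfl, rfl⟩ | ⟨rfl, rfl⟩) | ⟨rfl, rfl⟩
      exacts [⟨0, by omega, rfl, rfl⟩, ⟨1, by omega, rfl, rfl⟩, ⟨2, by omega, rfl, rfl⟩,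
        ⟨0, by omega, rfl, rfl⟩, ⟨1, by omega, rfl, rfl⟩, ⟨2, by omega, rfl, rfl⟩]
    · rintro ⟨-, k, hk, rfl, rfl⟩
      cases o <;> interval_cases k <;> simp [tri, edge, cyc]

end Item

section

variable {A : Item V} {B : List (Item V)}

/-- The vertices on the triangles and on the attached paths. -/
def netVertex (A : Item V) (B : List (Item V)) (x : CombVertex B.length (combLen A B) × ℕ) : V :=
  if (x.1.2 : ℕ) = 0 then ((A :: B)[(x.1.1 : ℕ)]'x.1.1.2).cyc x.2 else stemVertex A B x.1

/-- The vertex of the triangle that is incident with a neighbour. -/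
def netPort (A : Item V) (B : List (Item V)) (x y : CombVertex B.length (combLen A B)) : ℕ :=
  if (x.2 : ℕ) = 0 then
    if (y.1 : ℕ) < x.1 then 0 else
    if (x.1 : ℕ) < y.1 then ((A :: B)[(x.1 : ℕ)]'x.1.2).outPort else
    ((A :: B)[(x.1 : ℕ)]'x.1.2).stemPort
  else 0

theorem netVertex_pos {x : CombVertex B.length (combLen A B)} (h : (x.2 : ℕ) ≠ 0) (k : ℕ) :
    netVertex A B (x, k) = stemVertex A B x := if_neg h

theorem netVertex_zero {x : CombVertex B.length (combLen A B)} (h : (x.2 : ℕ) = 0) (k : ℕ) :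
    netVertex A B (x, k) = ((A :: B)[(x.1 : ℕ)]'x.1.2).cyc k := if_pos h

theorem stemVertex_zero {x : CombVertex B.length (combLen A B)} (h : (x.2 : ℕ) = 0) :
    stemVertex A B x = ((A :: B)[(x.1 : ℕ)]'x.1.2).stem.1 := by
  have h1 := legAt_stemVertex x
  rw [h] at h1
  obtain ⟨X, h2, h3⟩ := legAt_map_stem.1 h1
  rw [(List.getElem?_eq_some_iff.1 h2).2]
  simpa using h3.symm

theorem stemVertex_mem_tail {x : CombVertex B.length (combLen A B)} (h : (x.2 : ℕ) ≠ 0) :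
    stemVertex A B x ∈ ((A :: B)[(x.1 : ℕ)]'x.1.2).stem.2 := by
  obtain ⟨X, h2, h3⟩ := legAt_map_stem.1 (legAt_stemVertex x)
  rw [(List.getElem?_eq_some_iff.1 h2).2]
  obtain ⟨j, hj⟩ := Nat.exists_eq_succ_of_ne_zero h
  rw [hj] at h3
  exact List.mem_of_getElem? (by simpa using h3)

theorem netVertex_mem (x : CombVertex B.length (combLen A B) × ℕ) :
    netVertex A B x ∈ ((A :: B)[(x.1.1 : ℕ)]'x.1.1.2).vertices := by
  unfold netVertex
  split_ifs with h
  · exact cyc_mem _ _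
  · exact (Item.stem_sublist _).subset (List.mem_cons_of_mem _ (stemVertex_mem_tail h))

theorem netVertex_stem {x y : CombVertex B.length (combLen A B)} (h : x.1 = y.1) :
    netVertex A B (x, netPort A B x y) = stemVertex A B x := by
  by_cases hx : (x.2 : ℕ) = 0
  · rw [netVertex_zero hx, netPort, if_pos hx, if_neg (by rw [h]; omega), if_neg (by rw [h]; omega),
      cyc_stemPort, stemVertex_zero hx]
  · rw [netVertex_pos hx]

theorem netVertex_out {x y : CombVertex B.length (combLen A B)} (hx : (x.2 : ℕ) = 0)
    (h : (y.1 : ℕ) = x.1 + 1) :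
    netVertex A B (x, netPort A B x y) = ((A :: B)[(x.1 : ℕ)]'x.1.2).out := by
  rw [netVertex_zero hx, netPort, if_pos hx, if_neg (by omega), if_pos (by omega), cyc_outPort]

theorem netVertex_inp {x y : CombVertex B.length (combLen A B)} (hx : (x.2 : ℕ) = 0)
    (h : (x.1 : ℕ) = y.1 + 1) :
    netVertex A B (x, netPort A B x y) = ((A :: B)[(x.1 : ℕ)]'x.1.2).inp := by
  rw [netVertex_zero hx, netPort, if_pos hx, if_pos (by omega), cyc_zero]

theorem item_eq_of_mem (hnd : (combVerts (A :: B)).Nodup) {i i' : ℕ} (hi : i < (A :: B).length)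
    (hi' : i' < (A :: B).length) {v : V} (h : v ∈ ((A :: B)[i]).vertices)
    (h' : v ∈ ((A :: B)[i']).vertices) : i = i' := by
  obtain ⟨-, h2⟩ := List.nodup_flatMap.1 hnd
  by_contra hne
  rcases lt_or_gt_of_ne hne with hlt | hlt
  · exact List.pairwise_iff_getElem.1 h2 _ _ hi hi' hlt h h'
  · exact List.pairwise_iff_getElem.1 h2 _ _ hi' hi hlt h' h

/-- Without claws, the items with an attached path are exactly the nets. As the first and the last
item are not nets, `mem_combJunctions` identifies the nets with the junctions, and their triangles
are the cycles that replace these. -/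
theorem shapedByComb_nets (hclaw : ∀ X ∈ A :: B, X.isClaw = false)
    (hnd : (combVerts (A :: B)).Nodup) (hA : A.isNet = false)
    (hB : ((A :: B)[B.length]'(Nat.lt_succ_self _)).isNet = false) :
    ∃ T, ShapedByComb (combOf (A :: B)) T ∧ ∀ X ∈ A :: B, X.isNet = true → legEnd X.stem ∈ T := by
  have hmem : ∀ x : CombVertex B.length (combLen A B), (A :: B)[(x.1 : ℕ)]'x.1.2 ∈ A :: B :=
    fun x => List.getElem_mem _
  have hnone : ∀ X ∈ A :: B, (X.len ≠ none ↔ X.isNet = true) := by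
    intro X hX
    have := hclaw X hX
    cases X <;> simp_all [isClaw, isNet, len]
  have hJ : ∀ x : CombVertex B.length (combLen A B), x ∈ combJunctions B.length (combLen A B) ↔
      (x.2 : ℕ) = 0 ∧ ((A :: B)[(x.1 : ℕ)]'x.1.2).isNet = true := by
    intro x
    rw [mem_combJunctions, ← hnone _ (hmem x)]
    · rfl
    · by_contra h
      exact absurd ((hnone A (by simp)).1 h) (by simp [hA])
    · by_contra h
      exact absurd ((hnone _ (List.getElem_mem _)).1 h) (by simp [hB])
  have hnd' : ∀ x : CombVertex B.length (combLen A B),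
      ((A :: B)[(x.1 : ℕ)]'x.1.2).vertices.Nodup := fun x =>
    (List.nodup_flatMap.1 hnd).1 _ (hmem x)
  set R := replaceByCycles (combGraph B.length (combLen A B))
    (combJunctions B.length (combLen A B)) 3 (netPort A B) with hR
  have hverts : ∀ x k, (x, k) ∈ R.verts ↔ (x ∈ combJunctions B.length (combLen A B) ∧ k < 3) ∨
      (x ∉ combJunctions B.length (combLen A B) ∧ k = 0) := fun x k => Iff.rfl
  have hadj : ∀ x y, R.Adj x y ↔ x ∈ R.verts ∧ y ∈ R.verts ∧
      ((x.1 = y.1 ∧ x.1 ∈ combJunctions B.length (combLen A B) ∧ y.2 = (x.2 + 1) % 3) ∨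
        ((combGraph B.length (combLen A B)).Adj x.1 y.1 ∧ x.2 = netPort A B x.1 y.1 ∧
          y.2 = netPort A B y.1 x.1)) := fun x y => Iff.rfl
  have hport : ∀ x y, (x, netPort A B x y) ∈ R.verts := by
    intro x y
    rw [hverts, hJ]
    by_cases hx : (x.2 : ℕ) = 0
    · rw [netPort, if_pos hx]
      cases hX : ((A :: B)[(x.1 : ℕ)]'x.1.2).isNet with
      | true =>
        obtain ⟨h1, h2, -⟩ := ports_net hX
        refine .inl ⟨⟨hx, rfl⟩, ?_⟩
        split_ifs <;> omega
      | false =>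
        obtain ⟨h1, h2⟩ := ports_not_net hX
        refine .inr ⟨by simp, ?_⟩
        split_ifs <;> omega
    · exact .inr ⟨fun h => hx h.1, if_neg hx⟩
  have hlift : ∀ x y, (combGraph B.length (combLen A B)).Adj x y →
      R.Adj (x, netPort A B x y) (y, netPort A B y x) := fun x y h =>
    (hadj _ _).2 ⟨hport x y, hport y x, .inr ⟨h, rfl, rfl⟩⟩
  have hinj : Set.InjOn (netVertex A B) R.verts := by
    rintro ⟨x, k⟩ hx ⟨y, k'⟩ hy e
    have h1 := netVertex_mem (x, k)
    have h2 := netVertex_mem (y, k')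
    rw [← e] at h2
    have h3 : (x.1 : ℕ) = y.1 := item_eq_of_mem hnd x.1.2 y.1.2 h1 h2
    rw [hverts, hJ] at hx hy
    by_cases hx0 : (x.2 : ℕ) = 0
    · by_cases hy0 : (y.2 : ℕ) = 0
      · obtain rfl : x = y := combVertex_ext h3 (hx0.trans hy0.symm)
        rw [netVertex_zero hx0, netVertex_zero hx0] at e
        rcases hx with ⟨hx, hk⟩ | ⟨hx, rfl⟩ <;> rcases hy with ⟨hy, hk'⟩ | ⟨hy, rfl⟩
        · rw [cyc_inj hx.2 (hnd' x) hk hk' e]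
        · exact absurd hx hy
        · exact absurd hy hx
        · rfl
      · rw [netVertex_zero hx0, netVertex_pos hy0] at e
        have h4 := stemVertex_mem_tail hy0
        rw [← e] at h4
        simp only [← h3] at h4
        exact absurd h4 (cyc_notMem (hnd' x) k)
    · by_cases hy0 : (y.2 : ℕ) = 0
      · rw [netVertex_zero hy0, netVertex_pos hx0] at e
        have h4 := stemVertex_mem_tail hx0
        rw [e] at h4
        simp only [h3] at h4
        exact absurd h4 (cyc_notMem (hnd' y) k')
      · rw [netVertex_pos hx0, netVertex_pos hy0] at e
        obtain rfl := stemVertex_inj hnd e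
        obtain rfl : k = 0 := by
          rcases hx with hx | hx
          exacts [absurd hx.1.1 hx0, hx.2]
        obtain rfl : k' = 0 := by
          rcases hy with hy | hy
          exacts [absurd hy.1.1 hx0, hy.2]
        rfl
  have hitem : ∀ {i : ℕ} {X : Item V}, (A :: B)[i]? = some X →
      ∃ x : CombVertex B.length (combLen A B), (x.1 : ℕ) = i ∧ (x.2 : ℕ) = 0 ∧
        (A :: B)[(x.1 : ℕ)]'x.1.2 = X := by
    intro i X h
    obtain ⟨h1, h2⟩ := List.getElem?_eq_some_iff.1 h
    exact ⟨⟨⟨i, h1⟩, 0⟩, rfl, rfl, h2⟩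
  have hcyc : ∀ X ∈ A :: B, ∀ k, ((X.isNet = true ∧ k < 3) ∨ (X.isNet = false ∧ k = 0)) →
      ∃ x : CombVertex B.length (combLen A B), (x.2 : ℕ) = 0 ∧ (A :: B)[(x.1 : ℕ)]'x.1.2 = X ∧
        (x, k) ∈ R.verts ∧ netVertex A B (x, k) = X.cyc k := by
    intro X hX k hk
    obtain ⟨i, hi⟩ := List.mem_iff_getElem?.1 hX
    obtain ⟨x, -, h2, rfl⟩ := hitem hi
    refine ⟨x, h2, rfl, ?_, netVertex_zero h2 k⟩
    rw [hverts, hJ]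
    rcases hk with hk | hk
    · exact .inl ⟨⟨h2, hk.1⟩, hk.2⟩
    · exact .inr ⟨by simp [hk.1], hk.2⟩
  refine ⟨netVertex A B '' replacedTeeth (combGraph B.length (combLen A B))
    (combJunctions B.length (combLen A B)) 3 (netPort A B) (combTeeth B.length (combLen A B)),
    ⟨B.length, combLen A B, .inr ⟨netPort A B, ⟨?_, ?_⟩,
      isCopyOf_of_map (netVertex A B) hinj ?_ ?_ ?_ rfl⟩⟩, ?_⟩
  · intro x hx y _
    rcases (hverts _ _).1 (hport x y) with h | h
    exacts [absurd h.1 hx, h.2]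
  · intro x hx
    have hx' := (hJ x).1 hx
    refine ⟨fun y _ => ?_, ?_⟩
    · rcases (hverts _ _).1 (hport x y) with h | h
      exacts [h.2, absurd hx h.1]
    -- The neighbours to the left, to the right and on the leg use the three different positions on
    -- the triangle, so the port determines the neighbour.
    · intro y hy y' hy' e
      obtain ⟨-, -, h1, h2, h3⟩ := ports_net hx'.2
      rw [netPort, netPort, if_pos hx'.1, if_pos hx'.1] at e
      have hy1 := combGraph_adj.1 hy
      have hy2 := combGraph_adj.1 hy'
      have e1 : x.1 = y.1 → (x.1 : ℕ) = y.1 := congrArg _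
      have e2 : x.1 = y'.1 → (x.1 : ℕ) = y'.1 := congrArg _
      refine combVertex_ext ?_ ?_
      · split_ifs at e <;> omega
      · split_ifs at e <;> omega
  · rw [combOf_verts]
    ext v
    constructor
    · rintro ⟨x, -, rfl⟩
      exact List.mem_flatMap.2 ⟨_, hmem x.1, netVertex_mem x⟩
    · intro hv
      obtain ⟨X, hX, hv⟩ := List.mem_flatMap.1 hv
      rcases mem_vertices_cases hv with hv | ⟨k, hk, rfl⟩
      · obtain ⟨i, hi⟩ := List.mem_iff_getElem?.1 hX
        obtain ⟨j, hj⟩ := List.mem_iff_getElem?.1 hv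
        obtain ⟨x, -, h1, h2⟩ := exists_stemVertex (i := i) (j := j + 1) (v := v)
          (legAt_map_stem.2 ⟨X, hi, by simpa using hj⟩)
        have h3 : (x.2 : ℕ) ≠ 0 := by omega
        exact ⟨(x, 0), (hverts _ _).2 (.inr ⟨fun h => h3 ((hJ x).1 h).1, rfl⟩),
          (netVertex_pos h3 0).trans h2⟩
      · obtain ⟨x, -, -, h1, h2⟩ := hcyc X hX k hk
        exact ⟨_, h1, h2⟩
  · rintro ⟨x, k⟩ ⟨y, k'⟩ h
    refine combOf_adj.2 ?_
    obtain ⟨hx, -, ⟨h1, h2, h3⟩ | ⟨h1, h2, h3⟩⟩ := (hadj _ _).1 h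
    · simp only at h1 h2 h3
      subst h1 h3
      obtain ⟨h4, h5⟩ := (hJ x).1 h2
      refine .inl ⟨_, hmem x, tri_adj.2 ⟨h5, k, ?_, (netVertex_zero h4 _).symm,
        (netVertex_zero h4 _).symm⟩⟩
      rcases (hverts _ _).1 hx with h | h
      exacts [h.2, absurd h2 h.1]
    · simp only at h1 h2 h3
      subst h2 h3
      refine .inr ?_
      have h1' := legAt_stemVertex x
      have h2' := legAt_stemVertex y
      rcases combGraph_adj.1 h1 with ⟨h, h' | h'⟩ | ⟨hx, hy, h | h⟩
      · rw [netVertex_stem h, netVertex_stem h.symm]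
        rw [h', ← congrArg Fin.val h] at h2'
        exact .inl ⟨x.1, x.2, .inl ⟨h1', h2'⟩⟩
      · rw [netVertex_stem h, netVertex_stem h.symm]
        rw [h', congrArg Fin.val h] at h1'
        exact .inl ⟨y.1, y.2, .inr ⟨h2', h1'⟩⟩
      · rw [netVertex_out hx h, netVertex_inp hy h]
        exact .inr ⟨x.1, _, _, List.getElem?_eq_getElem _,
          by rw [← h]; exact List.getElem?_eq_getElem _, .inl ⟨rfl, rfl⟩⟩
      · rw [netVertex_out hy h, netVertex_inp hx h]
        exact .inr ⟨y.1, _, _, List.getElem?_eq_getElem _,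
          by rw [← h]; exact List.getElem?_eq_getElem _, .inr ⟨rfl, rfl⟩⟩
  · have hleg : ∀ i j a b, legAt ((A :: B).map stem) i j = some a →
        legAt ((A :: B).map stem) i (j + 1) = some b →
        ∃ x y, R.Adj x y ∧ R.Adj y x ∧ netVertex A B x = a ∧ netVertex A B y = b := by
      intro i j a b ha hb
      obtain ⟨x, h1, h2, h3⟩ := exists_stemVertex ha
      obtain ⟨y, h4, h5, h6⟩ := exists_stemVertex hb
      have h7 : x.1 = y.1 := Fin.ext (by omega)
      have h8 : (combGraph B.length (combLen A B)).Adj x y :=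
        combGraph_adj.2 (.inl ⟨h7, .inl (by omega)⟩)
      exact ⟨_, _, hlift _ _ h8, hlift _ _ h8.symm, (netVertex_stem h7).trans h3,
        (netVertex_stem h7.symm).trans h6⟩
    have hcon : ∀ i X Y, (A :: B)[i]? = some X → (A :: B)[i + 1]? = some Y →
        ∃ x y, R.Adj x y ∧ R.Adj y x ∧ netVertex A B x = X.out ∧ netVertex A B y = Y.inp := by
      intro i X Y hX hY
      obtain ⟨x, h1, h2, rfl⟩ := hitem hX
      obtain ⟨y, h4, h5, rfl⟩ := hitem hY
      have h7 : (y.1 : ℕ) = x.1 + 1 := by omega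
      have h8 : (combGraph B.length (combLen A B)).Adj x y :=
        combGraph_adj.2 (.inr ⟨h2, h5, .inl h7⟩)
      exact ⟨_, _, hlift _ _ h8, hlift _ _ h8.symm, netVertex_out h2 h7, netVertex_inp h5 h7⟩
    intro a b h
    rcases combOf_adj.1 h with ⟨X, hX, h⟩ | ⟨i, j, ⟨h1, h2⟩ | ⟨h1, h2⟩⟩ |
      ⟨i, X, Y, h1, h2, ⟨rfl, rfl⟩ | ⟨rfl, rfl⟩⟩
    · obtain ⟨hnet, k, hk, rfl, rfl⟩ := tri_adj.1 h
      have hk' : (k + 1) % 3 < 3 := Nat.mod_lt _ (by omega)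
      obtain ⟨x, h1, rfl, h3, h4⟩ := hcyc X hX k (.inl ⟨hnet, hk⟩)
      have h5 : x ∈ combJunctions B.length (combLen A B) := (hJ x).2 ⟨h1, hnet⟩
      exact ⟨(x, k), (x, (k + 1) % 3), (hadj _ _).2 ⟨h3, (hverts _ _).2 (.inl ⟨h5, hk'⟩),
        .inl ⟨rfl, h5, rfl⟩⟩, h4, netVertex_zero h1 _⟩
    · obtain ⟨x, y, h3, -, h4⟩ := hleg i j a b h1 h2
      exact ⟨x, y, h3, h4⟩
    · obtain ⟨x, y, -, h3, h4, h5⟩ := hleg i j b a h1 h2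
      exact ⟨y, x, h3, h5, h4⟩
    · obtain ⟨x, y, h3, -, h4⟩ := hcon i X Y h1 h2
      exact ⟨x, y, h3, h4⟩
    · obtain ⟨x, y, -, h3, h4, h5⟩ := hcon i X Y h1 h2
      exact ⟨y, x, h3, h5, h4⟩
  · intro X hX hc
    have hlen := len_tooth (.inr hc)
    -- If the attached path is trivial, the tooth is the vertex of the triangle at `stemPort`: there
    -- is no neighbour on the leg, so it is not a port. Otherwise the tooth is the last vertex of
    -- the attached path, which is not on a triangle.
    by_cases hl : X.stem.2.length = 0
    · obtain ⟨x, h1, rfl, h3, h4⟩ := hcyc X hX X.stemPort (.inl ⟨hc, (ports_net hc).2.1⟩)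
      refine ⟨_, ⟨h3, ?_, fun _ y hy => ?_⟩, ?_⟩
      · change ((A :: B)[(x.1 : ℕ)]'x.1.2).len = some (x.2 : ℕ)
        rw [hlen, hl, h1]
      · rcases combGraph_adj.1 (show (combGraph B.length (combLen A B)).Adj x y from hy) with
          ⟨h, h' | h'⟩ | ⟨-, -, h⟩
        · have h5 := y.2.2
          have h6 : (combLen A B y.1).getD 0 = 0 := by
            rw [← h]
            change ((A :: B)[(x.1 : ℕ)]'x.1.2).len.getD 0 = 0
            rw [hlen, hl]
            rfl
          omega
        · omega
        · obtain ⟨-, -, h5, h6, h7⟩ := ports_net hc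
          simp only [netPort, h1, if_true]
          split_ifs <;> omega
      · rw [h4, cyc_stemPort, legEnd]
        generalize ((A :: B)[(x.1 : ℕ)]'x.1.2).stem = p at hl
        obtain ⟨c, l⟩ := p
        obtain rfl := List.length_eq_zero_iff.1 hl
        rfl
    · obtain ⟨i, hi⟩ := List.mem_iff_getElem?.1 hX
      have : (X.stem.1 :: X.stem.2)[X.stem.2.length]? = some (legEnd X.stem) := by
        rw [legEnd, List.getLast_eq_getElem, List.getElem?_eq_getElem (by simp)]
        simp
      obtain ⟨x, h1, h2, h3⟩ := exists_stemVertex (legAt_map_stem.2 ⟨X, hi, this⟩)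
      have h4 : (A :: B)[(x.1 : ℕ)]'x.1.2 = X := by
        rw [← h1] at hi
        exact (List.getElem?_eq_some_iff.1 hi).2
      have h5 : (x.2 : ℕ) ≠ 0 := by omega
      have h6 : x ∉ combJunctions B.length (combLen A B) := fun h => h5 ((hJ x).1 h).1
      refine ⟨(x, 0), ⟨(hverts _ _).2 (.inr ⟨h6, rfl⟩), ?_, fun h => absurd h h6⟩,
        (netVertex_pos h5 0).trans h3⟩
      change ((A :: B)[(x.1 : ℕ)]'x.1.2).len = some (x.2 : ℕ)
      rw [h4, hlen, h2]

end

/-- The stems of distinct items are disjoint, so the `n` claws or nets have distinct teeth in `U`.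
The plain vertices at both ends ensure that every net is an inner item. -/
theorem hasShape_of_comb {H : VDigraph V} {U : Set V} {n : ℕ} {v w : V} {C : List (Item V)}
    (hred : Red ∅ H (combOf (plain v :: (C ++ [plain w]))))
    (hnd : (combVerts (plain v :: (C ++ [plain w]))).Nodup)
    (htip : ∀ X ∈ C, X.isClaw = true ∨ X.isNet = true → legEnd X.stem ∈ U)
    (hC : Uniform n n C) : HasShape H U n := by
  have hsub : C.Sublist (plain v :: (C ++ [plain w])) :=
    .cons _ (List.sublist_append_left _ _)
  have hmem : ∀ X ∈ plain v :: (C ++ [plain w]), X = plain v ∨ X ∈ C ∨ X = plain w := by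
    simp
  have hleg : ∀ f : Item V → Bool, ((C.filter f).map fun X => legEnd X.stem).Nodup := by
    intro f
    have h1 : (((plain v :: (C ++ [plain w])).map stem).map legEnd).Nodup :=
      legEnd_nodup ((legVerts_map_stem_sublist _).nodup hnd)
    rw [List.map_map] at h1
    exact ((List.filter_sublist.trans hsub).map _).nodup h1
  have key : ∀ (f : Item V → Bool) (T : Set V), (∀ X, f X = true → X.isClaw = true ∨ X.isNet = true) →
      n ≤ C.countP f → (∀ X ∈ plain v :: (C ++ [plain w]), f X = true → legEnd X.stem ∈ T) →
      (n : ℕ∞) ≤ (T ∩ U).encard := by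
    intro f T hf hn hT
    refine le_encard_of_nodup (hleg f) ?_ (by rwa [List.length_map, ← List.countP_eq_length_filter])
    intro u hu
    obtain ⟨X, hX, rfl⟩ := List.mem_map.1 hu
    obtain ⟨hX, hfX⟩ := List.mem_filter.1 hX
    exact ⟨hT X (hsub.subset hX) hfX, htip X hX (hf X hfX)⟩
  rcases hC with ⟨h1, h2⟩ | ⟨h1, h2⟩
  · obtain ⟨T, h3, h4⟩ := shapedByComb_claws (fun X hX => by
      rcases hmem X hX with rfl | hX | rfl
      exacts [rfl, h2 X hX, rfl]) hnd
    exact ⟨_, T, hred, .inr h3, key _ T (fun X => .inl) h1 h4⟩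
  · obtain ⟨T, h3, h4⟩ := shapedByComb_nets (fun X hX => by
      rcases hmem X hX with rfl | hX | rfl
      exacts [rfl, h2 X hX, rfl]) hnd rfl (by simp [isNet])
    exact ⟨_, T, hred, .inr h3, key _ T (fun X => .inr) h1 h4⟩

/-! ### Finite subgraphs and the final bound -/

/-- The number of vertices of `U` that force a shape with `n` teeth. -/
def shapeBound (n : ℕ) : ℕ :=
  ladderBound n (1 + (12 * n + 3) * (2 * n * n * (2 * n * n + 2) + 1))

theorem hasShape_of_stronglyConnected {H : VDigraph V} {U : Set V} {n : ℕ} (hn : 3 ≤ n)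
    (hfin : H.verts.Finite) (hloop : H.Loopless)
    (hsc : ∀ v ∈ H.verts, ∀ w ∈ H.verts, H.Reach v w)
    (hU : shapeBound n ≤ (U ∩ H.verts).ncard) : HasShape H U n := by
  by_contra hno
  obtain ⟨r, hr⟩ : (U ∩ H.verts).Nonempty :=
    Set.nonempty_of_ncard_ne_zero (by have := ladderBound_pos n; unfold shapeBound at hU; grind)
  obtain ⟨L, -, hL⟩ := exists_ladder hn _ H _ r rfl hfin hloop hsc hr.2 hno hU
  obtain ⟨v, C, w, h1, h2, h3, h4⟩ := L.exists_uniform_comb hn hfin hloop hno hL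
  exact hno (hasShape_of_comb h1 h2 h3 h4)

/-- `S` consists of the vertices of a path. Each of them is reached from `a` and reaches `b` within
`S`, so unions of such sets for paths to and from a common vertex will be strongly connected. -/
theorem exists_finite_path {α : Type*} {r : α → α → Prop} {a b : α} (h : ReflTransGen r a b) :
    ∃ S : Set α, S.Finite ∧ a ∈ S ∧ b ∈ S ∧ ∀ x ∈ S,
      ReflTransGen (fun x y => r x y ∧ x ∈ S ∧ y ∈ S) a x ∧
      ReflTransGen (fun x y => r x y ∧ x ∈ S ∧ y ∈ S) x b := by
  induction h using ReflTransGen.head_induction_on with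
  | refl => exact ⟨{b}, Set.finite_singleton b, rfl, rfl, by rintro x rfl; exact ⟨.refl, .refl⟩⟩
  | @head a c e _ ih =>
    obtain ⟨S, h1, h2, h3, h4⟩ := ih
    have hmono : ∀ {x y : α}, ReflTransGen (fun x y => r x y ∧ x ∈ S ∧ y ∈ S) x y →
        ReflTransGen (fun x y => r x y ∧ x ∈ insert a S ∧ y ∈ insert a S) x y := fun h =>
      rtg_mono (fun x y e => ⟨e.1, .inr e.2.1, .inr e.2.2⟩) h
    have hstep : ReflTransGen (fun x y => r x y ∧ x ∈ insert a S ∧ y ∈ insert a S) a c :=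
      .single ⟨e, .inl rfl, .inr h2⟩
    refine ⟨insert a S, h1.insert a, .inl rfl, .inr h3, ?_⟩
    rintro x (rfl | hx)
    · exact ⟨.refl, hstep.trans (hmono (h4 c h2).2)⟩
    · exact ⟨hstep.trans (hmono (h4 x hx).1), hmono (h4 x hx).2⟩

/-- Finitely many vertices of a strongly connected directed graph lie in a finite strongly connected
subgraph. -/
theorem exists_finite_stronglyConnected {D : Digraph V} (hD : StronglyConnected D) {F : Set V}
    (hF : F.Finite) : ∃ H : VDigraph V, H.IsSubgraphOf D ∧ H.verts.Finite ∧ H.Loopless ∧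
      (∀ v ∈ H.verts, ∀ w ∈ H.verts, H.Reach v w) ∧ F ⊆ H.verts := by
  rcases F.eq_empty_or_nonempty with rfl | ⟨a, -⟩
  · exact ⟨bip [], fun _ _ h => h.elim, by simp, fun _ h => h, by simp, by simp⟩
  choose S h1 h2 h3 h4 using fun u v => exists_finite_path (hD u v)
  -- The union of paths from a fixed `a` to each vertex of `F` and back; loops of `D` are dropped.
  set W : Set V := ⋃ u ∈ F, S a u ∪ S u a with hW
  let H : VDigraph V := ⟨W, fun x y => D.Adj x y ∧ x ≠ y ∧ x ∈ W ∧ y ∈ W, fun h => h.2.2.1,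
    fun h => h.2.2.2⟩
  have hreach : ∀ (T : Set V), T ⊆ W → ∀ x y,
      ReflTransGen (fun x y => D.Adj x y ∧ x ∈ T ∧ y ∈ T) x y → H.Reach x y := by
    intro T hT x y h
    induction h with
    | refl => exact .refl _
    | @tail y z _ e ih =>
      by_cases hyz : y = z
      · exact hyz ▸ ih
      · exact ih.tail ⟨e.1, hyz, hT e.2.1, hT e.2.2⟩
  have hsub : ∀ u ∈ F, S a u ⊆ W ∧ S u a ⊆ W := fun u hu =>
    ⟨fun x hx => Set.mem_biUnion hu (.inl hx), fun x hx => Set.mem_biUnion hu (.inr hx)⟩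
  have hroot : ∀ x ∈ W, H.Reach a x ∧ H.Reach x a := by
    intro x hx
    obtain ⟨u, hu, hx⟩ := Set.mem_iUnion₂.1 hx
    obtain ⟨s1, s2⟩ := hsub u hu
    have hau := hreach _ s1 _ _ (h4 a u u (h3 a u)).1
    have hua := hreach _ s2 _ _ (h4 u a u (h2 u a)).2
    rcases hx with hx | hx
    · exact ⟨hreach _ s1 _ _ (h4 a u x hx).1, (hreach _ s1 _ _ (h4 a u x hx).2).trans hua⟩
    · exact ⟨hau.trans (hreach _ s2 _ _ (h4 u a x hx).1), hreach _ s2 _ _ (h4 u a x hx).2⟩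
  exact ⟨H, fun _ _ h => h.1, hF.biUnion fun u _ => (h1 a u).union (h1 u a), fun _ h => h.2.1 rfl,
    fun v hv w hw => (hroot v hv).2.trans (hroot w hw).1, fun u hu => (hsub u hu).1 (h3 a u)⟩

end VDigraph

end Butterfly

theorem theorem1 :
    ∃ g : ℕ → ℕ, ∀ (n : ℕ) (V : Type*) (D : Digraph V), Butterfly.StronglyConnected D →
      ∀ U : Set V, (g n : ℕ∞) ≤ U.encard →
        ∃ (H : Butterfly.VDigraph V) (T : Set V), H.IsButterflyMinorOf D ∧
          (Butterfly.ShapedByStar H T ∨ Butterfly.ShapedByComb H T) ∧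
          (n : ℕ∞) ≤ (T ∩ U).encard := by
  -- A cycle can replace the centre of a star only if there are at least three legs, so the argument
  -- is run with at least three teeth.
  refine ⟨fun n => Butterfly.VDigraph.shapeBound (max n 3), fun n V D hD U hU => ?_⟩
  -- `U` may be infinite; a finite subset of the required size is enough.
  obtain ⟨F, hFU, hF⟩ := Set.exists_subset_encard_eq hU
  have hfin : F.Finite := Set.finite_of_encard_eq_coe hF
  obtain ⟨H, h1, h2, h3, h4, h5⟩ := Butterfly.VDigraph.exists_finite_stronglyConnected hD hfin
  obtain ⟨K, T, h6, h7, h8⟩ :=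
    Butterfly.VDigraph.hasShape_of_stronglyConnected (U := U) (n := max n 3) (le_max_right _ _)
      h2 h3 h4 (by
        have h9 : F.ncard ≤ (U ∩ H.verts).ncard :=
          Set.ncard_le_ncard (fun x hx => ⟨hFU hx, h5 hx⟩) (h2.subset Set.inter_subset_right)
        rwa [Set.ncard, hF, ENat.toNat_natCast] at h9)
  exact ⟨K, T, h6.isButterflyMinorOf h1, h7, le_trans (by exact_mod_cast le_max_left n 3) h8⟩
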